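/- Let $p$ be an odd prime, $\xi(x)=e^{2\pi i x/p}$ for $x\in\mathbb F_p$, and $\mathcal H_p=\mathbb C^p$ with basis $|x\rangle$, $x\in\mathbb F_p$. **Stabiliser maps.** The $n$-qupit Pauli group consists of the operators $\xi(y)X^{x}Z^{z}$ ($y\in\mathbb F_p$, $x,z\in\mathbb F_p^n$) on $\mathcal H_p^{\otimes n}$, where $X^xZ^z|k\rangle=\xi(z\cdot k)|k+x\rangle$; put $\pi(a,(x,z))=\xi(a+\tfrac12 z\cdot x)X^xZ^z$. A stabiliser state is a unit vector fixed by all elements of a subgroup of the Pauli group that is maximal among the Abelian subgroups containing no scalar $\xi(a)1$ with $a\ne0$. A Clifford operator is a unitary that conjugates Pauli operators to Pauli operators. $\mathsf{Stab}_p$ is the $\dagger$-compact closed subcategory of finite-dimensional Hilbert spaces $\mathsf{FHilb}$ on the objects $\mathcal H_p^{\otimes n}$ $(n\ge0)$ generated by the stabiliser states, the Clifford operators and the scalars $\sqrt p$, $1/\sqrt p$ under composition, tensor product and Hermitian adjoint. **Mixed maps.** For a $\dagger$-compact closed category $\mathsf C$, $\mathrm{CPM}(\mathsf C)$ has the same objects;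 its morphisms $X\to Y$ are classes $[f,S]$ of maps $f:X\otimes S\to Y$ of $\mathsf C$, where $(f,S)\sim(g,T)$ when the doubled maps $X\otimes X^*\to Y\otimes Y^*$, obtained from $f\otimes f_*$ (respectively $g\otimes g_*$) by contracting $S$ with $S^*$ (respectively $T$ with $T^*$), agree. Let $\mathrm{Tr}_X=[\epsilon_X\circ\mathrm{swap}_{X,X^*},X^*]:X\to I$; a morphism $\Phi:X\to Y$ is causal if $\mathrm{Tr}_Y\circ\Phi=\mathrm{Tr}_X$, and $\mathrm{Caus}(\mathrm{CPM}(\mathsf C))$ is the symmetric monoidal subcategory of the causal morphisms. $\mathrm{Proj}$ denotes the quotient of a symmetric monoidal category by its invertible scalars. **Affine coisotropic relations.** $\mathsf{ACR}$ has as objects the finite-dimensional symplectic $\mathbb F_p$-vector spaces, and as morphisms $(V,\omega_V)\to(W,\omega_W)$ the affine subspaces of $(V\oplus W,-\omega_V\oplus\omega_W)$ that are empty or have a coisotropic linear part, with relational composition and direct sum as monoidal product. $\mathrm{Total}(\mathsf{ACR})$ is the subcategory of the relations in which each $v\in V$ is related to some $w\in W$. Let $\omega_n((x,z),(x',z'))=x\cdot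 z'-z\cdot x'$ on $\mathbb F_p^{2n}$. **The functor $\mathrm{Rel}$.** For a stabiliser map $f:\mathcal H_p^{\otimes n}\to\mathcal H_p^{\otimes m}$ let $L_f\subseteq\mathbb F_p^{2n}\oplus\mathbb F_p^{2m}$ be the set of all $(v,w)$ such that, for all $t\in\mathbb F_p$, $b\in\mathbb F_p^{2n}$ and $c\in\mathbb F_p^{2m}$ with $f\,\pi(0,b)=\pi(t,c)\,f$, one has $t=\omega_n(v,b)-\omega_m(w,c)$. (So $L_{\pi(a,u)}$ is the graph of the translation by $u$, and $L_0=\varnothing$.) For a class $[f,S]:\mathcal H_p^{\otimes n}\to\mathcal H_p^{\otimes m}$ with $S=\mathcal H_p^{\otimes l}$ put $$\mathrm{Rel}[f,S]=\{(v,w)\mid \exists s\in\mathbb F_p^{2l}:\ ((v,s),w)\in L_f\}.$$ **Proposition.** This defines a symmetric monoidal functor $\mathrm{Rel}:\mathrm{CPM}(\mathsf{Stab}_p)\to\mathsf{ACR}$, $\mathcal H_p^{\otimes n}\mapsto(\mathbb F_p^{2n},\omega_n)$, whose structure maps are the canonical isomorphisms $\mathbb F_p^{2n}\oplus\mathbb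 F_p^{2m}\cong\mathbb F_p^{2(n+m)}$. It sends causal morphisms to total relations and restricts to a symmetric monoidal equivalence $\mathrm{Caus}(\mathrm{CPM}(\mathsf{Stab}_p))\simeq\mathrm{Total}(\mathsf{ACR})$ (no quotient by scalars is needed). It also identifies morphisms that differ by an invertible scalar and induces a symmetric monoidal equivalence $\mathrm{Proj}(\mathrm{CPM}(\mathsf{Stab}_p))\simeq\mathsf{ACR}$. Moreover the following diagram of symmetric monoidal categories and symmetric monoidal functors commutes up to monoidal natural isomorphism, where the vertical functors from the second to the third row are the (faithful) inclusions, the vertical functors from the third to the fourth row are the equivalences given by $[f,S]\mapsto\bigl(\rho\mapsto\sum_s K_s\rho K_s^\dagger\bigr)$ with $K_s=f(1\otimes|s\rangle)$, the functors from the first to the second column are the inclusions and those from the second to the third column are the quotient functors: $$\begin{array}{ccccc} \mathrm{Total}(\mathsf{ACR}) & & \rightarrowtail & & \mathsf{ACR}\\ \simeq & & & & \simeq\\ \mathrm{Caus}(\mathrm{CPM}(\mathsf{Stab}_p)) & \rightarrowtail & \mathrm{CPM}(\mathsf{Stab}_p) & \twoheadrightarrow & \mathrm{Proj}(\mathrm{CPM}(\mathsf{Stab}_p))\\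 \downarrow & & \downarrow & & \downarrow\\ \mathrm{Caus}(\mathrm{CPM}(\mathsf{FHilb})) & \rightarrowtail & \mathrm{CPM}(\mathsf{FHilb}) & \twoheadrightarrow & \mathrm{Proj}(\mathrm{CPM}(\mathsf{FHilb}))\\ \simeq & & \simeq & & \simeq\\ \{\text{CPTP maps}\} & \rightarrowtail & \{\text{CP maps}\} & \twoheadrightarrow & \mathrm{Proj}\{\text{CP maps}\} \end{array}$$ Here the CP and CPTP maps in the last row are the completely positive, respectively completely positive trace-preserving, maps between the matrix algebras $\mathcal B(\mathcal H)$, $\mathcal H$ in $\mathsf{FHilb}$. -/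

import Mathlib

open CategoryTheory MonoidalCategory
open scoped Kronecker

universe u

set_option linter.unusedVariables false

noncomputable section

/-- A finite-dimensional Hilbert space, presented as `ℂ ^ basis` with its canonical orthonormal
basis. -/
structure FHilb : Type 1 where
  basis : Type
  [fin : Fintype basis]
  [dec : DecidableEq basis]

attribute [instance] FHilb.fin FHilb.dec

namespace FHilb

/-- Linear maps, presented by their matrices in the canonical bases. -/
@[ext]
structure Hom (X Y : FHilb) : Type where
  mat : Matrix Y.basis X.basis ℂ

instance : Category FHilb where
  Hom X Y := Hom X Y
  id X := ⟨1⟩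
  comp f g := ⟨g.mat * f.mat⟩
  id_comp f := by ext1; simp
  comp_id f := by ext1; simp
  assoc f g h := by ext1; simp [Matrix.mul_assoc]

@[ext] theorem hom_ext {X Y : FHilb} {f g : X ⟶ Y} (h : f.mat = g.mat) : f = g := Hom.ext h
@[simp] theorem id_mat (X : FHilb) : (𝟙 X : X ⟶ X).mat = 1 := rfl
@[simp] theorem comp_mat {X Y Z : FHilb} (f : X ⟶ Y) (g : Y ⟶ Z) :
    (f ≫ g).mat = g.mat * f.mat := rfl

/-- The Hermitian adjoint. -/
def adj {X Y : FHilb} (f : X ⟶ Y) : Y ⟶ X := ⟨f.mat.conjTranspose⟩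

/-- The unitary map that relabels basis vectors along a bijection of the bases. -/
def perm {X Y : FHilb} (e : X.basis ≃ Y.basis) : X ⟶ Y := ⟨(1 : Matrix _ _ ℂ).submatrix id e⟩

theorem perm_apply {X Y : FHilb} (e : X.basis ≃ Y.basis) (y x) :
    (perm e).mat y x = if y = e x then 1 else 0 := by
  simp [perm, Matrix.one_apply]

@[simp] theorem comp_perm_apply {X Y Z : FHilb} (f : X ⟶ Y) (e : Y.basis ≃ Z.basis) (z x) :
    (f ≫ perm e).mat z x = f.mat (e.symm z) x := by
  simp [perm_apply, Matrix.mul_apply, ← Equiv.symm_apply_eq]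

@[simp] theorem perm_comp_apply {X Y Z : FHilb} (e : X.basis ≃ Y.basis) (f : Y ⟶ Z) (z x) :
    (perm e ≫ f).mat z x = f.mat z (e x) := by
  simp [perm_apply, Matrix.mul_apply]

@[simp] theorem perm_refl (X : FHilb) : perm (Equiv.refl X.basis) = 𝟙 X := by
  ext i j; rw [perm_apply, id_mat, Matrix.one_apply]; congr

@[simp] theorem perm_comp {X Y Z : FHilb} (e : X.basis ≃ Y.basis) (f : Y.basis ≃ Z.basis) :
    (perm e ≫ perm f : X ⟶ Z) = perm (e.trans f) := by
  ext z x
  rw [perm_comp_apply, perm_apply, perm_apply, Equiv.trans_apply]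

@[simps] def permIso {X Y : FHilb} (e : X.basis ≃ Y.basis) : X ≅ Y where
  hom := perm e
  inv := perm e.symm

theorem adj_perm {X Y : FHilb} (e : X.basis ≃ Y.basis) : adj (perm e) = perm e.symm := by
  ext x y
  simp [adj, perm_apply, Equiv.eq_symm_apply, apply_ite, eq_comm]

@[simps tensorObj tensorUnit tensorHom whiskerLeft whiskerRight]
instance : MonoidalCategoryStruct FHilb where
  tensorObj X Y := ⟨X.basis × Y.basis⟩
  tensorUnit := ⟨Unit⟩
  tensorHom f g := ⟨f.mat ⊗ₖ g.mat⟩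
  whiskerLeft X _ _ f := ⟨(1 : Matrix X.basis X.basis ℂ) ⊗ₖ f.mat⟩
  whiskerRight f Y := ⟨f.mat ⊗ₖ (1 : Matrix Y.basis Y.basis ℂ)⟩
  associator X Y Z := permIso (Equiv.prodAssoc X.basis Y.basis Z.basis)
  leftUnitor X := permIso (Equiv.punitProd X.basis)
  rightUnitor X := permIso (Equiv.prodPUnit X.basis)

theorem tensorHom_apply {X Y Z W : FHilb} (f : X ⟶ Y) (g : Z ⟶ W) (y w x z) :
   (f ⊗ₘ g).mat (y, w) (x, z) = f.mat y x * g.mat w z := rfl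

theorem perm_tensor {X Y Z W : FHilb} (e : X.basis ≃ Y.basis) (f : Z.basis ≃ W.basis) :
    (perm e ⊗ₘ perm f : X ⊗ Z ⟶ Y ⊗ W) =
      perm (X := X ⊗ Z) (Y := Y ⊗ W) (Equiv.prodCongr e f) := by
  ext ⟨_, _⟩ ⟨_, _⟩
  rw [tensorHom_apply, perm_apply, perm_apply, perm_apply]
  rename_i y w x z
  have h : (y, w) = Equiv.prodCongr e f (x, z) ↔ y = e x ∧ w = f z := Prod.mk.injEq .. ▸ Iff.rfl
  by_cases h1 : y = e x <;> by_cases h2 : w = f z <;> simp [h1, h2]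

theorem whisker_perm {X Y Z : FHilb} (e : X.basis ≃ Y.basis) :
    Z ◁ (perm e : X ⟶ Y) =
      perm (X := Z ⊗ X) (Y := Z ⊗ Y) (Equiv.prodCongr (Equiv.refl _) e) := by
  rw [← perm_tensor, perm_refl]; rfl

theorem perm_whisker {X Y Z : FHilb} (e : X.basis ≃ Y.basis) :
    (perm e : X ⟶ Y) ▷ Z =
      perm (X := X ⊗ Z) (Y := Y ⊗ Z) (Equiv.prodCongr e (Equiv.refl _)) := by
  rw [← perm_tensor, perm_refl]; rfl

theorem associator_perm (X Y Z : FHilb) : (α_ X Y Z) =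
    permIso (X := (X ⊗ Y) ⊗ Z) (Y := X ⊗ (Y ⊗ Z)) (Equiv.prodAssoc X.basis Y.basis Z.basis) := rfl
theorem leftUnitor_perm (X : FHilb) : (λ_ X) =
    permIso (X := 𝟙_ _ ⊗ X) (Equiv.punitProd X.basis) := rfl
theorem rightUnitor_perm (X : FHilb) : (ρ_ X) =
    permIso (X := X ⊗ 𝟙_ _) (Equiv.prodPUnit X.basis) := rfl

instance : MonoidalCategory FHilb where
  tensorHom_def f g := by
    ext1; simp [← Matrix.mul_kronecker_mul]
  id_tensorHom_id X Y := by ext1; exact Matrix.one_kronecker_one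
  tensorHom_comp_tensorHom f g h k := by ext1; simp [← Matrix.mul_kronecker_mul]
  whiskerLeft_id X Y := by ext1; exact Matrix.one_kronecker_one
  id_whiskerRight X Y := by ext1; exact Matrix.one_kronecker_one
  associator_naturality f g h := by
    ext ⟨_, _, _⟩ ⟨⟨_, _⟩, _⟩
    erw [comp_perm_apply, perm_comp_apply]
    exact mul_assoc _ _ _
  leftUnitor_naturality f := by
    ext _ ⟨⟨⟩, _⟩
    erw [comp_perm_apply, perm_comp_apply]
    change (1 : Matrix Unit Unit ℂ) () () * _ = _
    rw [Matrix.one_apply_eq, one_mul]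
    rfl
  rightUnitor_naturality f := by
    ext _ ⟨_, ⟨⟩⟩
    erw [comp_perm_apply, perm_comp_apply]
    change _ * (1 : Matrix Unit Unit ℂ) () () = _
    rw [Matrix.one_apply_eq, mul_one]
    rfl
  pentagon W X Y Z := by
    simp only [associator_perm, permIso_hom, whisker_perm, perm_whisker, perm_comp]
    rfl
  triangle X Y := by
    simp only [associator_perm, leftUnitor_perm, rightUnitor_perm, permIso_hom, whisker_perm,
      perm_whisker, perm_comp]
    rfl

instance : BraidedCategory FHilb where
  braiding X Y := permIso (X := X ⊗ Y) (Y := Y ⊗ X) (Equiv.prodComm X.basis Y.basis)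
  braiding_naturality_right X Y Z f := by
    ext ⟨_, _⟩ ⟨_, _⟩
    erw [comp_perm_apply, perm_comp_apply]
    exact mul_comm _ _
  braiding_naturality_left {X Y} f Z := by
    ext ⟨_, _⟩ ⟨_, _⟩
    erw [comp_perm_apply, perm_comp_apply]
    exact mul_comm _ _
  hexagon_forward X Y Z := by
    simp only [associator_perm, permIso_hom, whisker_perm, perm_whisker, perm_comp]
    rfl
  hexagon_reverse X Y Z := by
    simp only [associator_perm, permIso_hom, permIso_inv, whisker_perm, perm_whisker, perm_comp]
    rfl

theorem braiding_perm (X Y : FHilb) : (β_ X Y) =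
    permIso (X := X ⊗ Y) (Y := Y ⊗ X) (Equiv.prodComm X.basis Y.basis) := rfl

instance : SymmetricCategory FHilb where
  symmetry X Y := by
    simp only [braiding_perm, permIso_hom, perm_comp]
    exact perm_refl _

/-- The cup `∑ x, |x⟩ ⊗ |x⟩`; a based space is identified with its dual through the basis. -/
def cup (X : FHilb) : 𝟙_ FHilb ⟶ X ⊗ X :=
  ⟨Matrix.of fun (x : X.basis × X.basis) _ => if x.1 = x.2 then 1 else 0⟩

end FHilb

/-- A family of based finite-dimensional Hilbert spaces, closed under tensor products. -/
structure TensorFamily : Type (u + 1) where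
  Obj : Type u
  space : Obj → FHilb
  unit : Obj
  tensor : Obj → Obj → Obj
  unitEquiv : (space unit).basis ≃ Unit
  tensorEquiv (X Y : Obj) : (space (tensor X Y)).basis ≃ (space X).basis × (space Y).basis

namespace TensorFamily
variable (T : TensorFamily.{u})

/-- The canonical isomorphism `H_X ⊗ H_Y ≅ H_(X ⊗ Y)`. -/
def μ (X Y : T.Obj) : T.space X ⊗ T.space Y ≅ T.space (T.tensor X Y) :=
  FHilb.permIso (X := T.space X ⊗ T.space Y) (T.tensorEquiv X Y).symm

/-- The canonical isomorphism `ℂ ≅ H_I`. -/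
def ε : 𝟙_ FHilb ≅ T.space T.unit :=
  FHilb.permIso (X := 𝟙_ FHilb) T.unitEquiv.symm

theorem μ_hom (X Y : T.Obj) : (T.μ X Y).hom =
    FHilb.perm (X := T.space X ⊗ T.space Y) (T.tensorEquiv X Y).symm := rfl
theorem μ_inv (X Y : T.Obj) : (T.μ X Y).inv =
    FHilb.perm (Y := T.space X ⊗ T.space Y) (T.tensorEquiv X Y) := rfl
theorem ε_inv : T.ε.inv = FHilb.perm (Y := 𝟙_ FHilb) T.unitEquiv := rfl

/-- The tensor product of two maps, transported along the canonical isomorphisms. -/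
def tensorMap {X Y Z W : T.Obj} (f : T.space X ⟶ T.space Y) (g : T.space Z ⟶ T.space W) :
    T.space (T.tensor X Z) ⟶ T.space (T.tensor Y W) :=
  (T.μ X Z).inv ≫ (f ⊗ₘ g) ≫ (T.μ Y W).hom

/-- The re-bracketing of basis labels. -/
def assocEquiv (X Y Z : T.Obj) :
    (T.space (T.tensor (T.tensor X Y) Z)).basis ≃ (T.space (T.tensor X (T.tensor Y Z))).basis :=
  (T.tensorEquiv _ _).trans <| ((T.tensorEquiv X Y).prodCongr (Equiv.refl _)).trans <|
    (Equiv.prodAssoc _ _ _).trans <|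
    ((Equiv.refl _).prodCongr (T.tensorEquiv Y Z).symm).trans (T.tensorEquiv _ _).symm

def leftUnitEquiv (X : T.Obj) : (T.space (T.tensor T.unit X)).basis ≃ (T.space X).basis :=
  (T.tensorEquiv _ _).trans <| (T.unitEquiv.prodCongr (Equiv.refl _)).trans (Equiv.punitProd _)

def rightUnitEquiv (X : T.Obj) : (T.space (T.tensor X T.unit)).basis ≃ (T.space X).basis :=
  (T.tensorEquiv _ _).trans <| ((Equiv.refl _).prodCongr T.unitEquiv).trans (Equiv.prodPUnit _)

def swapEquiv (X Y : T.Obj) :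
    (T.space (T.tensor X Y)).basis ≃ (T.space (T.tensor Y X)).basis :=
  (T.tensorEquiv _ _).trans <| (Equiv.prodComm _ _).trans (T.tensorEquiv _ _).symm

/-- The cup on `H_X`, transported along the canonical isomorphisms. -/
def cupMap (X : T.Obj) : T.space T.unit ⟶ T.space (T.tensor X X) :=
  T.ε.inv ≫ FHilb.cup (T.space X) ≫ (T.μ X X).hom

end TensorFamily

/-- A `†`-compact closed subcategory of finite-dimensional Hilbert spaces: a tensor-closed family
of based spaces with a class of linear maps that contains the structural maps and is closed under
composition, tensor product and Hermitian adjoint. -/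
structure HilbTheory : Type (u + 1) extends TensorFamily.{u} where
  Mor (X Y : Obj) : Set (space X ⟶ space Y)
  id_mem (X : Obj) : 𝟙 (space X) ∈ Mor X X
  comp_mem {X Y Z : Obj} {f : space X ⟶ space Y} {g : space Y ⟶ space Z} :
    f ∈ Mor X Y → g ∈ Mor Y Z → f ≫ g ∈ Mor X Z
  adj_mem {X Y : Obj} {f : space X ⟶ space Y} : f ∈ Mor X Y → FHilb.adj f ∈ Mor Y X
  tensor_mem {X Y Z W : Obj} {f : space X ⟶ space Y} {g : space Z ⟶ space W} :
    f ∈ Mor X Y → g ∈ Mor Z W → toTensorFamily.tensorMap f g ∈ Mor (tensor X Z) (tensor Y W)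
  assoc_mem (X Y Z : Obj) : FHilb.perm (toTensorFamily.assocEquiv X Y Z) ∈
    Mor (tensor (tensor X Y) Z) (tensor X (tensor Y Z))
  leftUnit_mem (X : Obj) : FHilb.perm (toTensorFamily.leftUnitEquiv X) ∈ Mor (tensor unit X) X
  rightUnit_mem (X : Obj) : FHilb.perm (toTensorFamily.rightUnitEquiv X) ∈ Mor (tensor X unit) X
  swap_mem (X Y : Obj) : FHilb.perm (toTensorFamily.swapEquiv X Y) ∈
    Mor (tensor X Y) (tensor Y X)
  cup_mem (X : Obj) : toTensorFamily.cupMap X ∈ Mor unit (tensor X X)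

namespace HilbTheory

/-- The objects of the category presented by a theory. -/
@[ext]
structure Cat (T : HilbTheory.{u}) : Type u where
  obj : T.Obj

variable {T : HilbTheory.{u}}

@[ext]
structure Hom (X Y : T.Cat) : Type where
  map : T.space X.obj ⟶ T.space Y.obj
  mem : map ∈ T.Mor X.obj Y.obj

instance : Category T.Cat where
  Hom X Y := Hom X Y
  id X := ⟨𝟙 _, T.id_mem _⟩
  comp f g := ⟨f.map ≫ g.map, T.comp_mem f.mem g.mem⟩

@[ext] theorem hom_ext {X Y : T.Cat} {f g : X ⟶ Y} (h : f.map = g.map) : f = g := Hom.ext h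

@[simp] theorem id_map (X : T.Cat) : (𝟙 X : X ⟶ X).map = 𝟙 _ := rfl
@[simp] theorem comp_map {X Y Z : T.Cat} (f : X ⟶ Y) (g : Y ⟶ Z) :
    (f ≫ g).map = f.map ≫ g.map := rfl

/-- The Hermitian adjoint. -/
def adj {X Y : T.Cat} (f : X ⟶ Y) : Y ⟶ X := ⟨FHilb.adj f.map, T.adj_mem f.mem⟩

/-- The isomorphism given by a relabelling of the basis that belongs to the theory. -/
@[simps]
def permIso {X Y : T.Cat} (e : (T.space X.obj).basis ≃ (T.space Y.obj).basis)
    (h : FHilb.perm e ∈ T.Mor X.obj Y.obj) : X ≅ Y where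
  hom := ⟨FHilb.perm e, h⟩
  inv := ⟨FHilb.perm e.symm, FHilb.adj_perm e ▸ T.adj_mem h⟩
  hom_inv_id := by ext1; simp
  inv_hom_id := by ext1; simp

instance : MonoidalCategoryStruct T.Cat where
  tensorObj X Y := ⟨T.tensor X.obj Y.obj⟩
  tensorUnit := ⟨T.unit⟩
  tensorHom f g := ⟨T.tensorMap f.map g.map, T.tensor_mem f.mem g.mem⟩
  whiskerLeft X _ _ f := ⟨T.tensorMap (𝟙 _) f.map, T.tensor_mem (T.id_mem _) f.mem⟩
  whiskerRight f Y := ⟨T.tensorMap f.map (𝟙 _), T.tensor_mem f.mem (T.id_mem _)⟩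
  associator X Y Z := permIso (T.assocEquiv X.obj Y.obj Z.obj) (T.assoc_mem _ _ _)
  leftUnitor X := permIso (T.leftUnitEquiv X.obj) (T.leftUnit_mem _)
  rightUnitor X := permIso (T.rightUnitEquiv X.obj) (T.rightUnit_mem _)

/-- The inclusion into finite-dimensional Hilbert spaces. -/
@[simps]
def incl (T : HilbTheory.{u}) : T.Cat ⥤ FHilb where
  obj X := T.space X.obj
  map f := f.map

instance : T.incl.Faithful where
  map_injective h := hom_ext h

open FHilb in
/-- The inclusion respects all the structure. -/
def inclData (T : HilbTheory.{u}) : Monoidal.InducingFunctorData T.incl where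
  μIso X Y := T.μ X.obj Y.obj
  εIso := T.ε
  whiskerLeft_eq X _ _ f := by
    simp only [← id_tensorHom]; rfl
  whiskerRight_eq f Y := by
    simp only [← tensorHom_id]; rfl
  tensorHom_eq f g := rfl
  associator_eq X Y Z := by
    change perm (T.assocEquiv X.obj Y.obj Z.obj) =
      ((T.μ (T.tensor X.obj Y.obj) Z.obj).inv ≫ ((T.μ X.obj Y.obj).inv ⊗ₘ 𝟙 _)) ≫
        (α_ _ _ _).hom ≫ (𝟙 _ ⊗ₘ (T.μ Y.obj Z.obj).hom) ≫
          (T.μ X.obj (T.tensor Y.obj Z.obj)).hom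
    simp only [T.μ_hom, T.μ_inv, id_tensorHom, tensorHom_id, FHilb.permIso_hom, associator_perm,
      whisker_perm, perm_whisker, perm_comp]
    rfl
  leftUnitor_eq X := by
    change perm (T.leftUnitEquiv X.obj) =
      ((T.μ T.unit X.obj).inv ≫ (T.ε.inv ⊗ₘ 𝟙 _)) ≫ (λ_ _).hom
    simp only [T.μ_inv, T.ε_inv, tensorHom_id, FHilb.permIso_hom, leftUnitor_perm,
      perm_whisker, perm_comp]
    rfl
  rightUnitor_eq X := by
    change perm (T.rightUnitEquiv X.obj) =
      ((T.μ X.obj T.unit).inv ≫ (𝟙 _ ⊗ₘ T.ε.inv)) ≫ (ρ_ _).hom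
    simp only [T.μ_inv, T.ε_inv, id_tensorHom, FHilb.permIso_hom, rightUnitor_perm,
      whisker_perm, perm_comp]
    rfl

instance : MonoidalCategory T.Cat := Monoidal.induced T.incl T.inclData

instance : T.incl.Monoidal := Monoidal.fromInducedMonoidal T.incl T.inclData

open FHilb in
theorem swap_compat (X Y : T.Cat) :
    (T.μ X.obj Y.obj).hom ≫ perm (T.swapEquiv X.obj Y.obj) =
      (β_ (T.space X.obj) (T.space Y.obj)).hom ≫ (T.μ Y.obj X.obj).hom := by
  simp only [T.μ_hom, FHilb.permIso_hom, braiding_perm, perm_comp]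
  congr 1
  ext x
  simp [TensorFamily.swapEquiv]

instance : BraidedCategory T.Cat :=
  BraidedCategory.ofFaithful T.incl
    (fun X Y => permIso (T.swapEquiv X.obj Y.obj) (T.swap_mem _ _)) swap_compat

instance : T.incl.Braided where
  braided X Y := swap_compat X Y

instance : SymmetricCategory T.Cat := SymmetricCategory.ofFaithful T.incl

end HilbTheory

namespace FHilb

theorem tensorμ_perm (X Y Z W : FHilb) : tensorμ X Y Z W =
    perm (X := (X ⊗ Y) ⊗ (Z ⊗ W)) (Y := (X ⊗ Z) ⊗ (Y ⊗ W))
      (Equiv.prodProdProdComm X.basis Y.basis Z.basis W.basis) := by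
  simp only [tensorμ, associator_perm, braiding_perm, permIso_hom, permIso_inv, whisker_perm,
    perm_whisker, perm_comp]
  rfl

/-- The complex conjugate `f_* : X* ⟶ Y*` of `f`; each dual space is identified with the space
itself through the canonical basis. -/
def conjugate {X Y : FHilb} (f : X ⟶ Y) : X ⟶ Y := ⟨f.mat.map star⟩

theorem conjugate_perm {X Y : FHilb} (e : X.basis ≃ Y.basis) :
    conjugate (perm e : X ⟶ Y) = perm e := by
  ext y x
  simp [conjugate, perm_apply, apply_ite]

theorem conjugate_id (X : FHilb) : conjugate (𝟙 X) = 𝟙 X := by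
  rw [← perm_refl, conjugate_perm]

theorem conjugate_comp {X Y Z : FHilb} (f : X ⟶ Y) (g : Y ⟶ Z) :
    conjugate (f ≫ g) = conjugate f ≫ conjugate g := by
  ext z x
  simp [conjugate, Matrix.mul_apply]

/-- The doubled map `(f ⊗ f_*) ∘ (1 ⊗ η_S) : X ⊗ X* ⟶ Y ⊗ Y*` of `f : X ⊗ S ⟶ Y`. -/
def double {X S Y : FHilb} (f : X ⊗ S ⟶ Y) : X ⊗ X ⟶ Y ⊗ Y :=
  (ρ_ (X ⊗ X)).inv ≫ ((X ⊗ X) ◁ cup S) ≫ tensorμ X X S S ≫ (f ⊗ₘ conjugate f)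

theorem cup_comp_apply {X S Z : FHilb} (g : X ⊗ (S ⊗ S) ⟶ Z) (z : Z.basis) (x : X.basis) :
    ((ρ_ X).inv ≫ (X ◁ cup S) ≫ g).mat z x = ∑ s : S.basis, g.mat z (x, (s, s)) := by
  rw [rightUnitor_perm, permIso_inv, perm_comp_apply, comp_mat, Matrix.mul_apply]
  have h (a : X.basis × (S.basis × S.basis)) : (X ◁ cup S).mat a ((Equiv.prodPUnit X.basis).symm x) =
      (1 : Matrix X.basis X.basis ℂ) a.1 x * if a.2.1 = a.2.2 then 1 else 0 := rfl
  refine (Finset.sum_congr rfl fun a _ => congrArg _ (h a)).trans ?_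
  refine (Fintype.sum_prod_type _).trans ?_
  refine (Finset.sum_eq_single x (fun a _ ha => ?_) (fun h => absurd (Finset.mem_univ _) h)).trans ?_
  · simp [ha]
  · refine (Fintype.sum_prod_type _).trans (Finset.sum_congr rfl fun s _ => ?_)
    simp

theorem double_apply {X S Y : FHilb} (f : X ⊗ S ⟶ Y) (y y' : Y.basis) (x x' : X.basis) :
    (double f).mat (y, y') (x, x') = ∑ s : S.basis, f.mat y (x, s) * star (f.mat y' (x', s)) := by
  rw [double, cup_comp_apply]
  refine Finset.sum_congr rfl fun s _ => ?_
  rw [tensorμ_perm, perm_comp_apply]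
  rfl

theorem comp_apply {X Y Z : FHilb} (f : X ⟶ Y) (g : Y ⟶ Z) (z : Z.basis) (x : X.basis) :
    (f ≫ g).mat z x = ∑ y : Y.basis, g.mat z y * f.mat y x := Matrix.mul_apply

theorem whisker_comp_apply {X Y Z R : FHilb} (f : X ⟶ Y) (g : Y ⊗ R ⟶ Z) (z : Z.basis)
    (x : X.basis) (r : R.basis) :
    (f ▷ R ≫ g).mat z (x, r) = ∑ y : Y.basis, g.mat z (y, r) * f.mat y x := by
  rw [comp_apply]
  refine (Fintype.sum_prod_type _).trans (Finset.sum_congr rfl fun y _ => ?_)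
  refine (Finset.sum_eq_single r (fun a _ ha => ?_) (fun h => absurd (Finset.mem_univ _) h)).trans ?_
  · change _ * (_ * (1 : Matrix R.basis R.basis ℂ) a r) = 0
    rw [Matrix.one_apply_ne ha, mul_zero, mul_zero]
  · change _ * (_ * (1 : Matrix R.basis R.basis ℂ) r r) = _
    rw [Matrix.one_apply_eq, mul_one]

theorem double_comp {X Y Z S R : FHilb} (f : X ⊗ S ⟶ Y) (g : Y ⊗ R ⟶ Z) :
    double ((α_ X S R).inv ≫ f ▷ R ≫ g) = double f ≫ double g := by
  ext ⟨z, z'⟩ ⟨x, x'⟩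
  rw [double_apply, comp_apply]
  have h (z : Z.basis) (x : X.basis) (s : S.basis) (r : R.basis) :
      ((α_ X S R).inv ≫ f ▷ R ≫ g).mat z (x, (s, r)) =
        ∑ y : Y.basis, g.mat z (y, r) * f.mat y (x, s) := by
    rw [associator_perm, permIso_inv, perm_comp_apply]
    exact whisker_comp_apply _ _ _ _ _
  refine (Fintype.sum_prod_type _).trans ?_
  simp only [h]
  refine Eq.trans ?_ (Fintype.sum_prod_type _).symm
  simp only [double_apply, star_sum, Finset.sum_mul_sum, star_mul']
  rw [Finset.sum_congr rfl fun _ _ => Finset.sum_comm, Finset.sum_comm]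
  refine Finset.sum_congr rfl fun y _ => ?_
  rw [Finset.sum_congr rfl fun _ _ => Finset.sum_comm, Finset.sum_comm]
  refine Finset.sum_congr rfl fun y' _ => ?_
  rw [Finset.sum_comm]
  refine Finset.sum_congr rfl fun r _ => ?_
  refine Finset.sum_congr rfl fun s _ => ?_
  ring

theorem double_relabel {X S S' Y : FHilb} (e : S.basis ≃ S'.basis) (f : X ⊗ S' ⟶ Y) :
    double ((X ◁ perm e) ≫ f) = double f := by
  ext ⟨y, y'⟩ ⟨x, x'⟩
  rw [double_apply, double_apply, whisker_perm, ← e.sum_comp]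
  simp only [perm_comp_apply]
  rfl

theorem double_perm {X X' S S' Y Y' : FHilb} (a : X.basis ≃ X'.basis) (b : S.basis ≃ S'.basis)
    (c : Y.basis ≃ Y'.basis) (f : X' ⊗ S' ⟶ Y) :
    double (((perm a : X ⟶ X') ⊗ₘ (perm b : S ⟶ S')) ≫ f ≫ perm c) =
      ((perm a : X ⟶ X') ⊗ₘ (perm a : X ⟶ X')) ≫ double f ≫
        ((perm c : Y ⟶ Y') ⊗ₘ (perm c : Y ⟶ Y')) := by
  ext ⟨y, y'⟩ ⟨x, x'⟩
  rw [perm_tensor, perm_tensor, perm_tensor, perm_comp_apply, comp_perm_apply, double_apply,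
    ← b.symm.sum_comp]
  refine Eq.trans ?_ (double_apply f _ _ _ _).symm
  refine Finset.sum_congr rfl fun s _ => ?_
  rw [perm_comp_apply, perm_comp_apply, comp_perm_apply, comp_perm_apply]
  simp

theorem double_pure {X Y : FHilb} (f : X ⟶ Y) : double ((ρ_ X).hom ≫ f) = (f ⊗ₘ conjugate f) := by
  ext ⟨y, y'⟩ ⟨x, x'⟩
  rw [double_apply, rightUnitor_perm, permIso_hom]
  simp only [perm_comp_apply]
  exact (Fintype.sum_unique (ι := Unit) _)

theorem double_tensor {X S Y X' S' Y' : FHilb} (f : X ⊗ S ⟶ Y) (g : X' ⊗ S' ⟶ Y') :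
    double (tensorμ X X' S S' ≫ (f ⊗ₘ g)) =
      tensorμ X X' X X' ≫ (double f ⊗ₘ double g) ≫ tensorμ Y Y Y' Y' := by
  ext ⟨⟨y1, y2⟩, ⟨y1', y2'⟩⟩ ⟨⟨x1, x2⟩, ⟨x1', x2'⟩⟩
  rw [double_apply, tensorμ_perm, tensorμ_perm, tensorμ_perm, perm_comp_apply, comp_perm_apply]
  refine (Fintype.sum_prod_type _).trans ?_
  refine Eq.trans ?_ (congrArg₂ (· * ·) (double_apply f y1 y1' x1 x1')
    (double_apply g y2 y2' x2 x2')).symm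
  rw [Finset.sum_mul_sum]
  refine Finset.sum_congr rfl fun r _ => Finset.sum_congr rfl fun s _ => ?_
  rw [perm_comp_apply, perm_comp_apply]
  change f.mat _ _ * g.mat _ _ * star (f.mat _ _ * g.mat _ _) = _
  rw [star_mul']
  exact mul_mul_mul_comm _ _ _ _

end FHilb

namespace HilbTheory
variable {T : HilbTheory.{u}}

/-- A map `f : X ⊗ S ⟶ Y` together with its ancilla `S`. -/
structure Dilation (X Y : T.Cat) : Type u where
  anc : T.Cat
  map : X ⊗ anc ⟶ Y

namespace Dilation

/-- The underlying map `H_X ⊗ H_S ⟶ H_Y`. -/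
def under {X Y : T.Cat} (f : Dilation X Y) : T.space X.obj ⊗ T.space f.anc.obj ⟶ T.space Y.obj :=
  (T.μ X.obj f.anc.obj).hom ≫ f.map.map

/-- The doubled map of a dilation. -/
def dbl {X Y : T.Cat} (f : Dilation X Y) :
    T.space X.obj ⊗ T.space X.obj ⟶ T.space Y.obj ⊗ T.space Y.obj :=
  FHilb.double f.under

/-- Two dilations are identified when their doubled maps agree. -/
instance setoid (X Y : T.Cat) : Setoid (Dilation X Y) where
  r f g := f.dbl = g.dbl
  iseqv := ⟨fun _ => rfl, Eq.symm, Eq.trans⟩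

/-- A pure map, with trivial ancilla. -/
def pure {X Y : T.Cat} (f : X ⟶ Y) : Dilation X Y := ⟨𝟙_ _, (ρ_ X).hom ≫ f⟩

/-- Sequential composition; the ancillas are tensored. -/
def comp {X Y Z : T.Cat} (f : Dilation X Y) (g : Dilation Y Z) : Dilation X Z :=
  ⟨f.anc ⊗ g.anc, (α_ X f.anc g.anc).inv ≫ f.map ▷ g.anc ≫ g.map⟩

/-- Parallel composition; the ancillas are tensored. -/
def tensor {X Y X' Y' : T.Cat} (f : Dilation X Y) (g : Dilation X' Y') :
    Dilation (X ⊗ X') (Y ⊗ Y') :=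
  ⟨f.anc ⊗ g.anc, tensorμ X X' f.anc g.anc ≫ (f.map ⊗ₘ g.map)⟩

open FHilb in
theorem under_pure {X Y : T.Cat} (f : X ⟶ Y) : (pure f).under =
    (T.space X.obj ◁ T.ε.inv) ≫ (ρ_ (T.space X.obj)).hom ≫ f.map := by
  change (T.μ X.obj T.unit).hom ≫ perm (T.rightUnitEquiv X.obj) ≫ f.map = _
  rw [T.μ_hom, T.ε_inv, whisker_perm, rightUnitor_perm, permIso_hom, ← Category.assoc,
    ← Category.assoc, perm_comp, perm_comp]
  refine congrArg (fun e => perm e ≫ f.map) (Equiv.ext fun x => ?_)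
  simp [TensorFamily.rightUnitEquiv]

open FHilb in
theorem under_comp {X Y Z : T.Cat} (f : Dilation X Y) (g : Dilation Y Z) : (f.comp g).under =
    (T.space X.obj ◁ (T.μ f.anc.obj g.anc.obj).inv) ≫ (α_ _ _ _).inv ≫
      f.under ▷ T.space g.anc.obj ≫ g.under := by
  change (T.μ X.obj (T.tensor f.anc.obj g.anc.obj)).hom ≫
    perm (T.assocEquiv X.obj f.anc.obj g.anc.obj).symm ≫
    ((T.μ _ _).inv ≫ (f.map.map ⊗ₘ 𝟙 _) ≫ (T.μ _ _).hom) ≫ g.map.map = _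
  have h : (T.μ X.obj (T.tensor f.anc.obj g.anc.obj)).hom ≫
      perm (T.assocEquiv X.obj f.anc.obj g.anc.obj).symm ≫
        (T.μ (T.tensor X.obj f.anc.obj) g.anc.obj).inv =
      (T.space X.obj ◁ (T.μ f.anc.obj g.anc.obj).inv) ≫ (α_ _ _ _).inv ≫
        (T.μ X.obj f.anc.obj).hom ▷ _ := by
    rw [T.μ_hom, T.μ_inv, T.μ_inv, T.μ_hom, whisker_perm, perm_whisker, associator_perm,
      permIso_inv, perm_comp, perm_comp, perm_comp, perm_comp]
    refine congrArg perm (Equiv.ext fun x => ?_)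
    simp [TensorFamily.assocEquiv]
  rw [tensorHom_id]
  simp only [Category.assoc, under, comp_whiskerRight]
  rw [← reassoc_of% h]

open FHilb in
theorem under_tensor {X Y X' Y' : T.Cat} (f : Dilation X Y) (g : Dilation X' Y') :
    (f.tensor g).under = ((T.μ X.obj X'.obj).inv ⊗ₘ (T.μ f.anc.obj g.anc.obj).inv) ≫
      tensorμ _ _ _ _ ≫ (f.under ⊗ₘ g.under) ≫ (T.μ Y.obj Y'.obj).hom := by
  have h := MonoidalCategory.tensorμ_comp_μ_tensorHom_μ_comp_μ T.incl X X' f.anc g.anc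
  change tensorμ _ _ _ _ ≫ ((T.μ X.obj f.anc.obj).hom ⊗ₘ (T.μ X'.obj g.anc.obj).hom) ≫
      (T.μ (X ⊗ f.anc).obj (X' ⊗ g.anc).obj).hom =
    ((T.μ X.obj X'.obj).hom ⊗ₘ (T.μ f.anc.obj g.anc.obj).hom) ≫
      (T.μ (X ⊗ X').obj (f.anc ⊗ g.anc).obj).hom ≫ (tensorμ X X' f.anc g.anc).map at h
  have h' := congrArg (fun k => ((T.μ X.obj X'.obj).inv ⊗ₘ (T.μ f.anc.obj g.anc.obj).inv) ≫ k ≫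
    (T.μ (X ⊗ f.anc).obj (X' ⊗ g.anc).obj).inv ≫ (f.map.map ⊗ₘ g.map.map) ≫
      (T.μ Y.obj Y'.obj).hom) h
  simp only [Category.assoc, Iso.hom_inv_id_assoc] at h'
  simp only [MonoidalCategory.tensorHom_comp_tensorHom_assoc, Iso.inv_hom_id, id_tensorHom,
    whiskerLeft_id, Category.id_comp] at h'
  exact h'.symm

open FHilb in
theorem dbl_pure {X Y : T.Cat} (f : X ⟶ Y) : (pure f).dbl = (f.map ⊗ₘ conjugate f.map) := by
  rw [dbl, under_pure]
  exact (double_relabel (S' := 𝟙_ FHilb) T.unitEquiv _).trans (double_pure _)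

open FHilb in
theorem dbl_comp {X Y Z : T.Cat} (f : Dilation X Y) (g : Dilation Y Z) :
    (f.comp g).dbl = f.dbl ≫ g.dbl := by
  rw [dbl, under_comp]
  exact (double_relabel (S' := T.space f.anc.obj ⊗ T.space g.anc.obj)
    (T.tensorEquiv f.anc.obj g.anc.obj) _).trans (double_comp _ _)

open FHilb in
theorem dbl_tensor {X Y X' Y' : T.Cat} (f : Dilation X Y) (g : Dilation X' Y') :
    (f.tensor g).dbl = ((T.μ X.obj X'.obj).inv ⊗ₘ (T.μ X.obj X'.obj).inv) ≫
      tensorμ _ _ _ _ ≫ (f.dbl ⊗ₘ g.dbl) ≫ tensorμ _ _ _ _ ≫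
        ((T.μ Y.obj Y'.obj).hom ⊗ₘ (T.μ Y.obj Y'.obj).hom) := by
  rw [dbl, under_tensor, T.μ_inv, T.μ_inv, T.μ_hom, ← Category.assoc (tensorμ _ _ _ _)]
  refine (double_perm (X := T.space (X ⊗ X').obj) (S := T.space (f.tensor g).anc.obj)
    (X' := T.space X.obj ⊗ T.space X'.obj) (S' := T.space f.anc.obj ⊗ T.space g.anc.obj)
    _ _ _ _).trans ?_
  rw [double_tensor]
  simp only [Category.assoc]
  rfl

theorem dbl_id (X : T.Cat) : (pure (𝟙 X)).dbl = 𝟙 _ := by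
  rw [dbl_pure, id_map, FHilb.conjugate_id, id_tensorHom_id]

theorem dbl_pure_comp {X Y Z : T.Cat} (f : X ⟶ Y) (g : Y ⟶ Z) :
    (pure (f ≫ g)).dbl = (pure f).dbl ≫ (pure g).dbl := by
  rw [dbl_pure, dbl_pure, dbl_pure, comp_map, FHilb.conjugate_comp, tensorHom_comp_tensorHom]

theorem comp_congr {X Y Z : T.Cat} {f f' : Dilation X Y} (hf : f ≈ f') {g g' : Dilation Y Z}
    (hg : g ≈ g') : f.comp g ≈ f'.comp g' := by
  change (f.comp g).dbl = (f'.comp g').dbl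
  rw [dbl_comp, dbl_comp, show f.dbl = f'.dbl from hf, show g.dbl = g'.dbl from hg]

theorem tensor_congr {X Y X' Y' : T.Cat} {f f' : Dilation X Y} (hf : f ≈ f')
    {g g' : Dilation X' Y'} (hg : g ≈ g') : f.tensor g ≈ f'.tensor g' := by
  change (f.tensor g).dbl = (f'.tensor g').dbl
  rw [dbl_tensor, dbl_tensor, show f.dbl = f'.dbl from hf, show g.dbl = g'.dbl from hg]

/-- Sequential composition of classes. -/
def compCls {X Y Z : T.Cat} :
    Quotient (setoid X Y) → Quotient (setoid Y Z) → Quotient (setoid X Z) :=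
  Quotient.map₂ (fun f g => f.comp g) (fun _ _ hf _ _ hg => comp_congr hf hg)

/-- Parallel composition of classes. -/
def tensorCls {X Y X' Y' : T.Cat} :
    Quotient (setoid X Y) → Quotient (setoid X' Y') → Quotient (setoid (X ⊗ X') (Y ⊗ Y')) :=
  Quotient.map₂ (fun f g => f.tensor g) (fun _ _ hf _ _ hg => tensor_congr hf hg)

end Dilation

end HilbTheory

/-- The category of completely positive maps of a theory `T`. -/
@[ext]
structure CPM (T : HilbTheory.{u}) : Type u where of ::
  obj : T.Cat

namespace CPM
open HilbTheory
variable {T : HilbTheory.{u}}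

/-- Morphisms are classes of dilations with the same doubled map. -/
def Hom (X Y : CPM T) : Type u := Quotient (Dilation.setoid X.obj Y.obj)

/-- The class `[f, S]` of a dilation `f : X ⊗ S ⟶ Y`. -/
def Hom.mk {X Y : CPM T} (f : Dilation X.obj Y.obj) : Hom X Y := Quotient.mk _ f

/-- The doubled map of a class. -/
def Hom.dbl {X Y : CPM T} (Φ : Hom X Y) :
    T.space X.obj.obj ⊗ T.space X.obj.obj ⟶ T.space Y.obj.obj ⊗ T.space Y.obj.obj :=
  Quotient.lift Dilation.dbl (fun _ _ h => h) Φ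

def Hom.comp {X Y Z : CPM T} (Φ : Hom X Y) (Ψ : Hom Y Z) : Hom X Z :=
  Dilation.compCls Φ Ψ

def Hom.tensor {X Y X' Y' : CPM T} (Φ : Hom X Y) (Ψ : Hom X' Y') :
    Hom (⟨X.obj ⊗ X'.obj⟩ : CPM T) ⟨Y.obj ⊗ Y'.obj⟩ :=
  Dilation.tensorCls Φ Ψ

theorem Hom.mk_surjective {X Y : CPM T} (Φ : Hom X Y) : ∃ f, Hom.mk f = Φ :=
  Quotient.exists_rep Φ

theorem Hom.dbl_injective {X Y : CPM T} {Φ Ψ : Hom X Y} (h : Φ.dbl = Ψ.dbl) : Φ = Ψ := by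
  obtain ⟨f, rfl⟩ := Φ.mk_surjective
  obtain ⟨g, rfl⟩ := Ψ.mk_surjective
  exact Quotient.sound h

theorem Hom.dbl_comp {X Y Z : CPM T} (Φ : Hom X Y) (Ψ : Hom Y Z) :
    (Hom.comp Φ Ψ).dbl = Φ.dbl ≫ Ψ.dbl := by
  obtain ⟨f, rfl⟩ := Φ.mk_surjective
  obtain ⟨g, rfl⟩ := Ψ.mk_surjective
  exact Dilation.dbl_comp f g

theorem Hom.dbl_id (X : CPM T) : (Hom.mk (X := X) (Y := X) (Dilation.pure (𝟙 X.obj))).dbl = 𝟙 _ :=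
  Dilation.dbl_id X.obj

instance : Category (CPM T) where
  Hom X Y := Hom X Y
  id X := Hom.mk (Dilation.pure (𝟙 X.obj))
  comp Φ Ψ := Hom.comp Φ Ψ
  id_comp Φ := Hom.dbl_injective (by rw [Hom.dbl_comp, Hom.dbl_id, Category.id_comp])
  comp_id Φ := Hom.dbl_injective (by rw [Hom.dbl_comp, Hom.dbl_id, Category.comp_id])
  assoc Φ Ψ Θ := Hom.dbl_injective (by simp only [Hom.dbl_comp, Category.assoc])

/-- The class `[f, S]`, as a morphism. -/
def mk {X Y : CPM T} (f : Dilation X.obj Y.obj) : X ⟶ Y := Hom.mk f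

theorem mk_surjective {X Y : CPM T} (Φ : X ⟶ Y) : ∃ f, mk f = Φ := Hom.mk_surjective Φ

/-- Doubling as a functor. -/
def double (T : HilbTheory.{u}) : CPM T ⥤ FHilb where
  obj X := T.space X.obj.obj ⊗ T.space X.obj.obj
  map Φ := Hom.dbl Φ
  map_id X := Hom.dbl_id X
  map_comp Φ Ψ := Hom.dbl_comp Φ Ψ

instance : (double T).Faithful where
  map_injective h := Hom.dbl_injective h

theorem double_mk {X Y : CPM T} (f : Dilation X.obj Y.obj) : (double T).map (mk f) = f.dbl := rfl

/-- The inclusion of the pure maps. -/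
def pure (T : HilbTheory.{u}) : T.Cat ⥤ CPM T where
  obj X := ⟨X⟩
  map f := mk (Dilation.pure f)
  map_id _ := rfl
  map_comp f g := (double T).map_injective <| by
    rw [Functor.map_comp]
    exact Dilation.dbl_pure_comp f g

theorem double_pure_perm {X Y : T.Cat} (e : (T.space X.obj).basis ≃ (T.space Y.obj).basis)
    (h : FHilb.perm e ∈ T.Mor X.obj Y.obj) :
    (double T).map ((pure T).map (permIso e h).hom) =
      (FHilb.perm e ⊗ₘ FHilb.perm e : T.space X.obj ⊗ T.space X.obj ⟶ _) := by
  refine (Dilation.dbl_pure _).trans ?_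
  exact congrArg (fun k => (FHilb.perm e ⊗ₘ k : T.space X.obj ⊗ T.space X.obj ⟶ _))
    (FHilb.conjugate_perm e)

instance : MonoidalCategoryStruct (CPM T) where
  tensorObj X Y := ⟨X.obj ⊗ Y.obj⟩
  tensorUnit := ⟨𝟙_ T.Cat⟩
  tensorHom Φ Ψ := Hom.tensor Φ Ψ
  whiskerLeft X _ _ Φ := Hom.tensor (𝟙 X) Φ
  whiskerRight Φ X := Hom.tensor Φ (𝟙 X)
  associator X Y Z := (pure T).mapIso (α_ X.obj Y.obj Z.obj)
  leftUnitor X := (pure T).mapIso (λ_ X.obj)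
  rightUnitor X := (pure T).mapIso (ρ_ X.obj)

/-- The middle swap that relates doubling and tensor products. -/
def doubleEquiv (X Y : T.Cat) :
    ((T.space X.obj).basis × (T.space X.obj).basis) ×
      ((T.space Y.obj).basis × (T.space Y.obj).basis) ≃
    (T.space (X ⊗ Y).obj).basis × (T.space (X ⊗ Y).obj).basis :=
  (Equiv.prodProdProdComm _ _ _ _).trans
    ((T.tensorEquiv X.obj Y.obj).symm.prodCongr (T.tensorEquiv X.obj Y.obj).symm)

def doubleμ (X Y : CPM T) :
    (double T).obj X ⊗ (double T).obj Y ≅ (double T).obj (X ⊗ Y) :=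
  FHilb.permIso (X := (double T).obj X ⊗ (double T).obj Y) (Y := (double T).obj (X ⊗ Y))
    (doubleEquiv X.obj Y.obj)

def doubleε : 𝟙_ FHilb ≅ (double T).obj (𝟙_ (CPM T)) :=
  FHilb.permIso (X := 𝟙_ FHilb) (Y := (double T).obj (𝟙_ (CPM T)))
    ((Equiv.punitProd Unit).symm.trans (T.unitEquiv.symm.prodCongr T.unitEquiv.symm))

open FHilb in
theorem dbl_tensor_eq {X Y X' Y' : T.Cat} (f : Dilation X Y) (g : Dilation X' Y') :
    (f.tensor g).dbl =
      perm (X := T.space (X ⊗ X').obj ⊗ T.space (X ⊗ X').obj)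
        (Y := (T.space X.obj ⊗ T.space X.obj) ⊗ (T.space X'.obj ⊗ T.space X'.obj))
        (doubleEquiv X X').symm ≫ (f.dbl ⊗ₘ g.dbl) ≫
      perm (Y := T.space (Y ⊗ Y').obj ⊗ T.space (Y ⊗ Y').obj)
        (X := (T.space Y.obj ⊗ T.space Y.obj) ⊗ (T.space Y'.obj ⊗ T.space Y'.obj))
        (doubleEquiv Y Y') := by
  refine (Dilation.dbl_tensor f g).trans ?_
  rw [T.μ_inv, T.μ_hom, perm_tensor, perm_tensor, tensorμ_perm, tensorμ_perm, ← Category.assoc,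
    perm_comp, perm_comp]
  rfl

theorem double_tensorHom {X Y X' Y' : CPM T} (Φ : X ⟶ Y) (Ψ : X' ⟶ Y') :
    (double T).map (Φ ⊗ₘ Ψ) =
      (doubleμ _ _).inv ≫ ((double T).map Φ ⊗ₘ (double T).map Ψ) ≫ (doubleμ _ _).hom := by
  obtain ⟨f, rfl⟩ := mk_surjective Φ
  obtain ⟨g, rfl⟩ := mk_surjective Ψ
  exact dbl_tensor_eq f g

/-- The doubled space of an object. -/
abbrev dblSpace (X : T.Cat) : FHilb := T.space X.obj ⊗ T.space X.obj

open FHilb in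
theorem double_assoc (X Y Z : T.Cat) :
    (perm (T.assocEquiv X.obj Y.obj Z.obj) ⊗ₘ perm (T.assocEquiv X.obj Y.obj Z.obj) :
      dblSpace ((X ⊗ Y) ⊗ Z) ⟶ dblSpace (X ⊗ (Y ⊗ Z))) =
    (perm (X := dblSpace ((X ⊗ Y) ⊗ Z)) (Y := dblSpace (X ⊗ Y) ⊗ dblSpace Z)
        (doubleEquiv (X ⊗ Y) Z).symm ≫
      ((perm (X := dblSpace (X ⊗ Y)) (Y := dblSpace X ⊗ dblSpace Y) (doubleEquiv X Y).symm) ⊗ₘ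
        𝟙 _)) ≫ (α_ _ _ _).hom ≫
      (𝟙 _ ⊗ₘ (perm (Y := dblSpace (Y ⊗ Z)) (X := dblSpace Y ⊗ dblSpace Z) (doubleEquiv Y Z))) ≫
      perm (Y := dblSpace (X ⊗ (Y ⊗ Z))) (X := dblSpace X ⊗ dblSpace (Y ⊗ Z))
        (doubleEquiv X (Y ⊗ Z)) := by
  simp only [id_tensorHom, tensorHom_id, FHilb.permIso_hom,
      associator_perm, whisker_perm, perm_whisker, perm_comp, perm_tensor]
  exact congrArg FHilb.perm (Equiv.ext fun x => rfl)

open FHilb in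
theorem double_leftUnit (X : T.Cat) :
    (perm (T.leftUnitEquiv X.obj) ⊗ₘ perm (T.leftUnitEquiv X.obj) :
      dblSpace (𝟙_ T.Cat ⊗ X) ⟶ dblSpace X) =
    (perm (X := dblSpace (𝟙_ T.Cat ⊗ X)) (Y := dblSpace (𝟙_ T.Cat) ⊗ dblSpace X)
        (doubleEquiv (𝟙_ T.Cat) X).symm ≫
      (perm (X := dblSpace (𝟙_ T.Cat)) (Y := 𝟙_ FHilb)
        ((Equiv.punitProd Unit).symm.trans (T.unitEquiv.symm.prodCongr T.unitEquiv.symm)).symm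
          ⊗ₘ 𝟙 _)) ≫ (λ_ _).hom := by
  simp only [tensorHom_id, FHilb.permIso_hom, leftUnitor_perm, perm_whisker, perm_comp, perm_tensor]
  exact congrArg FHilb.perm (Equiv.ext fun x => rfl)

open FHilb in
theorem double_rightUnit (X : T.Cat) :
    (perm (T.rightUnitEquiv X.obj) ⊗ₘ perm (T.rightUnitEquiv X.obj) :
      dblSpace (X ⊗ 𝟙_ T.Cat) ⟶ dblSpace X) =
    (perm (X := dblSpace (X ⊗ 𝟙_ T.Cat)) (Y := dblSpace X ⊗ dblSpace (𝟙_ T.Cat))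
        (doubleEquiv X (𝟙_ T.Cat)).symm ≫
      (𝟙 _ ⊗ₘ perm (X := dblSpace (𝟙_ T.Cat)) (Y := 𝟙_ FHilb)
        ((Equiv.punitProd Unit).symm.trans (T.unitEquiv.symm.prodCongr T.unitEquiv.symm)).symm))
          ≫ (ρ_ _).hom := by
  simp only [id_tensorHom, FHilb.permIso_hom, rightUnitor_perm, whisker_perm, perm_comp,
    perm_tensor]
  exact congrArg FHilb.perm (Equiv.ext fun x => rfl)

open FHilb in
theorem double_braiding (X Y : T.Cat) :
    perm (X := dblSpace X ⊗ dblSpace Y) (Y := dblSpace (X ⊗ Y)) (doubleEquiv X Y) ≫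
      (perm (T.swapEquiv X.obj Y.obj) ⊗ₘ perm (T.swapEquiv X.obj Y.obj) :
        dblSpace (X ⊗ Y) ⟶ dblSpace (Y ⊗ X)) =
    (β_ _ _).hom ≫
      perm (X := dblSpace Y ⊗ dblSpace X) (Y := dblSpace (Y ⊗ X)) (doubleEquiv Y X) := by
  simp only [FHilb.permIso_hom, braiding_perm, perm_comp, perm_tensor]
  refine congrArg FHilb.perm (Equiv.ext fun x => ?_)
  simp [doubleEquiv, TensorFamily.swapEquiv]

open FHilb in
/-- Doubling respects all the structure. -/
def doubleData (T : HilbTheory.{u}) : Monoidal.InducingFunctorData (double T) where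
  μIso X Y := doubleμ X Y
  εIso := doubleε
  whiskerLeft_eq X _ _ Φ := by
    rw [← id_tensorHom, ← (double T).map_id]
    exact double_tensorHom _ _
  whiskerRight_eq Φ X := by
    rw [← tensorHom_id, ← (double T).map_id]
    exact double_tensorHom _ _
  tensorHom_eq := double_tensorHom
  associator_eq X Y Z := by
    refine (double_pure_perm (T.assocEquiv X.obj.obj Y.obj.obj Z.obj.obj) (T.assoc_mem _ _ _)).trans ?_
    exact double_assoc X.obj Y.obj Z.obj
  leftUnitor_eq X := by
    refine (double_pure_perm (T.leftUnitEquiv X.obj.obj) (T.leftUnit_mem _)).trans ?_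
    exact double_leftUnit X.obj
  rightUnitor_eq X := by
    refine (double_pure_perm (T.rightUnitEquiv X.obj.obj) (T.rightUnit_mem _)).trans ?_
    exact double_rightUnit X.obj

instance : MonoidalCategory (CPM T) := Monoidal.induced (double T) (doubleData T)

instance : (double T).Monoidal := Monoidal.fromInducedMonoidal (double T) (doubleData T)

theorem swap_compat (X Y : CPM T) :
    (doubleμ X Y).hom ≫ (double T).map ((pure T).map (β_ X.obj Y.obj).hom) =
      (β_ ((double T).obj X) ((double T).obj Y)).hom ≫ (doubleμ Y X).hom :=
  (congrArg (fun k => (doubleμ X Y).hom ≫ k)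
    (double_pure_perm (T.swapEquiv X.obj.obj Y.obj.obj) (T.swap_mem _ _))).trans
    (double_braiding X.obj Y.obj)

instance : BraidedCategory (CPM T) :=
  BraidedCategory.ofFaithful (double T) (fun X Y => (pure T).mapIso (β_ X.obj Y.obj)) swap_compat

instance : (double T).Braided where
  braided X Y := swap_compat X Y

instance : SymmetricCategory (CPM T) := SymmetricCategory.ofFaithful (double T)

end CPM

namespace CPM
open HilbTheory
variable {T : HilbTheory.{u}}

/-- The abstract trace `[ε_X ∘ swap, X*] = [η_X†, X]`, as a dilation. -/
def trDilation (X : T.Cat) : Dilation X (𝟙_ T.Cat) :=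
  ⟨X, HilbTheory.adj ⟨T.cupMap X.obj, T.cup_mem X.obj⟩⟩

/-- The abstract trace `Tr_X : X ⟶ I`. -/
def tr (X : CPM T) : X ⟶ 𝟙_ (CPM T) := mk (Y := 𝟙_ (CPM T)) (trDilation X.obj)

/-- A morphism is causal when it preserves the abstract trace. -/
def causal (T : HilbTheory.{u}) : MorphismProperty (CPM T) := fun X Y Φ => Φ ≫ tr Y = tr X

open FHilb in
theorem adj_cup_apply {I X P : FHilb} (a : I.basis ≃ Unit) (b : P.basis ≃ X.basis × X.basis)
    (i : I.basis) (x s : X.basis) :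
    (perm (X := X ⊗ X) b.symm ≫
      adj (perm (Y := 𝟙_ FHilb) a ≫ cup X ≫ perm (X := X ⊗ X) b.symm)).mat i (x, s) =
      if x = s then 1 else 0 := by
  rw [perm_comp_apply]
  change star ((perm (Y := 𝟙_ FHilb) a ≫ cup X ≫ perm (X := X ⊗ X) b.symm).mat _ _) = _
  rw [perm_comp_apply, comp_perm_apply, Equiv.symm_symm, Equiv.apply_symm_apply]
  change star (if x = s then (1 : ℂ) else 0) = _
  simp [apply_ite]

open FHilb in
theorem double_adj_cup {I X : FHilb} (f : X ⊗ X ⟶ I)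
    (h : ∀ i x s, f.mat i (x, s) = if x = s then 1 else 0) (i i' : I.basis) (x x' : X.basis) :
    (FHilb.double f).mat (i, i') (x, x') = if x = x' then 1 else 0 := by
  rw [double_apply]
  simp only [h]
  rw [Finset.sum_eq_single x]
  · simp [eq_comm]
  · intro s _ hs
    simp [Ne.symm hs]
  · exact fun h => absurd (Finset.mem_univ _) h

theorem trDilation_dbl (X : T.Cat) (i i' : (T.space (𝟙_ T.Cat).obj).basis)
    (x x' : (T.space X.obj).basis) :
    (trDilation X).dbl.mat (i, i') (x, x') = if x = x' then 1 else 0 :=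
  double_adj_cup (trDilation X).under
    (fun i x s => adj_cup_apply T.unitEquiv (T.tensorEquiv X.obj X.obj) i x s) i i' x x'

open FHilb in
theorem comp_tr_apply {I X Y : FHilb} (f : X ⊗ X ⟶ Y ⊗ Y) (g : Y ⊗ Y ⟶ I ⊗ I)
    (h : ∀ i i' y y', g.mat (i, i') (y, y') = if y = y' then 1 else 0)
    (i i' : I.basis) (x x' : X.basis) :
    (f ≫ g).mat (i, i') (x, x') = ∑ y : Y.basis, f.mat (y, y) (x, x') := by
  rw [FHilb.comp_apply]
  refine (Fintype.sum_prod_type _).trans (Finset.sum_congr rfl fun y _ => ?_)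
  simp only [h]
  rw [Finset.sum_eq_single y]
  · simp
  · intro s _ hs
    simp [Ne.symm hs]
  · exact fun h => absurd (Finset.mem_univ _) h

theorem causal_iff {X Y : CPM T} (Φ : X ⟶ Y) : causal T Φ ↔
    ∀ x x' : (T.space X.obj.obj).basis,
      ∑ y : (T.space Y.obj.obj).basis, (Hom.dbl Φ).mat (y, y) (x, x') =
        if x = x' then 1 else 0 := by
  have key (i i' : (T.space (𝟙_ T.Cat).obj).basis) (x x' : (T.space X.obj.obj).basis) :
      (Hom.dbl (Φ ≫ tr Y)).mat (i, i') (x, x') =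
        ∑ y : (T.space Y.obj.obj).basis, (Hom.dbl Φ).mat (y, y) (x, x') :=
    (congrArg (fun k : dblSpace _ ⟶ dblSpace _ => k.mat (i, i') (x, x'))
      (Hom.dbl_comp Φ (tr Y))).trans
      (comp_tr_apply _ _ (fun i i' y y' => trDilation_dbl Y.obj i i' y y') i i' x x')
  constructor
  · intro h x x'
    have i : (T.space (𝟙_ T.Cat).obj).basis := T.unitEquiv.symm ()
    rw [← key i i, ← trDilation_dbl X.obj i i]
    exact congrArg (fun k => (Hom.dbl k).mat (i, i) (x, x')) h
  · intro h
    refine Hom.dbl_injective (FHilb.hom_ext ?_)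
    ext ⟨i, i'⟩ ⟨x, x'⟩
    exact (key i i' x x').trans ((h x x').trans (trDilation_dbl X.obj i i' x x').symm)

open FHilb in
theorem tr_perm {X Y : FHilb} (e : X.basis ≃ Y.basis) (x x' : X.basis) :
    ∑ y : Y.basis, ((perm e : X ⟶ Y) ⊗ₘ (perm e : X ⟶ Y)).mat (y, y) (x, x') =
      if x = x' then 1 else 0 := by
  simp only [tensorHom_apply, perm_apply]
  rw [Finset.sum_eq_single (e x)]
  · simp
  · intro s _ hs
    simp [hs]
  · exact fun h => absurd (Finset.mem_univ _) h

theorem causal_perm {X Y : T.Cat} (e : (T.space X.obj).basis ≃ (T.space Y.obj).basis)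
    (h : FHilb.perm e ∈ T.Mor X.obj Y.obj) : causal T ((pure T).map (permIso e h).hom) := by
  rw [causal_iff]
  intro x x'
  refine (Finset.sum_congr rfl fun y _ => ?_).trans (tr_perm e x x')
  exact congrArg (fun k : dblSpace _ ⟶ dblSpace _ => k.mat (y, y) (x, x')) (double_pure_perm e h)

theorem causal_perm_inv {X Y : T.Cat} (e : (T.space X.obj).basis ≃ (T.space Y.obj).basis)
    (h : FHilb.perm e ∈ T.Mor X.obj Y.obj) : causal T ((pure T).map (permIso e h).inv) :=
  causal_perm e.symm (permIso e h).inv.mem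

open FHilb in
theorem tr_tensor {X Y X' Y' P Q : FHilb} (f : X ⊗ X ⟶ Y ⊗ Y) (g : X' ⊗ X' ⟶ Y' ⊗ Y')
    (a : P.basis ≃ X.basis × X'.basis) (b : Q.basis ≃ Y.basis × Y'.basis)
    (hf : ∀ x x', ∑ y, f.mat (y, y) (x, x') = if x = x' then 1 else 0)
    (hg : ∀ x x', ∑ y, g.mat (y, y) (x, x') = if x = x' then 1 else 0) (r r' : P.basis) :
    ∑ q : Q.basis, f.mat ((b q).1, (b q).1) ((a r).1, (a r').1) *
      g.mat ((b q).2, (b q).2) ((a r).2, (a r').2) = if r = r' then 1 else 0 := by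
  rw [← b.symm.sum_comp]
  simp only [Equiv.apply_symm_apply]
  rw [Fintype.sum_prod_type]
  simp only
  rw [← Finset.sum_mul_sum, hf, hg]
  by_cases h : r = r'
  · simp [h]
  · have : ¬ ((a r).1 = (a r').1 ∧ (a r).2 = (a r').2) := fun k => h (a.injective (Prod.ext k.1 k.2))
    rw [if_neg h]
    by_cases k : (a r).1 = (a r').1
    · rw [if_neg (fun l => this ⟨k, l⟩), mul_zero]
    · rw [if_neg k, zero_mul]

open FHilb in
theorem conj_perm_apply {P P' Q Q' : FHilb} (a : P.basis ≃ P'.basis) (b : Q'.basis ≃ Q.basis)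
    (f : P' ⟶ Q') (q : Q.basis) (x : P.basis) :
    (perm a ≫ f ≫ perm b).mat q x = f.mat (b.symm q) (a x) := by
  rw [perm_comp_apply, comp_perm_apply]

theorem causal_tensor {X Y X' Y' : CPM T} (Φ : X ⟶ Y) (Ψ : X' ⟶ Y') (hΦ : causal T Φ)
    (hΨ : causal T Ψ) : causal T (Φ ⊗ₘ Ψ) := by
  rw [causal_iff] at *
  intro r r'
  refine (Finset.sum_congr rfl fun q _ => ?_).trans
    (tr_tensor (Hom.dbl Φ) (Hom.dbl Ψ) (T.tensorEquiv X.obj.obj X'.obj.obj)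
      (T.tensorEquiv Y.obj.obj Y'.obj.obj) hΦ hΨ r r')
  refine (congrArg (fun k : dblSpace _ ⟶ dblSpace _ => k.mat (q, q) (r, r'))
    (double_tensorHom Φ Ψ)).trans ?_
  exact conj_perm_apply _ _ _ _ _

instance : (causal T).IsMultiplicative where
  id_mem X := Category.id_comp _
  comp_mem Φ Ψ hΦ hΨ := by
    change (Φ ≫ Ψ) ≫ tr _ = tr _
    rw [Category.assoc, show Ψ ≫ tr _ = tr _ from hΨ]
    exact hΦ

instance : (causal T).IsStableUnderBraiding where
  whiskerLeft X _ _ Φ hΦ := by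
    rw [← id_tensorHom]
    exact causal_tensor _ _ ((causal T).id_mem X) hΦ
  whiskerRight Φ hΦ X := by
    rw [← tensorHom_id]
    exact causal_tensor _ _ hΦ ((causal T).id_mem X)
  associator_hom_mem _ _ _ := causal_perm _ _
  associator_inv_mem _ _ _ := causal_perm_inv _ _
  leftUnitor_hom_mem _ := causal_perm _ _
  leftUnitor_inv_mem _ := causal_perm_inv _ _
  rightUnitor_hom_mem _ := causal_perm _ _
  rightUnitor_inv_mem _ := causal_perm_inv _ _
  braiding_hom_mem _ _ := causal_perm _ _
  braiding_inv_mem _ _ := causal_perm_inv _ _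

end CPM

/-- The subcategory of causal morphisms. -/
abbrev Caus (T : HilbTheory.{u}) : Type u := WideSubcategory (CPM.causal T)

section Proj
universe v w v' w'
variable {C : Type w} [Category.{v} C] [MonoidalCategory C]
variable {D : Type w'} [Category.{v'} D] [MonoidalCategory D]

/-- Multiplication of a morphism by a scalar. -/
def scale (s : 𝟙_ C ⟶ 𝟙_ C) {X Y : C} (f : X ⟶ Y) : X ⟶ Y :=
  (λ_ X).inv ≫ (s ▷ X) ≫ (λ_ X).hom ≫ f

theorem scale_whiskerRight (s : 𝟙_ C ⟶ 𝟙_ C) {X Y : C} (f : X ⟶ Y) (Z : C) :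
    scale s f ▷ Z = scale s (f ▷ Z) := by
  simp only [scale, comp_whiskerRight]
  rw [leftUnitor_tensor_inv, leftUnitor_tensor_hom]
  simp

theorem scale_comp (s : 𝟙_ C ⟶ 𝟙_ C) {X Y Z : C} (f : X ⟶ Y) (g : Y ⟶ Z) :
    scale s f ≫ g = scale s (f ≫ g) := by
  simp [scale]

theorem comp_scale (s : 𝟙_ C ⟶ 𝟙_ C) {X Y Z : C} (f : X ⟶ Y) (g : Y ⟶ Z) :
    f ≫ scale s g = scale s (f ≫ g) := by
  simp only [scale]
  rw [leftUnitor_inv_naturality_assoc, whisker_exchange_assoc, leftUnitor_naturality_assoc]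

theorem whiskerLeft_scale [BraidedCategory C] (s : 𝟙_ C ⟶ 𝟙_ C) {X Y : C} (f : X ⟶ Y) (Z : C) :
    Z ◁ scale s f = scale s (Z ◁ f) := by
  have h {X Y : C} (g : X ⟶ Y) : Z ◁ g = (β_ Z X).hom ≫ g ▷ Z ≫ (β_ Z Y).inv := by
    rw [BraidedCategory.braiding_inv_naturality_left, Iso.hom_inv_id_assoc]
  rw [h, h, scale_whiskerRight, scale_comp, comp_scale]

theorem map_scale (F : C ⥤ D) [F.Monoidal] (s : 𝟙_ C ⟶ 𝟙_ C) {X Y : C} (f : X ⟶ Y) :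
    F.map (scale s f) =
      scale (Functor.LaxMonoidal.ε F ≫ F.map s ≫ Functor.OplaxMonoidal.η F) (F.map f) := by
  simp only [scale, Functor.map_comp, Functor.Monoidal.map_leftUnitor,
    Functor.Monoidal.map_leftUnitor_inv, Functor.Monoidal.map_whiskerRight, comp_whiskerRight,
    Category.assoc, Functor.Monoidal.μ_δ_assoc]

/-- Morphisms that differ by an invertible scalar. -/
def projRel (C : Type w) [Category.{v} C] [MonoidalCategory C] : HomRel C :=
  fun _ _ f g => ∃ s : 𝟙_ C ≅ 𝟙_ C, f = scale s.hom g

/-- The quotient of a symmetric monoidal category by its invertible scalars. -/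
abbrev Proj (C : Type w) [Category.{v} C] [MonoidalCategory C] : Type w :=
  CategoryTheory.Quotient (projRel C)

namespace Proj

/-- The quotient functor. -/
abbrev quot (C : Type w) [Category.{v} C] [MonoidalCategory C] : C ⥤ Proj C :=
  CategoryTheory.Quotient.functor (projRel C)

theorem map_sound (F : C ⥤ D) [F.Monoidal] ⦃X Y : C⦄ (f g : X ⟶ Y) (h : projRel C f g) :
    (F ⋙ quot D).map f = (F ⋙ quot D).map g := by
  obtain ⟨s, rfl⟩ := h
  exact CategoryTheory.Quotient.sound _ ⟨(Functor.Monoidal.εIso F) ≪≫ F.mapIso s ≪≫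
    (Functor.Monoidal.εIso F).symm, map_scale F s.hom g⟩

theorem quot_surj {X Y : Proj C} (f : X ⟶ Y) : ∃ g : X.as ⟶ Y.as, (quot C).map g = f :=
  (quot C).map_surjective f

variable [BraidedCategory C]

/-- Whiskering on the left. -/
def whiskerLeft (X : C) {Y Z : C} :
    ((quot C).obj Y ⟶ (quot C).obj Z) → ((quot C).obj (X ⊗ Y) ⟶ (quot C).obj (X ⊗ Z)) :=
  Quot.lift (fun f => (quot C).map (X ◁ f)) (by
    rintro _ _ ⟨A, B, a, m, m', b, s, rfl⟩
    refine CategoryTheory.Quotient.sound _ ⟨s, ?_⟩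
    rw [← whiskerLeft_scale, scale_comp, comp_scale])

/-- Whiskering on the right. -/
def whiskerRight (X : C) {Y Z : C} :
    ((quot C).obj Y ⟶ (quot C).obj Z) → ((quot C).obj (Y ⊗ X) ⟶ (quot C).obj (Z ⊗ X)) :=
  Quot.lift (fun f => (quot C).map (f ▷ X)) (by
    rintro _ _ ⟨A, B, a, m, m', b, s, rfl⟩
    refine CategoryTheory.Quotient.sound _ ⟨s, ?_⟩
    rw [← scale_whiskerRight, scale_comp, comp_scale])

instance : MonoidalCategoryStruct (Proj C) where
  tensorObj X Y := (quot C).obj (X.as ⊗ Y.as)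
  tensorUnit := (quot C).obj (𝟙_ C)
  tensorHom {_ Y Z _} f g :=
    whiskerRight Z.as f ≫ whiskerLeft Y.as g
  whiskerLeft X _ _ f := whiskerLeft X.as f
  whiskerRight f X := whiskerRight X.as f
  associator X Y Z := (quot C).mapIso (α_ X.as Y.as Z.as)
  leftUnitor X := (quot C).mapIso (λ_ X.as)
  rightUnitor X := (quot C).mapIso (ρ_ X.as)

theorem quot_tensorHom {X Y X' Y' : C} (f : X ⟶ Y) (g : X' ⟶ Y') :
    (quot C).map f ⊗ₘ (quot C).map g = (quot C).map (f ⊗ₘ g) := by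
  rw [tensorHom_def (C := C)]
  exact ((quot C).map_comp _ _).symm

instance : MonoidalCategory (Proj C) where
  tensorHom_def _ _ := rfl
  id_tensorHom_id X Y :=
    (quot_tensorHom (𝟙 X.as) (𝟙 Y.as)).trans (congrArg (quot C).map (id_tensorHom_id _ _))
  tensorHom_comp_tensorHom f g h k := by
    obtain ⟨f, rfl⟩ := quot_surj f
    obtain ⟨g, rfl⟩ := quot_surj g
    obtain ⟨h, rfl⟩ := quot_surj h
    obtain ⟨k, rfl⟩ := quot_surj k
    refine (congrArg₂ _ (quot_tensorHom f g) (quot_tensorHom h k)).trans ?_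
    refine Eq.trans ?_ (quot_tensorHom (f ≫ h) (g ≫ k)).symm
    rw [← tensorHom_comp_tensorHom]
    rfl
  whiskerLeft_id X Y := congrArg (quot C).map (MonoidalCategory.whiskerLeft_id X.as Y.as)
  id_whiskerRight X Y := congrArg (quot C).map (MonoidalCategory.id_whiskerRight X.as Y.as)
  associator_naturality f g h := by
    obtain ⟨f, rfl⟩ := quot_surj f
    obtain ⟨g, rfl⟩ := quot_surj g
    obtain ⟨h, rfl⟩ := quot_surj h
    have a : ((quot C).map f ⊗ₘ (quot C).map g) ⊗ₘ (quot C).map h =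
        (quot C).map ((f ⊗ₘ g) ⊗ₘ h) :=
      (congrArg (fun k => k ⊗ₘ (quot C).map h) (quot_tensorHom f g)).trans
        (quot_tensorHom (f ⊗ₘ g) h)
    have b : (quot C).map f ⊗ₘ ((quot C).map g ⊗ₘ (quot C).map h) =
        (quot C).map (f ⊗ₘ (g ⊗ₘ h)) :=
      (congrArg (fun k => (quot C).map f ⊗ₘ k) (quot_tensorHom g h)).trans
        (quot_tensorHom f (g ⊗ₘ h))
    refine (congrArg (fun k => k ≫ (quot C).map (α_ _ _ _).hom) a).trans ?_
    refine Eq.trans ?_ (congrArg (fun k => (quot C).map (α_ _ _ _).hom ≫ k) b).symm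
    exact congrArg (quot C).map (associator_naturality f g h)
  leftUnitor_naturality f := by
    obtain ⟨f, rfl⟩ := quot_surj f
    exact congrArg (quot C).map (leftUnitor_naturality f)
  rightUnitor_naturality f := by
    obtain ⟨f, rfl⟩ := quot_surj f
    exact congrArg (quot C).map (rightUnitor_naturality f)
  pentagon W X Y Z := congrArg (quot C).map (pentagon W.as X.as Y.as Z.as)
  triangle X Y := congrArg (quot C).map (triangle X.as Y.as)

instance : BraidedCategory (Proj C) where
  braiding X Y := (quot C).mapIso (β_ X.as Y.as)
  braiding_naturality_right X Y Z f := by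
    obtain ⟨f, rfl⟩ := quot_surj f
    exact congrArg (quot C).map (BraidedCategory.braiding_naturality_right X.as f)
  braiding_naturality_left f Z := by
    obtain ⟨f, rfl⟩ := quot_surj f
    exact congrArg (quot C).map (BraidedCategory.braiding_naturality_left f Z.as)
  hexagon_forward X Y Z :=
    congrArg (quot C).map (BraidedCategory.hexagon_forward X.as Y.as Z.as)
  hexagon_reverse X Y Z :=
    congrArg (quot C).map (BraidedCategory.hexagon_reverse X.as Y.as Z.as)

instance {C : Type w} [Category.{v} C] [MonoidalCategory C] [SymmetricCategory C] :
    SymmetricCategory (Proj C) where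
  symmetry X Y := congrArg (quot C).map (SymmetricCategory.symmetry X.as Y.as)

instance : (quot C).Monoidal := Functor.CoreMonoidal.toMonoidal
  { εIso := Iso.refl _
    μIso _ _ := Iso.refl _
    μIso_hom_natural_left f X' := (Category.comp_id _).trans (Category.id_comp _).symm
    μIso_hom_natural_right X' f := (Category.comp_id _).trans (Category.id_comp _).symm
    associativity X Y Z := congrArg (quot C).map (show 𝟙 (X ⊗ Y) ▷ Z ≫ 𝟙 _ ≫ (α_ X Y Z).hom =
      (α_ X Y Z).hom ≫ X ◁ 𝟙 (Y ⊗ Z) ≫ 𝟙 _ by simp)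
    left_unitality X := congrArg (quot C).map (show (λ_ X).hom =
      𝟙 (𝟙_ C) ▷ X ≫ 𝟙 _ ≫ (λ_ X).hom by simp)
    right_unitality X := congrArg (quot C).map (show (ρ_ X).hom =
      X ◁ 𝟙 (𝟙_ C) ≫ 𝟙 _ ≫ (ρ_ X).hom by simp) }

instance : (quot C).Braided where
  braided X Y := congrArg (quot C).map (show 𝟙 (X ⊗ Y) ≫ (β_ X Y).hom =
    (β_ X Y).hom ≫ 𝟙 (Y ⊗ X) by simp)

end Proj
end Proj

section Wide
universe v w v' w'
variable {C : Type w} [Category.{v} C] {D : Type w'} [Category.{v'} D]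

/-- The restriction of a functor to wide subcategories. -/
def restrictWide (F : C ⥤ D) (P : MorphismProperty C) (Q : MorphismProperty D)
    [P.IsMultiplicative] [Q.IsMultiplicative] (h : ∀ ⦃X Y : C⦄ (f : X ⟶ Y), P f → Q (F.map f)) :
    WideSubcategory P ⥤ WideSubcategory Q where
  obj X := ⟨F.obj X.obj⟩
  map f := ⟨F.map f.hom, h _ f.property⟩
  map_id X := WideSubcategory.hom_ext _ (F.map_id _)
  map_comp f g := WideSubcategory.hom_ext _ (F.map_comp _ _)

variable [MonoidalCategory C] [BraidedCategory C]

instance (P : MorphismProperty C) [P.IsStableUnderBraiding] :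
    (wideSubcategoryInclusion P).Monoidal :=
  Monoidal.fromInducedMonoidal (wideSubcategoryInclusion P)
    { εIso := Iso.refl _
      μIso _ _ := Iso.refl _ }

instance (P : MorphismProperty C) [P.IsStableUnderBraiding] :
    (wideSubcategoryInclusion P).Braided where
  braided X Y := (Category.id_comp (β_ X.obj Y.obj).hom).trans
    (Category.comp_id (β_ X.obj Y.obj).hom).symm

end Wide

/-- Two composites of monoidal functors agree up to a monoidal natural isomorphism. -/
def MonoidallyIso {C D : Type*} [Category* C] [Category* D] [MonoidalCategory C]
    [MonoidalCategory D] (F G : C ⥤ D) [F.LaxMonoidal] [G.LaxMonoidal] : Prop :=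
  ∃ e : F ≅ G, NatTrans.IsMonoidal e.hom

/-- The matrix algebra `M_n(ℂ)`, where `n` is the basis of a finite-dimensional Hilbert space. -/
@[ext]
structure MatAlg : Type 1 where
  space : FHilb

namespace MatAlg
open scoped Matrix.Norms.L2Operator MatrixOrder CStarAlgebra ComplexOrder

/-- The underlying algebra. -/
abbrev alg (X : MatAlg) : Type := Matrix X.space.basis X.space.basis ℂ

theorem nonneg_iff_star_mul {A : Type} [NonUnitalCStarAlgebra A] [PartialOrder A]
    [StarOrderedRing A] (a : A) : 0 ≤ a ↔ ∃ b, a = star b * b :=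
  CStarAlgebra.nonneg_iff_eq_star_mul_self

theorem nonneg_iff {k X : Type} [Fintype k] [DecidableEq k] [Fintype X] [DecidableEq X]
    (M : CStarMatrix k k (Matrix X X ℂ)) :
    0 ≤ M ↔ (Matrix.comp k k X X ℂ (CStarMatrix.ofMatrix.symm M)).PosSemidef := by
  refine (nonneg_iff_star_mul M).trans ?_
  rw [← Matrix.nonneg_iff_posSemidef, CStarAlgebra.nonneg_iff_eq_star_mul_self]
  have h (B : Matrix k k (Matrix X X ℂ)) : Matrix.comp k k X X ℂ (star B * B) =
      star (Matrix.comp k k X X ℂ B) * Matrix.comp k k X X ℂ B :=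
    ((Matrix.compRingEquiv k X ℂ).map_mul (star B) B).trans rfl
  constructor
  · rintro ⟨B, rfl⟩
    exact ⟨_, h B⟩
  · rintro ⟨B, hB⟩
    refine ⟨CStarMatrix.ofMatrix ((Matrix.comp k k X X ℂ).symm B), ?_⟩
    apply (Matrix.comp k k X X ℂ).injective
    refine hB.trans ?_
    refine Eq.trans ?_ (h ((Matrix.comp k k X X ℂ).symm B)).symm
    rw [Equiv.apply_symm_apply]

/-- Completely positive maps between matrix algebras. -/
abbrev Hom (X Y : MatAlg) : Type := X.alg →CP Y.alg

theorem Hom.ext' {X Y : MatAlg} {Φ Ψ : Hom X Y} (h : ∀ M, Φ M = Ψ M) : Φ = Ψ := DFunLike.ext _ _ h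

/-- Complete positivity as positivity of all amplifications. -/
def ofPos {X Y : MatAlg} (Φ : X.alg →ₗ[ℂ] Y.alg)
    (h : ∀ (k : Type) [Fintype k] [DecidableEq k] (M : Matrix k k X.alg),
      (Matrix.comp k k _ _ ℂ M).PosSemidef →
        (Matrix.comp k k _ _ ℂ (M.map Φ)).PosSemidef) : Hom X Y where
  toLinearMap := Φ
  map_cstarMatrix_nonneg' k M hM := (nonneg_iff _).2 (h (Fin k) M ((nonneg_iff M).1 hM))

theorem Hom.pos {X Y : MatAlg} (Φ : Hom X Y) (k : Type) [Fintype k] [DecidableEq k]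
    (M : Matrix k k X.alg) (h : (Matrix.comp k k _ _ ℂ M).PosSemidef) :
    (Matrix.comp k k _ _ ℂ (M.map Φ)).PosSemidef :=
  (nonneg_iff _).1 (Φ.map_cstarMatrix_nonneg (CStarMatrix.ofMatrix M) ((nonneg_iff _).2 h))

instance : Category MatAlg where
  Hom X Y := Hom X Y
  id X := ofPos LinearMap.id (fun _ _ _ _ h => h)
  comp {X Y Z} Φ Ψ := ofPos ((Ψ : Y.alg →ₗ[ℂ] Z.alg) ∘ₗ (Φ : X.alg →ₗ[ℂ] Y.alg))
    (fun k _ _ M h => Hom.pos Ψ k _ (Hom.pos Φ k M h))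

/-- The underlying linear map. -/
def lin {X Y : MatAlg} (Φ : X ⟶ Y) : X.alg →ₗ[ℂ] Y.alg := CompletelyPositiveMap.toLinearMap Φ

theorem lin_injective {X Y : MatAlg} {Φ Ψ : X ⟶ Y} (h : lin Φ = lin Ψ) : Φ = Ψ :=
  Hom.ext' (fun M => LinearMap.congr_fun h M)

theorem lin_id (X : MatAlg) : lin (𝟙 X) = LinearMap.id := rfl
theorem lin_comp {X Y Z : MatAlg} (Φ : X ⟶ Y) (Ψ : Y ⟶ Z) : lin (Φ ≫ Ψ) = lin Ψ ∘ₗ lin Φ := rfl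

/-- Relabelling along a bijection of bases. -/
def relabel {X Y : MatAlg} (e : X.space.basis ≃ Y.space.basis) : X ⟶ Y :=
  ofPos (Matrix.reindexLinearEquiv ℂ ℂ e e).toLinearMap (fun k _ _ _ h =>
    h.submatrix (Prod.map (id : k → k) e.symm))

theorem relabel_apply {X Y : MatAlg} (e : X.space.basis ≃ Y.space.basis) (M : X.alg) (y y') :
    lin (relabel e) M y y' = M (e.symm y) (e.symm y') := rfl

/-- The isomorphism given by a relabelling. -/
def relabelIso {X Y : MatAlg} (e : X.space.basis ≃ Y.space.basis) : X ≅ Y where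
  hom := relabel e
  inv := relabel e.symm
  hom_inv_id := lin_injective (LinearMap.ext fun M => by
    ext x x'
    exact congrArg₂ M (e.symm_apply_apply x) (e.symm_apply_apply x'))
  inv_hom_id := lin_injective (LinearMap.ext fun M => by
    ext x x'
    exact congrArg₂ M (e.apply_symm_apply x) (e.apply_symm_apply x'))

/-- The amplification `1 ⊗ Φ`. -/
def ampLin (R : FHilb) {X Y : MatAlg} (Φ : X.alg →ₗ[ℂ] Y.alg) :
    alg ⟨R ⊗ X.space⟩ →ₗ[ℂ] alg ⟨R ⊗ Y.space⟩ where
  toFun M := Matrix.of fun (a b : R.basis × Y.space.basis) =>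
    Φ (Matrix.of fun x x' => M (a.1, x) (b.1, x')) a.2 b.2
  map_add' M N := by
    ext a b
    exact congrArg (fun K : Y.alg => K a.2 b.2) (Φ.map_add
      (Matrix.of fun x x' => M (a.1, x) (b.1, x')) (Matrix.of fun x x' => N (a.1, x) (b.1, x')))
  map_smul' c M := by
    ext a b
    exact congrArg (fun K : Y.alg => K a.2 b.2) (Φ.map_smul c
      (Matrix.of fun x x' => M (a.1, x) (b.1, x')))

theorem ampLin_apply (R : FHilb) {X Y : MatAlg} (Φ : X.alg →ₗ[ℂ] Y.alg)
    (M : alg ⟨R ⊗ X.space⟩) (r r' : R.basis) (y y' : Y.space.basis) :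
    ampLin R Φ M (r, y) (r', y') = Φ (Matrix.of fun x x' => M (r, x) (r', x')) y y' := rfl

/-- The amplification `1 ⊗ Φ` of a completely positive map. -/
def amp (R : FHilb) {X Y : MatAlg} (Φ : X ⟶ Y) : (⟨R ⊗ X.space⟩ : MatAlg) ⟶ ⟨R ⊗ Y.space⟩ :=
  ofPos (ampLin R (lin Φ)) (fun k _ _ M h => by
    have h1 := Hom.pos Φ (k × R.basis) (Matrix.of fun a b => Matrix.of fun x x' =>
      M a.1 b.1 (a.2, x) (b.2, x')) (h.submatrix (Equiv.prodAssoc k R.basis X.space.basis))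
    exact h1.submatrix (Equiv.prodAssoc k R.basis Y.space.basis).symm)

/-- The flip `M_(X ⊗ Y) ⟶ M_(Y ⊗ X)`. -/
def flip (X Y : FHilb) : (⟨X ⊗ Y⟩ : MatAlg) ⟶ ⟨Y ⊗ X⟩ :=
  relabel (X := ⟨X ⊗ Y⟩) (Y := ⟨Y ⊗ X⟩) (Equiv.prodComm X.basis Y.basis)

/-- The tensor product of completely positive maps, as `(Φ ⊗ 1) ∘ (1 ⊗ Ψ)`. -/
def tensor {X Y X' Y' : MatAlg} (Φ : X ⟶ Y) (Ψ : X' ⟶ Y') :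
    (⟨X.space ⊗ X'.space⟩ : MatAlg) ⟶ ⟨Y.space ⊗ Y'.space⟩ :=
  amp X.space Ψ ≫ flip X.space Y'.space ≫ amp Y'.space Φ ≫ flip Y'.space Y.space

theorem tensor_apply {X Y X' Y' : MatAlg} (Φ : X ⟶ Y) (Ψ : X' ⟶ Y')
    (M : alg ⟨X.space ⊗ X'.space⟩) (y w : Y.space.basis) (y' w' : Y'.space.basis) :
    lin (tensor Φ Ψ) M (y, y') (w, w') = lin Φ (Matrix.of fun x z =>
      lin Ψ (Matrix.of fun x' z' => M (x, x') (z, z')) y' w') y w := rfl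

/-- The matrix of a completely positive map with respect to the matrix units. -/
def supMap {X Y : MatAlg} (Φ : X ⟶ Y) : X.space ⊗ X.space ⟶ Y.space ⊗ Y.space :=
  ⟨Matrix.of fun (y : Y.space.basis × Y.space.basis) (x : X.space.basis × X.space.basis) =>
    lin Φ (Matrix.single x.1 x.2 1) y.1 y.2⟩

theorem lin_apply {X Y : MatAlg} (Φ : X ⟶ Y) (M : X.alg) (y y' : Y.space.basis) :
    lin Φ M y y' = ∑ x : X.space.basis, ∑ x' : X.space.basis,
      (supMap Φ).mat (y, y') (x, x') * M x x' := by
  conv_lhs => rw [Matrix.matrix_eq_sum_single M]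
  simp only [map_sum, Matrix.sum_apply]
  refine Finset.sum_congr rfl fun x _ => Finset.sum_congr rfl fun x' _ => ?_
  have : Matrix.single x x' (M x x') = M x x' • Matrix.single x x' (1 : ℂ) := by
    rw [Matrix.smul_single, smul_eq_mul, mul_one]
  rw [this, map_smul, Matrix.smul_apply, smul_eq_mul, mul_comm]
  rfl

theorem supMap_injective {X Y : MatAlg} {Φ Ψ : X ⟶ Y} (h : supMap Φ = supMap Ψ) : Φ = Ψ :=
  lin_injective (LinearMap.ext fun M => by
    ext y y'
    rw [lin_apply, lin_apply, h])

theorem supMap_id (X : MatAlg) : supMap (𝟙 X) = 𝟙 _ := by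
  ext ⟨y, y'⟩ ⟨x, x'⟩
  change Matrix.single x x' (1 : ℂ) y y' = (1 : Matrix (X.space.basis × X.space.basis)
    (X.space.basis × X.space.basis) ℂ) (y, y') (x, x')
  simp [Matrix.single_apply, Matrix.one_apply, Prod.ext_iff, eq_comm]

theorem supMap_comp {X Y Z : MatAlg} (Φ : X ⟶ Y) (Ψ : Y ⟶ Z) :
    supMap (Φ ≫ Ψ) = supMap Φ ≫ supMap Ψ := by
  ext ⟨z, z'⟩ ⟨x, x'⟩
  refine Eq.trans ?_ (FHilb.comp_apply _ _ _ _).symm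
  refine Eq.trans ?_ (Fintype.sum_prod_type _).symm
  exact lin_apply Ψ (lin Φ (Matrix.single x x' 1)) z z'

/-- The matrix of a completely positive map, as a functor. -/
def sup : MatAlg ⥤ FHilb where
  obj X := X.space ⊗ X.space
  map Φ := supMap Φ
  map_id := supMap_id
  map_comp := supMap_comp

instance : sup.Faithful where
  map_injective h := supMap_injective h

instance : MonoidalCategoryStruct MatAlg where
  tensorObj X Y := ⟨X.space ⊗ Y.space⟩
  tensorUnit := ⟨𝟙_ FHilb⟩
  tensorHom Φ Ψ := tensor Φ Ψ
  whiskerLeft X _ _ Φ := tensor (𝟙 X) Φ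
  whiskerRight Φ X := tensor Φ (𝟙 X)
  associator X Y Z := relabelIso (X := ⟨(X.space ⊗ Y.space) ⊗ Z.space⟩)
    (Y := ⟨X.space ⊗ (Y.space ⊗ Z.space)⟩)
    (Equiv.prodAssoc X.space.basis Y.space.basis Z.space.basis)
  leftUnitor X := relabelIso (X := ⟨𝟙_ FHilb ⊗ X.space⟩) (Y := X)
    (Equiv.punitProd X.space.basis)
  rightUnitor X := relabelIso (X := ⟨X.space ⊗ 𝟙_ FHilb⟩) (Y := X)
    (Equiv.prodPUnit X.space.basis)

theorem supMap_relabel {X Y : MatAlg} (e : X.space.basis ≃ Y.space.basis) :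
    supMap (relabel e) =
      (FHilb.perm e ⊗ₘ FHilb.perm e : X.space ⊗ X.space ⟶ Y.space ⊗ Y.space) := by
  ext ⟨y, y'⟩ ⟨x, x'⟩
  rw [FHilb.tensorHom_apply, FHilb.perm_apply, FHilb.perm_apply]
  change Matrix.single x x' (1 : ℂ) (e.symm y) (e.symm y') = _
  have h (a : X.space.basis) (b : Y.space.basis) : (b = e a) = (a = e.symm b) := by
    rw [Equiv.eq_symm_apply, @eq_comm _ b (e a)]
  simp only [Matrix.single_apply, h, ite_and, ite_mul, one_mul, zero_mul]

/-- The middle swap. -/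
def supμ (X Y : MatAlg) : sup.obj X ⊗ sup.obj Y ≅ sup.obj (X ⊗ Y) :=
  FHilb.permIso (X := sup.obj X ⊗ sup.obj Y) (Y := sup.obj (X ⊗ Y))
    (Equiv.prodProdProdComm X.space.basis X.space.basis Y.space.basis Y.space.basis)

def supε : 𝟙_ FHilb ≅ sup.obj (𝟙_ MatAlg) :=
  FHilb.permIso (X := 𝟙_ FHilb) (Y := sup.obj (𝟙_ MatAlg)) (Equiv.punitProd Unit).symm

theorem supMap_tensor {X Y X' Y' : MatAlg} (Φ : X ⟶ Y) (Ψ : X' ⟶ Y') :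
    supMap (tensor Φ Ψ) = (supμ X X').inv ≫ (supMap Φ ⊗ₘ supMap Ψ) ≫ (supμ Y Y').hom := by
  ext ⟨⟨y, y'⟩, ⟨w, w'⟩⟩ ⟨⟨x, x'⟩, ⟨z, z'⟩⟩
  refine Eq.trans ?_ (CPM.conj_perm_apply _ _ _ _ _).symm
  change _ = lin Φ (Matrix.single x z 1) y w * lin Ψ (Matrix.single x' z' 1) y' w'
  refine (tensor_apply Φ Ψ (Matrix.single (x, x') (z, z') 1) y w y' w').trans ?_
  have h : (Matrix.of fun a c => lin Ψ (Matrix.of fun a' c' =>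
      (Matrix.single (x, x') (z, z') (1 : ℂ)) (a, a') (c, c')) y' w') =
      lin Ψ (Matrix.single x' z' 1) y' w' • (Matrix.single x z 1 : X.alg) := by
    ext a c
    have h' : (Matrix.of fun a' c' => (Matrix.single (x, x') (z, z') (1 : ℂ)) (a, a') (c, c')) =
        (Matrix.single x z (1 : ℂ) a c) • (Matrix.single x' z' 1 : X'.alg) := by
      ext a' c'
      by_cases h1 : x = a <;> by_cases h2 : z = c <;> by_cases h3 : x' = a' <;>
        by_cases h4 : z' = c' <;> simp [Matrix.single_apply, h1, h2, h3, h4]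
    rw [Matrix.of_apply, h', map_smul, Matrix.smul_apply, Matrix.smul_apply, smul_eq_mul,
      smul_eq_mul, mul_comm]
  rw [h, map_smul, Matrix.smul_apply, smul_eq_mul, mul_comm]

open FHilb in
theorem sup_assoc (X Y Z : FHilb) :
    (perm (Equiv.prodAssoc X.basis Y.basis Z.basis) ⊗ₘ
        perm (Equiv.prodAssoc X.basis Y.basis Z.basis) :
      ((X ⊗ Y) ⊗ Z) ⊗ ((X ⊗ Y) ⊗ Z) ⟶ (X ⊗ (Y ⊗ Z)) ⊗ (X ⊗ (Y ⊗ Z))) =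
    (perm (X := ((X ⊗ Y) ⊗ Z) ⊗ ((X ⊗ Y) ⊗ Z)) (Y := ((X ⊗ Y) ⊗ (X ⊗ Y)) ⊗ (Z ⊗ Z))
        (Equiv.prodProdProdComm (X.basis × Y.basis) (X.basis × Y.basis) Z.basis Z.basis).symm ≫
      ((perm (X := (X ⊗ Y) ⊗ (X ⊗ Y)) (Y := (X ⊗ X) ⊗ (Y ⊗ Y))
        (Equiv.prodProdProdComm X.basis X.basis Y.basis Y.basis).symm) ⊗ₘ 𝟙 _)) ≫
      (α_ _ _ _).hom ≫
      (𝟙 _ ⊗ₘ (perm (X := (Y ⊗ Y) ⊗ (Z ⊗ Z)) (Y := (Y ⊗ Z) ⊗ (Y ⊗ Z))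
        (Equiv.prodProdProdComm Y.basis Y.basis Z.basis Z.basis))) ≫
      perm (X := (X ⊗ X) ⊗ ((Y ⊗ Z) ⊗ (Y ⊗ Z))) (Y := (X ⊗ (Y ⊗ Z)) ⊗ (X ⊗ (Y ⊗ Z)))
        (Equiv.prodProdProdComm X.basis X.basis (Y.basis × Z.basis) (Y.basis × Z.basis)) := by
  simp only [id_tensorHom, tensorHom_id, permIso_hom, associator_perm, whisker_perm, perm_whisker,
    perm_comp, perm_tensor]
  exact congrArg FHilb.perm (Equiv.ext fun x => rfl)

open FHilb in
theorem sup_leftUnit (X : FHilb) :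
    (perm (Equiv.punitProd X.basis) ⊗ₘ perm (Equiv.punitProd X.basis) :
      (𝟙_ FHilb ⊗ X) ⊗ (𝟙_ FHilb ⊗ X) ⟶ X ⊗ X) =
    (perm (X := (𝟙_ FHilb ⊗ X) ⊗ (𝟙_ FHilb ⊗ X)) (Y := (𝟙_ FHilb ⊗ 𝟙_ FHilb) ⊗ (X ⊗ X))
        (Equiv.prodProdProdComm Unit Unit X.basis X.basis).symm ≫
      (perm (X := 𝟙_ FHilb ⊗ 𝟙_ FHilb) (Y := 𝟙_ FHilb) (Equiv.punitProd Unit) ⊗ₘ 𝟙 _)) ≫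
        (λ_ _).hom := by
  simp only [tensorHom_id, permIso_hom, leftUnitor_perm, perm_whisker, perm_comp, perm_tensor]
  exact congrArg FHilb.perm (Equiv.ext fun x => rfl)

open FHilb in
theorem sup_rightUnit (X : FHilb) :
    (perm (Equiv.prodPUnit X.basis) ⊗ₘ perm (Equiv.prodPUnit X.basis) :
      (X ⊗ 𝟙_ FHilb) ⊗ (X ⊗ 𝟙_ FHilb) ⟶ X ⊗ X) =
    (perm (X := (X ⊗ 𝟙_ FHilb) ⊗ (X ⊗ 𝟙_ FHilb)) (Y := (X ⊗ X) ⊗ (𝟙_ FHilb ⊗ 𝟙_ FHilb))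
        (Equiv.prodProdProdComm X.basis X.basis Unit Unit).symm ≫
      (𝟙 _ ⊗ₘ perm (X := 𝟙_ FHilb ⊗ 𝟙_ FHilb) (Y := 𝟙_ FHilb) (Equiv.punitProd Unit))) ≫
        (ρ_ _).hom := by
  simp only [id_tensorHom, permIso_hom, rightUnitor_perm, whisker_perm, perm_comp, perm_tensor]
  exact congrArg FHilb.perm (Equiv.ext fun x => rfl)

open FHilb in
theorem sup_braiding (X Y : FHilb) :
    perm (X := (X ⊗ X) ⊗ (Y ⊗ Y)) (Y := (X ⊗ Y) ⊗ (X ⊗ Y))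
        (Equiv.prodProdProdComm X.basis X.basis Y.basis Y.basis) ≫
      (perm (Equiv.prodComm X.basis Y.basis) ⊗ₘ perm (Equiv.prodComm X.basis Y.basis) :
        (X ⊗ Y) ⊗ (X ⊗ Y) ⟶ (Y ⊗ X) ⊗ (Y ⊗ X)) =
    (β_ _ _).hom ≫
      perm (X := (Y ⊗ Y) ⊗ (X ⊗ X)) (Y := (Y ⊗ X) ⊗ (Y ⊗ X))
        (Equiv.prodProdProdComm Y.basis Y.basis X.basis X.basis) := by
  simp only [permIso_hom, braiding_perm, perm_comp, perm_tensor]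
  exact congrArg FHilb.perm (Equiv.ext fun x => rfl)

open FHilb in
/-- The matrix functor respects all the structure. -/
def supData : Monoidal.InducingFunctorData sup where
  μIso := supμ
  εIso := supε
  whiskerLeft_eq X _ _ Φ := by
    rw [← id_tensorHom, ← sup.map_id]
    exact supMap_tensor _ _
  whiskerRight_eq Φ X := by
    rw [← tensorHom_id, ← sup.map_id]
    exact supMap_tensor _ _
  tensorHom_eq := supMap_tensor
  associator_eq X Y Z := by
    refine (supMap_relabel (X := ⟨(X.space ⊗ Y.space) ⊗ Z.space⟩)
      (Y := ⟨X.space ⊗ (Y.space ⊗ Z.space)⟩)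
      (Equiv.prodAssoc X.space.basis Y.space.basis Z.space.basis)).trans ?_
    exact sup_assoc X.space Y.space Z.space
  leftUnitor_eq X := by
    refine (supMap_relabel (X := ⟨𝟙_ FHilb ⊗ X.space⟩) (Y := X)
      (Equiv.punitProd X.space.basis)).trans ?_
    exact sup_leftUnit X.space
  rightUnitor_eq X := by
    refine (supMap_relabel (X := ⟨X.space ⊗ 𝟙_ FHilb⟩) (Y := X)
      (Equiv.prodPUnit X.space.basis)).trans ?_
    exact sup_rightUnit X.space

instance : MonoidalCategory MatAlg := Monoidal.induced sup supData

instance : sup.Monoidal := Monoidal.fromInducedMonoidal sup supData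

theorem swap_compat (X Y : MatAlg) :
    (supμ X Y).hom ≫ sup.map (relabelIso (X := X ⊗ Y) (Y := Y ⊗ X)
        (Equiv.prodComm X.space.basis Y.space.basis)).hom =
      (β_ (sup.obj X) (sup.obj Y)).hom ≫ (supμ Y X).hom :=
  (congrArg (fun k => (supμ X Y).hom ≫ k)
    (supMap_relabel (X := X ⊗ Y) (Y := Y ⊗ X)
      (Equiv.prodComm X.space.basis Y.space.basis))).trans (sup_braiding X.space Y.space)

instance : BraidedCategory MatAlg :=
  BraidedCategory.ofFaithful sup (fun X Y => relabelIso (X := X ⊗ Y) (Y := Y ⊗ X)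
    (Equiv.prodComm X.space.basis Y.space.basis)) swap_compat

instance : sup.Braided where
  braided X Y := swap_compat X Y

instance : SymmetricCategory MatAlg := SymmetricCategory.ofFaithful sup

/-- The trace-preserving completely positive maps. -/
def tracePreserving : MorphismProperty MatAlg :=
  fun _ _ Φ => ∀ M, (lin Φ M).trace = M.trace

theorem relabel_trace {X Y : MatAlg} (e : X.space.basis ≃ Y.space.basis) :
    tracePreserving (relabel e) := fun M =>
  Equiv.sum_comp e.symm (fun x => M x x)

theorem amp_trace (R : FHilb) {X Y : MatAlg} (Φ : X ⟶ Y) (h : tracePreserving Φ) :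
    tracePreserving (amp R Φ) := fun M => by
  refine (Fintype.sum_prod_type _).trans (Eq.trans ?_ (Fintype.sum_prod_type _).symm)
  exact Finset.sum_congr rfl fun r _ => h (Matrix.of fun x x' => M (r, x) (r, x'))

instance : tracePreserving.IsMultiplicative where
  id_mem X := fun _ => rfl
  comp_mem Φ Ψ h k := fun M => (k (lin Φ M)).trans (h M)

theorem tensor_trace {X Y X' Y' : MatAlg} (Φ : X ⟶ Y) (Ψ : X' ⟶ Y') (h : tracePreserving Φ)
    (k : tracePreserving Ψ) : tracePreserving (tensor Φ Ψ) :=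
  tracePreserving.comp_mem _ _ (amp_trace _ _ k) <|
    tracePreserving.comp_mem _ _ (relabel_trace _) <|
    tracePreserving.comp_mem _ _ (amp_trace _ _ h) (relabel_trace _)

instance : tracePreserving.IsStableUnderBraiding where
  whiskerLeft X _ _ Φ h := tensor_trace _ _ (tracePreserving.id_mem X) h
  whiskerRight Φ h X := tensor_trace _ _ h (tracePreserving.id_mem X)
  associator_hom_mem _ _ _ := relabel_trace _
  associator_inv_mem _ _ _ := relabel_trace _
  leftUnitor_hom_mem _ := relabel_trace _
  leftUnitor_inv_mem _ := relabel_trace _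
  rightUnitor_hom_mem _ := relabel_trace _
  rightUnitor_inv_mem _ := relabel_trace _
  braiding_hom_mem _ _ := relabel_trace _
  braiding_inv_mem _ _ := relabel_trace _

end MatAlg

/-- Completely positive trace-preserving maps between matrix algebras. -/
abbrev CPTP : Type 1 := WideSubcategory MatAlg.tracePreserving

/-- All finite-dimensional Hilbert spaces and all linear maps. -/
def HilbTheory.full : HilbTheory.{1} where
  Obj := FHilb
  space X := X
  unit := 𝟙_ FHilb
  tensor X Y := X ⊗ Y
  unitEquiv := Equiv.refl Unit
  tensorEquiv X Y := Equiv.refl (X.basis × Y.basis)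
  Mor _ _ := Set.univ
  id_mem _ := trivial
  comp_mem _ _ := trivial
  adj_mem _ := trivial
  tensor_mem _ _ := trivial
  assoc_mem _ _ _ := trivial
  leftUnit_mem _ := trivial
  rightUnit_mem _ := trivial
  swap_mem _ _ := trivial
  cup_mem _ := trivial

namespace HilbTheory
variable (T : HilbTheory.{u})

/-- A dilation, regarded as a dilation in finite-dimensional Hilbert spaces. -/
def Dilation.toFull {T : HilbTheory.{u}} {X Y : T.Cat} (f : Dilation X Y) :
    Dilation (T := full) ⟨T.space X.obj⟩ ⟨T.space Y.obj⟩ :=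
  ⟨⟨T.space f.anc.obj⟩, ⟨f.under, trivial⟩⟩

theorem Dilation.toFull_dbl {T : HilbTheory.{u}} {X Y : T.Cat} (f : Dilation X Y) :
    f.toFull.dbl = f.dbl := by
  have h : f.toFull.under = f.under := by
    change FHilb.perm (X := T.space X.obj ⊗ T.space f.anc.obj)
      (Y := T.space X.obj ⊗ T.space f.anc.obj) (Equiv.refl _) ≫ f.under = f.under
    rw [FHilb.perm_refl]
    exact Category.id_comp f.under
  exact congrArg (fun g : T.space X.obj ⊗ T.space f.anc.obj ⟶ T.space Y.obj => FHilb.double g) h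

end HilbTheory

namespace CPM
open HilbTheory

/-- The inclusion of the completely positive maps of a theory into those of all
finite-dimensional Hilbert spaces. -/
def toFull (T : HilbTheory.{u}) : CPM T ⥤ CPM HilbTheory.full where
  obj X := ⟨⟨T.space X.obj.obj⟩⟩
  map {X Y} Φ := Quotient.map (sa := Dilation.setoid X.obj Y.obj)
    (sb := Dilation.setoid (T := HilbTheory.full) ⟨T.space X.obj.obj⟩ ⟨T.space Y.obj.obj⟩)
    Dilation.toFull
    (fun f g h => f.toFull_dbl.trans ((show f.dbl = g.dbl from h).trans g.toFull_dbl.symm)) Φ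
  map_id X := Hom.dbl_injective ((Dilation.toFull_dbl (Dilation.pure (𝟙 X.obj))).trans
    ((Dilation.dbl_id X.obj).trans
      (Hom.dbl_id (T := HilbTheory.full) ⟨⟨T.space X.obj.obj⟩⟩).symm))
  map_comp Φ Ψ := by
    obtain ⟨f, rfl⟩ := mk_surjective Φ
    obtain ⟨g, rfl⟩ := mk_surjective Ψ
    refine Hom.dbl_injective ((Dilation.toFull_dbl (f.comp g)).trans
      ((Dilation.dbl_comp f g).trans ?_))
    refine Eq.trans ?_ (Dilation.dbl_comp (T := HilbTheory.full) f.toFull g.toFull).symm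
    exact (congrArg₂ (fun a b => a ≫ b) f.toFull_dbl g.toFull_dbl).symm

/-- The Kraus operator `f ∘ (1 ⊗ |s⟩)`. -/
def krausOp {X S Y : FHilb} (f : X ⊗ S ⟶ Y) (s : S.basis) : Matrix Y.basis X.basis ℂ :=
  Matrix.of fun y x => f.mat y (x, s)

theorem sandwich {X Y : Type} [Fintype X] (A : Matrix Y X ℂ) (ρ : Matrix X X ℂ) (y y' : Y) :
    (A * ρ * A.conjTranspose) y y' = ∑ x, ∑ x', A y x * ρ x x' * star (A y' x') := by
  simp only [Matrix.mul_apply, Matrix.conjTranspose_apply, Finset.sum_mul]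
  exact Finset.sum_comm

theorem sandwich_amp {k X Y : Type} [Fintype k] [DecidableEq k] [Fintype X] (A : Matrix Y X ℂ)
    (N : Matrix (k × X) (k × X) ℂ) (i j : k) (y y' : Y) :
    (((1 : Matrix k k ℂ) ⊗ₖ A) * N * ((1 : Matrix k k ℂ) ⊗ₖ A).conjTranspose) (i, y) (j, y') =
      (A * (Matrix.of fun x x' => N (i, x) (j, x')) * A.conjTranspose) y y' := by
  rw [sandwich, sandwich, Fintype.sum_prod_type]
  refine (Finset.sum_eq_single i (fun a _ ha => ?_) (fun h => absurd (Finset.mem_univ _) h)).trans ?_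
  · simp [Matrix.one_apply_ne (Ne.symm ha)]
  · refine Finset.sum_congr rfl fun x _ => ?_
    rw [Fintype.sum_prod_type]
    refine (Finset.sum_eq_single j (fun a _ ha => ?_)
      (fun h => absurd (Finset.mem_univ _) h)).trans ?_
    · simp [Matrix.one_apply_ne (Ne.symm ha)]
    · simp

open scoped ComplexOrder in
theorem kraus_pos {k X Y S : Type} [Fintype k] [DecidableEq k] [Fintype X] [Fintype Y] [Fintype S]
    (K : S → Matrix Y X ℂ) (M : Matrix k k (Matrix X X ℂ))
    (h : (Matrix.comp k k X X ℂ M).PosSemidef) :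
    (Matrix.comp k k Y Y ℂ (M.map fun ρ => ∑ s, K s * ρ * (K s).conjTranspose)).PosSemidef := by
  have key : Matrix.comp k k Y Y ℂ (M.map fun ρ => ∑ s, K s * ρ * (K s).conjTranspose) =
      ∑ s, ((1 : Matrix k k ℂ) ⊗ₖ K s) * Matrix.comp k k X X ℂ M *
        ((1 : Matrix k k ℂ) ⊗ₖ K s).conjTranspose := by
    ext ⟨i, y⟩ ⟨j, y'⟩
    rw [Matrix.comp_apply, Matrix.map_apply, Matrix.sum_apply, Matrix.sum_apply]
    refine Finset.sum_congr rfl fun s _ => ?_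
    exact (sandwich_amp (K s) (Matrix.comp k k X X ℂ M) i j y y').symm
  rw [key]
  exact Matrix.posSemidef_sum _ fun s _ => h.mul_mul_conjTranspose_same _

/-- The completely positive map `ρ ↦ ∑ s, K_s ρ K_s†`, where `K_s = f ∘ (1 ⊗ |s⟩)`. -/
def kraus {X S Y : FHilb} (f : X ⊗ S ⟶ Y) : (⟨X⟩ : MatAlg) ⟶ ⟨Y⟩ :=
  MatAlg.ofPos (X := ⟨X⟩) (Y := ⟨Y⟩)
    { toFun := fun ρ => ∑ s : S.basis, krausOp f s * ρ * (krausOp f s).conjTranspose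
      map_add' := fun ρ σ => by
        simp only [Matrix.mul_add, Matrix.add_mul, Finset.sum_add_distrib]
      map_smul' := fun c ρ => by
        simp only [Matrix.mul_smul, Matrix.smul_mul, Finset.smul_sum, RingHom.id_apply] }
    (fun _ _ _ M h => kraus_pos (krausOp f) M h)

theorem sandwich_single {X Y : Type} [Fintype X] [DecidableEq X] (A : Matrix Y X ℂ) (x x' : X)
    (y y' : Y) : (A * Matrix.single x x' (1 : ℂ) * A.conjTranspose) y y' =
      A y x * star (A y' x') := by
  rw [sandwich, Finset.sum_eq_single x, Finset.sum_eq_single x']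
  · rw [Matrix.single_apply_same, mul_one]
  · intro a _ ha
    rw [Matrix.single_apply_of_col_ne _ _ (Ne.symm ha), mul_zero, zero_mul]
  · exact fun h => absurd (Finset.mem_univ _) h
  · intro a _ ha
    exact Finset.sum_eq_zero fun b _ => by
      rw [Matrix.single_apply_of_row_ne (Ne.symm ha), mul_zero, zero_mul]
  · exact fun h => absurd (Finset.mem_univ _) h

theorem supMap_kraus {X S Y : FHilb} (f : X ⊗ S ⟶ Y) :
    MatAlg.supMap (kraus f) = FHilb.double f := by
  ext ⟨y, y'⟩ ⟨x, x'⟩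
  rw [FHilb.double_apply]
  refine (Matrix.sum_apply y y' Finset.univ fun s : S.basis =>
    krausOp f s * Matrix.single x x' (1 : ℂ) * (krausOp f s).conjTranspose).trans ?_
  exact Finset.sum_congr rfl fun s _ => sandwich_single (krausOp f s) x x' y y'

/-- The comparison `[f, S] ↦ (ρ ↦ ∑ s, K_s ρ K_s†)` with completely positive maps between matrix
algebras. -/
def toMatAlg : CPM HilbTheory.full ⥤ MatAlg where
  obj X := ⟨X.obj.obj⟩
  map {X Y} Φ := Quotient.lift (s := Dilation.setoid X.obj Y.obj)
    (fun f => (kraus (X := X.obj.obj) (Y := Y.obj.obj) (S := f.anc.obj) f.under))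
    (fun f g h => MatAlg.supMap_injective ((supMap_kraus _).trans
      ((show f.dbl = g.dbl from h).trans (supMap_kraus _).symm))) Φ
  map_id X := MatAlg.supMap_injective ((supMap_kraus _).trans
    ((Dilation.dbl_id X.obj).trans (MatAlg.supMap_id _).symm))
  map_comp {X Y Z} Φ Ψ := by
    obtain ⟨f, rfl⟩ := mk_surjective Φ
    obtain ⟨g, rfl⟩ := mk_surjective Ψ
    refine MatAlg.supMap_injective ((supMap_kraus (f.comp g).under).trans
      ((Dilation.dbl_comp f g).trans ?_))
    refine Eq.trans ?_ (MatAlg.supMap_comp (X := ⟨X.obj.obj⟩) (Y := ⟨Y.obj.obj⟩)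
      (Z := ⟨Z.obj.obj⟩) (kraus f.under) (kraus g.under)).symm
    exact (congrArg₂ (fun a b => a ≫ b) (supMap_kraus f.under) (supMap_kraus g.under)).symm

end CPM

/-- A finite-dimensional symplectic vector space. -/
structure SympSpace (k : Type) [Field k] : Type 1 where
  carrier : Type
  [addCommGroup : AddCommGroup carrier]
  [module : Module k carrier]
  [finite : FiniteDimensional k carrier]
  form : LinearMap.BilinForm k carrier
  alt : form.IsAlt
  nondegenerate : form.Nondegenerate

namespace SympSpace
variable {k : Type} [Field k]

instance : CoeSort (SympSpace k) Type := ⟨carrier⟩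
attribute [instance] addCommGroup module finite

/-- The form `-ω_V ⊕ ω_W` on `V ⊕ W`. -/
def relForm (V W : SympSpace k) : LinearMap.BilinForm k (V × W) :=
  W.form.compl₁₂ (LinearMap.snd k V W) (LinearMap.snd k V W) -
    V.form.compl₁₂ (LinearMap.fst k V W) (LinearMap.fst k V W)

theorem relForm_apply (V W : SympSpace k) (a b : V × W) :
    relForm V W a b = W.form a.2 b.2 - V.form a.1 b.1 := rfl

/-- An affine coisotropic relation: an affine subspace of `(V ⊕ W, -ω_V ⊕ ω_W)` that is empty or
a translate of a coisotropic linear subspace. -/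
@[ext]
structure Hom (V W : SympSpace k) : Type where
  rel : AffineSubspace k (V × W)
  coisotropic : rel = ⊥ ∨ (relForm V W).orthogonal rel.direction ≤ rel.direction

/-- `v` and `w` are related. -/
def Hom.R {V W : SympSpace k} (f : Hom V W) (v : V) (w : W) : Prop := (v, w) ∈ f.rel

theorem Hom.ext' {V W : SympSpace k} {f g : Hom V W} (h : ∀ v w, f.R v w ↔ g.R v w) : f = g :=
  Hom.ext (SetLike.ext fun _ => h _ _)

/-- Affine combinations of related pairs. -/
theorem Hom.affine {V W : SympSpace k} (f : Hom V W) (c : k) {v₁ v₂ v₃ : V} {w₁ w₂ w₃ : W}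
    (h₁ : f.R v₁ w₁) (h₂ : f.R v₂ w₂) (h₃ : f.R v₃ w₃) :
    f.R (c • (v₁ - v₂) + v₃) (c • (w₁ - w₂) + w₃) :=
  f.rel.smul_vsub_vadd_mem c h₁ h₂ h₃

/-- Coisotropy in terms of a base point. -/
theorem Hom.coisotropic_apply {V W : SympSpace k} (f : Hom V W) {v₀ : V} {w₀ : W} (h₀ : f.R v₀ w₀)
    (v : V) (w : W)
    (h : ∀ v' w', f.R v' w' → W.form (w' - w₀) w - V.form (v' - v₀) v = 0) :
    f.R (v + v₀) (w + w₀) := by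
  rcases f.coisotropic with hf | hf
  · have : (v₀, w₀) ∈ f.rel := h₀
    rw [hf] at this
    exact absurd this (AffineSubspace.notMem_bot k _ _)
  · have h1 : (v, w) ∈ f.rel.direction := hf (by
      rw [LinearMap.BilinForm.mem_orthogonal_iff]
      intro n hn
      obtain ⟨q, hq, rfl⟩ := (AffineSubspace.mem_direction_iff_eq_vsub_right h₀ n).1 hn
      exact h q.1 q.2 hq)
    exact AffineSubspace.vadd_mem_of_mem_direction h1 h₀

/-- An affine coisotropic relation, from a base point criterion. -/
def Hom.ofRel {V W : SympSpace k} (r : V → W → Prop)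
    (affine : ∀ (c : k) {v₁ v₂ v₃ : V} {w₁ w₂ w₃ : W}, r v₁ w₁ → r v₂ w₂ → r v₃ w₃ →
      r (c • (v₁ - v₂) + v₃) (c • (w₁ - w₂) + w₃))
    (cois : ∀ v₀ w₀, r v₀ w₀ → ∀ v w,
      (∀ v' w', r v' w' → W.form (w' - w₀) w - V.form (v' - v₀) v = 0) → r (v + v₀) (w + w₀)) :
    Hom V W where
  rel :=
    { carrier := {a | r a.1 a.2}
      smul_vsub_vadd_mem' := fun c _ _ _ h₁ h₂ h₃ => affine c h₁ h₂ h₃ }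
  coisotropic := by
    rw [or_iff_not_imp_left]
    intro hne
    obtain ⟨a, ha⟩ := (AffineSubspace.nonempty_iff_ne_bot _).2 hne
    intro x hx
    rw [LinearMap.BilinForm.mem_orthogonal_iff] at hx
    rw [AffineSubspace.mem_direction_iff_eq_vsub_right ha]
    refine ⟨x + a, cois a.1 a.2 ha x.1 x.2 fun v' w' h => ?_, (add_sub_cancel_right x a).symm⟩
    exact hx ((v', w') - a) (AffineSubspace.vsub_mem_direction (p₁ := (v', w')) h ha)

theorem Hom.ofRel_R {V W : SympSpace k} (r : V → W → Prop) (h₁ h₂) (v : V) (w : W) :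
    (Hom.ofRel r h₁ h₂).R v w ↔ r v w := Iff.rfl

theorem form_right_cancel (V : SympSpace k) {v : V} (h : ∀ u, V.form u v = 0) : v = 0 :=
  V.nondegenerate.2 v h

/-- The graph of a linear symplectomorphism. -/
def graph {V W : SympSpace k} (e : V ≃ₗ[k] W) (he : ∀ u v, W.form (e u) (e v) = V.form u v) :
    Hom V W :=
  Hom.ofRel (fun v w => w = e v) (by rintro c v₁ v₂ v₃ _ _ _ rfl rfl rfl; simp) (by
    rintro v₀ _ rfl v w h
    have : w - e v = 0 := W.form_right_cancel fun u => by
      have := h (e.symm u + v₀) (e (e.symm u + v₀)) rfl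
      rw [map_add, add_sub_cancel_right, add_sub_cancel_right, ← he, e.apply_symm_apply] at this
      rw [map_sub, this]
    rw [map_add, sub_eq_zero.1 this])

/-- Relational composition. -/
def comp {U V W : SympSpace k} (f : Hom U V) (g : Hom V W) : Hom U W :=
  Hom.ofRel (fun u w => ∃ v, f.R u v ∧ g.R v w)
    (by
      rintro c u₁ u₂ u₃ w₁ w₂ w₃ ⟨v₁, hf₁, hg₁⟩ ⟨v₂, hf₂, hg₂⟩ ⟨v₃, hf₃, hg₃⟩
      exact ⟨_, f.affine c hf₁ hf₂ hf₃, g.affine c hg₁ hg₂ hg₃⟩)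
    (by
      rintro u₀ w₀ ⟨v₀, hf₀, hg₀⟩ u w h
      let d : f.rel.direction × g.rel.direction →ₗ[k] V :=
        (LinearMap.snd k U V ∘ₗ f.rel.direction.subtype).coprod
          (-(LinearMap.fst k V W ∘ₗ g.rel.direction.subtype))
      let φ : f.rel.direction × g.rel.direction →ₗ[k] k :=
        (-(U.form.flip u ∘ₗ LinearMap.fst k U V ∘ₗ f.rel.direction.subtype)).coprod
          (W.form.flip w ∘ₗ LinearMap.snd k V W ∘ₗ g.rel.direction.subtype)
      have hφ : φ ∈ (LinearMap.ker d).dualAnnihilator := by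
        rw [Submodule.mem_dualAnnihilator]
        rintro ⟨⟨l, hl⟩, ⟨m, hm⟩⟩ hd
        have e : l.2 = m.1 := by
          have : l.2 + -m.1 = 0 := hd
          rwa [← sub_eq_add_neg, sub_eq_zero] at this
        have hl' : f.R (l.1 + u₀) (l.2 + v₀) := AffineSubspace.vadd_mem_of_mem_direction hl hf₀
        have hm' : g.R (m.1 + v₀) (m.2 + w₀) := AffineSubspace.vadd_mem_of_mem_direction hm hg₀
        have := h (l.1 + u₀) (m.2 + w₀) ⟨l.2 + v₀, hl', e ▸ hm'⟩
        rw [add_sub_cancel_right, add_sub_cancel_right] at this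
        change -(U.form l.1 u) + W.form m.2 w = 0
        rw [← this]
        ring
      rw [← LinearMap.range_dualMap_eq_dualAnnihilator_ker] at hφ
      obtain ⟨ψ, hψ⟩ := hφ
      let v : V := (LinearMap.BilinForm.toDual V.form V.nondegenerate).symm ψ
      have hv (x : V) : V.form x v = -ψ x := by
        have : V.form v x = ψ x := LinearMap.BilinForm.apply_toDual_symm_apply ψ x
        rw [← this]
        exact (LinearMap.IsAlt.neg V.alt v x).symm
      refine ⟨v + v₀, f.coisotropic_apply hf₀ u v fun u' v' h' => ?_,
        g.coisotropic_apply hg₀ v w fun v' w' h' => ?_⟩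
      · have := LinearMap.congr_fun hψ
          (⟨(u', v') - (u₀, v₀), AffineSubspace.vsub_mem_direction h' hf₀⟩, 0)
        have : ψ ((v' - v₀) + -0) = -(U.form (u' - u₀) u) + W.form 0 w := this
        rw [hv]
        simp at this
        simp [this]
      · have := LinearMap.congr_fun hψ
          (0, ⟨(v', w') - (v₀, w₀), AffineSubspace.vsub_mem_direction h' hg₀⟩)
        have : ψ (0 + -(v' - v₀)) = -(U.form 0 u) + W.form (w' - w₀) w := this
        rw [hv]
        simp at this
        simp [← this])

theorem comp_R {U V W : SympSpace k} (f : Hom U V) (g : Hom V W) (u : U) (w : W) :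
    (comp f g).R u w ↔ ∃ v, f.R u v ∧ g.R v w := Iff.rfl

theorem graph_R {V W : SympSpace k} (e : V ≃ₗ[k] W) (he) (v : V) (w : W) :
    (graph e he).R v w ↔ w = e v := Iff.rfl

theorem graph_comp_R {U V W : SympSpace k} (e : U ≃ₗ[k] V) (he) (g : Hom V W) (u : U) (w : W) :
    (comp (graph e he) g).R u w ↔ g.R (e u) w := by
  rw [comp_R]
  simp only [graph_R]
  exact exists_eq_left

theorem comp_graph_R {U V W : SympSpace k} (f : Hom U V) (e : V ≃ₗ[k] W) (he) (u : U) (w : W) :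
    (comp f (graph e he)).R u w ↔ f.R u (e.symm w) := by
  rw [comp_R]
  simp only [graph_R, ← LinearEquiv.symm_apply_eq]
  exact exists_eq_right'

/-- `f` is the graph of `e`. -/
def IsGraph {V W : SympSpace k} (f : Hom V W) (e : V ≃ₗ[k] W) : Prop := ∀ v w, f.R v w ↔ w = e v

theorem isGraph {V W : SympSpace k} (e : V ≃ₗ[k] W) (he) : IsGraph (graph e he) e :=
  fun _ _ => Iff.rfl

theorem IsGraph.comp {U V W : SympSpace k} {f : Hom U V} {g : Hom V W} {e : U ≃ₗ[k] V}
    {e' : V ≃ₗ[k] W} (hf : IsGraph f e) (hg : IsGraph g e') :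
    IsGraph (comp f g) (e.trans e') := fun u w => by
  rw [comp_R]
  simp only [hf u, hg _ w]
  exact exists_eq_left

theorem IsGraph.ext {V W : SympSpace k} {f g : Hom V W} {e e' : V ≃ₗ[k] W} (hf : IsGraph f e)
    (hg : IsGraph g e') (h : ∀ v, e v = e' v) : f = g :=
  Hom.ext' fun v w => by rw [hf v w, hg v w, h]

/-- The category of affine coisotropic relations. -/
instance : Category (SympSpace k) where
  Hom V W := Hom V W
  id V := graph (LinearEquiv.refl k V) (fun _ _ => rfl)
  comp f g := comp f g
  id_comp f := Hom.ext' fun v w => graph_comp_R _ _ f v w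
  comp_id f := Hom.ext' fun v w => comp_graph_R f _ _ v w
  assoc f g h := Hom.ext' fun v w => by
    simp only [comp_R]
    exact ⟨fun ⟨b, ⟨a, h₁, h₂⟩, h₃⟩ => ⟨a, h₁, b, h₂, h₃⟩,
      fun ⟨a, h₁, b, h₂, h₃⟩ => ⟨b, ⟨a, h₁, h₂⟩, h₃⟩⟩

/-- `v` and `w` are related by the morphism `f`. -/
def Related {V W : SympSpace k} (f : V ⟶ W) (v : V) (w : W) : Prop := Hom.R f v w

theorem hom_ext {V W : SympSpace k} {f g : V ⟶ W} (h : ∀ v w, Related f v w ↔ Related g v w) :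
    f = g := Hom.ext' h

theorem id_related (V : SympSpace k) (v w : V) : Related (𝟙 V) v w ↔ w = v := Iff.rfl

theorem comp_related {U V W : SympSpace k} (f : U ⟶ V) (g : V ⟶ W) (u : U) (w : W) :
    Related (f ≫ g) u w ↔ ∃ v, Related f u v ∧ Related g v w := Iff.rfl

/-- The isomorphism given by a linear symplectomorphism. -/
def graphIso {V W : SympSpace k} (e : V ≃ₗ[k] W) (he : ∀ u v, W.form (e u) (e v) = V.form u v) :
    V ≅ W where
  hom := graph e he
  inv := graph e.symm (fun u v => by rw [← he, e.apply_symm_apply, e.apply_symm_apply])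
  hom_inv_id := ((isGraph _ _).comp (isGraph _ _)).ext
    (isGraph (LinearEquiv.refl k V) fun _ _ => rfl) e.symm_apply_apply
  inv_hom_id := ((isGraph _ _).comp (isGraph _ _)).ext
    (isGraph (LinearEquiv.refl k W) fun _ _ => rfl) e.apply_symm_apply

theorem isGraph_hom {V W : SympSpace k} (e : V ≃ₗ[k] W) (he) : IsGraph (graphIso e he).hom e :=
  fun _ _ => Iff.rfl

theorem isGraph_inv {V W : SympSpace k} (e : V ≃ₗ[k] W) (he) :
    IsGraph (graphIso e he).inv e.symm :=
  fun _ _ => Iff.rfl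

theorem isGraph_id (V : SympSpace k) : IsGraph (𝟙 V) (LinearEquiv.refl k V) :=
  fun _ _ => Iff.rfl

theorem graphIso_hom_related {V W : SympSpace k} (e : V ≃ₗ[k] W) (he) (v : V) (w : W) :
    Related (graphIso e he).hom v w ↔ w = e v := Iff.rfl

/-- The direct sum of symplectic spaces. -/
def prod (V W : SympSpace k) : SympSpace k where
  carrier := V × W
  form := V.form.compl₁₂ (LinearMap.fst k V W) (LinearMap.fst k V W) +
    W.form.compl₁₂ (LinearMap.snd k V W) (LinearMap.snd k V W)
  alt a := by
    change V.form a.1 a.1 + W.form a.2 a.2 = 0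
    rw [V.alt, W.alt, add_zero]
  nondegenerate := by
    constructor
    · intro a h
      refine Prod.ext (V.nondegenerate.1 _ fun v => ?_) (W.nondegenerate.1 _ fun w => ?_)
      · have : V.form a.1 v + W.form a.2 0 = 0 := h (v, 0)
        simpa using this
      · have : V.form a.1 0 + W.form a.2 w = 0 := h (0, w)
        simpa using this
    · intro a h
      refine Prod.ext (V.nondegenerate.2 _ fun v => ?_) (W.nondegenerate.2 _ fun w => ?_)
      · have : V.form v a.1 + W.form 0 a.2 = 0 := h (v, 0)
        simpa using this
      · have : V.form 0 a.1 + W.form w a.2 = 0 := h (0, w)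
        simpa using this

theorem prod_form (V W : SympSpace k) (a b : V × W) :
    (prod V W).form a b = V.form a.1 b.1 + W.form a.2 b.2 := rfl

/-- The zero-dimensional symplectic space. -/
def zero : SympSpace k where
  carrier := Unit
  form := 0
  alt _ := rfl
  nondegenerate := ⟨fun _ _ => rfl, fun _ _ => rfl⟩

theorem zero_form (a b : Unit) : (zero (k := k)).form a b = 0 := rfl

/-- The direct sum of relations. -/
def prodRel {V W V' W' : SympSpace k} (f : Hom V W) (g : Hom V' W') :
    Hom (prod V V') (prod W W') :=
  Hom.ofRel (fun (a : V × V') (b : W × W') => f.R a.1 b.1 ∧ g.R a.2 b.2)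
    (by
      rintro c a₁ a₂ a₃ b₁ b₂ b₃ ⟨h₁, k₁⟩ ⟨h₂, k₂⟩ ⟨h₃, k₃⟩
      exact ⟨f.affine c h₁ h₂ h₃, g.affine c k₁ k₂ k₃⟩)
    (by
      rintro a₀ b₀ ⟨h₀, k₀⟩ a b h
      constructor
      · refine f.coisotropic_apply h₀ a.1 b.1 fun v' w' h' => ?_
        have : (W.form (w' - b₀.1) b.1 + W'.form (b₀.2 - b₀.2) b.2) -
          (V.form (v' - a₀.1) a.1 + V'.form (a₀.2 - a₀.2) a.2) = 0 :=
            h (v', a₀.2) (w', b₀.2) ⟨h', k₀⟩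
        simpa using this
      · refine g.coisotropic_apply k₀ a.2 b.2 fun v' w' h' => ?_
        have : (W.form (b₀.1 - b₀.1) b.1 + W'.form (w' - b₀.2) b.2) -
          (V.form (a₀.1 - a₀.1) a.1 + V'.form (v' - a₀.2) a.2) = 0 :=
            h (a₀.1, v') (b₀.1, w') ⟨h₀, h'⟩
        simpa using this)

theorem IsGraph.prodRel {V W V' W' : SympSpace k} {f : Hom V W} {g : Hom V' W'} {e : V ≃ₗ[k] W}
    {e' : V' ≃ₗ[k] W'} (hf : IsGraph f e) (hg : IsGraph g e') :
    IsGraph (V := prod V V') (W := prod W W') (prodRel f g) (LinearEquiv.prodCongr e e') :=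
  fun a b => (and_congr (hf a.1 b.1) (hg a.2 b.2)).trans
    (Prod.ext_iff (x := b) (y := (e a.1, e' a.2))).symm

theorem prodRel_comp {U V W U' V' W' : SympSpace k} (f : Hom U V) (g : Hom V W) (f' : Hom U' V')
    (g' : Hom V' W') : comp (prodRel f f') (prodRel g g') = prodRel (comp f g) (comp f' g') :=
  Hom.ext' fun _ _ =>
    ⟨fun ⟨c, ⟨h₁, h₂⟩, ⟨h₃, h₄⟩⟩ => ⟨⟨c.1, h₁, h₃⟩, ⟨c.2, h₂, h₄⟩⟩,
      fun ⟨⟨c, h₁, h₃⟩, ⟨d, h₂, h₄⟩⟩ => ⟨(c, d), ⟨h₁, h₂⟩, ⟨h₃, h₄⟩⟩⟩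

/-- The re-bracketing symplectomorphism. -/
def assocIso (U V W : SympSpace k) : prod (prod U V) W ≅ prod U (prod V W) :=
  graphIso (V := prod (prod U V) W) (W := prod U (prod V W))
    (LinearEquiv.prodAssoc k U V W) (fun _ _ => (add_assoc _ _ _).symm)

def leftUnitIso (V : SympSpace k) : prod zero V ≅ V :=
  graphIso (V := prod zero V) (W := V)
    ((LinearEquiv.prodComm k Unit V).trans LinearEquiv.prodUnique) (fun _ _ => (zero_add _).symm)

def rightUnitIso (V : SympSpace k) : prod V zero ≅ V :=
  graphIso (V := prod V zero) (W := V)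
    (LinearEquiv.prodUnique (R := k) (M := V) (M₂ := Unit)) (fun _ _ => (add_zero _).symm)

/-- The swap symplectomorphism. -/
def swapIso (V W : SympSpace k) : prod V W ≅ prod W V :=
  graphIso (V := prod V W) (W := prod W V)
    (LinearEquiv.prodComm k V W) (fun _ _ => add_comm _ _)

theorem assoc_nat {U V W U' V' W' : SympSpace k} (f : Hom U U') (g : Hom V V') (h : Hom W W') :
    comp (prodRel (prodRel f g) h) (assocIso U' V' W').hom =
      comp (assocIso U V W).hom (prodRel f (prodRel g h)) :=
  Hom.ext' fun a b => (comp_graph_R (V := prod (prod U' V') W') (W := prod U' (prod V' W'))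
    (prodRel (prodRel f g) h) (LinearEquiv.prodAssoc k U' V' W')
    (fun _ _ => (add_assoc _ _ _).symm) a b).trans (Iff.trans and_assoc
      (graph_comp_R (U := prod (prod U V) W) (V := prod U (prod V W))
        (LinearEquiv.prodAssoc k U V W) (fun _ _ => (add_assoc _ _ _).symm)
        (prodRel f (prodRel g h)) a b).symm)

theorem leftUnit_nat {V W : SympSpace k} (f : Hom V W) :
    comp (prodRel (𝟙 zero) f) (leftUnitIso W).hom = comp (leftUnitIso V).hom f :=
  Hom.ext' fun a b => (comp_graph_R (prodRel (𝟙 zero) f)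
    ((LinearEquiv.prodComm k Unit W).trans LinearEquiv.prodUnique)
    (fun _ _ => (zero_add _).symm) a b).trans (Iff.trans (and_iff_right rfl)
      (graph_comp_R ((LinearEquiv.prodComm k Unit V).trans LinearEquiv.prodUnique)
        (fun _ _ => (zero_add _).symm) f a b).symm)

theorem rightUnit_nat {V W : SympSpace k} (f : Hom V W) :
    comp (prodRel f (𝟙 zero)) (rightUnitIso W).hom = comp (rightUnitIso V).hom f :=
  Hom.ext' fun a b => (comp_graph_R (prodRel f (𝟙 zero))
    (LinearEquiv.prodUnique (R := k) (M := W) (M₂ := Unit))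
    (fun _ _ => (add_zero _).symm) a b).trans (Iff.trans (and_iff_left rfl)
      (graph_comp_R (LinearEquiv.prodUnique (R := k) (M := V) (M₂ := Unit))
        (fun _ _ => (add_zero _).symm) f a b).symm)

theorem swap_nat {V W V' W' : SympSpace k} (f : Hom V V') (g : Hom W W') :
    comp (prodRel f g) (swapIso V' W').hom = comp (swapIso V W).hom (prodRel g f) :=
  Hom.ext' fun a b => (comp_graph_R (V := prod V' W') (W := prod W' V')
    (prodRel f g) (LinearEquiv.prodComm k V' W')
    (fun _ _ => add_comm _ _) a b).trans (Iff.trans and_comm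
      (graph_comp_R (U := prod V W) (V := prod W V)
        (LinearEquiv.prodComm k V W) (fun _ _ => add_comm _ _)
        (prodRel g f) a b).symm)

instance : MonoidalCategoryStruct (SympSpace k) where
  tensorObj V W := prod V W
  tensorUnit := zero
  tensorHom f g := prodRel f g
  whiskerLeft V _ _ f := prodRel (𝟙 V) f
  whiskerRight f V := prodRel f (𝟙 V)
  associator := assocIso
  leftUnitor := leftUnitIso
  rightUnitor := rightUnitIso

theorem tensor_related {V W V' W' : SympSpace k} (f : V ⟶ W) (g : V' ⟶ W') (a : V × V')
    (b : W × W') : Related (f ⊗ₘ g) a b ↔ Related f a.1 b.1 ∧ Related g a.2 b.2 := Iff.rfl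

theorem isGraph_assoc (U V W : SympSpace k) : IsGraph (V := prod (prod U V) W)
    (W := prod U (prod V W)) (α_ U V W).hom (LinearEquiv.prodAssoc k U V W) := isGraph_hom _ _
theorem isGraph_assoc_inv (U V W : SympSpace k) : IsGraph (W := prod (prod U V) W)
    (V := prod U (prod V W)) (α_ U V W).inv (LinearEquiv.prodAssoc k U V W).symm := isGraph_inv _ _
theorem isGraph_leftUnitor (V : SympSpace k) : IsGraph (V := prod zero V) (W := V) (λ_ V).hom
    ((LinearEquiv.prodComm k Unit V).trans LinearEquiv.prodUnique) := isGraph_hom _ _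
theorem isGraph_leftUnitor_inv (V : SympSpace k) : IsGraph (W := prod zero V) (V := V) (λ_ V).inv
    ((LinearEquiv.prodComm k Unit V).trans LinearEquiv.prodUnique).symm := isGraph_inv _ _
theorem isGraph_rightUnitor (V : SympSpace k) : IsGraph (V := prod V zero) (W := V) (ρ_ V).hom
    (LinearEquiv.prodUnique (R := k) (M := V) (M₂ := Unit)) := isGraph_hom _ _
theorem isGraph_rightUnitor_inv (V : SympSpace k) : IsGraph (W := prod V zero) (V := V) (ρ_ V).inv
    (LinearEquiv.prodUnique (R := k) (M := V) (M₂ := Unit)).symm := isGraph_inv _ _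
theorem isGraph_swap (V W : SympSpace k) : IsGraph (V := prod V W) (W := prod W V)
    (swapIso V W).hom (LinearEquiv.prodComm k V W) := isGraph_hom _ _

instance : MonoidalCategory (SympSpace k) := MonoidalCategory.ofTensorHom
  (id_tensorHom_id := fun V W => ((isGraph_id V).prodRel (isGraph_id W)).ext
    (isGraph_id (prod V W)) fun _ => rfl)
  (id_tensorHom := fun _ _ _ _ => rfl)
  (tensorHom_id := fun _ _ => rfl)
  (tensorHom_comp_tensorHom := fun f g h k => prodRel_comp f h g k)
  (associator_naturality := assoc_nat)
  (leftUnitor_naturality := leftUnit_nat)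
  (rightUnitor_naturality := rightUnit_nat)
  (pentagon := fun U V W X =>
    (((isGraph_assoc U V W).prodRel (isGraph_id X)).comp
      ((isGraph_assoc U (prod V W) X).comp ((isGraph_id U).prodRel (isGraph_assoc V W X)))).ext
    ((isGraph_assoc (prod U V) W X).comp (isGraph_assoc U V (prod W X))) fun _ => rfl)
  (triangle := fun V W =>
    ((isGraph_assoc V zero W).comp ((isGraph_id V).prodRel (isGraph_leftUnitor W))).ext
    ((isGraph_rightUnitor V).prodRel (isGraph_id W)) fun _ => rfl)

instance : BraidedCategory (SympSpace k) where
  braiding V W := swapIso V W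
  braiding_naturality_right X _ _ f := swap_nat (𝟙 X) f
  braiding_naturality_left f Z := swap_nat f (𝟙 Z)
  hexagon_forward X Y Z :=
    ((isGraph_assoc X Y Z).comp ((isGraph_swap X (prod Y Z)).comp (isGraph_assoc Y Z X))).ext
    (((isGraph_swap X Y).prodRel (isGraph_id Z)).comp
      ((isGraph_assoc Y X Z).comp ((isGraph_id Y).prodRel (isGraph_swap X Z)))) fun _ => rfl
  hexagon_reverse X Y Z :=
    ((isGraph_assoc_inv X Y Z).comp
      ((isGraph_swap (prod X Y) Z).comp (isGraph_assoc_inv Z X Y))).ext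
    (((isGraph_id X).prodRel (isGraph_swap Y Z)).comp
      ((isGraph_assoc_inv X Z Y).comp ((isGraph_swap X Z).prodRel (isGraph_id Y)))) fun _ => rfl

instance : SymmetricCategory (SympSpace k) where
  symmetry V W := ((isGraph_swap V W).comp (isGraph_swap W V)).ext (isGraph_id (prod V W))
    fun _ => rfl

/-- A relation is total when every element of its source is related to some element of its
target. -/
def total (k : Type) [Field k] : MorphismProperty (SympSpace k) :=
  fun _ _ f => ∀ v, ∃ w, Related f v w

theorem IsGraph.total {V W : SympSpace k} {f : Hom V W} {e : V ≃ₗ[k] W} (h : IsGraph f e) :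
    total k (X := V) (Y := W) f := fun v => ⟨e v, (h v (e v)).2 rfl⟩

instance : (total k).IsMultiplicative where
  id_mem _ := fun v => ⟨v, rfl⟩
  comp_mem _ _ hf hg := fun u =>
    let ⟨v, h⟩ := hf u
    let ⟨w, h'⟩ := hg v
    ⟨w, v, h, h'⟩

instance : (total k).IsStableUnderBraiding where
  whiskerLeft V V' _ _ hf := fun (a : V × V') => let ⟨w, h⟩ := hf a.2; ⟨(a.1, w), rfl, h⟩
  whiskerRight {V' _} _ hf V := fun (a : V' × V) => let ⟨w, h⟩ := hf a.1; ⟨(w, a.2), h, rfl⟩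
  associator_hom_mem U V W := (isGraph_assoc U V W).total
  associator_inv_mem U V W := (isGraph_assoc_inv U V W).total
  leftUnitor_hom_mem V := (isGraph_leftUnitor V).total
  leftUnitor_inv_mem V := (isGraph_leftUnitor_inv V).total
  rightUnitor_hom_mem V := (isGraph_rightUnitor V).total
  rightUnitor_inv_mem V := (isGraph_rightUnitor_inv V).total
  braiding_hom_mem V W := (isGraph_swap V W).total
  braiding_inv_mem V W := (isGraph_inv (V := prod V W) (W := prod W V)
    (LinearEquiv.prodComm k V W) (fun _ _ => add_comm _ _)).total

end SympSpace

/-- The category of affine coisotropic relations over a field. -/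
abbrev ACR (k : Type) [Field k] : Type 1 := SympSpace k

/-- The subcategory of total affine coisotropic relations. -/
abbrev TotalACR (k : Type) [Field k] : Type 1 := WideSubcategory (SympSpace.total k)

namespace Proj
universe v w v' w'
variable {C : Type w} [Category.{v} C] [MonoidalCategory C] [BraidedCategory C]
variable {D : Type w'} [Category.{v'} D] [MonoidalCategory D]
open Functor.LaxMonoidal

/-- The functor induced by a functor that does not see invertible scalars. -/
abbrev lift (F : C ⥤ D) (h : ∀ ⦃X Y : C⦄ (f g : X ⟶ Y), projRel C f g → F.map f = F.map g) :
    Proj C ⥤ D :=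
  CategoryTheory.Quotient.lift (projRel C) F (fun _ _ f g r => h f g r)

instance (F : C ⥤ D) [F.Monoidal] (h) : (lift F h).Monoidal := Functor.CoreMonoidal.toMonoidal
  { εIso := Functor.Monoidal.εIso F
    μIso X Y := Functor.Monoidal.μIso F X.as Y.as
    μIso_hom_natural_left f X' := by
      obtain ⟨f, rfl⟩ := quot_surj f
      exact μ_natural_left F f X'.as
    μIso_hom_natural_right X' f := by
      obtain ⟨f, rfl⟩ := quot_surj f
      exact μ_natural_right F X'.as f
    associativity X Y Z := Functor.LaxMonoidal.associativity F X.as Y.as Z.as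
    left_unitality X := Functor.LaxMonoidal.left_unitality F X.as
    right_unitality X := Functor.LaxMonoidal.right_unitality F X.as }

instance [BraidedCategory D] (F : C ⥤ D) [F.Braided] (h) : (lift F h).Braided where
  braided X Y := Functor.LaxBraided.braided (F := F) X.as Y.as

/-- The functor induced by a symmetric monoidal functor. -/
abbrev map [BraidedCategory D] (F : C ⥤ D) [F.Braided] : Proj C ⥤ Proj D :=
  lift (F ⋙ quot D) (map_sound F)

end Proj

section Stabiliser
variable (p : ℕ) [Fact p.Prime]

/-- The Hilbert space of `n` qupits, with basis `𝔽_p ^ n`. -/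
abbrev qupits (n : ℕ) : FHilb := ⟨Fin n → ZMod p⟩

/-- The matrices of operators on `n` qupits. -/
abbrev QMatrix (n : ℕ) : Type := Matrix (Fin n → ZMod p) (Fin n → ZMod p) ℂ

/-- The family of the `n`-qupit spaces; a basis vector of the `(n + m)`-qupit space, a word of length
`n + m`, is identified with a pair of words of lengths `n` and `m`. -/
def qupitFamily : TensorFamily.{0} where
  Obj := ℕ
  space n := qupits p n
  unit := 0
  tensor n m := n + m
  unitEquiv := Equiv.ofUnique (Fin 0 → ZMod p) Unit
  tensorEquiv n m := (Fin.appendEquiv n m).symm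

variable {p}

/-- The character `ξ(x) = exp(2πix/p)`. -/
def ξ : AddChar (ZMod p) ℂ := ZMod.stdAddChar

/-- The Pauli operator `ξ(y) ⨂ⱼ X ^ xⱼ Z ^ zⱼ`, which maps `|k⟩` to `ξ(y + z·k) |k + x⟩`. -/
def pauli {n : ℕ} (y : ZMod p) (x z : Fin n → ZMod p) : QMatrix p n :=
  Matrix.of fun j k => if j = k + x then ξ (y + z ⬝ᵥ k) else 0

/-- The Pauli group. -/
def IsPauli {n : ℕ} (P : QMatrix p n) : Prop := ∃ y x z, P = pauli y x z

/-- The isomorphism `π` from the Heisenberg group to the Pauli group: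
`π(a, x, z) = ξ(a + z·x/2) ⨂ⱼ X ^ xⱼ Z ^ zⱼ`. -/
def heis {n : ℕ} (a : ZMod p) (b : (Fin n → ZMod p) × (Fin n → ZMod p)) : QMatrix p n :=
  pauli (a + 2⁻¹ * (b.2 ⬝ᵥ b.1)) b.1 b.2

/-- An Abelian subgroup of the Pauli group that contains no nontrivial scalar. -/
structure IsScalarFreeAbelian {n : ℕ} (S : Subgroup (QMatrix p n)ˣ) : Prop where
  pauli : ∀ P ∈ S, IsPauli (P : QMatrix p n)
  comm : ∀ P ∈ S, ∀ Q ∈ S, P * Q = Q * P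
  scalar : ∀ P ∈ S, ∀ a : ZMod p, (P : QMatrix p n) = ξ a • 1 → a = 0

/-- A stabiliser state: a normalised state fixed by a maximal Abelian subgroup of the Pauli group
that contains no nontrivial scalar. -/
def IsStabiliserState {n : ℕ} (ψ : qupits p 0 ⟶ qupits p n) : Prop :=
  ψ ≫ FHilb.adj ψ = 𝟙 _ ∧
    ∃ S : Subgroup (QMatrix p n)ˣ, Maximal IsScalarFreeAbelian S ∧
      ∀ P ∈ S, ψ ≫ (⟨(P : QMatrix p n)⟩ : qupits p n ⟶ qupits p n) = ψ

/-- A Clifford operator: a unitary that normalises the Pauli group. -/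
def IsClifford {n : ℕ} (U : qupits p n ⟶ qupits p n) : Prop :=
  (U.mat : QMatrix p n) ∈ Matrix.unitaryGroup (Fin n → ZMod p) ℂ ∧
    ∀ P : QMatrix p n, IsPauli P → IsPauli (p := p) (n := n) ((U.mat : QMatrix p n) * P * star (U.mat : QMatrix p n))

/-- Scalar multiples of linear maps. -/
def smulMap {X Y : FHilb} (c : ℂ) (f : X ⟶ Y) : X ⟶ Y := ⟨c • f.mat⟩

/-- The stabiliser maps: the linear maps generated by the stabiliser states, the Clifford operators
and the scalars `√p`, `1/√p` under composition, tensor product and Hermitian adjoint, starting from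
the identities, the swaps and the cups. -/
inductive IsStab : ∀ {n m : ℕ}, (qupits p n ⟶ qupits p m) → Prop
  | state {n : ℕ} {ψ : qupits p 0 ⟶ qupits p n} : IsStabiliserState ψ → IsStab ψ
  | clifford {n : ℕ} {U : qupits p n ⟶ qupits p n} : IsClifford U → IsStab U
  | sqrt : IsStab (smulMap (Real.sqrt p : ℂ) (𝟙 (qupits p 0)))
  | invSqrt : IsStab (smulMap (1 / Real.sqrt p : ℂ) (𝟙 (qupits p 0)))
  | id (n : ℕ) : IsStab (𝟙 (qupits p n))
  | swap (n m : ℕ) : IsStab (FHilb.perm ((qupitFamily p).swapEquiv n m) :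
      qupits p (n + m) ⟶ qupits p (m + n))
  | cup (n : ℕ) : IsStab ((qupitFamily p).cupMap n : qupits p 0 ⟶ qupits p (n + n))
  | comp {n m l : ℕ} {f : qupits p n ⟶ qupits p m} {g : qupits p m ⟶ qupits p l} :
      IsStab f → IsStab g → IsStab (f ≫ g)
  | tensor {n m n' m' : ℕ} {f : qupits p n ⟶ qupits p m} {g : qupits p n' ⟶ qupits p m'} :
      IsStab f → IsStab g → IsStab ((qupitFamily p).tensorMap f g :
        qupits p (n + n') ⟶ qupits p (m + m'))
  | adj {n m : ℕ} {f : qupits p n ⟶ qupits p m} : IsStab f → IsStab (FHilb.adj f)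

/-- Relabellings along equalities of the number of qupits are trivial. -/
theorem IsStab.perm_cast {n m : ℕ} (h : n = m) (e : (Fin n → ZMod p) ≃ (Fin m → ZMod p))
    (he : ∀ x i, e x i = x (Fin.cast h.symm i)) :
    IsStab (FHilb.perm e : qupits p n ⟶ qupits p m) := by
  subst h
  have : e = Equiv.refl _ := Equiv.ext fun x => funext fun i => he x i
  subst this
  exact (FHilb.perm_refl (qupits p n)).symm ▸ IsStab.id n

theorem append_cast (n m l : ℕ) {α : Type} (x : Fin (n + m + l) → α) (i : Fin (n + (m + l))) :
    Fin.append (fun i => x (Fin.castAdd l (Fin.castAdd m i)))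
      (Fin.append (fun i => x (Fin.castAdd l (Fin.natAdd n i))) (fun i => x (Fin.natAdd (n + m) i)))
        i = x (Fin.cast (Nat.add_assoc n m l).symm i) := by
  refine Fin.addCases (fun i => ?_) (fun i => ?_) i
  · rw [Fin.append_left]
    exact congrArg x (Fin.ext rfl)
  · rw [Fin.append_right]
    refine Fin.addCases (fun i => ?_) (fun i => ?_) i
    · rw [Fin.append_left]
      exact congrArg x (Fin.ext rfl)
    · rw [Fin.append_right]
      exact congrArg x (Fin.ext (Nat.add_assoc n m i))

variable (p)

/-- The theory of stabiliser maps. -/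
def Stab : HilbTheory.{0} where
  toTensorFamily := qupitFamily p
  Mor n m := {f | IsStab (p := p) (n := n) (m := m) f}
  id_mem n := IsStab.id n
  comp_mem hf hg := IsStab.comp hf hg
  adj_mem hf := IsStab.adj hf
  tensor_mem hf hg := IsStab.tensor hf hg
  assoc_mem n m l := IsStab.perm_cast (Nat.add_assoc n m l) _ fun x i =>
    append_cast n m l x i
  leftUnit_mem n := IsStab.perm_cast (Nat.zero_add n) _ fun x _ =>
    congrArg x (Fin.ext (Nat.zero_add _))
  rightUnit_mem n := IsStab.perm_cast (Nat.add_zero n) _ fun x _ => congrArg x (Fin.ext rfl)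
  swap_mem n m := IsStab.swap n m
  cup_mem n := IsStab.cup n

/-- The standard symplectic space `𝔽_p ^ 2n`, with `ω((x, z), (x', z')) = x·z' - z·x'`. -/
def stdSymp (n : ℕ) : SympSpace (ZMod p) where
  carrier := (Fin n → ZMod p) × (Fin n → ZMod p)
  form := LinearMap.mk₂ (ZMod p) (fun v w => v.1 ⬝ᵥ w.2 - v.2 ⬝ᵥ w.1)
    (fun _ _ _ => by simp only [Prod.fst_add, Prod.snd_add, add_dotProduct]; ring)
    (fun _ _ _ => by simp only [Prod.smul_fst, Prod.smul_snd, smul_dotProduct, smul_sub])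
    (fun _ _ _ => by simp only [Prod.fst_add, Prod.snd_add, dotProduct_add]; ring)
    (fun _ _ _ => by simp only [Prod.smul_fst, Prod.smul_snd, dotProduct_smul, smul_sub])
  alt v := by
    change v.1 ⬝ᵥ v.2 - v.2 ⬝ᵥ v.1 = 0
    rw [dotProduct_comm, sub_self]
  nondegenerate := by
    constructor
    · intro v h
      refine Prod.ext (dotProduct_eq_zero _ fun u => ?_) (dotProduct_eq_zero _ fun u => ?_)
      · have : v.1 ⬝ᵥ u - v.2 ⬝ᵥ 0 = 0 := h (0, u)
        simpa using this
      · have : v.1 ⬝ᵥ 0 - v.2 ⬝ᵥ u = 0 := h (u, 0)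
        simpa using this
    · intro v h
      refine Prod.ext (dotProduct_eq_zero _ fun u => ?_) (dotProduct_eq_zero _ fun u => ?_)
      · have : 0 ⬝ᵥ v.2 - u ⬝ᵥ v.1 = 0 := h (0, u)
        simpa [dotProduct_comm] using this
      · have : u ⬝ᵥ v.2 - 0 ⬝ᵥ v.1 = 0 := h (u, 0)
        simpa [dotProduct_comm] using this

theorem stdSymp_form (n : ℕ) (v w : (Fin n → ZMod p) × (Fin n → ZMod p)) :
    (stdSymp p n).form v w = v.1 ⬝ᵥ w.2 - v.2 ⬝ᵥ w.1 := rfl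

/-- The splitting of phase space vectors, `(xx', zz') ↦ ((x, z), (x', z'))`. -/
def splitEquiv (n m : ℕ) :
    stdSymp p (n + m) ≃ₗ[ZMod p] (stdSymp p n ⊗ stdSymp p m : SympSpace (ZMod p)) where
  toFun (b : (Fin (n + m) → ZMod p) × (Fin (n + m) → ZMod p)) :=
    ((fun i => b.1 (Fin.castAdd m i), fun i => b.2 (Fin.castAdd m i)),
      (fun i => b.1 (Fin.natAdd n i), fun i => b.2 (Fin.natAdd n i)))
  invFun a := (Fin.append a.1.1 a.2.1, Fin.append a.1.2 a.2.2)
  left_inv _ := Prod.ext (Fin.append_castAdd_natAdd) (Fin.append_castAdd_natAdd)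
  right_inv a := by
    refine Prod.ext (Prod.ext ?_ ?_) (Prod.ext ?_ ?_) <;> funext i
    · exact Fin.append_left a.1.1 a.2.1 i
    · exact Fin.append_left a.1.2 a.2.2 i
    · exact Fin.append_right a.1.1 a.2.1 i
    · exact Fin.append_right a.1.2 a.2.2 i
  map_add' _ _ := rfl
  map_smul' _ _ := rfl

variable {p}

/-- The affine relation of a pure stabiliser map `f : n ⟶ m`: whenever `f` intertwines the Pauli
operators `π(0, b)` and `π(t, c)`, the phase is `t = ω(v, b) - ω(w, c)`. This is the graph of the
translation by `u` when `f = π(a, u)`, and empty when `f = 0`. -/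
def PureRel {n m : ℕ} (f : qupits p n ⟶ qupits p m) (v : stdSymp p n) (w : stdSymp p m) : Prop :=
  ∀ (t : ZMod p) (b : stdSymp p n) (c : stdSymp p m),
    f.mat * (heis 0 b : QMatrix p n) = (heis t c : QMatrix p m) * f.mat →
      t = (stdSymp p n).form v b - (stdSymp p m).form w c

/-- The relation `R ∘ (1 ⊕ im)` of a dilation `f : n ⊗ S ⟶ m`, where `R` is the relation of `f`. -/
def MixedRel {X Y : (Stab p).Cat} (f : HilbTheory.Dilation X Y) (v : stdSymp p X.obj)
    (w : stdSymp p Y.obj) : Prop :=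
  ∃ s : stdSymp p f.anc.obj,
    PureRel (n := (Stab p).tensor X.obj f.anc.obj) (m := Y.obj) f.map.map
      ((splitEquiv p X.obj f.anc.obj).symm (v, s)) w

variable (p)

/-- The functor `Rel` to affine coisotropic relations, as the assignment of the relation
`R ∘ (1 ⊕ im)` to the class `[f, S]`. -/
structure StabRel where
  map {X Y : CPM (Stab p)} : (X ⟶ Y) → (stdSymp p X.obj.obj ⟶ stdSymp p Y.obj.obj)
  map_mk {X Y : CPM (Stab p)} (f : HilbTheory.Dilation X.obj Y.obj) (v w) :
    SympSpace.Related (map (CPM.mk f)) v w ↔ MixedRel f v w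
  map_id (X : CPM (Stab p)) : map (𝟙 X) = 𝟙 _
  map_comp {X Y Z : CPM (Stab p)} (Φ : X ⟶ Y) (Ψ : Y ⟶ Z) : map (Φ ≫ Ψ) = map Φ ≫ map Ψ

variable {p}

/-- `Rel` as a functor. -/
@[simps]
def StabRel.functor (R : StabRel p) : CPM (Stab p) ⥤ ACR (ZMod p) where
  obj X := stdSymp p X.obj.obj
  map Φ := R.map Φ
  map_id X := R.map_id X
  map_comp Φ Ψ := R.map_comp Φ Ψ

end Stabiliser

end

/-! The proof is a calculation with discrete Wigner functions. Since 2 is invertible modulo p, the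
phase point operators A_v, which are the symplectic Fourier transforms of the Pauli operators π(0,
b), form an orthogonal basis of Hermitian operators. In this basis composition of superoperators is
matrix multiplication (`wigner_mul`), tensor products become products of entries (`wigner_tensor`),
adjoints of pure maps become transposes up to a power of p (`pureWigner_conjTranspose`), and nothing
is lost (`wigner_injective`).

The central claim is that the Wigner matrix of every stabiliser map is a power of p times the
indicator function of an affine coisotropic relation (`Supports`, `IsStab.exists_supports`), by
induction on the generation of the map. For Clifford operators and stabiliser states, the pairs of
Pauli operators intertwined by f form a Lagrangian subspace M; the characteristic function of f is a
multiple of a character on M and zero elsewhere, so its Fourier transform is a multiple of the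
indicator of an affine Lagrangian subspace (`supports_pureHom`). For composites, an entry of the
product counts the points of a fibre, and all nonempty fibres are cosets of one subspace
(`Supports.comp`). Contracting an ancilla amounts to letting its phase space point be arbitrary,
because A_v has trace one (`supports_mixed`). The relation that the theorem defines through
intertwined Pauli operators is exactly this support (`Supports.matRel_iff`). A Wigner matrix
determines its support, so functoriality and monoidality of Rel are inherited from the Wigner
matrix.

Two mixed maps with the same relation differ by a power of p, and the generators √p and 1/√p make
every power of p an invertible scalar (`projRel_of_relOf_eq`). The discarding map relates
everything, so a total map can be rescaled to a causal one (`exists_causal`), and the scale is then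
unique (`causal_ext`). This gives faithfulness, with and without the quotient by scalars.

For fullness, an affine Lagrangian subspace is the relation of a stabiliser state
(`exists_pure_of_lagrangian`); a coisotropic subspace is the projection of a Lagrangian one on the
doubled system (`exists_state_of_coisotropic`); a nonempty relation is a bent state
(`exists_relOf_eq_of_holds`); and the empty relation comes from ⟨1|0⟩ = 0. Essential surjectivity is
the existence of symplectic bases.

For the lower rows, doubling is a faithful symmetric monoidal functor, and coherence is checked
after applying it. Choi's theorem gives the comparison with matrix algebras. The inclusion stays
faithful modulo scalars because proportional stabiliser maps have the same relation, hence already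
differ by a power of p (`proj_toFull_faithful`). -/

set_option linter.unusedSectionVars false

noncomputable section

/-! ### Pauli operators and phase point operators -/

section Weyl
open Matrix
variable {p : ℕ} [Fact p.Prime]

/-- Words of length `n` over `𝔽_p`. -/
abbrev Word (p n : ℕ) : Type := Fin n → ZMod p

/-- Phase space points of `n` qupits. -/
abbrev Phase (p n : ℕ) : Type := Word p n × Word p n

theorem ξ_eq_one_iff {x : ZMod p} : (ξ x : ℂ) = 1 ↔ x = 0 := by
  rw [← AddChar.map_zero_eq_one (ξ (p := p))]
  exact ZMod.injective_stdAddChar.eq_iff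

theorem ξ_ne_zero (x : ZMod p) : (ξ x : ℂ) ≠ 0 := by
  rw [← norm_ne_zero_iff, ξ, AddChar.norm_apply]; exact one_ne_zero

theorem star_ξ (x : ZMod p) : star (ξ x : ℂ) = ξ (-x) := (AddChar.map_neg_eq_conj _ _).symm

theorem norm_ξ (x : ZMod p) : ‖(ξ x : ℂ)‖ = 1 := AddChar.norm_apply _ _

/-- The p-th roots of unity are the powers of ξ(1). This converts a scalar produced by the order p
of the Pauli operators into a phase in 𝔽_p. -/
theorem exists_ξ_eq {z : ℂ} (hz : z ^ p = 1) : ∃ t : ZMod p, ξ t = z := by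
  have h := (Complex.isPrimitiveRoot_exp p (NeZero.ne p)).eq_pow_of_pow_eq_one hz
  obtain ⟨i, -, hi⟩ := h
  refine ⟨i, ?_⟩
  have h1 : (ξ (1 : ZMod p) : ℂ) = Complex.exp (2 * Real.pi * Complex.I / p) := by
    simpa [ξ] using ZMod.stdAddChar_coe (N := p) 1
  rw [← hi, ← h1, ← nsmul_one, AddChar.map_nsmul_eq_pow]

/-- Orthogonality of characters; the pullback of ξ is trivial only for φ = 0 because ξ is injective.
The Fourier sums over words, over phase space points and over intertwined pairs below are instances.
-/
theorem sum_ξ_hom {G : Type*} [AddCommGroup G] [Fintype G] (φ : G →+ ZMod p) :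
    ∑ g, (ξ (φ g) : ℂ) = if ∀ g, φ g = 0 then (Fintype.card G : ℂ) else 0 := by
  have h := AddChar.sum_eq_ite ((ξ (p := p)).compAddMonoidHom φ)
  refine h.trans ?_
  congr 1
  rw [eq_iff_iff]
  constructor
  · intro h g
    exact ξ_eq_one_iff.1 (DFunLike.congr_fun h g)
  · intro h
    ext g
    simpa using ξ_eq_one_iff.2 (h g)

theorem card_word (n : ℕ) : (Fintype.card (Word p n) : ℂ) = (p : ℂ) ^ n := by
  simp [Word]

theorem sum_ξ_dot {n : ℕ} (d : Word p n) :
    ∑ z : Word p n, (ξ (z ⬝ᵥ d) : ℂ) = if d = 0 then (p : ℂ) ^ n else 0 := by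
  refine (sum_ξ_hom (G := Word p n)
    { toFun := fun z => z ⬝ᵥ d, map_zero' := zero_dotProduct _,
      map_add' := fun _ _ => add_dotProduct _ _ _ }).trans ?_
  rw [card_word]
  congr 1
  rw [eq_iff_iff]
  exact ⟨fun h => dotProduct_eq_zero _ fun u => (dotProduct_comm _ _).trans (h u),
    fun h g => by simp [h]⟩

/-- The standard symplectic form. -/
def symp {n : ℕ} (v w : Phase p n) : ZMod p := v.1 ⬝ᵥ w.2 - v.2 ⬝ᵥ w.1

section symp
variable {n : ℕ} (u v w : Phase p n) (c : ZMod p)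
@[simp] theorem symp_add_left : symp (u + v) w = symp u w + symp v w := by
  simp [symp, add_dotProduct]; ring
@[simp] theorem symp_add_right : symp u (v + w) = symp u v + symp u w := by
  simp [symp, dotProduct_add]; ring
@[simp] theorem symp_sub_left : symp (u - v) w = symp u w - symp v w := by
  simp [symp, sub_dotProduct]; ring
@[simp] theorem symp_sub_right : symp u (v - w) = symp u v - symp u w := by
  simp [symp, dotProduct_sub]; ring
@[simp] theorem symp_neg_left : symp (-u) w = - symp u w := by
  simp [symp]; ring
@[simp] theorem symp_neg_right : symp u (-w) = - symp u w := by
  simp [symp]; ring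
@[simp] theorem symp_smul_left : symp (c • u) w = c * symp u w := by
  simp [symp]; ring
@[simp] theorem symp_smul_right : symp u (c • w) = c * symp u w := by
  simp [symp]; ring
@[simp] theorem symp_zero_left : symp 0 w = 0 := by simp [symp]
@[simp] theorem symp_zero_right : symp w 0 = 0 := by simp [symp]
@[simp] theorem symp_self : symp w w = 0 := by simp [symp, dotProduct_comm]
theorem symp_swap : symp u w = - symp w u := by simp [symp, dotProduct_comm]
end symp

theorem eq_zero_of_symp {n : ℕ} {v : Phase p n} (h : ∀ u, symp u v = 0) : v = 0 :=
  SympSpace.form_right_cancel (stdSymp p n) h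

theorem heis_apply {n : ℕ} (a : ZMod p) (b : Phase p n) (j k : Word p n) :
    heis a b j k = if j = k + b.1 then (ξ (a + 2⁻¹ * (b.2 ⬝ᵥ b.1) + b.2 ⬝ᵥ k) : ℂ) else 0 := rfl

theorem heis_eq_smul {n : ℕ} (a : ZMod p) (b : Phase p n) : heis a b = ξ a • heis 0 b := by
  ext j k
  rw [Matrix.smul_apply, heis_apply, heis_apply, smul_eq_mul, mul_ite, mul_zero, ← AddChar.map_add_eq_mul]
  simp only [zero_add, add_assoc]

@[simp] theorem heis_zero {n : ℕ} : (heis 0 (0 : Phase p n) : QMatrix p n) = 1 := by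
  ext j k
  rw [heis_apply, one_apply]
  simp

/-- In column k the position of the only nonzero entry gives x, and its phase, as an affine function
of k, gives z and then a. -/
theorem heis_injective {n : ℕ} {a a' : ZMod p} {b b' : Phase p n}
    (h : (heis a b : QMatrix p n) = heis a' b') : a = a' ∧ b = b' := by
  have key (k : Word p n) : b.1 = b'.1 ∧
      a + 2⁻¹ * (b.2 ⬝ᵥ b.1) + b.2 ⬝ᵥ k = a' + 2⁻¹ * (b'.2 ⬝ᵥ b'.1) + b'.2 ⬝ᵥ k := by
    have h1 := congrFun (congrFun h (k + b.1)) k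
    rw [heis_apply, heis_apply, if_pos rfl] at h1
    by_cases hb : k + b.1 = k + b'.1
    · rw [if_pos hb] at h1
      exact ⟨add_left_cancel hb, ZMod.injective_stdAddChar h1⟩
    · rw [if_neg hb] at h1
      exact absurd h1 (ξ_ne_zero _)
  have h0 := key 0
  simp only [dotProduct_zero, add_zero] at h0
  have h2 : b.2 = b'.2 := by
    rw [← sub_eq_zero]
    refine dotProduct_eq_zero _ fun k => ?_
    rw [sub_dotProduct, sub_eq_zero]
    have := (key k).2
    rw [h0.2] at this
    exact add_left_cancel this
  have hb : b = b' := Prod.ext h0.1 h2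
  subst hb
  exact ⟨add_right_cancel h0.2, rfl⟩

variable [NeZero (2 : ZMod p)]

theorem half_add (x : ZMod p) : 2⁻¹ * x + 2⁻¹ * x = x := by
  have : (2 : ZMod p) ≠ 0 := NeZero.ne _
  field_simp
  ring

/-- The phase ½ z·x in `heis` symmetrises the ordering of X and Z, so that the cocycle is the
alternating form -½ω. This is where 2 must be invertible. -/
theorem heis_mul {n : ℕ} (a a' : ZMod p) (b b' : Phase p n) :
    (heis a b * heis a' b' : QMatrix p n) = heis (a + a' - 2⁻¹ * symp b b') (b + b') := by
  ext j k
  rw [mul_apply]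
  simp only [heis_apply]
  rw [Finset.sum_eq_single (k + b'.1)]
  · rw [if_pos rfl, ite_mul, zero_mul, ← AddChar.map_add_eq_mul]
    have : k + b'.1 + b.1 = k + (b + b').1 := by rw [Prod.fst_add]; abel
    rw [this]
    congr 2
    have h := half_add (b.2 ⬝ᵥ b'.1)
    simp only [symp, Prod.fst_add, Prod.snd_add, add_dotProduct, dotProduct_add]
    rw [dotProduct_comm b.1 b'.2]
    linear_combination -h
  · intro l _ hl
    rw [if_neg hl, mul_zero]
  · simp

theorem heis_comm {n : ℕ} (b c : Phase p n) :
    (heis 0 b * heis 0 c : QMatrix p n) = ξ (- symp b c) • (heis 0 c * heis 0 b) := by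
  rw [heis_mul, heis_mul, heis_eq_smul, heis_eq_smul (0 + 0 - 2⁻¹ * symp c b), smul_smul,
    ← AddChar.map_add_eq_mul, add_comm c b, symp_swap c b]
  congr 2
  linear_combination -half_add (symp b c)

theorem heis_mul_neg {n : ℕ} (a : ZMod p) (b : Phase p n) :
    (heis a b * heis (-a) (-b) : QMatrix p n) = 1 := by
  rw [heis_mul]; simp

theorem heis_neg_mul {n : ℕ} (a : ZMod p) (b : Phase p n) :
    (heis (-a) (-b) * heis a b : QMatrix p n) = 1 := by
  rw [heis_mul]; simp

theorem heis_conjTranspose {n : ℕ} (a : ZMod p) (b : Phase p n) :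
    (heis a b : QMatrix p n)ᴴ = heis (-a) (-b) := by
  ext j k
  rw [conjTranspose_apply, heis_apply, heis_apply, apply_ite star, star_zero, star_ξ]
  have : (k = j + b.1) = (j = k + (-b).1) := by
    rw [Prod.fst_neg, ← sub_eq_add_neg, eq_sub_iff_add_eq, eq_iff_iff]
    exact eq_comm
  simp only [this]
  split_ifs with h
  · congr 1
    simp only [h, Prod.snd_neg, Prod.fst_neg, neg_dotProduct, dotProduct_neg, dotProduct_add, neg_neg]
    linear_combination -half_add (b.2 ⬝ᵥ b.1)
  · rfl

/-- The cocycle is alternating, so it vanishes on multiples of b and no phase accumulates. In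
particular π(0, b) has order dividing p. -/
theorem heis_zero_pow {n : ℕ} (b : Phase p n) (j : ℕ) :
    (heis 0 b : QMatrix p n) ^ j = heis 0 ((j : ZMod p) • b) := by
  induction j with
  | zero => simp
  | succ j ih => rw [pow_succ, ih, heis_mul]; simp [add_smul]

theorem heis_zero_pow_prime {n : ℕ} (b : Phase p n) : (heis 0 b : QMatrix p n) ^ p = 1 := by
  rw [heis_zero_pow]; simp

theorem isPauli_iff {n : ℕ} (P : QMatrix p n) : IsPauli P ↔ ∃ a b, P = heis a b := by
  constructor
  · rintro ⟨y, x, z, rfl⟩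
    exact ⟨y - 2⁻¹ * (z ⬝ᵥ x), (x, z), by simp [heis]⟩
  · rintro ⟨a, b, rfl⟩
    exact ⟨_, _, _, rfl⟩

theorem trace_heis {n : ℕ} (a : ZMod p) (b : Phase p n) :
    (heis a b : QMatrix p n).trace = if b = 0 then ξ a * (p : ℂ) ^ n else 0 := by
  simp only [trace, diag_apply, heis_apply, left_eq_add]
  by_cases h : b.1 = 0
  · simp only [h, if_true, dotProduct_zero, mul_zero, add_zero]
    simp only [AddChar.map_add_eq_mul, ← Finset.mul_sum]
    rw [show ∑ i : Word p n, (ξ (b.2 ⬝ᵥ i) : ℂ) = _ from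
      (Finset.sum_congr rfl fun i _ => by rw [dotProduct_comm]).trans (sum_ξ_dot b.2)]
    by_cases h2 : b.2 = 0
    · rw [if_pos h2, if_pos (Prod.ext h h2)]
    · rw [if_neg h2, if_neg (fun k => h2 (by rw [k]; rfl)), mul_zero]
  · rw [if_neg (fun k => h (by rw [k]; rfl))]
    simp [h]

/-- The phase point operators, as the columns of a matrix. -/
def phaseMat (p n : ℕ) [Fact p.Prime] : Matrix (Word p n × Word p n) (Phase p n) ℂ :=
  of fun jk v => if jk.1 + jk.2 = (2 : ZMod p) • v.1 then ξ (v.2 ⬝ᵥ (jk.1 - jk.2)) else 0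

/-- The phase point operator at `v`. -/
def phaseOp {n : ℕ} (v : Phase p n) : QMatrix p n := of fun j k => phaseMat p n (j, k) v

/-- Read as an operator, column v = (x, z) sends |k⟩ to ξ(2z·(x - k)) |2x - k⟩: it is the reflection
of phase space at the point v. -/
theorem phaseMat_apply {n : ℕ} (j k : Word p n) (v : Phase p n) : phaseMat p n (j, k) v =
    if j + k = (2 : ZMod p) • v.1 then (ξ (v.2 ⬝ᵥ (j - k)) : ℂ) else 0 := rfl

theorem two_smul_eq_iff {n : ℕ} (a x : Word p n) :
    a = (2 : ZMod p) • x ↔ x = (2⁻¹ : ZMod p) • a := by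
  have : (2 : ZMod p) ≠ 0 := NeZero.ne _
  constructor
  · rintro rfl; rw [smul_smul, inv_mul_cancel₀ this, one_smul]
  · rintro rfl; rw [smul_smul, mul_inv_cancel₀ this, one_smul]

theorem phaseMat_apply' {n : ℕ} (j k : Word p n) (v : Phase p n) : phaseMat p n (j, k) v =
    if v.1 = (2⁻¹ : ZMod p) • (j + k) then (ξ (v.2 ⬝ᵥ (j - k)) : ℂ) else 0 := by
  rw [phaseMat_apply]; simp only [two_smul_eq_iff]

/-- An entry (j, k) only sees phase space points whose position is the midpoint of j and k, which
leaves a Fourier sum over the momentum. -/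
theorem sum_phaseMat_mul {n : ℕ} (j k : Word p n) (F : Phase p n → ℂ) :
    ∑ v, phaseMat p n (j, k) v * F v =
      ∑ z, ξ (z ⬝ᵥ (j - k)) * F ((2⁻¹ : ZMod p) • (j + k), z) := by
  rw [Fintype.sum_prod_type, Finset.sum_eq_single ((2⁻¹ : ZMod p) • (j + k))]
  · exact Finset.sum_congr rfl fun z _ => by rw [phaseMat_apply', if_pos rfl]
  · intro x _ hx
    exact Finset.sum_eq_zero fun z _ => by rw [phaseMat_apply', if_neg hx, zero_mul]
  · simp

theorem half_add_sub {n : ℕ} {j k j' k' : Word p n}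
    (h : (2⁻¹ : ZMod p) • (j + k) = (2⁻¹ : ZMod p) • (j' + k')) (h' : j - k = j' - k') :
    j = j' ∧ k = k' := by
  have h2 : (2 : ZMod p) ≠ 0 := NeZero.ne _
  have h3 : j + k = j' + k' := smul_right_injective _ (inv_ne_zero h2) h
  have hj : (2 : ZMod p) • j = (2 : ZMod p) • j' := by
    rw [two_smul, two_smul]
    calc j + j = (j + k) + (j - k) := by abel
      _ = (j' + k') + (j' - k') := by rw [h3, h']
      _ = j' + j' := by abel
  have := smul_right_injective _ h2 hj
  exact ⟨this, by simpa [this] using h3⟩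

/-- The supports compare the midpoints of (j, k) and (j', k'), and the remaining sum over momenta
compares the differences; midpoint and difference together determine both words (`half_add_sub`). -/
theorem phaseMat_mul_conjTranspose (n : ℕ) :
    phaseMat p n * (phaseMat p n)ᴴ = ((p : ℂ) ^ n) • 1 := by
  ext ⟨j, k⟩ ⟨j', k'⟩
  rw [mul_apply]
  simp only [conjTranspose_apply]
  rw [sum_phaseMat_mul, Matrix.smul_apply, one_apply]
  simp only [phaseMat_apply', apply_ite star, star_zero, star_ξ]
  by_cases h : (2⁻¹ : ZMod p) • (j + k) = (2⁻¹ : ZMod p) • (j' + k')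
  · simp only [h, if_true]
    have (z : Word p n) : (ξ (z ⬝ᵥ (j - k)) : ℂ) * ξ (-(z ⬝ᵥ (j' - k'))) =
        ξ (z ⬝ᵥ ((j - k) - (j' - k'))) := by
      rw [← AddChar.map_add_eq_mul, dotProduct_sub z (j - k), sub_eq_add_neg (z ⬝ᵥ (j - k))]
    simp only [this, sum_ξ_dot]
    by_cases h' : j - k = j' - k'
    · obtain ⟨rfl, rfl⟩ := half_add_sub h h'
      simp
    · rw [if_neg (by rwa [sub_eq_zero]), if_neg (by rintro ⟨⟩; exact h' rfl), smul_zero]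
  · have h0 : (j, k) ≠ (j', k') := by rintro ⟨⟩; exact h rfl
    simp only [if_neg h, mul_zero, Finset.sum_const_zero, if_neg h0, smul_zero]

theorem cast_pow_ne_zero (n : ℕ) : (p : ℂ) ^ n ≠ 0 :=
  pow_ne_zero _ (Nat.cast_ne_zero.2 (Fact.out : p.Prime).ne_zero)

theorem phaseMat_conjTranspose_mul (n : ℕ) :
    (phaseMat p n)ᴴ * phaseMat p n = ((p : ℂ) ^ n) • 1 := by
  have h0 := cast_pow_ne_zero (p := p) n
  have h : phaseMat p n * (((p : ℂ) ^ n)⁻¹ • (phaseMat p n)ᴴ) = 1 := by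
    rw [Matrix.mul_smul, phaseMat_mul_conjTranspose, smul_smul, inv_mul_cancel₀ h0, one_smul]
  -- Both index types are the product of two copies of the words, so the matrix is square and a
  -- right inverse is a left inverse.
  have h' := mul_eq_one_comm.1 h
  rw [Matrix.smul_mul] at h'
  rw [← h', smul_smul, mul_inv_cancel₀ h0, one_smul]

/-- Covariance: a Pauli operator moves the centre of the reflection, and the two symmetrising half
phases absorb the remaining phase. -/
theorem heis_conj_phaseOp {n : ℕ} (b v : Phase p n) :
    heis 0 b * phaseOp v * (heis 0 b)ᴴ = phaseOp (v + b) := by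
  rw [heis_conjTranspose]
  ext j k
  have h1 (M : QMatrix p n) : (heis 0 b * M) j k =
      ξ (2⁻¹ * (b.2 ⬝ᵥ b.1) + b.2 ⬝ᵥ (j - b.1)) * M (j - b.1) k := by
    rw [mul_apply, Finset.sum_eq_single (j - b.1)]
    · rw [heis_apply, if_pos (by simp), zero_add]
    · intro l _ hl
      rw [heis_apply, if_neg (fun h => hl (by rw [h]; simp)), zero_mul]
    · simp
  rw [mul_assoc, h1, mul_apply, Finset.sum_eq_single (k - b.1)]
  · rw [heis_apply, if_pos (by simp [sub_eq_add_neg])]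
    change _ * (phaseMat p n _ _ * _) = phaseMat p n _ _
    rw [phaseMat_apply, phaseMat_apply]
    have : (j - b.1 + (k - b.1) = (2 : ZMod p) • v.1) = (j + k = (2 : ZMod p) • (v + b).1) := by
      rw [Prod.fst_add, smul_add, two_smul _ b.1, ← sub_eq_iff_eq_add, eq_iff_iff]
      constructor <;> intro h <;> rw [← h] <;> abel
    simp only [this]
    split_ifs with h
    · rw [← AddChar.map_add_eq_mul, ← AddChar.map_add_eq_mul]
      congr 1
      simp only [Prod.snd_neg, Prod.fst_neg, Prod.snd_add, neg_dotProduct, dotProduct_neg,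
        dotProduct_sub, add_dotProduct, neg_neg]
      linear_combination half_add (b.2 ⬝ᵥ b.1)
    · simp
  · intro l _ hl
    rw [heis_apply, if_neg (fun h => hl (by rw [h]; simp [sub_eq_add_neg])), mul_zero]
  · simp

/-- Pauli operators and phase point operators are symplectic Fourier transforms of each other. Here
the sum over momenta selects the entries j = k + x of π(0, (x, z)), and the midpoint supplies the
phase. -/
theorem sum_phaseOp_smul {n : ℕ} (b : Phase p n) :
    ∑ v, (ξ (symp v b) : ℂ) • phaseOp v = ((p : ℂ) ^ n) • heis 0 b := by
  ext j k
  rw [Matrix.sum_apply]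
  simp only [Matrix.smul_apply, smul_eq_mul]
  rw [show ∑ v, (ξ (symp v b) : ℂ) * phaseOp v j k = _ from
    (Finset.sum_congr rfl fun v _ => mul_comm _ _).trans (sum_phaseMat_mul j k _)]
  have (z : Word p n) : (ξ (z ⬝ᵥ (j - k)) : ℂ) * ξ (symp ((2⁻¹ : ZMod p) • (j + k), z) b) =
      ξ (((2⁻¹ : ZMod p) • (j + k)) ⬝ᵥ b.2) * ξ (z ⬝ᵥ (j - k - b.1)) := by
    rw [← AddChar.map_add_eq_mul, ← AddChar.map_add_eq_mul]
    congr 1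
    simp only [symp, dotProduct_sub]
    ring
  simp only [this, ← Finset.mul_sum, sum_ξ_dot, heis_apply]
  by_cases h : j = k + b.1
  · rw [if_pos h, if_pos (by rw [h]; simp), mul_comm]
    congr 2
    rw [h]
    simp only [smul_dotProduct, add_dotProduct, smul_eq_mul, dotProduct_comm k, dotProduct_comm b.1]
    linear_combination half_add (b.2 ⬝ᵥ k)
  · rw [if_neg h, if_neg (fun h' => h (by rw [sub_eq_zero, sub_eq_iff_eq_add] at h'; rw [h', add_comm])),
      mul_zero, mul_zero]

theorem sum_ξ_symp {n : ℕ} (d : Phase p n) :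
    ∑ b, (ξ (symp b d) : ℂ) = if d = 0 then (p : ℂ) ^ (n + n) else 0 := by
  refine (sum_ξ_hom (G := Phase p n)
    { toFun := fun z => symp z d, map_zero' := symp_zero_left _,
      map_add' := fun _ _ => symp_add_left _ _ _ }).trans ?_
  rw [Fintype.card_prod, Nat.cast_mul, card_word, ← pow_add]
  congr 1
  rw [eq_iff_iff]
  exact ⟨fun h => eq_zero_of_symp h, fun h g => by simp [h]⟩

/-- Fourier inversion: each Pauli operator is expanded in phase point operators and the sum over b
is done first. -/
theorem sum_heis_smul {n : ℕ} (v : Phase p n) :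
    ∑ b, (ξ (symp b v) : ℂ) • heis 0 b = ((p : ℂ) ^ n) • phaseOp v := by
  have h0 := cast_pow_ne_zero (p := p) n
  have h (b : Phase p n) : (heis 0 b : QMatrix p n) =
      ((p : ℂ) ^ n)⁻¹ • ∑ u, (ξ (symp u b) : ℂ) • phaseOp u := by
    rw [sum_phaseOp_smul, smul_smul, inv_mul_cancel₀ h0, one_smul]
  simp only [h, Finset.smul_sum, smul_smul]
  rw [Finset.sum_comm]
  have h2 (u : Phase p n) : ∑ b, ((ξ (symp b v) : ℂ) * (((p : ℂ) ^ n)⁻¹ * ξ (symp u b))) • phaseOp u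
      = if v = u then ((p : ℂ) ^ n) • phaseOp u else 0 := by
    rw [← Finset.sum_smul]
    have (b : Phase p n) : (ξ (symp b v) : ℂ) * (((p : ℂ) ^ n)⁻¹ * ξ (symp u b)) =
        ((p : ℂ) ^ n)⁻¹ * ξ (symp b (v - u)) := by
      rw [mul_left_comm, ← AddChar.map_add_eq_mul, symp_sub_right, symp_swap u b, sub_eq_add_neg]
    simp only [this, ← Finset.mul_sum, sum_ξ_symp, sub_eq_zero]
    split_ifs with h
    · rw [pow_add, inv_mul_cancel_left₀ h0]
    · simp
  simp only [h2]
  simp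

end Weyl

/-! ### The Wigner matrix of a superoperator -/

section Wigner
open Matrix
variable {p : ℕ} [Fact p.Prime]

/-- Superoperators from `n` to `m` qupits, in the basis of matrix units. -/
abbrev SupMatrix (p m n : ℕ) : Type := Matrix (Word p m × Word p m) (Word p n × Word p n) ℂ

/-- The matrix of a superoperator in the basis of phase point operators. -/
def wigner {m n : ℕ} (D : SupMatrix p m n) : Matrix (Phase p m) (Phase p n) ℂ :=
  ((p : ℂ) ^ m)⁻¹ • ((phaseMat p m)ᴴ * D * phaseMat p n)

/-- The Wigner matrix of `ρ ↦ f ρ f†`. -/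
def pureWigner {m n : ℕ} (f : Matrix (Word p m) (Word p n) ℂ) : Matrix (Phase p m) (Phase p n) ℂ :=
  wigner (f ⊗ₖ f.map star)

variable [NeZero (2 : ZMod p)]

/-- The resolution of the identity by phase point operators sits in the middle of the product, and
its factor p ^ m is cancelled by the normalisation of the outer factor. -/
theorem wigner_mul {l m n : ℕ} (E : SupMatrix p l m) (D : SupMatrix p m n) :
    wigner (E * D) = wigner E * wigner D := by
  have h : wigner E * wigner D = (((p : ℂ) ^ l)⁻¹ * ((p : ℂ) ^ m)⁻¹) •
      ((phaseMat p l)ᴴ * E * (phaseMat p m * (phaseMat p m)ᴴ) * D * phaseMat p n) := by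
    simp only [wigner, Matrix.smul_mul, Matrix.mul_smul, smul_smul, Matrix.mul_assoc]
    rw [mul_comm]
  rw [h, phaseMat_mul_conjTranspose]
  simp only [Matrix.smul_mul, Matrix.mul_smul, smul_smul, Matrix.mul_one]
  rw [mul_assoc, inv_mul_cancel₀ (cast_pow_ne_zero m), mul_one]
  simp only [wigner, Matrix.mul_assoc]

theorem wigner_one (n : ℕ) : wigner (1 : SupMatrix p n n) = 1 := by
  rw [wigner, Matrix.mul_one, phaseMat_conjTranspose_mul, smul_smul,
    inv_mul_cancel₀ (cast_pow_ne_zero n), one_smul]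

theorem wigner_smul {m n : ℕ} (c : ℂ) (D : SupMatrix p m n) : wigner (c • D) = c • wigner D := by
  simp only [wigner, Matrix.smul_mul, Matrix.mul_smul, smul_comm c]

/-- The inverse change of basis; a superoperator is recovered from its Wigner matrix. -/
theorem phaseMat_mul_wigner {m n : ℕ} (D : SupMatrix p m n) :
    phaseMat p m * wigner D * (phaseMat p n)ᴴ = ((p : ℂ) ^ n) • D := by
  have h : phaseMat p m * wigner D * (phaseMat p n)ᴴ = ((p : ℂ) ^ m)⁻¹ •
      ((phaseMat p m * (phaseMat p m)ᴴ) * D * (phaseMat p n * (phaseMat p n)ᴴ)) := by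
    simp only [wigner, Matrix.smul_mul, Matrix.mul_smul, Matrix.mul_assoc]
  rw [h, phaseMat_mul_conjTranspose, phaseMat_mul_conjTranspose]
  simp only [Matrix.smul_mul, Matrix.mul_smul, smul_smul, Matrix.mul_one, Matrix.one_mul]
  rw [mul_comm ((p : ℂ) ^ n), inv_mul_cancel_left₀ (cast_pow_ne_zero m)]

theorem wigner_injective {m n : ℕ} {D E : SupMatrix p m n} (h : wigner D = wigner E) : D = E := by
  have h1 := phaseMat_mul_wigner D
  rw [h, phaseMat_mul_wigner] at h1
  exact (smul_right_injective _ (cast_pow_ne_zero n) h1).symm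

theorem pureWigner_mul {l m n : ℕ} (g : Matrix (Word p l) (Word p m) ℂ)
    (f : Matrix (Word p m) (Word p n) ℂ) : pureWigner (g * f) = pureWigner g * pureWigner f := by
  rw [pureWigner, pureWigner, pureWigner, ← wigner_mul, ← mul_kronecker_mul]
  congr 2
  ext i j
  simp [Matrix.mul_apply]

theorem wigner_apply {m n : ℕ} (D : SupMatrix p m n) (w : Phase p m) (v : Phase p n) :
    wigner D w v = ((p : ℂ) ^ m)⁻¹ *
      ∑ y, star (phaseMat p m y w) * ∑ x, D y x * phaseMat p n x v := by
  rw [wigner, Matrix.smul_apply, smul_eq_mul, Matrix.mul_assoc, Matrix.mul_apply]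
  simp only [Matrix.mul_apply, conjTranspose_apply]

theorem kronecker_sum {m n : ℕ} (f : Matrix (Word p m) (Word p n) ℂ) (M : QMatrix p n)
    (y y' : Word p m) :
    ∑ x : Word p n × Word p n, (f ⊗ₖ f.map star) (y, y') x * M x.1 x.2 = (f * M * fᴴ) y y' := by
  rw [CPM.sandwich, Fintype.sum_prod_type]
  refine Finset.sum_congr rfl fun x _ => Finset.sum_congr rfl fun x' _ => ?_
  rw [kroneckerMap_apply, map_apply]
  ring

theorem trace_conjTranspose_mul {n : ℕ} (A C : QMatrix p n) :
    (Aᴴ * C).trace = ∑ x : Word p n × Word p n, star (A x.1 x.2) * C x.1 x.2 := by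
  rw [Fintype.sum_prod_type, Finset.sum_comm, trace]
  simp only [diag_apply, Matrix.mul_apply, conjTranspose_apply]

theorem pureWigner_apply {m n : ℕ} (f : Matrix (Word p m) (Word p n) ℂ) (w : Phase p m)
    (v : Phase p n) : pureWigner f w v =
      ((p : ℂ) ^ m)⁻¹ * ((phaseOp w)ᴴ * (f * phaseOp v * fᴴ)).trace := by
  rw [trace_conjTranspose_mul, pureWigner, wigner_apply]
  congr 1
  refine Finset.sum_congr rfl fun y _ => ?_
  congr 1
  exact kronecker_sum f (phaseOp v) y.1 y.2

theorem heis_conjTranspose_mul {n : ℕ} (a : ZMod p) (b : Phase p n) :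
    ((heis a b : QMatrix p n)ᴴ * heis a b) = 1 := by
  rw [heis_conjTranspose, heis_neg_mul]

theorem heis_mul_conjTranspose {n : ℕ} (a : ZMod p) (b : Phase p n) :
    ((heis a b : QMatrix p n) * (heis a b)ᴴ) = 1 := by
  rw [heis_conjTranspose, heis_mul_neg]

/-- Covariance of the phase point operators on both sides, followed by cyclicity of the trace. -/
theorem pureWigner_translate {m n : ℕ} (f : Matrix (Word p m) (Word p n) ℂ) (b : Phase p n)
    (c : Phase p m) (w : Phase p m) (v : Phase p n) :
    pureWigner (heis 0 c * f * (heis 0 b)ᴴ) (w + c) (v + b) = pureWigner f w v := by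
  rw [pureWigner_apply, pureWigner_apply, ← heis_conj_phaseOp, ← heis_conj_phaseOp]
  congr 1
  have h1 := heis_conjTranspose_mul 0 b
  have h2 := heis_conjTranspose_mul 0 c
  set P := (heis 0 b : QMatrix p n)
  set Q := (heis 0 c : QMatrix p m)
  rw [conjTranspose_mul, conjTranspose_mul, conjTranspose_mul, conjTranspose_mul,
    conjTranspose_conjTranspose, conjTranspose_conjTranspose]
  have : Q * ((phaseOp w)ᴴ * Qᴴ) * (Q * f * Pᴴ * (P * phaseOp v * Pᴴ) * (P * (fᴴ * Qᴴ))) =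
      Q * ((phaseOp w)ᴴ * (Qᴴ * Q) * f * (Pᴴ * P) * phaseOp v * (Pᴴ * P) * fᴴ * Qᴴ) := by
    simp only [Matrix.mul_assoc]
  rw [this, h1, h2, trace_mul_comm]
  simp only [Matrix.mul_assoc, h2, Matrix.mul_one]

/-- The characteristic function of `ρ ↦ f ρ f†`. -/
def chi {m n : ℕ} (f : Matrix (Word p m) (Word p n) ℂ) (b : Phase p n) (c : Phase p m) : ℂ :=
  ((heis 0 c)ᴴ * (f * heis 0 b * fᴴ)).trace

/-- Both Pauli operators are expanded in phase point operators. The characteristic function is thus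
the Fourier transform of the Wigner matrix for the form -ω ⊕ ω; it is easy to compute on intertwined
pairs, whereas the Wigner matrix is what composes. -/
theorem chi_eq_sum {m n : ℕ} (f : Matrix (Word p m) (Word p n) ℂ) (b : Phase p n) (c : Phase p m) :
    (p : ℂ) ^ n * chi f b c =
      ∑ v, ∑ w, ξ (symp v b - symp w c) * pureWigner f w v := by
  have hm := cast_pow_ne_zero (p := p) m
  have h : (p : ℂ) ^ m * ((p : ℂ) ^ n * chi f b c) =
      (((p : ℂ) ^ m • heis 0 c)ᴴ * (f * ((p : ℂ) ^ n • heis 0 b) * fᴴ)).trace := by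
    simp only [chi, conjTranspose_smul, Matrix.smul_mul, Matrix.mul_smul, trace_smul, smul_eq_mul]
    rw [star_pow, show star (p : ℂ) = p from Complex.conj_natCast p]
    ring
  refine mul_left_cancel₀ hm ?_
  rw [h, ← sum_phaseOp_smul, ← sum_phaseOp_smul]
  simp only [conjTranspose_sum, Matrix.mul_sum, Matrix.sum_mul, trace_sum, Finset.mul_sum]
  refine Finset.sum_congr rfl fun v _ => Finset.sum_congr rfl fun w _ => ?_
  rw [pureWigner_apply, conjTranspose_smul, star_ξ]
  simp only [Matrix.smul_mul, Matrix.mul_smul, trace_smul, smul_eq_mul]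
  rw [sub_eq_add_neg, AddChar.map_add_eq_mul]
  field_simp

/-- The inverse transform. One factor p ^ m is the normalisation of the Wigner matrix; the other p ^
m and the p ^ n come from expanding the phase point operators at w and at v. -/
theorem pureWigner_eq_sum {m n : ℕ} (f : Matrix (Word p m) (Word p n) ℂ) (w : Phase p m)
    (v : Phase p n) : (p : ℂ) ^ (m + m + n) * pureWigner f w v =
      ∑ b, ∑ c, ξ (symp b v - symp c w) * chi f b c := by
  have hm := cast_pow_ne_zero (p := p) m
  have h : (p : ℂ) ^ (m + m + n) * pureWigner f w v =
      (((p : ℂ) ^ m • phaseOp w)ᴴ * (f * ((p : ℂ) ^ n • phaseOp v) * fᴴ)).trace := by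
    rw [pureWigner_apply]
    simp only [conjTranspose_smul, Matrix.smul_mul, Matrix.mul_smul, trace_smul, smul_eq_mul]
    rw [star_pow, show star (p : ℂ) = p from Complex.conj_natCast p]
    rw [pow_add, pow_add]
    field_simp
  rw [h, ← sum_heis_smul, ← sum_heis_smul]
  simp only [conjTranspose_sum, Matrix.mul_sum, Matrix.sum_mul, trace_sum]
  refine Finset.sum_congr rfl fun v _ => Finset.sum_congr rfl fun w _ => ?_
  rw [chi, conjTranspose_smul, star_ξ]
  simp only [Matrix.smul_mul, Matrix.mul_smul, trace_smul, smul_eq_mul]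
  rw [sub_eq_add_neg, AddChar.map_add_eq_mul]
  ring

/-- `f` intertwines `π(0, b)` and `π(t, c)`. -/
def Intertwines {m n : ℕ} (f : Matrix (Word p m) (Word p n) ℂ) (t : ZMod p) (b : Phase p n)
    (c : Phase p m) : Prop := f * heis 0 b = heis t c * f

/-- Pauli operators are invertible, so two phases for the same pair would differ by a factor ξ(t -
t') = 1 as soon as f ≠ 0. -/
theorem Intertwines.unique {m n : ℕ} {f : Matrix (Word p m) (Word p n) ℂ} (hf : f ≠ 0)
    {t t' : ZMod p} {b : Phase p n} {c : Phase p m} (h : Intertwines f t b c)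
    (h' : Intertwines f t' b c) : t = t' := by
  have h1 : (heis t c * f) = heis t' c * f := h.symm.trans h'
  rw [heis_eq_smul, heis_eq_smul t', Matrix.smul_mul, Matrix.smul_mul, ← sub_eq_zero,
    ← sub_smul, smul_eq_zero] at h1
  rcases h1 with h1 | h1
  · exact ZMod.injective_stdAddChar (sub_eq_zero.1 h1)
  · refine absurd ?_ hf
    rw [← Matrix.one_mul f, ← heis_conjTranspose_mul 0 c, Matrix.mul_assoc, h1, Matrix.mul_zero]

/-- Multiplying two intertwining relations adds the phases; the correction is the difference of the
cocycles on the two sides. -/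
theorem Intertwines.add {m n : ℕ} {f : Matrix (Word p m) (Word p n) ℂ} {t t' : ZMod p}
    {b b' : Phase p n} {c c' : Phase p m} (h : Intertwines f t b c) (h' : Intertwines f t' b' c') :
    Intertwines f (t + t' + 2⁻¹ * (symp b b' - symp c c')) (b + b') (c + c') := by
  have h1 : f * (heis 0 b * heis 0 b') = heis t c * heis t' c' * f := by
    rw [← Matrix.mul_assoc, h, Matrix.mul_assoc, h', Matrix.mul_assoc]
  rw [heis_mul, heis_mul, heis_eq_smul, Matrix.mul_smul] at h1
  have h2 := congrArg (fun M => (ξ (2⁻¹ * symp b b') : ℂ) • M) h1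
  simp only [smul_smul, ← AddChar.map_add_eq_mul, ← Matrix.smul_mul] at h2
  rw [heis_eq_smul (t + t' - _), smul_smul, ← AddChar.map_add_eq_mul, ← heis_eq_smul] at h2
  rw [show 2⁻¹ * symp b b' + (0 + 0 - 2⁻¹ * symp b b') = 0 by ring, AddChar.map_zero_eq_one,
    one_smul] at h2
  rw [Intertwines, h2]
  congr 2
  ring

/-- Adding the two pairs in either order must give the same phase, but the correction in
`Intertwines.add` changes sign. So the intertwined pairs are isotropic for -ω ⊕ ω. -/
theorem Intertwines.symp_eq {m n : ℕ} {f : Matrix (Word p m) (Word p n) ℂ} (hf : f ≠ 0)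
    {t t' : ZMod p} {b b' : Phase p n} {c c' : Phase p m} (h : Intertwines f t b c)
    (h' : Intertwines f t' b' c') : symp b b' = symp c c' := by
  have h1 := h'.add h
  rw [add_comm b', add_comm c'] at h1
  have h2 := (h.add h').unique hf h1
  rw [symp_swap b' b, symp_swap c' c] at h2
  have := half_add (symp b b' - symp c c')
  rw [← sub_eq_zero, ← this]
  linear_combination h2

theorem Intertwines.zero {m n : ℕ} (f : Matrix (Word p m) (Word p n) ℂ) :
    Intertwines f 0 0 0 := by simp [Intertwines]

theorem Intertwines.neg {m n : ℕ} {f : Matrix (Word p m) (Word p n) ℂ} {t : ZMod p}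
    {b : Phase p n} {c : Phase p m} (h : Intertwines f t b c) : Intertwines f (-t) (-b) (-c) := by
  have h1 : f * heis 0 b * heis 0 (-b) = heis t c * f * heis 0 (-b) := by rw [h]
  have h2 : (heis 0 b * heis 0 (-b) : QMatrix p n) = 1 := by
    have := heis_mul_neg 0 b; rwa [neg_zero] at this
  rw [Matrix.mul_assoc, h2, Matrix.mul_one] at h1
  rw [Intertwines]
  conv_rhs => rw [h1]
  rw [Matrix.mul_assoc, ← Matrix.mul_assoc, heis_neg_mul, Matrix.one_mul]

theorem Intertwines.conj_eq {m n : ℕ} {f : Matrix (Word p m) (Word p n) ℂ} {t : ZMod p}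
    {b : Phase p n} {c : Phase p m} (h : Intertwines f t b c) :
    heis t c * f * (heis 0 b)ᴴ = f := by
  rw [← h, Matrix.mul_assoc, heis_mul_conjTranspose, Matrix.mul_one]

/-- The Pauli operator on the right of f moves to the left, where it cancels its adjoint up to the
phase ξ(t). -/
theorem chi_of_intertwines {m n : ℕ} {f : Matrix (Word p m) (Word p n) ℂ} {t : ZMod p}
    {b : Phase p n} {c : Phase p m} (h : Intertwines f t b c) :
    chi f b c = ξ t * (f * fᴴ).trace := by
  rw [chi, h, heis_eq_smul t c]
  simp only [Matrix.smul_mul, Matrix.mul_smul, trace_smul, smul_eq_mul]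
  rw [Matrix.mul_assoc, ← Matrix.mul_assoc, heis_conjTranspose_mul, Matrix.one_mul]

theorem heis_conj_heis {n : ℕ} (t : ZMod p) (b c : Phase p n) :
    ((heis t b)ᴴ * heis 0 c * heis t b : QMatrix p n) = ξ (symp b c) • heis 0 c := by
  rw [heis_eq_smul t, conjTranspose_smul, star_ξ, Matrix.smul_mul, Matrix.smul_mul,
    Matrix.mul_smul, smul_smul, ← AddChar.map_add_eq_mul, neg_add_cancel, AddChar.map_zero_eq_one,
    one_smul, Matrix.mul_assoc, heis_comm, Matrix.mul_smul, ← Matrix.mul_assoc,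
    heis_conjTranspose_mul, Matrix.one_mul, symp_swap c b, neg_neg]

/-- Replacing f by its conjugate under an intertwined pair (b', c') leaves f unchanged but
multiplies the characteristic function at (b, c) by ξ(ω(b', b) - ω(c', c)), which is not 1. -/
theorem chi_eq_zero {m n : ℕ} {f : Matrix (Word p m) (Word p n) ℂ} {t : ZMod p}
    {b b' : Phase p n} {c c' : Phase p m} (h : Intertwines f t b' c')
    (hne : symp b b' ≠ symp c c') : chi f b c = 0 := by
  have h1 : chi f b c = ξ (symp b' b - symp c' c) * chi f b c := by
    conv_lhs => rw [chi, ← h.conj_eq]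
    have h2 : (heis 0 c)ᴴ * (heis t c' * f * (heis 0 b')ᴴ * heis 0 b * (heis t c' * f * (heis 0 b')ᴴ)ᴴ)
        = ((heis 0 c)ᴴ * heis t c' * (f * ((heis 0 b')ᴴ * heis 0 b * heis 0 b') * fᴴ)) * (heis t c')ᴴ := by
      simp only [conjTranspose_mul, conjTranspose_conjTranspose, Matrix.mul_assoc]
    have h3 : (heis t c')ᴴ * ((heis 0 c)ᴴ * heis t c') = ξ (- symp c' c) • (heis 0 c)ᴴ := by
      rw [← Matrix.mul_assoc, heis_conjTranspose 0 c, neg_zero, heis_conj_heis, symp_neg_right]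
    rw [h2, trace_mul_comm, ← Matrix.mul_assoc, h3, heis_conj_heis, chi]
    simp only [Matrix.smul_mul, Matrix.mul_smul, trace_smul, smul_eq_mul]
    rw [sub_eq_add_neg, AddChar.map_add_eq_mul]
    ring
  have h2 : (1 - ξ (symp b' b - symp c' c)) * chi f b c = 0 := by linear_combination h1
  rcases mul_eq_zero.1 h2 with h3 | h3
  · rw [sub_eq_zero] at h3
    have := ξ_eq_one_iff.1 h3.symm
    refine absurd ?_ hne
    rw [symp_swap b, symp_swap c]
    linear_combination -this
  · exact h3

end Wigner

/-! ### Wigner matrices supported on affine coisotropic relations -/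

section Supports
open Matrix
variable {p : ℕ} [Fact p.Prime]

namespace SympSpace

theorem relForm_nondegenerate {k : Type} [Field k] (V W : SympSpace k) :
    (relForm V W).Nondegenerate := by
  constructor
  · intro a h
    refine Prod.ext (V.nondegenerate.1 _ fun v => ?_) (W.nondegenerate.1 _ fun w => ?_)
    · have := h (v, 0)
      rw [relForm_apply] at this
      simpa using this
    · have := h (0, w)
      rw [relForm_apply] at this
      simpa using this
  · intro a h
    refine Prod.ext (V.nondegenerate.2 _ fun v => ?_) (W.nondegenerate.2 _ fun w => ?_)
    · have := h (v, 0)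
      rw [relForm_apply] at this
      simpa using this
    · have := h (0, w)
      rw [relForm_apply] at this
      simpa using this

theorem relForm_isRefl {k : Type} [Field k] (V W : SympSpace k) : (relForm V W).IsRefl := by
  intro a b h
  rw [relForm_apply] at *
  have h1 : -W.form b.2 a.2 = W.form a.2 b.2 := LinearMap.IsAlt.neg W.alt _ _
  have h2 : -V.form b.1 a.1 = V.form a.1 b.1 := LinearMap.IsAlt.neg V.alt _ _
  linear_combination -h - h1 + h2

theorem card_submodule {V : Type*} [AddCommGroup V] [Module (ZMod p) V] [Finite V]
    (S : Submodule (ZMod p) V) : ∃ j : ℕ, Nat.card S = p ^ j :=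
  ⟨_, by rw [Module.natCard_eq_pow_finrank (K := ZMod p), Nat.card_zmod]⟩

theorem Hom.R_iff_direction {k : Type} [Field k] {V W : SympSpace k} (f : Hom V W) {v : V} {w : W}
    (h : f.R v w) (v' : V) (w' : W) : f.R v' w' ↔ (v' - v, w' - w) ∈ f.rel.direction := by
  have := AffineSubspace.vadd_mem_iff_mem_direction (s := f.rel) (v' - v, w' - w) h
  rw [← this]
  change (v', w') ∈ f.rel ↔ (v' - v + v, w' - w + w) ∈ f.rel
  rw [sub_add_cancel, sub_add_cancel]

/-- The fibres of a composite all have the same size, a power of `p`. -/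
theorem card_fibre {U V W : SympSpace (ZMod p)} [Finite V] (f : Hom U V) (g : Hom V W) :
    ∃ j : ℕ, ∀ u w, (comp f g).R u w → Nat.card {v // f.R u v ∧ g.R v w} = p ^ j := by
  -- The subspace of all v with (0, v) in the direction of f and (v, 0) in the direction of g: any
  -- point of a fibre identifies the fibre with it, and it does not depend on the endpoints.
  obtain ⟨j, hj⟩ := card_submodule (p := p) (V := V)
    (f.rel.direction.comap (LinearMap.inr (ZMod p) U V) ⊓
      g.rel.direction.comap (LinearMap.inl (ZMod p) V W))
  refine ⟨j, ?_⟩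
  rintro u w ⟨v, hf, hg⟩
  rw [← hj]
  refine Nat.card_congr ((Equiv.subRight v).subtypeEquiv fun v' => ?_)
  rw [f.R_iff_direction hf, g.R_iff_direction hg]
  simp

end SympSpace

open SympSpace


/-- The phase space points `v` and `w` are related by `A`. -/
def Holds {m n : ℕ} (A : Hom (stdSymp p n) (stdSymp p m)) (v : Phase p n) (w : Phase p m) : Prop :=
  A.R v w

/-- The Wigner matrix `W` is a power of `p` times the indicator function of `A`. -/
def Supports {m n : ℕ} (A : Hom (stdSymp p n) (stdSymp p m))
    (W : Matrix (Phase p m) (Phase p n) ℂ) : Prop :=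
  ∃ k : ℤ, ∀ (v : Phase p n) (w : Phase p m),
    (Holds A v w → W w v = (p : ℂ) ^ k) ∧ (¬ Holds A v w → W w v = 0)

theorem p_cast_ne_zero : (p : ℂ) ≠ 0 := Nat.cast_ne_zero.2 (Fact.out : p.Prime).ne_zero

theorem Supports.holds_iff {m n : ℕ} {A : Hom (stdSymp p n) (stdSymp p m)}
    {W : Matrix (Phase p m) (Phase p n) ℂ} (h : Supports A W) (v : Phase p n) (w : Phase p m) :
    Holds A v w ↔ W w v ≠ 0 := by
  obtain ⟨k, hk⟩ := h
  refine ⟨fun hR => ?_, fun hW => by_contra fun hR => hW ((hk v w).2 hR)⟩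
  rw [(hk v w).1 hR]
  exact zpow_ne_zero _ p_cast_ne_zero

theorem hom_ext_holds {m n : ℕ} {A B : Hom (stdSymp p n) (stdSymp p m)}
    (h : ∀ v w, Holds A v w ↔ Holds B v w) : A = B := Hom.ext' h

/-- Powers of p do not vanish, so a Wigner matrix determines its relation. Identities between
relations of maps are deduced from identities between Wigner matrices in this way. -/
theorem Supports.ext {m n : ℕ} {A B : Hom (stdSymp p n) (stdSymp p m)}
    {W : Matrix (Phase p m) (Phase p n) ℂ} (h : Supports A W) (h' : Supports B W) : A = B :=
  hom_ext_holds fun v w => (h.holds_iff v w).trans (h'.holds_iff v w).symm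

theorem Supports.smul {m n : ℕ} {A : Hom (stdSymp p n) (stdSymp p m)}
    {W : Matrix (Phase p m) (Phase p n) ℂ} (h : Supports A W) (j : ℤ) :
    Supports A ((p : ℂ) ^ j • W) := by
  obtain ⟨k, hk⟩ := h
  refine ⟨j + k, fun v w => ⟨fun hR => ?_, fun hR => ?_⟩⟩
  · rw [Matrix.smul_apply, (hk v w).1 hR, smul_eq_mul, zpow_add₀ p_cast_ne_zero]
  · rw [Matrix.smul_apply, (hk v w).2 hR, smul_zero]

theorem holds_comp {l m n : ℕ} (A : Hom (stdSymp p n) (stdSymp p m))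
    (B : Hom (stdSymp p m) (stdSymp p l)) (u : Phase p n) (w : Phase p l) :
    Holds (SympSpace.comp A B) u w ↔ ∃ v, Holds A u v ∧ Holds B v w := Iff.rfl

theorem card_fibre_holds {l m n : ℕ} (A : Hom (stdSymp p n) (stdSymp p m))
    (B : Hom (stdSymp p m) (stdSymp p l)) :
    ∃ j : ℕ, ∀ u w, Holds (SympSpace.comp A B) u w →
      Nat.card {v : Phase p m // Holds A u v ∧ Holds B v w} = p ^ j :=
  have : Finite (stdSymp p m) := inferInstanceAs (Finite (Phase p m))
  card_fibre A B

/-- An entry of the product is p ^ (k + k') times the number of intermediate points, and by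
`card_fibre` this number is one fixed power of p wherever it is not zero. -/
theorem Supports.comp {l m n : ℕ} {A : Hom (stdSymp p n) (stdSymp p m)}
    {B : Hom (stdSymp p m) (stdSymp p l)}
    {W : Matrix (Phase p m) (Phase p n) ℂ} {W' : Matrix (Phase p l) (Phase p m) ℂ}
    (h : Supports A W) (h' : Supports B W') : Supports (SympSpace.comp A B) (W' * W) := by
  classical
  obtain ⟨k, hk⟩ := h
  obtain ⟨k', hk'⟩ := h'
  obtain ⟨j, hj⟩ := card_fibre_holds A B
  have key (u : Phase p n) (w : Phase p l) : (W' * W) w u =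
      (p : ℂ) ^ (k + k') * Nat.card {v // Holds A u v ∧ Holds B v w} := by
    have h1 (v : Phase p m) : W' w v * W v u =
        if Holds A u v ∧ Holds B v w then (p : ℂ) ^ (k + k') else 0 := by
      by_cases hA : Holds A u v
      · by_cases hB : Holds B v w
        · rw [(hk u v).1 hA, (hk' v w).1 hB, if_pos ⟨hA, hB⟩, zpow_add₀ p_cast_ne_zero, mul_comm]
        · rw [(hk' v w).2 hB, if_neg (fun h => hB h.2), zero_mul]
      · rw [(hk u v).2 hA, if_neg (fun h => hA h.1), mul_zero]
    rw [Matrix.mul_apply, Finset.sum_congr rfl fun v _ => h1 v, ← Finset.sum_filter,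
      Finset.sum_const, nsmul_eq_mul, mul_comm, Nat.card_eq_fintype_card, Fintype.card_subtype]
  refine ⟨k + k' + j, fun u w => ⟨fun hR => ?_, fun hR => ?_⟩⟩
  · rw [key, hj u w hR, zpow_add₀ p_cast_ne_zero (k + k'), zpow_natCast, Nat.cast_pow]
  · rw [key]
    have : IsEmpty {v // Holds A u v ∧ Holds B v w} := ⟨fun v => hR ⟨v.1, v.2⟩⟩
    simp

/-- The converse relation. -/
def SympSpace.Hom.swap {k : Type} [Field k] {V W : SympSpace k} (A : Hom V W) : Hom W V :=
  Hom.ofRel (fun w v => A.R v w) (fun c _ _ _ _ _ _ h₁ h₂ h₃ => A.affine c h₁ h₂ h₃)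
    (fun w₀ v₀ h₀ w v h => A.coisotropic_apply h₀ v w fun v' w' h' => by
      have := h w' v' h'
      linear_combination -this)

theorem Supports.transpose {m n : ℕ} {A : Hom (stdSymp p n) (stdSymp p m)}
    {W : Matrix (Phase p m) (Phase p n) ℂ} (h : Supports A W) : Supports A.swap Wᵀ := by
  obtain ⟨k, hk⟩ := h
  exact ⟨k, fun v w => hk w v⟩


/-- An affine coisotropic relation on phase spaces, from a base point criterion. -/
def ofHolds {m n : ℕ} (r : Phase p n → Phase p m → Prop)
    (affine : ∀ (c : ZMod p) {v₁ v₂ v₃ : Phase p n} {w₁ w₂ w₃ : Phase p m}, r v₁ w₁ → r v₂ w₂ →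
      r v₃ w₃ → r (c • (v₁ - v₂) + v₃) (c • (w₁ - w₂) + w₃))
    (cois : ∀ v₀ w₀, r v₀ w₀ → ∀ v w,
      (∀ v' w', r v' w' → symp (w' - w₀) w - symp (v' - v₀) v = 0) → r (v + v₀) (w + w₀)) :
    Hom (stdSymp p n) (stdSymp p m) :=
  Hom.ofRel r affine cois

theorem Holds.coisotropic {m n : ℕ} {A : Hom (stdSymp p n) (stdSymp p m)} {v₀ : Phase p n}
    {w₀ : Phase p m} (h₀ : Holds A v₀ w₀) (v : Phase p n) (w : Phase p m)
    (h : ∀ v' w', Holds A v' w' → symp (w' - w₀) w - symp (v' - v₀) v = 0) :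
    Holds A (v + v₀) (w + w₀) := A.coisotropic_apply h₀ v w h

theorem Holds.affine {m n : ℕ} {A : Hom (stdSymp p n) (stdSymp p m)} (c : ZMod p)
    {v₁ v₂ v₃ : Phase p n} {w₁ w₂ w₃ : Phase p m} (h₁ : Holds A v₁ w₁) (h₂ : Holds A v₂ w₂)
    (h₃ : Holds A v₃ w₃) : Holds A (c • (v₁ - v₂) + v₃) (c • (w₁ - w₂) + w₃) :=
  Hom.affine A c h₁ h₂ h₃

/-- The form `-ω ⊕ ω` on pairs of phase space points. -/
def relSymp (p m n : ℕ) [Fact p.Prime] : LinearMap.BilinForm (ZMod p) (Phase p n × Phase p m) :=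
  relForm (stdSymp p n) (stdSymp p m)

theorem relSymp_apply {m n : ℕ} (a b : Phase p n × Phase p m) :
    relSymp p m n a b = symp a.2 b.2 - symp a.1 b.1 := rfl

theorem relSymp_orthogonal_orthogonal {m n : ℕ} (M : Submodule (ZMod p) (Phase p n × Phase p m)) :
    (relSymp p m n).orthogonal ((relSymp p m n).orthogonal M) = M :=
  LinearMap.BilinForm.orthogonal_orthogonal (relForm_nondegenerate (stdSymp p n) (stdSymp p m))
    (relForm_isRefl _ _) M

variable [NeZero (2 : ZMod p)]

/-- The pairs of Pauli operators that are intertwined by `f`. -/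
def intertwiners {m n : ℕ} (f : Matrix (Word p m) (Word p n) ℂ) :
    Submodule (ZMod p) (Phase p n × Phase p m) :=
  AddSubgroup.toZModSubmodule p
    { carrier := {x | ∃ t, Intertwines f t x.1 x.2}
      zero_mem' := ⟨0, Intertwines.zero f⟩
      add_mem' := fun ⟨_, h⟩ ⟨_, h'⟩ => ⟨_, h.add h'⟩
      neg_mem' := fun ⟨_, h⟩ => ⟨_, h.neg⟩ }

theorem mem_intertwiners {m n : ℕ} (f : Matrix (Word p m) (Word p n) ℂ)
    (x : Phase p n × Phase p m) : x ∈ intertwiners f ↔ ∃ t, Intertwines f t x.1 x.2 := Iff.rfl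

/-- The relation of the map with matrix `f`. -/
def MatRel {m n : ℕ} (f : Matrix (Word p m) (Word p n) ℂ) (v : Phase p n) (w : Phase p m) : Prop :=
  ∀ t b c, Intertwines f t b c → t = symp v b - symp w c

/-- For M the space of intertwined pairs, the direction of `MatRel f` is the orthogonal complement
of M, so a vector orthogonal to the direction lies in the double complement, which is M. -/
theorem mem_intertwiners_of_orthogonal {m n : ℕ} {f : Matrix (Word p m) (Word p n) ℂ}
    {v₀ : Phase p n} {w₀ : Phase p m} (h₀ : MatRel f v₀ w₀) (v : Phase p n) (w : Phase p m)
    (h : ∀ v' w', MatRel f v' w' → symp (w' - w₀) w - symp (v' - v₀) v = 0) :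
    ∃ t, Intertwines f t v w := by
  rw [← mem_intertwiners f (v, w), ← relSymp_orthogonal_orthogonal (intertwiners f),
    LinearMap.BilinForm.mem_orthogonal_iff]
  intro x hx
  rw [LinearMap.BilinForm.mem_orthogonal_iff] at hx
  -- Moving the base point by a vector orthogonal to all intertwined pairs does not leave the
  -- relation.
  have h1 := h (v₀ + x.1) (w₀ + x.2) fun t b c hi => by
    have h2 : symp c x.2 - symp b x.1 = 0 := hx (b, c) ⟨t, hi⟩
    rw [h₀ t b c hi]
    simp only [symp_add_left]
    rw [symp_swap x.1, symp_swap x.2]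
    linear_combination -h2
  rw [add_sub_cancel_left, add_sub_cancel_left] at h1
  exact h1

/-- The affine coisotropic relation of a nonzero map. -/
def pureHom {m n : ℕ} (f : Matrix (Word p m) (Word p n) ℂ) (hf : f ≠ 0) :
    Hom (stdSymp p n) (stdSymp p m) :=
  ofHolds (MatRel f)
    (by
      intro c v₁ v₂ v₃ w₁ w₂ w₃ h₁ h₂ h₃ t b c' hi
      simp only [symp_add_left, symp_smul_left, symp_sub_left]
      linear_combination h₃ t b c' hi + c * h₁ t b c' hi - c * h₂ t b c' hi)
    (by
      intro v₀ w₀ h₀ v w h t b c hi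
      -- The vector (v, w) is itself an intertwined pair, and such pairs are isotropic, so
      -- translating by it preserves the defining equations.
      obtain ⟨s, hs⟩ := mem_intertwiners_of_orthogonal h₀ v w h
      rw [h₀ t b c hi, symp_add_left, symp_add_left, hs.symp_eq hf hi]
      ring)

theorem holds_pureHom {m n : ℕ} (f : Matrix (Word p m) (Word p n) ℂ) (hf : f ≠ 0)
    (v : Phase p n) (w : Phase p m) : Holds (pureHom f hf) v w ↔ MatRel f v w := Iff.rfl

/-- The phase by which `f` intertwines a pair of Pauli operators, relative to `(v, w)`. -/
def phaseHom {m n : ℕ} {f : Matrix (Word p m) (Word p n) ℂ} (hf : f ≠ 0)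
    (θ : intertwiners f → ZMod p) (hθ : ∀ x, Intertwines f (θ x) x.1.1 x.1.2) (v : Phase p n)
    (w : Phase p m) : intertwiners f →+ ZMod p where
  toFun x := symp x.1.1 v - symp x.1.2 w + θ x
  map_zero' := by
    have : θ 0 = 0 := (hθ 0).unique hf (Intertwines.zero f)
    simp [this]
  map_add' x y := by
    have h1 := (hθ x).symp_eq hf (hθ y)
    have : θ (x + y) = θ x + θ y := by
      refine ((hθ (x + y)).unique hf ((hθ x).add (hθ y))).trans ?_
      rw [h1]
      ring
    rw [this]
    simp only [Submodule.coe_add, Prod.fst_add, Prod.snd_add, symp_add_left]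
    ring

theorem phaseHom_eq_zero_iff {m n : ℕ} {f : Matrix (Word p m) (Word p n) ℂ} (hf : f ≠ 0)
    (θ : intertwiners f → ZMod p) (hθ : ∀ x, Intertwines f (θ x) x.1.1 x.1.2) (v : Phase p n)
    (w : Phase p m) : (∀ x, phaseHom hf θ hθ v w x = 0) ↔ MatRel f v w := by
  have hφ (x : intertwiners f) : phaseHom hf θ hθ v w x =
    symp x.1.1 v - symp x.1.2 w + θ x := rfl
  constructor
  · intro h t b c hi
    have hx : (b, c) ∈ intertwiners f := ⟨t, hi⟩
    have h3 := h ⟨(b, c), hx⟩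
    have h4 : θ ⟨(b, c), hx⟩ = t := Intertwines.unique hf (hθ ⟨(b, c), hx⟩) hi
    rw [hφ, h4] at h3
    rw [symp_swap v, symp_swap w]
    linear_combination h3
  · intro h x
    have h3 := h _ _ _ (hθ x)
    rw [hφ, symp_swap x.1.1, symp_swap x.1.2]
    linear_combination h3

/-- The hypothesis `hM` says that the orthogonal complement of the intertwined pairs consists of
intertwined pairs. Off that subspace the characteristic function vanishes by `chi_eq_zero`; on it,
its values are phases times Tr(f f†). -/
theorem sum_chi {m n : ℕ} {f : Matrix (Word p m) (Word p n) ℂ} (hf : f ≠ 0)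
    (θ : intertwiners f → ZMod p) (hθ : ∀ x, Intertwines f (θ x) x.1.1 x.1.2)
    (hM : ∀ b c, (∀ t b' c', Intertwines f t b' c' → symp b b' = symp c c') →
      ∃ t, Intertwines f t b c) [Fintype (intertwiners f)] (v : Phase p n) (w : Phase p m) :
    (p : ℂ) ^ (m + m + n) * pureWigner f w v =
      (f * fᴴ).trace * ∑ x, (ξ (phaseHom hf θ hθ v w x) : ℂ) := by
  classical
  rw [pureWigner_eq_sum, ← Fintype.sum_prod_type'
    (f := fun b c => ξ (symp b v - symp c w) * chi f b c), Finset.mul_sum]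
  have h2 : ∑ x : Phase p n × Phase p m, ξ (symp x.1 v - symp x.2 w) * chi f x.1 x.2 =
      ∑ x : intertwiners f, ξ (symp x.1.1 v - symp x.1.2 w) * chi f x.1.1 x.1.2 := by
    rw [← Finset.sum_subtype (s := Finset.univ.filter (· ∈ intertwiners f)) (by simp)
      (fun x => ξ (symp x.1 v - symp x.2 w) * chi f x.1 x.2)]
    symm
    refine Finset.sum_subset (Finset.subset_univ _) fun x _ hx => ?_
    have : ¬ ∀ t b' c', Intertwines f t b' c' → symp x.1 b' = symp x.2 c' :=
      fun h => hx (Finset.mem_filter.2 ⟨Finset.mem_univ _, hM x.1 x.2 h⟩)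
    push Not at this
    obtain ⟨t, b', c', hi, hne⟩ := this
    rw [chi_eq_zero hi hne, mul_zero]
  refine h2.trans (Finset.sum_congr rfl fun x _ => ?_)
  rw [chi_of_intertwines (hθ x)]
  change _ = _ * (ξ (symp x.1.1 v - symp x.1.2 w + θ x) : ℂ)
  rw [AddChar.map_add_eq_mul]
  ring

/-- Fourier inversion leaves the sum of a character over the group of intertwined pairs. The
character is trivial exactly when (v, w) satisfies the equations of `MatRel`, and otherwise the sum
is zero. -/
theorem supports_pureHom {m n : ℕ} {f : Matrix (Word p m) (Word p n) ℂ} (hf : f ≠ 0)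
    (k : ℤ) (hk : (f * fᴴ).trace = (p : ℂ) ^ k)
    (hM : ∀ b c, (∀ t b' c', Intertwines f t b' c' → symp b b' = symp c c') →
      ∃ t, Intertwines f t b c) : Supports (pureHom f hf) (pureWigner f) := by
  classical
  obtain ⟨j, hj⟩ := card_submodule (intertwiners f)
  have := Fintype.ofFinite (intertwiners f)
  choose θ hθ using fun x : intertwiners f => (mem_intertwiners f x.1).1 x.2
  -- The value on the support is the number p ^ j of intertwined pairs times Tr(f f†) = p ^ k,
  -- divided by the factor p ^ (m + m + n) of the inverse transform.
  refine ⟨j + k - (m + m + n), fun v w => ?_⟩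
  have h1 := sum_chi hf θ hθ hM v w
  rw [sum_ξ_hom, hk] at h1
  have h4 := cast_pow_ne_zero (p := p) (m + m + n)
  rw [holds_pureHom, ← phaseHom_eq_zero_iff hf θ hθ]
  constructor
  · intro hR
    rw [if_pos hR, ← Nat.card_eq_fintype_card, hj] at h1
    refine mul_left_cancel₀ h4 (h1.trans ?_)
    rw [Nat.cast_pow, ← zpow_natCast, ← zpow_natCast, ← zpow_add₀ p_cast_ne_zero,
      ← zpow_add₀ p_cast_ne_zero]
    congr 1
    push_cast
    ring
  · intro hR
    rw [if_neg hR, mul_zero] at h1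
    exact (mul_eq_zero.1 h1).resolve_left h4

end Supports

/-! ### The support of the Wigner matrix of a pure map is the relation given by intertwined Pauli
operators -/

section PureRel
open Matrix SympSpace
variable {p : ℕ} [Fact p.Prime] [NeZero (2 : ZMod p)]

theorem Supports.eq_ofReal {m n : ℕ} {A : Hom (stdSymp p n) (stdSymp p m)}
    {W : Matrix (Phase p m) (Phase p n) ℂ} (h : Supports A W) (w : Phase p m) (v : Phase p n) :
    W w v = ((W w v).re : ℂ) ∧ 0 ≤ (W w v).re := by
  obtain ⟨k, hk⟩ := h
  by_cases hA : Holds A v w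
  · rw [(hk v w).1 hA]
    have : ((p : ℂ) ^ k) = (((p : ℝ) ^ k : ℝ) : ℂ) := by push_cast; rfl
    rw [this, Complex.ofReal_re]
    exact ⟨rfl, by positivity⟩
  · rw [(hk v w).2 hA]
    simp

theorem ξ_re_le (x : ZMod p) : (ξ x : ℂ).re ≤ 1 := (Complex.re_le_norm _).trans (norm_ξ x).le

theorem eq_zero_of_ξ_re {x : ZMod p} (h : (ξ x : ℂ).re = 1) : x = 0 := by
  refine ξ_eq_one_iff.1 ?_
  have h1 := Complex.sq_norm (ξ x : ℂ)
  rw [norm_ξ, Complex.normSq_apply, h] at h1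
  have h2 : (ξ x : ℂ).im = 0 := by
    have : (ξ x : ℂ).im * (ξ x : ℂ).im = 0 := by linarith
    exact mul_self_eq_zero.1 this
  exact Complex.ext h h2

/-- Equality in the triangle inequality: the Wigner matrix is nonnegative, and an intertwined pair
gives χ(b, c) = ξ(t) χ(0, 0), so no phase in the Fourier sum may deviate from ξ(t) at a point of the
support. -/
theorem Supports.matRel_of_holds {m n : ℕ} {f : Matrix (Word p m) (Word p n) ℂ}
    {A : Hom (stdSymp p n) (stdSymp p m)} (h : Supports A (pureWigner f)) {v : Phase p n}
    {w : Phase p m} (hA : Holds A v w) : MatRel f v w := by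
  intro t b c hi
  have h1 := chi_eq_sum f b c
  have h2 := chi_eq_sum f 0 0
  rw [chi_of_intertwines hi] at h1
  rw [chi_of_intertwines (Intertwines.zero f), AddChar.map_zero_eq_one, one_mul] at h2
  -- Up to the common factor p ^ n this is ξ(-t) χ(b, c) - χ(0, 0), written as one weighted sum of
  -- ξ(…) - 1.
  have h3 : ∑ x : Phase p n × Phase p m,
      ((ξ (symp x.1 b - symp x.2 c - t) : ℂ) - 1) * pureWigner f x.2 x.1 = 0 := by
    have e (x : Phase p n × Phase p m) :
        ((ξ (symp x.1 b - symp x.2 c - t) : ℂ) - 1) * pureWigner f x.2 x.1 =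
        ξ (-t) * (ξ (symp x.1 b - symp x.2 c) * pureWigner f x.2 x.1) -
          ξ (symp x.1 0 - symp x.2 0) * pureWigner f x.2 x.1 := by
      rw [sub_eq_add_neg _ t, AddChar.map_add_eq_mul]
      simp only [symp_zero_right, sub_zero, AddChar.map_zero_eq_one]
      ring
    rw [Finset.sum_congr rfl fun x _ => e x, Finset.sum_sub_distrib, ← Finset.mul_sum,
      Fintype.sum_prod_type' (f := fun v w => ξ (symp v b - symp w c) * pureWigner f w v),
      Fintype.sum_prod_type' (f := fun v w => ξ (symp v 0 - symp w 0) * pureWigner f w v),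
      ← h1, ← h2, mul_left_comm, ← mul_assoc (ξ (-t) : ℂ), ← AddChar.map_add_eq_mul,
      neg_add_cancel, AddChar.map_zero_eq_one, one_mul, sub_self]
  have h4 (x : Phase p n × Phase p m) :
      (((ξ (symp x.1 b - symp x.2 c - t) : ℂ) - 1) * pureWigner f x.2 x.1).re =
        ((ξ (symp x.1 b - symp x.2 c - t) : ℂ).re - 1) * (pureWigner f x.2 x.1).re := by
    rw [(h.eq_ofReal x.2 x.1).1, Complex.re_mul_ofReal]
    simp
  have h5 := congrArg Complex.re h3
  rw [Complex.re_sum, Complex.zero_re] at h5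
  -- Every summand has nonpositive real part, so a vanishing sum makes each real part vanish.
  have h6 := (Finset.sum_eq_zero_iff_of_nonpos fun x _ => by
    rw [h4]
    exact mul_nonpos_of_nonpos_of_nonneg (sub_nonpos.2 (ξ_re_le _)) (h.eq_ofReal x.2 x.1).2).1 h5
    (v, w) (Finset.mem_univ _)
  rw [h4] at h6
  have h7 : (pureWigner f w v).re ≠ 0 := fun h8 => (h.holds_iff v w).1 hA (by
    rw [(h.eq_ofReal w v).1, h8, Complex.ofReal_zero])
  have h8 := (mul_eq_zero.1 h6).resolve_right h7
  have := eq_zero_of_ξ_re (sub_eq_zero.1 h8)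
  exact (sub_eq_zero.1 this).symm

/-- Fixing one nonzero entry of f in the second factor exhibits g as a multiple of f: the doubled
map forgets only a scalar. -/
theorem exists_smul_of_kronecker_eq {X Y : Type*} {f g : Matrix X Y ℂ} (hf : f ≠ 0)
    (h : g ⊗ₖ g.map star = f ⊗ₖ f.map star) : ∃ z : ℂ, g = z • f := by
  have key (i i' : X) (j j' : Y) : g i j * star (g i' j') = f i j * star (f i' j') :=
    congrFun (congrFun h (i, i')) (j, j')
  obtain ⟨i₀, j₀, h₀⟩ : ∃ i j, f i j ≠ 0 := by
    by_contra! h0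
    exact hf (Matrix.ext h0)
  have h₁ : star (g i₀ j₀) ≠ 0 := by
    intro h1
    have := key i₀ i₀ j₀ j₀
    rw [h1, mul_zero] at this
    exact (mul_ne_zero h₀ (star_ne_zero.2 h₀)) this.symm
  refine ⟨star (f i₀ j₀) / star (g i₀ j₀), Matrix.ext fun i j => ?_⟩
  rw [Matrix.smul_apply, smul_eq_mul, div_mul_eq_mul_div, eq_div_iff h₁, key, mul_comm]

theorem wigner_zero {m n : ℕ} : wigner (0 : SupMatrix p m n) = 0 := by
  simp [wigner]

/-- For f = 0 every phase t intertwines the trivial pair, which imposes both 0 = 0 and 1 = 0. So the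
zero map has the empty relation. -/
theorem matRel_ne_zero {m n : ℕ} {f : Matrix (Word p m) (Word p n) ℂ} {v : Phase p n}
    {w : Phase p m} (h : MatRel f v w) : f ≠ 0 := by
  rintro rfl
  have h0 := h 0 0 0 (by simp [Intertwines])
  have h1 := h 1 0 0 (by simp [Intertwines])
  exact zero_ne_one (h0.trans h1.symm)

/-- Translation invariance says that f and its conjugate by the two Pauli operators have the same
doubled map, so they differ by a scalar z. Iterating p times gives z ^ p = 1 since the Pauli
operators have order dividing p; hence z is a value of ξ. -/
theorem exists_intertwines {m n : ℕ} {f : Matrix (Word p m) (Word p n) ℂ} (hf : f ≠ 0)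
    {d : Phase p n} {e : Phase p m}
    (h : ∀ v w, pureWigner f (w - e) (v - d) = pureWigner f w v) : ∃ t, Intertwines f t d e := by
  have h1 : pureWigner (heis 0 e * f * (heis 0 d)ᴴ) = pureWigner f := by
    ext w v
    rw [← h, ← pureWigner_translate f d e, sub_add_cancel, sub_add_cancel]
  obtain ⟨z, hz⟩ := exists_smul_of_kronecker_eq hf (wigner_injective h1)
  have h2 : heis 0 e * f = z • (f * heis 0 d) := by
    have := congrArg (fun M : Matrix (Word p m) (Word p n) ℂ => M * (heis 0 d : QMatrix p n)) hz
    simpa only [Matrix.mul_assoc, heis_conjTranspose_mul, Matrix.mul_one, Matrix.smul_mul] using this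
  have h3 (j : ℕ) : (heis 0 e) ^ j * f = z ^ j • (f * (heis 0 d) ^ j) := by
    induction j with
    | zero => simp
    | succ j ih =>
      rw [pow_succ', Matrix.mul_assoc, ih, Matrix.mul_smul, ← Matrix.mul_assoc, h2,
        Matrix.smul_mul, smul_smul, Matrix.mul_assoc, ← pow_succ', ← pow_succ]
  have h4 := h3 p
  rw [heis_zero_pow_prime, heis_zero_pow_prime, Matrix.one_mul, Matrix.mul_one] at h4
  have h5 : z ^ p = 1 := by
    have : (1 - z ^ p) • f = 0 := by rw [sub_smul, one_smul, ← h4, sub_self]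
    exact (sub_eq_zero.1 ((smul_eq_zero.1 this).resolve_right hf)).symm
  obtain ⟨s, rfl⟩ := exists_ξ_eq h5
  refine ⟨-s, ?_⟩
  rw [Intertwines, heis_eq_smul (-s) e, Matrix.smul_mul, h2, smul_smul, ← AddChar.map_add_eq_mul,
    neg_add_cancel, AddChar.map_zero_eq_one, one_smul]

/-- One inclusion is `Supports.matRel_of_holds`. For the other, the Wigner matrix is invariant under
the direction of A, so every vector of the direction is an intertwined pair; a solution of the
`MatRel` equations is then orthogonal to the direction relative to a base point, and coisotropy
places it in A. -/
theorem Supports.matRel_iff {m n : ℕ} {f : Matrix (Word p m) (Word p n) ℂ}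
    {A : Hom (stdSymp p n) (stdSymp p m)} (h : Supports A (pureWigner f)) (v : Phase p n)
    (w : Phase p m) : MatRel f v w ↔ Holds A v w := by
  refine ⟨fun hR => ?_, h.matRel_of_holds⟩
  have hf := matRel_ne_zero hR
  obtain ⟨v₀, w₀, h₀⟩ : ∃ v w, Holds A v w := by
    by_contra! hA
    refine hf ?_
    have : pureWigner f = wigner 0 := by
      rw [wigner_zero]
      ext w v
      by_contra hne
      exact hA v w ((h.holds_iff v w).2 hne)
    have h1 := wigner_injective this
    ext i j
    have : f i j * star (f i j) = 0 := congrFun (congrFun h1 (i, i)) (j, j)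
    simpa using this
  -- Both (v, w) and (v₀, w₀) satisfy the equation of the intertwined pair (v' - v₀, w' - w₀), with
  -- the same phase; subtracting the equations gives the orthogonality needed.
  have := h₀.coisotropic (v - v₀) (w - w₀) fun v' w' h' => by
    have hinv (a : Phase p n) (b : Phase p m) :
        Holds A (a - (v' - v₀)) (b - (w' - w₀)) ↔ Holds A a b := by
      constructor
      · intro h1
        simpa using h'.affine 1 h₀ h1
      · intro h1
        have := h₀.affine 1 h' h1
        rw [one_smul, one_smul] at this
        convert this using 1 <;> abel
    obtain ⟨t, ht⟩ := exists_intertwines hf (d := v' - v₀) (e := w' - w₀) fun a b => by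
      obtain ⟨k, hk⟩ := h
      by_cases hb : Holds A a b
      · rw [(hk a b).1 hb, (hk _ _).1 ((hinv a b).2 hb)]
      · rw [(hk a b).2 hb, (hk _ _).2 (fun h => hb ((hinv a b).1 h))]
    have h1 := hR t _ _ ht
    have h2 := h.matRel_of_holds h₀ t _ _ ht
    simp only [symp_sub_left, symp_sub_right] at h1 h2 ⊢
    have e1 := symp_swap v v'
    have e2 := symp_swap w w'
    have e3 := symp_swap v v₀
    have e4 := symp_swap w w₀
    have e5 := symp_swap v₀ v'
    have e6 := symp_swap w₀ w'
    simp only [symp_self] at *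
    rw [e1, e2, e3, e4] at h1
    rw [e5, e6] at h2
    linear_combination h2 - h1
  simpa using this

theorem phaseOp_conjTranspose {n : ℕ} (v : Phase p n) : (phaseOp v)ᴴ = phaseOp v := by
  ext j k
  change star (phaseMat p n (k, j) v) = phaseMat p n (j, k) v
  rw [phaseMat_apply, phaseMat_apply, apply_ite star, star_zero, star_ξ, add_comm k j,
    ← dotProduct_neg, neg_sub]

/-- Phase point operators are Hermitian and the trace is cyclic. The factor reconciles the
normalisations p ^ (-n) and p ^ (-m) of the two Wigner matrices. -/
theorem pureWigner_conjTranspose {m n : ℕ} (f : Matrix (Word p m) (Word p n) ℂ) :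
    pureWigner fᴴ = ((p : ℂ) ^ ((m : ℤ) - n)) • (pureWigner f)ᵀ := by
  ext v w
  rw [Matrix.smul_apply, Matrix.transpose_apply, pureWigner_apply, pureWigner_apply,
    conjTranspose_conjTranspose, phaseOp_conjTranspose, phaseOp_conjTranspose,
    zpow_sub₀ p_cast_ne_zero, zpow_natCast, zpow_natCast, smul_eq_mul, div_mul_eq_mul_div,
    mul_inv_cancel_left₀ (cast_pow_ne_zero m), inv_mul_eq_div]
  congr 1
  rw [← Matrix.mul_assoc, ← Matrix.mul_assoc, trace_mul_comm, ← Matrix.mul_assoc,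
    ← Matrix.mul_assoc, Matrix.mul_assoc, trace_mul_comm]
  simp only [Matrix.mul_assoc]
  rw [trace_mul_comm]
  simp only [Matrix.mul_assoc]

theorem trace_phaseOp_mul {n : ℕ} (w v : Phase p n) :
    ((phaseOp w)ᴴ * phaseOp v).trace = if w = v then (p : ℂ) ^ n else 0 := by
  rw [trace_conjTranspose_mul]
  have h := congrFun (congrFun (phaseMat_conjTranspose_mul (p := p) n) w) v
  rw [Matrix.mul_apply] at h
  refine h.trans ?_
  rw [Matrix.smul_apply, Matrix.one_apply, smul_eq_mul, mul_ite, mul_one, mul_zero]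

/-- A map that permutes phase point operators has a permutation as Wigner matrix, by orthogonality.
-/
theorem pureWigner_of_conj {m n : ℕ} {f : Matrix (Word p m) (Word p n) ℂ} {v : Phase p n}
    {v' : Phase p m} (h : f * phaseOp v * fᴴ = phaseOp v') (w : Phase p m) :
    pureWigner f w v = if w = v' then 1 else 0 := by
  rw [pureWigner_apply, h, trace_phaseOp_mul]
  split_ifs
  · exact inv_mul_cancel₀ (cast_pow_ne_zero m)
  · exact mul_zero _

end PureRel

/-! ### Relabellings of qupits and tensor products -/

section Tensor
open Matrix SympSpace
variable {p : ℕ} [Fact p.Prime]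

/-- Relabelling of words along a bijection of the positions. -/
def relabelWord {m n : ℕ} (σ : Fin n ≃ Fin m) : Word p n ≃ Word p m := σ.arrowCongr (Equiv.refl _)

theorem relabelWord_apply {m n : ℕ} (σ : Fin n ≃ Fin m) (x : Word p n) (i : Fin m) :
    relabelWord σ x i = x (σ.symm i) := rfl

theorem relabelWord_dot {m n : ℕ} (σ : Fin n ≃ Fin m) (x y : Word p n) :
    relabelWord σ x ⬝ᵥ relabelWord σ y = x ⬝ᵥ y :=
  Equiv.sum_comp σ.symm fun i => x i * y i

/-- Relabelling of phase space points along a bijection of the positions. -/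
def relabelPhase {m n : ℕ} (σ : Fin n ≃ Fin m) : Phase p n ≃ₗ[ZMod p] Phase p m :=
  (LinearEquiv.funCongrLeft (ZMod p) (ZMod p) σ.symm).prodCongr
    (LinearEquiv.funCongrLeft (ZMod p) (ZMod p) σ.symm)

theorem relabelPhase_apply {m n : ℕ} (σ : Fin n ≃ Fin m) (v : Phase p n) :
    relabelPhase σ v = (relabelWord σ v.1, relabelWord σ v.2) := rfl

theorem symp_relabelPhase {m n : ℕ} (σ : Fin n ≃ Fin m) (u v : Phase p n) :
    symp (relabelPhase σ u) (relabelPhase σ v) = symp u v := by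
  rw [relabelPhase_apply, relabelPhase_apply, symp, relabelWord_dot, relabelWord_dot, symp]

/-- The graph of a relabelling. -/
def relabelHom (p : ℕ) [Fact p.Prime] {m n : ℕ} (σ : Fin n ≃ Fin m) :
    Hom (stdSymp p n) (stdSymp p m) :=
  SympSpace.graph (V := stdSymp p n) (W := stdSymp p m) (relabelPhase σ) (symp_relabelPhase σ)

/-- The first part of a word. -/
def Word.left {n m : ℕ} (x : Word p (n + m)) : Word p n := fun i => x (Fin.castAdd m i)
/-- The second part of a word. -/
def Word.right {n m : ℕ} (x : Word p (n + m)) : Word p m := fun i => x (Fin.natAdd n i)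
/-- The first part of a phase space point. -/
def Phase.left {n m : ℕ} (v : Phase p (n + m)) : Phase p n := (Word.left v.1, Word.left v.2)
/-- The second part of a phase space point. -/
def Phase.right {n m : ℕ} (v : Phase p (n + m)) : Phase p m := (Word.right v.1, Word.right v.2)
/-- The concatenation of phase space points. -/
def Phase.append {n m : ℕ} (v : Phase p n) (w : Phase p m) : Phase p (n + m) :=
  (Fin.append v.1 w.1, Fin.append v.2 w.2)

@[simp] theorem Word.left_append {n m : ℕ} (x : Word p n) (y : Word p m) :
    Word.left (Fin.append x y) = x := funext fun i => Fin.append_left x y i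
@[simp] theorem Word.right_append {n m : ℕ} (x : Word p n) (y : Word p m) :
    Word.right (Fin.append x y) = y := funext fun i => Fin.append_right x y i
@[simp] theorem Phase.left_append {n m : ℕ} (v : Phase p n) (w : Phase p m) :
    (Phase.append v w).left = v := by simp [Phase.left, Phase.append]
@[simp] theorem Phase.right_append {n m : ℕ} (v : Phase p n) (w : Phase p m) :
    (Phase.append v w).right = w := by simp [Phase.right, Phase.append]
@[simp] theorem Phase.append_left_right {n m : ℕ} (v : Phase p (n + m)) :
    Phase.append v.left v.right = v :=
  Prod.ext Fin.append_castAdd_natAdd Fin.append_castAdd_natAdd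

theorem dot_split {n m : ℕ} (x y : Word p (n + m)) :
    x ⬝ᵥ y = Word.left x ⬝ᵥ Word.left y + Word.right x ⬝ᵥ Word.right y :=
  Fin.sum_univ_add fun i => x i * y i

theorem symp_split {n m : ℕ} (u v : Phase p (n + m)) :
    symp u v = symp u.left v.left + symp u.right v.right := by
  simp only [symp, dot_split, Phase.left, Phase.right]
  ring

theorem word_ext_iff {n m : ℕ} {x y : Word p (n + m)} :
    x = y ↔ Word.left x = Word.left y ∧ Word.right x = Word.right y := by
  constructor
  · rintro rfl; exact ⟨rfl, rfl⟩
  · rintro ⟨h1, h2⟩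
    exact (Fin.append_castAdd_natAdd (f := x)).symm.trans
      ((congrArg₂ Fin.append h1 h2).trans Fin.append_castAdd_natAdd)

@[simp] theorem Phase.left_sub {n m : ℕ} (v w : Phase p (n + m)) :
    (v - w).left = v.left - w.left := rfl
@[simp] theorem Phase.right_sub {n m : ℕ} (v w : Phase p (n + m)) :
    (v - w).right = v.right - w.right := rfl
@[simp] theorem Phase.left_add {n m : ℕ} (v w : Phase p (n + m)) :
    (v + w).left = v.left + w.left := rfl
@[simp] theorem Phase.right_add {n m : ℕ} (v w : Phase p (n + m)) :
    (v + w).right = v.right + w.right := rfl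

/-- Pairs of words of length `n + m` as pairs of pairs of words. -/
def wordPairEquiv (p n m : ℕ) [Fact p.Prime] :
    (Word p n × Word p n) × (Word p m × Word p m) ≃ Word p (n + m) × Word p (n + m) :=
  (Equiv.prodProdProdComm _ _ _ _).trans ((Fin.appendEquiv n m).prodCongr (Fin.appendEquiv n m))

theorem sum_word_split {n m : ℕ} {F : Word p (n + m) × Word p (n + m) → ℂ}
    {G : Word p n × Word p n → ℂ} {H : Word p m × Word p m → ℂ}
    (h : ∀ x, F x = G (Word.left x.1, Word.left x.2) * H (Word.right x.1, Word.right x.2)) :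
    ∑ x, F x = (∑ x, G x) * ∑ x, H x := by
  rw [← (wordPairEquiv p n m).sum_comp, Fintype.sum_prod_type, Finset.sum_mul_sum]
  refine Finset.sum_congr rfl fun a _ => Finset.sum_congr rfl fun b _ => ?_
  rw [h]
  have e : wordPairEquiv p n m (a, b) = (Fin.append a.1 b.1, Fin.append a.2 b.2) := rfl
  rw [e]
  simp only [Word.left_append, Word.right_append]

theorem splitEquiv_form (n m : ℕ) (u v : stdSymp p (n + m)) :
    (stdSymp p n ⊗ stdSymp p m : SympSpace (ZMod p)).form (splitEquiv p n m u) (splitEquiv p n m v) =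
      (stdSymp p (n + m)).form u v := (symp_split u v).symm

theorem splitEquiv_symm_form (n m : ℕ) (u v : (stdSymp p n ⊗ stdSymp p m : SympSpace (ZMod p))) :
    (stdSymp p (n + m)).form ((splitEquiv p n m).symm u) ((splitEquiv p n m).symm v) =
    (stdSymp p n ⊗ stdSymp p m : SympSpace (ZMod p)).form u v := by
  rw [← splitEquiv_form, LinearEquiv.apply_symm_apply, LinearEquiv.apply_symm_apply]

/-- The direct sum of relations on standard symplectic spaces. -/
def tensorRel {n m n' m' : ℕ} (A : Hom (stdSymp p n) (stdSymp p m))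
    (B : Hom (stdSymp p n') (stdSymp p m')) : Hom (stdSymp p (n + n')) (stdSymp p (m + m')) :=
  ofHolds (fun v w => Holds A v.left w.left ∧ Holds B v.right w.right)
    (fun c _ _ _ _ _ _ h₁ h₂ h₃ => ⟨h₁.1.affine c h₂.1 h₃.1, h₁.2.affine c h₂.2 h₃.2⟩)
    (fun v₀ w₀ h₀ v w h => by
      constructor
      · refine h₀.1.coisotropic v.left w.left fun v' w' h' => ?_
        have := h (Phase.append v' v₀.right) (Phase.append w' w₀.right) (by simpa using ⟨h', h₀.2⟩)
        rw [symp_split, symp_split] at this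
        simpa only [Phase.left_sub, Phase.right_sub, Phase.left_append, Phase.right_append, sub_self,
          symp_zero_left, add_zero, zero_add] using this
      · refine h₀.2.coisotropic v.right w.right fun v' w' h' => ?_
        have := h (Phase.append v₀.left v') (Phase.append w₀.left w') (by simpa using ⟨h₀.1, h'⟩)
        rw [symp_split, symp_split] at this
        simpa only [Phase.left_sub, Phase.right_sub, Phase.left_append, Phase.right_append, sub_self,
          symp_zero_left, add_zero, zero_add] using this)


theorem holds_tensorRel {n m n' m' : ℕ} (A : Hom (stdSymp p n) (stdSymp p m))
    (B : Hom (stdSymp p n') (stdSymp p m')) (v w) :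
    Holds (tensorRel A B) v w ↔ Holds A v.left w.left ∧ Holds B v.right w.right := Iff.rfl

theorem Supports.tensor {n m n' m' : ℕ} {A : Hom (stdSymp p n) (stdSymp p m)}
    {B : Hom (stdSymp p n') (stdSymp p m')} {W : Matrix (Phase p m) (Phase p n) ℂ}
    {W' : Matrix (Phase p m') (Phase p n') ℂ} {V : Matrix (Phase p (m + m')) (Phase p (n + n')) ℂ}
    (h : Supports A W) (h' : Supports B W')
    (hV : ∀ w v, V w v = W w.left v.left * W' w.right v.right) : Supports (tensorRel A B) V := by
  obtain ⟨k, hk⟩ := h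
  obtain ⟨k', hk'⟩ := h'
  refine ⟨k + k', fun v w => ?_⟩
  rw [hV, holds_tensorRel, zpow_add₀ p_cast_ne_zero]
  constructor
  · rintro ⟨hA, hB⟩
    rw [(hk _ _).1 hA, (hk' _ _).1 hB]
  · intro hn
    rw [not_and_or] at hn
    rcases hn with hn | hn
    · rw [(hk _ _).2 hn, zero_mul]
    · rw [(hk' _ _).2 hn, mul_zero]

/-- The matrix of a linear map between spaces of qupits. -/
def qmat {n m : ℕ} (f : qupits p n ⟶ qupits p m) : Matrix (Word p m) (Word p n) ℂ := f.mat

theorem qmat_comp {n m l : ℕ} (f : qupits p n ⟶ qupits p m) (g : qupits p m ⟶ qupits p l) :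
    qmat (f ≫ g) = qmat g * qmat f := rfl

theorem qmat_adj {n m : ℕ} (f : qupits p n ⟶ qupits p m) : qmat (FHilb.adj f) = (qmat f)ᴴ := rfl

theorem qmat_id (n : ℕ) : qmat (𝟙 (qupits p n)) = 1 := rfl

theorem qmat_injective {n m : ℕ} {f g : qupits p n ⟶ qupits p m} (h : qmat f = qmat g) : f = g :=
  FHilb.hom_ext h

/-- The tensor product of maps between spaces of qupits. -/
def tensorMat {n m n' m' : ℕ} (f : qupits p n ⟶ qupits p m) (g : qupits p n' ⟶ qupits p m') :
    qupits p (n + n') ⟶ qupits p (m + m') := (qupitFamily p).tensorMap f g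

theorem tensorMat_apply {n m n' m' : ℕ} (f : qupits p n ⟶ qupits p m) (g : qupits p n' ⟶ qupits p m')
    (y : Word p (m + m')) (x : Word p (n + n')) : qmat (tensorMat f g) y x =
      qmat f (Word.left y) (Word.left x) * qmat g (Word.right y) (Word.right x) := by
  refine (FHilb.perm_comp_apply _ _ _ _).trans ?_
  refine (FHilb.comp_perm_apply _ _ _ _).trans ?_
  rfl

variable [NeZero (2 : ZMod p)]

/-- The midpoint condition and the dot product are invariant under permuting positions, so a
relabelling carries the phase point operator at v to the one at the relabelled point. -/
theorem pureWigner_relabel {m n : ℕ} (σ : Fin n ≃ Fin m) (w : Phase p m) (v : Phase p n) :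
    pureWigner (qmat (FHilb.perm (relabelWord σ) : qupits p n ⟶ qupits p m)) w v = if w = relabelPhase σ v then 1 else 0 := by
  refine pureWigner_of_conj ?_ w
  have hperm : qmat (FHilb.perm (relabelWord σ) : qupits p n ⟶ qupits p m) = (1 : QMatrix p m).submatrix id (relabelWord σ) := rfl
  have h1 : phaseOp (relabelPhase σ v) =
      (phaseOp v).submatrix (relabelWord σ).symm (relabelWord σ).symm := by
    ext j k
    obtain ⟨j, rfl⟩ := (relabelWord σ).surjective j
    obtain ⟨k, rfl⟩ := (relabelWord σ).surjective k
    rw [submatrix_apply, Equiv.symm_apply_apply, Equiv.symm_apply_apply]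
    change phaseMat p m _ _ = phaseMat p n _ _
    have e1 : relabelWord σ j + relabelWord σ k = relabelWord σ (j + k) := rfl
    have e2 : relabelWord σ j - relabelWord σ k = relabelWord σ (j - k) := rfl
    have e3 : (2 : ZMod p) • relabelWord σ v.1 = relabelWord σ ((2 : ZMod p) • v.1) := rfl
    rw [phaseMat_apply, phaseMat_apply, relabelPhase_apply]
    simp only [e1, e2, e3, relabelWord_dot, EmbeddingLike.apply_eq_iff_eq]
  rw [h1, hperm]
  ext j k
  obtain ⟨j, rfl⟩ := (relabelWord σ).surjective j
  obtain ⟨k, rfl⟩ := (relabelWord σ).surjective k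
  rw [submatrix_apply, Equiv.symm_apply_apply, Equiv.symm_apply_apply, CPM.sandwich]
  simp [Matrix.one_apply]

theorem supports_relabel {m n : ℕ} (σ : Fin n ≃ Fin m) :
    Supports (relabelHom p σ) (pureWigner (qmat (FHilb.perm (relabelWord σ) : qupits p n ⟶ qupits p m))) := by
  refine ⟨0, fun v w => ?_⟩
  rw [pureWigner_relabel, zpow_zero]
  exact ⟨fun h => if_pos h, fun h => if_neg h⟩

/-- The midpoint condition and the dot product both split over the two blocks: the phase point
operator of a concatenation is a tensor product. -/
theorem phaseMat_split {n m : ℕ} (x : Word p (n + m) × Word p (n + m)) (v : Phase p (n + m)) :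
    phaseMat p (n + m) x v = phaseMat p n (Word.left x.1, Word.left x.2) v.left *
      phaseMat p m (Word.right x.1, Word.right x.2) v.right := by
  obtain ⟨j, k⟩ := x
  have h : j + k = (2 : ZMod p) • v.1 ↔ Word.left j + Word.left k = (2 : ZMod p) • v.left.1 ∧
    Word.right j + Word.right k = (2 : ZMod p) • v.right.1 := word_ext_iff
  rw [phaseMat_apply, phaseMat_apply, phaseMat_apply]
  by_cases h1 : Word.left j + Word.left k = (2 : ZMod p) • v.left.1
  · by_cases h2 : Word.right j + Word.right k = (2 : ZMod p) • v.right.1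
    · rw [if_pos (h.2 ⟨h1, h2⟩), if_pos h1, if_pos h2, ← AddChar.map_add_eq_mul, dot_split]
      rfl
    · rw [if_neg (fun k => h2 (h.1 k).2), if_neg h2, mul_zero]
  · rw [if_neg (fun k => h1 (h.1 k).1), if_neg h1, zero_mul]

theorem wigner_tensor {n m n' m' : ℕ} {D : SupMatrix p (m + m') (n + n')} {D₁ : SupMatrix p m n}
    {D₂ : SupMatrix p m' n'}
    (h : ∀ y x, D y x = D₁ (Word.left y.1, Word.left y.2) (Word.left x.1, Word.left x.2) *
      D₂ (Word.right y.1, Word.right y.2) (Word.right x.1, Word.right x.2))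
    (w : Phase p (m + m')) (v : Phase p (n + n')) :
    wigner D w v = wigner D₁ w.left v.left * wigner D₂ w.right v.right := by
  rw [wigner_apply, wigner_apply, wigner_apply, mul_mul_mul_comm, ← mul_inv, ← pow_add]
  congr 1
  refine sum_word_split (G := fun y => star (phaseMat p m y w.left) *
    ∑ x, D₁ y x * phaseMat p n x v.left) (H := fun y => star (phaseMat p m' y w.right) *
    ∑ x, D₂ y x * phaseMat p n' x v.right) fun y => ?_
  rw [phaseMat_split, star_mul', mul_mul_mul_comm]
  congr 1
  refine sum_word_split (G := fun x => D₁ _ x * phaseMat p n x v.left)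
    (H := fun x => D₂ _ x * phaseMat p n' x v.right) fun x => ?_
  rw [phaseMat_split, h, mul_mul_mul_comm]

theorem pureWigner_tensor {n m n' m' : ℕ} (f : qupits p n ⟶ qupits p m)
    (g : qupits p n' ⟶ qupits p m') (w : Phase p (m + m')) (v : Phase p (n + n')) :
    pureWigner (qmat (tensorMat f g)) w v =
    pureWigner (qmat f) w.left v.left * pureWigner (qmat g) w.right v.right := by
  refine wigner_tensor (fun y x => ?_) w v
  rw [kroneckerMap_apply, kroneckerMap_apply, kroneckerMap_apply, map_apply, map_apply, map_apply,
    tensorMat_apply, tensorMat_apply, star_mul']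
  ring

end Tensor

/-! ### Wigner matrices of stabiliser maps -/

section Generators
open Matrix SympSpace
variable {p : ℕ} [Fact p.Prime]

theorem append_right_left {n m : ℕ} (x : Word p (n + m)) :
    Fin.append x.right x.left = relabelWord (p := p) finAddFlip x := by
  funext i
  rw [relabelWord_apply]
  refine Fin.addCases (fun i => ?_) (fun i => ?_) i
  · rw [Fin.append_left]; simp [Word.right, finAddFlip]
  · rw [Fin.append_right]; simp [Word.left, finAddFlip]

theorem swapEquiv_eq (n m : ℕ) :
    (qupitFamily p).swapEquiv n m = relabelWord (p := p) finAddFlip :=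
  Equiv.ext fun (x : Word p (n + m)) => append_right_left x

/-- The cup of `n` qupits. -/
def qupitCup (p n : ℕ) [Fact p.Prime] : qupits p 0 ⟶ qupits p (n + n) := (qupitFamily p).cupMap n

theorem qmat_cup (n : ℕ) (y : Word p (n + n)) (x : Word p 0) :
    qmat (qupitCup p n) y x =
      if Word.left y = Word.right y then 1 else 0 := by
  refine (FHilb.perm_comp_apply _ _ _ _).trans ?_
  refine (FHilb.comp_perm_apply _ _ _ _).trans ?_
  rfl

/-- The phase space point with reversed momentum. -/
def Phase.conj {n : ℕ} (v : Phase p n) : Phase p n := (v.1, -v.2)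

@[simp] theorem Phase.conj_conj {n : ℕ} (v : Phase p n) : v.conj.conj = v := by simp [Phase.conj]
theorem Phase.conj_add {n : ℕ} (v w : Phase p n) : (v + w).conj = v.conj + w.conj := by
  simp [Phase.conj, add_comm]
theorem Phase.conj_sub {n : ℕ} (v w : Phase p n) : (v - w).conj = v.conj - w.conj := by
  simp [Phase.conj, sub_eq_add_neg, add_comm]
theorem Phase.conj_smul {n : ℕ} (c : ZMod p) (v : Phase p n) : (c • v).conj = c • v.conj := by
  simp [Phase.conj]
theorem symp_conj {n : ℕ} (v w : Phase p n) : symp v.conj w = - symp v w.conj := by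
  simp [Phase.conj, symp]; ring

theorem eq_of_symp_left {n : ℕ} {v w : Phase p n} (h : ∀ u, symp u v = symp u w) : v = w := by
  rw [← sub_eq_zero]
  refine eq_zero_of_symp fun u => ?_
  rw [symp_sub_right, h, sub_self]

theorem phase_zero_eq (v : Phase p 0) : v = 0 := Subsingleton.elim _ _

/-- The relation of the cup. -/
def cupRel (p n : ℕ) [Fact p.Prime] : Hom (stdSymp p 0) (stdSymp p (n + n)) :=
  ofHolds (fun v w => w.left = w.right.conj)
    (fun c v₁ v₂ v₃ w₁ w₂ w₃ h₁ h₂ h₃ => by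
      have e1 : (c • (w₁ - w₂) + w₃).left = c • (w₁.left - w₂.left) + w₃.left := rfl
      have e2 : (c • (w₁ - w₂) + w₃).right = c • (w₁.right - w₂.right) + w₃.right := rfl
      rw [e1, e2, h₁, h₂, h₃, Phase.conj_add, Phase.conj_smul, Phase.conj_sub])
    (fun v₀ w₀ h₀ v w h => by
      rw [Phase.left_add, Phase.right_add, Phase.conj_add, h₀]
      congr 1
      refine eq_of_symp_left fun u => ?_
      -- The tangent vectors of the relation are the pairs (u, ū); testing against all of them
      -- recovers the two halves of w up to conjugation.
      have := h 0 (Phase.append u.conj.conj u.conj + w₀) (by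
        rw [Phase.left_add, Phase.right_add, Phase.conj_add, h₀]; simp)
      rw [phase_zero_eq v, add_sub_cancel_right, symp_zero_right, sub_zero, symp_split] at this
      simp only [Phase.left_append, Phase.right_append, Phase.conj_conj] at this
      rw [symp_conj] at this
      linear_combination this)

variable [NeZero (2 : ZMod p)]

/-- Complex conjugation inverts the phases, which is the same as reversing the momentum. -/
theorem star_phaseMat_conj {n : ℕ} (x : Word p n × Word p n) (v : Phase p n) :
    star (phaseMat p n x v) = phaseMat p n x v.conj := by
  obtain ⟨j, k⟩ := x
  rw [phaseMat_apply, phaseMat_apply, apply_ite star, star_zero, star_ξ]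
  simp [Phase.conj, sub_eq_add_neg, add_comm]

/-- The two halves of the cup are contracted, which turns the pair of phase point operators into the
inner product of the one at `w.left` with the conjugate of the one at `w.right`; orthogonality then
gives p ^ n out of the normalisation p ^ (n + n). -/
theorem pureWigner_cup (n : ℕ) (w : Phase p (n + n)) (v : Phase p 0) :
    pureWigner (qmat (qupitCup p n)) w v =
      if w.left = w.right.conj then ((p : ℂ) ^ n)⁻¹ else 0 := by
  set f := qmat (qupitCup p n) with hf
  have h1 (y : Word p (n + n) × Word p (n + n)) :
      ∑ x, (f ⊗ₖ f.map star) y x * phaseMat p 0 x v =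
        (if Word.left y.1 = Word.right y.1 then 1 else 0) *
          if Word.left y.2 = Word.right y.2 then 1 else 0 := by
    rw [Fintype.sum_prod_type, Fintype.sum_unique, Fintype.sum_unique, phaseMat_apply, if_pos (Subsingleton.elim _ _),
      Subsingleton.elim (v.2) 0, zero_dotProduct, AddChar.map_zero_eq_one, mul_one,
      kroneckerMap_apply, map_apply, hf, qmat_cup, qmat_cup, apply_ite star, star_one, star_zero]
  rw [pureWigner, wigner_apply]
  simp only [h1]
  have h2 : ∑ y : Word p (n + n) × Word p (n + n), star (phaseMat p (n + n) y w) *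
      ((if Word.left y.1 = Word.right y.1 then 1 else 0) *
          if Word.left y.2 = Word.right y.2 then 1 else 0) =
      ∑ x : Word p n × Word p n, star (phaseMat p n x w.left) * phaseMat p n x w.right.conj := by
    rw [← (wordPairEquiv p n n).sum_comp, Fintype.sum_prod_type]
    refine Finset.sum_congr rfl fun a _ => ?_
    have e (b : Word p n × Word p n) :
      wordPairEquiv p n n (a, b) = (Fin.append a.1 b.1, Fin.append a.2 b.2) := rfl
    simp only [e, Word.left_append, Word.right_append, phaseMat_split]
    rw [Finset.sum_eq_single a]
    · rw [if_pos rfl, if_pos rfl, mul_one, mul_one, star_mul', star_phaseMat_conj _ w.right]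
    · intro b _ hb
      by_cases h : a.1 = b.1
      · have h' : a.2 ≠ b.2 := fun h' => hb (Prod.ext h h').symm
        rw [if_neg h', mul_zero, mul_zero]
      · rw [if_neg h, zero_mul, mul_zero]
    · simp
  have h3 := congrFun (congrFun (phaseMat_conjTranspose_mul (p := p) n) w.left) w.right.conj
  rw [Matrix.mul_apply] at h3
  rw [h2]
  refine (congrArg _ h3).trans ?_
  rw [Matrix.smul_apply, Matrix.one_apply, smul_eq_mul, mul_ite, mul_one, mul_zero, mul_ite,
    mul_zero, pow_add, mul_inv, inv_mul_cancel_right₀ (cast_pow_ne_zero n)]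

theorem supports_cup (n : ℕ) : Supports (cupRel p n)
    (pureWigner (qmat (qupitCup p n))) := by
  refine ⟨-n, fun v w => ?_⟩
  rw [pureWigner_cup, _root_.zpow_neg, zpow_natCast]
  exact ⟨fun h => if_pos h, fun h => if_neg h⟩

/-- Scaling acts by |c|², so the generators √p and 1/√p contribute integral powers of p. -/
theorem pureWigner_smul {n m : ℕ} (c : ℂ) (f : Matrix (Word p m) (Word p n) ℂ) :
    pureWigner (c • f) = (c * star c) • pureWigner f := by
  rw [pureWigner, pureWigner, ← wigner_smul]
  congr 1
  ext i j
  simp only [kroneckerMap_apply, map_apply, Matrix.smul_apply, smul_eq_mul, star_mul']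
  ring

theorem sqrt_mul_star : ((Real.sqrt p : ℝ) : ℂ) * star ((Real.sqrt p : ℝ) : ℂ) = (p : ℂ) ^ (1 : ℤ) := by
  rw [show star ((Real.sqrt p : ℝ) : ℂ) = _ from Complex.conj_ofReal _, ← Complex.ofReal_mul,
    Real.mul_self_sqrt (Nat.cast_nonneg p), zpow_one, Complex.ofReal_natCast]

theorem inv_sqrt_mul_star : (1 / (Real.sqrt p : ℝ) : ℂ) * star (1 / (Real.sqrt p : ℝ) : ℂ) =
    (p : ℂ) ^ (-1 : ℤ) := by
  rw [one_div, star_inv₀, ← mul_inv, sqrt_mul_star, zpow_one, _root_.zpow_neg, zpow_one]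

theorem supports_id (n : ℕ) : Supports (relabelHom p (Equiv.refl (Fin n)))
    (pureWigner (qmat (𝟙 (qupits p n)))) := by
  have := supports_relabel (p := p) (Equiv.refl (Fin n))
  have e : relabelWord (p := p) (Equiv.refl (Fin n)) = Equiv.refl _ := rfl
  rwa [e, FHilb.perm_refl] at this

theorem qmat_ne_zero_of_trace {n m : ℕ} {f : Matrix (Word p m) (Word p n) ℂ} {k : ℤ}
    (h : (f * fᴴ).trace = (p : ℂ) ^ k) : f ≠ 0 := by
  rintro rfl
  rw [Matrix.zero_mul, trace_zero] at h
  exact zpow_ne_zero k p_cast_ne_zero h.symm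

/-- Conjugation by U defines a map S of phase space that preserves ω and is injective, hence
bijective. Its graph consists of intertwined pairs and is its own orthogonal complement, as
`supports_pureHom` requires. -/
theorem exists_supports_clifford {n : ℕ} {U : qupits p n ⟶ qupits p n} (hU : IsClifford U) :
    ∃ A, Supports A (pureWigner (qmat U)) := by
  obtain ⟨hu, hP⟩ := hU
  have hu1 : (qmat U)ᴴ * qmat U = 1 := (Matrix.mem_unitaryGroup_iff'.1 hu)
  have hu2 : qmat U * (qmat U)ᴴ = 1 := (Matrix.mem_unitaryGroup_iff.1 hu)
  have hk : (qmat U * (qmat U)ᴴ).trace = (p : ℂ) ^ (n : ℤ) := by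
    rw [hu2, trace_one, card_word, zpow_natCast]
  have hf := qmat_ne_zero_of_trace hk
  refine ⟨pureHom (qmat U) hf, supports_pureHom hf n hk fun b c h => ?_⟩
  have hex (b : Phase p n) : ∃ t c, Intertwines (qmat U) t b c := by
    have h1 : IsPauli (qmat U * heis 0 b * (qmat U)ᴴ) := hP _ ⟨_, _, _, rfl⟩
    obtain ⟨t, c, hc⟩ := (isPauli_iff _).1 h1
    refine ⟨t, c, ?_⟩
    rw [Intertwines, ← hc, Matrix.mul_assoc, hu1, Matrix.mul_one]
  choose θ S hS using hex
  -- A collision would make π(0, b - b') proportional to the identity after conjugation by U, hence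
  -- before it.
  have hinj : Function.Injective S := by
    intro b b' hb
    obtain ⟨s, h1⟩ : ∃ s, Intertwines (qmat U) s (b + -b') 0 := by
      have h1 := (hS b).add (hS b').neg
      rw [hb, add_neg_cancel] at h1
      exact ⟨_, h1⟩
    have h2 : (heis 0 (b + -b') : QMatrix p n) = heis s 0 := by
      have := congrArg (fun M => (qmat U)ᴴ * M) h1
      rw [heis_eq_smul s (0 : Phase p n), heis_zero] at this
      rw [← Matrix.mul_assoc, hu1, Matrix.one_mul, Matrix.smul_mul, Matrix.mul_smul, Matrix.one_mul,
        hu1] at this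
      rw [this, heis_eq_smul s (0 : Phase p n), heis_zero]
    have := (heis_injective h2).2
    rwa [← sub_eq_add_neg, sub_eq_zero] at this
  have hsurj := Finite.surjective_of_injective hinj
  refine ⟨θ b, ?_⟩
  -- Every test vector is some S b', and on these both S b and c have the same pairing as b has with
  -- b'.
  have : c = S b := by
    refine eq_of_symp_left fun u => ?_
    obtain ⟨b', rfl⟩ := hsurj u
    have h1 := h _ _ _ (hS b')
    have h2 := (hS b).symp_eq hf (hS b')
    rw [symp_swap, ← h1, h2, ← symp_swap]
  rw [this]
  exact hS b

theorem heis_pow {n : ℕ} (t : ZMod p) (b : Phase p n) (j : ℕ) :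
    (heis t b : QMatrix p n) ^ j = heis ((j : ZMod p) * t) ((j : ZMod p) • b) := by
  induction j with
  | zero => simp
  | succ j ih => rw [pow_succ, ih, heis_mul]; simp [add_smul, add_mul]

/-- The elements of the Heisenberg group as units. -/
def heisUnit {n : ℕ} (t : ZMod p) (b : Phase p n) : (QMatrix p n)ˣ where
  val := heis t b
  inv := heis (-t) (-b)
  val_inv := heis_mul_neg t b
  inv_val := heis_neg_mul t b

theorem val_heisUnit {n : ℕ} (t : ZMod p) (b : Phase p n) :
    (heisUnit t b : QMatrix p n) = heis t b := rfl

theorem heisUnit_mul {n : ℕ} (a a' : ZMod p) (b b' : Phase p n) :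
    heisUnit a b * heisUnit a' b' = heisUnit (a + a' - 2⁻¹ * symp b b') (b + b') :=
  Units.ext (heis_mul a a' b b')

theorem heisUnit_inv {n : ℕ} (a : ZMod p) (b : Phase p n) :
    (heisUnit a b)⁻¹ = heisUnit (-a) (-b) := Units.ext rfl

theorem heis_commute {n : ℕ} {t t' : ZMod p} {b c : Phase p n} (h : symp b c = 0) :
    (heis t b * heis t' c : QMatrix p n) = heis t' c * heis t b := by
  rw [heis_mul, heis_mul, symp_swap c b, h, add_comm t, add_comm b, neg_zero]

theorem heisUnit_commute {n : ℕ} {t t' : ZMod p} {b c : Phase p n} (h : symp b c = 0) :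
    heisUnit t b * heisUnit t' c = heisUnit t' c * heisUnit t b := Units.ext (heis_commute h)

theorem symp_eq_zero_of_commute {n : ℕ} {t t' : ZMod p} {b c : Phase p n}
    (h : (heis t b * heis t' c : QMatrix p n) = heis t' c * heis t b) : symp b c = 0 := by
  rw [heis_mul, heis_mul, symp_swap c b] at h
  have := (heis_injective h).1
  have h2 := half_add (symp b c)
  linear_combination -this - h2

theorem IsScalarFreeAbelian.exists_heisUnit {n : ℕ} {S : Subgroup (QMatrix p n)ˣ}
    (hS : IsScalarFreeAbelian S) {P : (QMatrix p n)ˣ} (hP : P ∈ S) : ∃ t b, P = heisUnit t b := by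
  obtain ⟨t, b, h⟩ := (isPauli_iff _).1 (hS.pauli P hP)
  exact ⟨t, b, Units.ext h⟩

/-- A subgroup of the Pauli group together with the powers of a commuting Pauli operator. -/
def adjoinHeis {n : ℕ} (S : Subgroup (QMatrix p n)ˣ) (c : Phase p n)
    (hc : ∀ P ∈ S, ∀ j : ZMod p, P * heisUnit 0 (j • c) = heisUnit 0 (j • c) * P) :
    Subgroup (QMatrix p n)ˣ where
  carrier := {Q | ∃ P ∈ S, ∃ j : ZMod p, Q = P * heisUnit 0 (j • c)}
  one_mem' := ⟨1, S.one_mem, 0, Units.ext (by simp [heisUnit])⟩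
  mul_mem' := by
    rintro _ _ ⟨P, hP, j, rfl⟩ ⟨P', hP', j', rfl⟩
    refine ⟨P * P', S.mul_mem hP hP', j + j', ?_⟩
    rw [add_smul, mul_assoc, ← mul_assoc (heisUnit 0 (j • c)), ← hc P' hP', mul_assoc P',
      heisUnit_mul, mul_assoc]
    simp
  inv_mem' := by
    rintro _ ⟨P, hP, j, rfl⟩
    refine ⟨P⁻¹, S.inv_mem hP, -j, ?_⟩
    rw [_root_.mul_inv_rev, hc _ (S.inv_mem hP), heisUnit_inv, neg_zero, neg_smul]

/-- A Pauli operator that commutes with S can be adjoined to S. If no phase of π(0, c) were in S,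
the larger group would still be scalar-free: a scalar P π(0, jc) with j ≠ 0 would place a power of P
proportional to π(0, c) in S. This would contradict maximality. -/
theorem exists_heis_mem_of_maximal {n : ℕ} {S : Subgroup (QMatrix p n)ˣ}
    (hS : Maximal IsScalarFreeAbelian S) {c : Phase p n}
    (hc : ∀ t b, heisUnit t b ∈ S → symp c b = 0) : ∃ t, heisUnit t c ∈ S := by
  by_contra hn
  have hcomm : ∀ P ∈ S, ∀ j : ZMod p, P * heisUnit 0 (j • c) = heisUnit 0 (j • c) * P := by
    intro P hP j
    obtain ⟨t, b, rfl⟩ := hS.1.exists_heisUnit hP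
    refine heisUnit_commute ?_
    rw [symp_smul_right, symp_swap, hc t b hP, neg_zero, mul_zero]
  have h1 : IsScalarFreeAbelian (adjoinHeis S c hcomm) := by
    refine ⟨?_, ?_, ?_⟩
    · rintro _ ⟨P, hP, j, rfl⟩
      obtain ⟨t, b, rfl⟩ := hS.1.exists_heisUnit hP
      rw [heisUnit_mul]
      exact ⟨_, _, _, rfl⟩
    · rintro _ ⟨P, hP, j, rfl⟩ _ ⟨P', hP', j', rfl⟩
      rw [mul_assoc, ← mul_assoc (heisUnit 0 (j • c)), ← hcomm P' hP', mul_assoc P',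
        ← mul_assoc P, hS.1.comm P hP P' hP', mul_assoc P', mul_assoc P', 
        ← mul_assoc (heisUnit 0 (j' • c)), ← hcomm P hP, mul_assoc P, 
        heisUnit_commute (b := j • c) (c := j' • c) (by simp)]
    · rintro _ ⟨P, hP, j, rfl⟩ a ha
      by_cases hj : j = 0
      · refine hS.1.scalar P hP a ?_
        rw [← ha, hj]
        simp [heisUnit]
      · exfalso
        obtain ⟨t, b, rfl⟩ := hS.1.exists_heisUnit hP
        rw [heisUnit_mul] at ha
        have h2 : (heis (t + 0 - 2⁻¹ * symp b (j • c)) (b + j • c) : QMatrix p n) = heis a 0 := by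
          rw [heis_eq_smul a, heis_zero]
          exact ha
        have h3 := (heis_injective h2).2
        refine hn ?_
        -- The scalar condition forces b = -j c, so the exponent -1/j turns b into c.
        have h4 := S.pow_mem hP (-j⁻¹ : ZMod p).val
        have h5 : heisUnit t b ^ (-j⁻¹ : ZMod p).val = heisUnit ((-j⁻¹ : ZMod p) * t) c := by
          refine Units.ext ?_
          rw [Units.val_pow_eq_pow_val]
          refine (heis_pow t b _).trans ?_
          rw [ZMod.natCast_zmod_val, eq_neg_of_add_eq_zero_left h3, neg_smul, smul_neg, neg_neg,
            smul_smul, inv_mul_cancel₀ hj, one_smul]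
          rfl
        rw [h5] at h4
        exact ⟨_, h4⟩
  have h2 : S ≤ adjoinHeis S c hcomm := fun P hP => ⟨P, hP, 0, by
    refine Units.ext ?_
    simp [heisUnit]⟩
  have h3 := hS.2 h1 h2
  refine hn ⟨0, h3 ⟨1, S.one_mem, 1, ?_⟩⟩
  rw [one_smul, one_mul]

theorem mul_qmat_of_comp_eq {n : ℕ} {ψ : qupits p 0 ⟶ qupits p n} {P : QMatrix p n}
    (h : ψ ≫ (⟨P⟩ : qupits p n ⟶ qupits p n) = ψ) : P * qmat ψ = qmat ψ :=
  congrArg FHilb.Hom.mat h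

/-- Stabilisers are intertwined pairs with trivial source. A phase space point orthogonal to all of
them belongs to the group up to a phase by `exists_heis_mem_of_maximal`, so the intertwined pairs
contain their orthogonal complement. -/
theorem exists_supports_state {n : ℕ} {ψ : qupits p 0 ⟶ qupits p n} (hψ : IsStabiliserState ψ) :
    ∃ A, Supports A (pureWigner (qmat ψ)) := by
  obtain ⟨hn, S, hS, hfix⟩ := hψ
  have h1 : (qmat ψ)ᴴ * qmat ψ = 1 := by
    rw [← qmat_adj, ← qmat_comp, hn, qmat_id]
  have hk : (qmat ψ * (qmat ψ)ᴴ).trace = (p : ℂ) ^ (0 : ℤ) := by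
    rw [trace_mul_comm, h1, trace_one, card_word, zpow_zero, pow_zero]
  have hf := qmat_ne_zero_of_trace hk
  have hint (t c) (h : heisUnit t c ∈ S) : Intertwines (qmat ψ) t 0 c := by
    have h2 := mul_qmat_of_comp_eq (hfix _ h)
    rw [val_heisUnit] at h2
    rw [Intertwines, heis_zero, Matrix.mul_one, h2]
  refine ⟨pureHom (qmat ψ) hf, supports_pureHom hf 0 hk fun b c h => ?_⟩
  obtain ⟨t, ht⟩ := exists_heis_mem_of_maximal hS (c := c) fun t b' hb' => by
    rw [← h t 0 b' (hint t b' hb'), symp_zero_right]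
  rw [phase_zero_eq b]
  exact ⟨t, hint t c ht⟩

/-- The maps whose Wigner matrix is a power of p times an affine coisotropic indicator contain all
generators and are closed under composition, tensor product and adjoint. -/
theorem IsStab.exists_supports {n m : ℕ} {f : qupits p n ⟶ qupits p m} (hf : IsStab f) :
    ∃ A, Supports A (pureWigner (qmat f)) := by
  induction hf with
  | state h => exact exists_supports_state h
  | clifford h => exact exists_supports_clifford h
  | sqrt =>
    refine ⟨relabelHom p (Equiv.refl (Fin 0)), ?_⟩
    have := (supports_id (p := p) 0).smul 1
    rw [← sqrt_mul_star, ← pureWigner_smul] at this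
    exact this
  | invSqrt =>
    refine ⟨relabelHom p (Equiv.refl (Fin 0)), ?_⟩
    have := (supports_id (p := p) 0).smul (-1)
    rw [← inv_sqrt_mul_star, ← pureWigner_smul] at this
    exact this
  | id n => exact ⟨_, supports_id n⟩
  | swap n m =>
    refine ⟨relabelHom p finAddFlip, ?_⟩
    rw [swapEquiv_eq]
    exact supports_relabel finAddFlip
  | cup n => exact ⟨_, supports_cup n⟩
  | comp _ _ ih ih' =>
    obtain ⟨A, hA⟩ := ih
    obtain ⟨B, hB⟩ := ih'
    refine ⟨SympSpace.comp A B, ?_⟩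
    have := hA.comp hB
    rw [← pureWigner_mul, ← qmat_comp] at this
    exact this
  | tensor _ _ ih ih' =>
    obtain ⟨A, hA⟩ := ih
    obtain ⟨B, hB⟩ := ih'
    exact ⟨_, hA.tensor hB (pureWigner_tensor _ _)⟩
  | adj _ ih =>
    obtain ⟨A, hA⟩ := ih
    refine ⟨A.swap, ?_⟩
    rw [qmat_adj, pureWigner_conjTranspose]
    exact hA.transpose.smul _

end Generators

/-! ### Wigner matrices of mixed stabiliser maps -/

section Mixed
open Matrix SympSpace
variable {p : ℕ} [Fact p.Prime]

/-- The system of `n` qupits. -/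
def nQupits (p n : ℕ) [Fact p.Prime] : CPM (Stab p) := ⟨⟨n⟩⟩

/-- The superoperator of a mixed stabiliser map. -/
def supMat {n m : ℕ} (Φ : nQupits p n ⟶ nQupits p m) : SupMatrix p m n := (CPM.Hom.dbl Φ).mat

theorem supMat_comp {n m l : ℕ} (Φ : nQupits p n ⟶ nQupits p m) (Ψ : nQupits p m ⟶ nQupits p l) :
    supMat (Φ ≫ Ψ) = supMat Ψ * supMat Φ := congrArg FHilb.Hom.mat (CPM.Hom.dbl_comp Φ Ψ)

theorem supMat_id (n : ℕ) : supMat (𝟙 (nQupits p n)) = 1 :=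
  congrArg FHilb.Hom.mat (CPM.Hom.dbl_id (nQupits p n))

theorem supMat_injective {n m : ℕ} {Φ Ψ : nQupits p n ⟶ nQupits p m} (h : supMat Φ = supMat Ψ) :
    Φ = Ψ := CPM.Hom.dbl_injective (FHilb.hom_ext h)

/-- The dilation given by a stabiliser map. -/
def stabDilation {n l m : ℕ} (f : qupits p (n + l) ⟶ qupits p m) (hf : IsStab f) :
    HilbTheory.Dilation (T := Stab p) ⟨n⟩ ⟨m⟩ := ⟨⟨l⟩, ⟨f, hf⟩⟩

/-- The class of a stabiliser map with ancilla. -/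
def mixed {n l m : ℕ} (f : qupits p (n + l) ⟶ qupits p m) (hf : IsStab f) :
    nQupits p n ⟶ nQupits p m := CPM.mk (T := Stab p) (X := ⟨⟨n⟩⟩) (Y := ⟨⟨m⟩⟩) (stabDilation f hf)

theorem exists_mixed {n m : ℕ} (Φ : nQupits p n ⟶ nQupits p m) :
    ∃ (l : ℕ) (f : qupits p (n + l) ⟶ qupits p m) (hf : IsStab f), Φ = mixed f hf := by
  obtain ⟨f, rfl⟩ := CPM.mk_surjective Φ
  exact ⟨f.anc.obj, f.map.map, f.map.mem, rfl⟩

theorem supMat_mixed {n l m : ℕ} (f : qupits p (n + l) ⟶ qupits p m) (hf : IsStab f)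
    (y : Word p m × Word p m) (x : Word p n × Word p n) : supMat (mixed f hf) y x =
      ∑ s : Word p l, qmat f y.1 (Fin.append x.1 s) * star (qmat f y.2 (Fin.append x.2 s)) := by
  refine (FHilb.double_apply (stabDilation f hf).under y.1 y.2 x.1 x.2).trans
    (Finset.sum_congr rfl fun s _ => ?_)
  have h (y : Word p m) (x : Word p n) :
      (stabDilation f hf).under.mat y (x, s) = qmat f y (Fin.append x s) :=
    FHilb.perm_comp_apply _ _ _ _
  exact congrArg₂ (fun a b => a * star b) (h y.1 x.1) (h y.2 x.2)

/-- The superoperator that adjoins a maximally entangled ancilla with its dual. -/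
def ancillaMat (p n l : ℕ) [Fact p.Prime] : SupMatrix p (n + l) n :=
  Matrix.of fun y x =>
    if (Word.left y.1, Word.left y.2) = x then if Word.right y.1 = Word.right y.2 then 1 else 0
    else 0

/-- A mixed map factors through adjoining a contracted pair of ancillas, so that only one further
Wigner matrix has to be computed. -/
theorem supMat_mixed_eq {n l m : ℕ} (f : qupits p (n + l) ⟶ qupits p m) (hf : IsStab f) :
    supMat (mixed f hf) = (qmat f ⊗ₖ (qmat f).map star) * ancillaMat p n l := by
  ext y x
  rw [supMat_mixed, Matrix.mul_apply, ← (wordPairEquiv p n l).sum_comp, Fintype.sum_prod_type]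
  have e (a : Word p n × Word p n) (b : Word p l × Word p l) :
    wordPairEquiv p n l (a, b) = (Fin.append a.1 b.1, Fin.append a.2 b.2) := rfl
  simp only [e, ancillaMat, Matrix.of_apply, Word.left_append, Word.right_append]
  rw [Finset.sum_eq_single x]
  · rw [Fintype.sum_prod_type]
    refine Finset.sum_congr rfl fun s _ => ?_
    rw [Finset.sum_eq_single s]
    · rw [if_pos rfl, if_pos rfl, mul_one]; rfl
    · intro b _ hb
      rw [if_pos rfl, if_neg (Ne.symm hb), mul_zero]
    · simp
  · intro a _ ha
    refine Finset.sum_eq_zero fun b _ => ?_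
    rw [if_neg ha, mul_zero]
  · simp

/-- The relation that adjoins an arbitrary phase space point. -/
def ancillaRel (p n l : ℕ) [Fact p.Prime] : Hom (stdSymp p n) (stdSymp p (n + l)) :=
  ofHolds (fun v w => w.left = v)
    (fun c v₁ v₂ v₃ w₁ w₂ w₃ h₁ h₂ h₃ => by
      rw [← h₁, ← h₂, ← h₃]; rfl)
    (fun v₀ w₀ h₀ v w h => by
      rw [Phase.left_add, h₀]
      congr 1
      refine eq_of_symp_left fun u => ?_
      have := h (u + v₀) (Phase.append u 0 + w₀) (by rw [Phase.left_add, h₀]; simp)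
      rw [add_sub_cancel_right, add_sub_cancel_right, symp_split] at this
      simp only [Phase.left_append, Phase.right_append, symp_zero_left, add_zero] at this
      exact sub_eq_zero.1 this)

variable [NeZero (2 : ZMod p)]

/-- Phase point operators have trace one: a reflection fixes one basis vector, namely the position
of its centre, with phase 1. -/
theorem sum_phaseMat_diag (l : ℕ) (u : Phase p l) :
    ∑ b : Word p l × Word p l, star (phaseMat p l b u) * (if b.1 = b.2 then 1 else 0) = 1 := by
  rw [Fintype.sum_prod_type]
  have h (a : Word p l) : ∑ b, star (phaseMat p l (a, b) u) * (if a = b then 1 else 0) =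
      if a = u.1 then (1 : ℂ) else 0 := by
    rw [Finset.sum_eq_single a]
    · rw [if_pos rfl, mul_one, phaseMat_apply, sub_self, dotProduct_zero, AddChar.map_zero_eq_one]
      have : a + a = (2 : ZMod p) • u.1 ↔ a = u.1 := by
        rw [← two_smul (ZMod p) a]
        exact (smul_right_injective _ (NeZero.ne (2 : ZMod p))).eq_iff
      simp only [this, apply_ite star, star_one, star_zero]
    · intro b _ hb
      rw [if_neg (Ne.symm hb), mul_zero]
    · simp
  simp only [h]
  simp

/-- Orthogonality on the system contributes p ^ n, trace one on the ancilla contributes 1, and the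
normalisation is p ^ (-(n + l)). The phase space point of the ancilla is left free. -/
theorem wigner_ancillaMat (n l : ℕ) (w : Phase p (n + l)) (v : Phase p n) :
    wigner (ancillaMat p n l) w v = if w.left = v then ((p : ℂ) ^ l)⁻¹ else 0 := by
  have h1 (y : Word p (n + l) × Word p (n + l)) :
      ∑ x, ancillaMat p n l y x * phaseMat p n x v =
        phaseMat p n (Word.left y.1, Word.left y.2) v *
          if Word.right y.1 = Word.right y.2 then 1 else 0 := by
    simp only [ancillaMat, Matrix.of_apply, ite_mul, zero_mul, Finset.sum_ite_eq, Finset.mem_univ,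
      if_true]
    rw [mul_ite, mul_zero, mul_one]; simp only [one_mul]
  rw [wigner_apply]
  simp only [h1]
  rw [sum_word_split (G := fun x => star (phaseMat p n x w.left) * phaseMat p n x v)
    (H := fun x => star (phaseMat p l x w.right) * if x.1 = x.2 then 1 else 0)]
  · have h3 := congrFun (congrFun (phaseMat_conjTranspose_mul (p := p) n) w.left) v
    rw [Matrix.mul_apply] at h3
    rw [sum_phaseMat_diag, mul_one]
    refine (congrArg _ h3).trans ?_
    rw [Matrix.smul_apply, Matrix.one_apply, smul_eq_mul, mul_ite, mul_one, mul_zero, mul_ite,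
      mul_zero, pow_add, mul_inv, mul_right_comm, inv_mul_cancel₀ (cast_pow_ne_zero n), one_mul]
  · intro x
    rw [phaseMat_split, star_mul']
    ring

theorem supports_ancilla (n l : ℕ) : Supports (ancillaRel p n l) (wigner (ancillaMat p n l)) := by
  refine ⟨-l, fun v w => ?_⟩
  rw [wigner_ancillaMat, _root_.zpow_neg, zpow_natCast]
  exact ⟨fun h => if_pos h, fun h => if_neg h⟩

theorem supports_mixed {n l m : ℕ} {f : qupits p (n + l) ⟶ qupits p m} (hf : IsStab f)
    {A : Hom (stdSymp p (n + l)) (stdSymp p m)} (hA : Supports A (pureWigner (qmat f))) :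
    Supports (SympSpace.comp (ancillaRel p n l) A) (wigner (supMat (mixed f hf))) := by
  rw [supMat_mixed_eq, wigner_mul]
  exact (supports_ancilla n l).comp hA

theorem exists_supports {n m : ℕ} (Φ : nQupits p n ⟶ nQupits p m) :
    ∃ A : Hom (stdSymp p n) (stdSymp p m), Supports A (wigner (supMat Φ)) := by
  obtain ⟨l, f, hf, rfl⟩ := exists_mixed Φ
  obtain ⟨A, hA⟩ := hf.exists_supports
  exact ⟨_, supports_mixed hf hA⟩

/-- The affine coisotropic relation that supports the Wigner matrix of a mixed stabiliser map. -/
def relOf {n m : ℕ} (Φ : nQupits p n ⟶ nQupits p m) : Hom (stdSymp p n) (stdSymp p m) :=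
  (exists_supports Φ).choose

theorem supports_relOf {n m : ℕ} (Φ : nQupits p n ⟶ nQupits p m) :
    Supports (relOf Φ) (wigner (supMat Φ)) := (exists_supports Φ).choose_spec

/-- This identifies the support of the Wigner matrix with the relation that defines Rel; the choice
hidden in `relOf` is harmless because supports are unique. -/
theorem holds_relOf_mixed {n l m : ℕ} (f : qupits p (n + l) ⟶ qupits p m) (hf : IsStab f)
    (v : Phase p n) (w : Phase p m) :
    Holds (relOf (mixed f hf)) v w ↔ ∃ s : Phase p l, MatRel (qmat f) (Phase.append v s) w := by
  obtain ⟨A, hA⟩ := hf.exists_supports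
  rw [(supports_relOf _).ext (supports_mixed hf hA), holds_comp]
  constructor
  · rintro ⟨u, h1, h2⟩
    refine ⟨u.right, (hA.matRel_iff _ _).2 ?_⟩
    have h1 : u.left = v := h1
    have : Phase.append v u.right = u := by
      rw [← h1]; exact Prod.ext Fin.append_castAdd_natAdd Fin.append_castAdd_natAdd
    rwa [this]
  · rintro ⟨s, h⟩
    exact ⟨Phase.append v s, Phase.left_append v s, (hA.matRel_iff _ _).1 h⟩

theorem relOf_id (n : ℕ) : relOf (𝟙 (nQupits p n)) = 𝟙 (stdSymp p n) := by
  refine (supports_relOf _).ext ⟨0, fun v w => ?_⟩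
  rw [supMat_id, wigner_one, zpow_zero]
  exact ⟨fun h => if_pos h, fun h => if_neg h⟩

/-- Both relations support the same product of Wigner matrices. -/
theorem relOf_comp {n m l : ℕ} (Φ : nQupits p n ⟶ nQupits p m) (Ψ : nQupits p m ⟶ nQupits p l) :
    relOf (Φ ≫ Ψ) = SympSpace.comp (relOf Φ) (relOf Ψ) := by
  have := (supports_relOf Φ).comp (supports_relOf Ψ)
  rw [← wigner_mul, ← supMat_comp] at this
  exact (supports_relOf _).ext this

/-- The relation of a mixed stabiliser map, as a functor. -/
def stabRel (p : ℕ) [Fact p.Prime] [NeZero (2 : ZMod p)] : StabRel p where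
  map {X Y} Φ := relOf (n := X.obj.obj) (m := Y.obj.obj) Φ
  map_mk {X Y} f v w := holds_relOf_mixed (n := X.obj.obj) (m := Y.obj.obj) (l := f.anc.obj)
    f.map.map f.map.mem v w
  map_id X := relOf_id X.obj.obj
  map_comp {X Y Z} Φ Ψ := relOf_comp (n := X.obj.obj) (m := Y.obj.obj) (l := Z.obj.obj) Φ Ψ

end Mixed

/-! ### The relation functor is symmetric monoidal -/

section RelMonoidal
open Matrix SympSpace
variable {p : ℕ} [Fact p.Prime]

/-- The tensor product of mixed stabiliser maps. -/
def mixedTensor {n m n' m' : ℕ} (Φ : nQupits p n ⟶ nQupits p m) (Ψ : nQupits p n' ⟶ nQupits p m') :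
    nQupits p (n + n') ⟶ nQupits p (m + m') := Φ ⊗ₘ Ψ

theorem supMat_tensor {n m n' m' : ℕ} (Φ : nQupits p n ⟶ nQupits p m)
    (Ψ : nQupits p n' ⟶ nQupits p m') (y : Word p (m + m') × Word p (m + m'))
    (x : Word p (n + n') × Word p (n + n')) : supMat (mixedTensor Φ Ψ) y x =
      supMat Φ (Word.left y.1, Word.left y.2) (Word.left x.1, Word.left x.2) *
      supMat Ψ (Word.right y.1, Word.right y.2) (Word.right x.1, Word.right x.2) :=
  (congrFun (congrFun (congrArg FHilb.Hom.mat (CPM.double_tensorHom Φ Ψ)) y) x).trans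
    (CPM.conj_perm_apply _ _ _ _ _)

/-- A pure stabiliser map. -/
def pureStab {n m : ℕ} (f : qupits p n ⟶ qupits p m) (hf : IsStab f) :
    nQupits p n ⟶ nQupits p m := (CPM.pure (Stab p)).map (X := ⟨n⟩) (Y := ⟨m⟩) ⟨f, hf⟩

theorem supMat_pure {n m : ℕ} (f : qupits p n ⟶ qupits p m) (hf : IsStab f) :
    supMat (pureStab f hf) = qmat f ⊗ₖ (qmat f).map star :=
  congrArg FHilb.Hom.mat (HilbTheory.Dilation.dbl_pure (T := Stab p) (X := ⟨n⟩) (Y := ⟨m⟩) ⟨f, hf⟩)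

theorem assocEquiv_eq (n m l : ℕ) : (qupitFamily p).assocEquiv n m l =
    relabelWord (p := p) (finCongr (Nat.add_assoc n m l)) :=
  Equiv.ext fun x => funext fun i => append_cast n m l x i

theorem leftUnitEquiv_eq (n : ℕ) : (qupitFamily p).leftUnitEquiv n =
    relabelWord (p := p) (finCongr (Nat.zero_add n)) :=
  Equiv.ext fun x => funext fun _ => congrArg x (Fin.ext (Nat.zero_add _))

theorem rightUnitEquiv_eq (n : ℕ) : (qupitFamily p).rightUnitEquiv n =
    relabelWord (p := p) (finCongr (Nat.add_zero n)) :=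
  Equiv.ext fun x => funext fun _ => congrArg x (Fin.ext rfl)

/-- The decomposition of a phase space, as an isomorphism of relations. -/
def splitIso (p n m : ℕ) [Fact p.Prime] : stdSymp p n ⊗ stdSymp p m ≅ stdSymp p (n + m) :=
  graphIso (V := stdSymp p n ⊗ stdSymp p m) (W := stdSymp p (n + m)) (splitEquiv p n m).symm
    (splitEquiv_symm_form n m)

/-- The phase space of zero qupits. -/
def unitEquivPhase (p : ℕ) [Fact p.Prime] :
    (𝟙_ (SympSpace (ZMod p)) : SympSpace (ZMod p)) ≃ₗ[ZMod p] stdSymp p 0 :=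
  (LinearEquiv.refl (ZMod p) PUnit.{1}).trans
    { toFun := fun _ => (0 : Phase p 0)
      map_add' := fun _ _ => (add_zero (0 : Phase p 0)).symm
      map_smul' := fun c _ => (smul_zero (A := Phase p 0) c).symm
      invFun := fun _ => PUnit.unit
      left_inv := fun _ => rfl
      right_inv := fun v => (phase_zero_eq v).symm }

/-- The unit of the relation functor. -/
def unitSympIso (p : ℕ) [Fact p.Prime] : 𝟙_ (SympSpace (ZMod p)) ≅ stdSymp p 0 :=
  graphIso (unitEquivPhase p) fun u v =>
    (congrArg₂ symp (phase_zero_eq _) (phase_zero_eq _)).trans (symp_self (0 : Phase p 0))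

theorem isGraph_splitIso (n m : ℕ) : IsGraph (V := stdSymp p n ⊗ stdSymp p m)
    (W := stdSymp p (n + m)) (splitIso p n m).hom (splitEquiv p n m).symm := isGraph_hom _ _

theorem isGraph_unitSympIso : IsGraph (W := stdSymp p 0) (unitSympIso p).hom (unitEquivPhase p) :=
  isGraph_hom _ _

theorem holds_tensorRel_append {n m n' m' : ℕ} (A : Hom (stdSymp p n) (stdSymp p m))
    (B : Hom (stdSymp p n') (stdSymp p m')) (v : Phase p n) (v' : Phase p n')
    (w : Phase p (m + m')) :
    Holds (tensorRel A B) (Phase.append v v') w ↔ Holds A v w.left ∧ Holds B v' w.right := by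
  rw [holds_tensorRel, Phase.left_append, Phase.right_append]

variable [NeZero (2 : ZMod p)]

theorem relOf_tensor {n m n' m' : ℕ} (Φ : nQupits p n ⟶ nQupits p m)
    (Ψ : nQupits p n' ⟶ nQupits p m') :
    relOf (mixedTensor Φ Ψ) = tensorRel (relOf Φ) (relOf Ψ) :=
  (supports_relOf _).ext ((supports_relOf Φ).tensor (supports_relOf Ψ)
    (wigner_tensor (supMat_tensor Φ Ψ)))

theorem relOf_pure {n m : ℕ} {f : qupits p n ⟶ qupits p m} (hf : IsStab f)
    {A : Hom (stdSymp p n) (stdSymp p m)} (hA : Supports A (pureWigner (qmat f))) :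
    relOf (pureStab f hf) = A := by
  have := supports_relOf (pureStab f hf)
  rw [supMat_pure] at this
  exact this.ext hA

/-- The associators, unitors and swaps of stabiliser maps relabel positions, so their relations are
graphs. Each coherence axiom for Rel then compares two graphs and reduces to an identity of linear
maps on concatenated phase space points. -/
theorem isGraph_pureStab {n m : ℕ} {e : Word p n ≃ Word p m} {σ : Fin n ≃ Fin m}
    (he : e = relabelWord σ) (h : IsStab (FHilb.perm e : qupits p n ⟶ qupits p m)) :
    IsGraph (V := stdSymp p n) (W := stdSymp p m) (relOf (pureStab _ h)) (relabelPhase σ) := by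
  subst he
  rw [relOf_pure h (supports_relabel σ)]
  exact isGraph (V := stdSymp p n) (W := stdSymp p m) _ _

theorem splitIso_natural {n m n' m' : ℕ} (Φ : nQupits p n ⟶ nQupits p m)
    (Ψ : nQupits p n' ⟶ nQupits p m') :
    SympSpace.comp (prodRel (relOf Φ) (relOf Ψ)) (splitIso p m m').hom =
      SympSpace.comp (splitIso p n n').hom (relOf (mixedTensor Φ Ψ)) := by
  rw [relOf_tensor]
  refine Hom.ext' fun a b => (comp_graph_R (V := stdSymp p m ⊗ stdSymp p m')
    (W := stdSymp p (m + m')) (prodRel (relOf Φ) (relOf Ψ)) (splitEquiv p m m').symm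
    (splitEquiv_symm_form m m') a b).trans (Iff.trans ?_
    (graph_comp_R (U := stdSymp p n ⊗ stdSymp p n') (V := stdSymp p (n + n'))
      (splitEquiv p n n').symm (splitEquiv_symm_form n n')
      (tensorRel (relOf Φ) (relOf Ψ)) a b).symm)
  exact (holds_tensorRel_append (relOf Φ) (relOf Ψ) a.1 a.2 b).symm

theorem relabelPhase_assoc {n m l : ℕ} (u : Phase p n) (v : Phase p m) (w : Phase p l) :
    relabelPhase (finCongr (Nat.add_assoc n m l)) (Phase.append (Phase.append u v) w) =
      Phase.append u (Phase.append v w) := by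
  have h (x : Word p n) (y : Word p m) (z : Word p l) :
      relabelWord (finCongr (Nat.add_assoc n m l)) (Fin.append (Fin.append x y) z) =
        Fin.append x (Fin.append y z) := by
    rw [Fin.append_assoc]
    funext i
    rw [relabelWord_apply]
    rfl
  exact Prod.ext (h _ _ _) (h _ _ _)

theorem relabelPhase_zero_add {n : ℕ} (u : Phase p 0) (v : Phase p n) :
    relabelPhase (finCongr (Nat.zero_add n)) (Phase.append u v) = v := by
  have h (x : Word p 0) (y : Word p n) :
      relabelWord (finCongr (Nat.zero_add n)) (Fin.append x y) = y := by
    rw [Fin.append_left_nil _ _ rfl]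
    rfl
  exact Prod.ext (h _ _) (h _ _)

theorem relabelPhase_add_zero {n : ℕ} (u : Phase p n) (v : Phase p 0) :
    relabelPhase (finCongr (Nat.add_zero n)) (Phase.append u v) = u := by
  have h (x : Word p n) (y : Word p 0) :
      relabelWord (finCongr (Nat.add_zero n)) (Fin.append x y) = x := by
    rw [Fin.append_right_nil _ _ rfl]
    rfl
  exact Prod.ext (h _ _) (h _ _)

theorem relabelPhase_flip {n m : ℕ} (u : Phase p n) (v : Phase p m) :
    relabelPhase finAddFlip (Phase.append u v) = Phase.append v u := by
  have h (x : Word p n) (y : Word p m) :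
      relabelWord (p := p) finAddFlip (Fin.append x y) = Fin.append y x := by
    rw [← append_right_left, Word.right_append, Word.left_append]
  exact Prod.ext (h _ _) (h _ _)

/-- The structure maps of the relation functor. -/
def relCoreMonoidal (p : ℕ) [Fact p.Prime] [NeZero (2 : ZMod p)] :
    (stabRel p).functor.CoreMonoidal where
  εIso := unitSympIso p
  μIso X Y := splitIso p X.obj.obj Y.obj.obj
  μIso_hom_natural_left {X Y} Φ Z := by
    refine Eq.trans ?_ (splitIso_natural (n := X.obj.obj) (m := Y.obj.obj) (n' := Z.obj.obj)
      (m' := Z.obj.obj) Φ (𝟙 Z))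
    exact congrArg (fun k => SympSpace.comp (prodRel (relOf (n := X.obj.obj) (m := Y.obj.obj) Φ) k)
      (splitIso p Y.obj.obj Z.obj.obj).hom) (relOf_id Z.obj.obj).symm
  μIso_hom_natural_right {X Y} Z Φ := by
    refine Eq.trans ?_ (splitIso_natural (n' := X.obj.obj) (m' := Y.obj.obj) (n := Z.obj.obj)
      (m := Z.obj.obj) (𝟙 Z) Φ)
    exact congrArg (fun k => SympSpace.comp (prodRel k (relOf (n := X.obj.obj) (m := Y.obj.obj) Φ))
      (splitIso p Z.obj.obj Y.obj.obj).hom) (relOf_id Z.obj.obj).symm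
  associativity X Y Z :=
    (((isGraph_splitIso X.obj.obj Y.obj.obj).prodRel (isGraph_id (stdSymp p Z.obj.obj))).comp
      ((isGraph_splitIso ((Stab p).tensor X.obj.obj Y.obj.obj) Z.obj.obj).comp
        (isGraph_pureStab (assocEquiv_eq X.obj.obj Y.obj.obj Z.obj.obj) _))).ext
    ((isGraph_assoc _ _ _).comp
      (((isGraph_id (stdSymp p X.obj.obj)).prodRel (isGraph_splitIso Y.obj.obj Z.obj.obj)).comp
        (isGraph_splitIso X.obj.obj ((Stab p).tensor Y.obj.obj Z.obj.obj))))
    fun a => relabelPhase_assoc a.1.1 a.1.2 a.2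
  left_unitality X := (isGraph_leftUnitor _).ext
    ((isGraph_unitSympIso.prodRel (isGraph_id (stdSymp p X.obj.obj))).comp
      ((isGraph_splitIso 0 X.obj.obj).comp (isGraph_pureStab (leftUnitEquiv_eq X.obj.obj) _)))
    fun a => (relabelPhase_zero_add _ a.2).symm
  right_unitality X := (isGraph_rightUnitor _).ext
    (((isGraph_id (stdSymp p X.obj.obj)).prodRel isGraph_unitSympIso).comp
      ((isGraph_splitIso X.obj.obj 0).comp (isGraph_pureStab (rightUnitEquiv_eq X.obj.obj) _)))
    fun a => (relabelPhase_add_zero a.1 _).symm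

/-- The relation functor is symmetric monoidal. -/
@[reducible]
def relBraided (p : ℕ) [Fact p.Prime] [NeZero (2 : ZMod p)] : (stabRel p).functor.Braided where
  toMonoidal := (relCoreMonoidal p).toMonoidal
  braided X Y := ((isGraph_splitIso X.obj.obj Y.obj.obj).comp
      (isGraph_pureStab (swapEquiv_eq X.obj.obj Y.obj.obj) (IsStab.swap _ _))).ext
    ((isGraph_swap (stdSymp p X.obj.obj) (stdSymp p Y.obj.obj)).comp
      (isGraph_splitIso Y.obj.obj X.obj.obj))
    fun a => relabelPhase_flip a.1 a.2

theorem relBraided_μ (X Y : CPM (Stab p)) (v w a) :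
    SympSpace.Related (V := stdSymp p X.obj.obj ⊗ stdSymp p Y.obj.obj)
      ((relBraided p).toMonoidal.toLaxMonoidal.μ X Y) (v, w) a ↔
        splitEquiv p X.obj.obj Y.obj.obj a = (v, w) :=
  LinearEquiv.eq_symm_apply (splitEquiv p X.obj.obj Y.obj.obj)

end RelMonoidal

/-! ### Scalars and causality -/

section ScalarValue
universe w

theorem FHilb.scale_mat (s : 𝟙_ FHilb ⟶ 𝟙_ FHilb) {X Y : FHilb} (f : X ⟶ Y) :
    (scale s f).mat = s.mat () () • f.mat := by
  have h : (s ▷ X).mat = s.mat () () • (𝟙 (𝟙_ FHilb ⊗ X) : _ ⟶ _).mat := by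
    ext ⟨⟨⟩, x⟩ ⟨⟨⟩, x'⟩
    change s.mat () () * (1 : Matrix X.basis X.basis ℂ) x x' =
      s.mat () () * (1 : Matrix (Unit × X.basis) (Unit × X.basis) ℂ) ((), x) ((), x')
    simp [Matrix.one_apply]
  have h2 : (scale s f).mat = ((λ_ X).hom ≫ f).mat * (s ▷ X).mat * (λ_ X).inv.mat := by
    simp only [scale, FHilb.comp_mat]
  have h3 : ((λ_ X).inv ≫ 𝟙 _ ≫ (λ_ X).hom ≫ f).mat = f.mat := by simp
  rw [h2, h, Matrix.mul_smul, Matrix.smul_mul]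
  exact congrArg _ h3

namespace CPM
open HilbTheory Functor
variable {T : HilbTheory.{w}}

/-- The complex number given by a scalar. -/
def scalarVal (s : 𝟙_ (CPM T) ⟶ 𝟙_ (CPM T)) : ℂ :=
  FHilb.Hom.mat (LaxMonoidal.ε (double T) ≫ (double T).map s ≫ OplaxMonoidal.η (double T)) () ()

/-- Doubling is monoidal, hence commutes with scaling, and a scalar of `FHilb` is a complex number.
-/
theorem dbl_scale (s : 𝟙_ (CPM T) ⟶ 𝟙_ (CPM T)) {X Y : CPM T} (Φ : X ⟶ Y) :
    (Hom.dbl (scale s Φ)).mat = scalarVal s • (Hom.dbl Φ).mat :=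
  (congrArg FHilb.Hom.mat (map_scale (double T) s Φ)).trans (FHilb.scale_mat _ _)

theorem scalarVal_id : scalarVal (𝟙 (𝟙_ (CPM T))) = 1 := by
  rw [scalarVal, CategoryTheory.Functor.map_id, Category.id_comp, Monoidal.ε_η]
  rfl

theorem scalarVal_comp (s t : 𝟙_ (CPM T) ⟶ 𝟙_ (CPM T)) :
    scalarVal (s ≫ t) = scalarVal s * scalarVal t := by
  have h : LaxMonoidal.ε (double T) ≫ (double T).map (s ≫ t) ≫ OplaxMonoidal.η (double T) =
      (LaxMonoidal.ε (double T) ≫ (double T).map s ≫ OplaxMonoidal.η (double T)) ≫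
      (LaxMonoidal.ε (double T) ≫ (double T).map t ≫ OplaxMonoidal.η (double T)) := by
    simp
  rw [scalarVal, h, FHilb.comp_mat, Matrix.mul_apply, mul_comm]
  exact Fintype.sum_unique (ι := Unit) _

theorem scalarVal_ne_zero (s : 𝟙_ (CPM T) ≅ 𝟙_ (CPM T)) : scalarVal s.hom ≠ 0 := by
  intro h
  have := scalarVal_comp s.hom s.inv
  rw [s.hom_inv_id, scalarVal_id, h, zero_mul] at this
  exact one_ne_zero this

theorem scalarVal_eq (s : 𝟙_ (CPM T) ⟶ 𝟙_ (CPM T)) (i : (T.space T.unit).basis) :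
    scalarVal s = (Hom.dbl s).mat (i, i) (i, i) := by
  have e : i = T.unitEquiv.symm () := T.unitEquiv.injective (Subsingleton.elim _ _)
  rw [e]
  exact conj_perm_apply _ _ _ _ _

end CPM
end ScalarValue

/-! ### Invertible stabiliser scalars, and causal maps versus total relations -/

section StabScalar
open Matrix SympSpace
variable {p : ℕ} [Fact p.Prime]

theorem supMat_scale {n m : ℕ} (s : 𝟙_ (CPM (Stab p)) ⟶ 𝟙_ (CPM (Stab p)))
    (Φ : nQupits p n ⟶ nQupits p m) : supMat (scale s Φ) = CPM.scalarVal s • supMat Φ :=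
  CPM.dbl_scale s Φ

theorem qmat_smulMap {n m : ℕ} (c : ℂ) (f : qupits p n ⟶ qupits p m) :
    qmat (smulMap c f) = c • qmat f := rfl

theorem smulMap_comp_smulMap (a b : ℂ) (h : a * b = 1) :
    smulMap a (𝟙 (qupits p 0)) ≫ smulMap b (𝟙 (qupits p 0)) = 𝟙 _ :=
  qmat_injective (by
    rw [qmat_comp, qmat_smulMap, qmat_smulMap, qmat_id, Matrix.smul_mul, Matrix.one_mul, smul_smul,
      mul_comm, h, one_smul])

theorem sqrt_p_ne_zero : ((Real.sqrt p : ℝ) : ℂ) ≠ 0 :=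
  Complex.ofReal_ne_zero.2 (Real.sqrt_ne_zero'.2 (Nat.cast_pos.2 (Fact.out : p.Prime).pos))

/-- The invertible scalar `p`. -/
def scalarP (p : ℕ) [Fact p.Prime] : 𝟙_ (CPM (Stab p)) ≅ 𝟙_ (CPM (Stab p)) :=
  (CPM.pure (Stab p)).mapIso (X := 𝟙_ (Stab p).Cat) (Y := 𝟙_ (Stab p).Cat)
    { hom := ⟨smulMap (Real.sqrt p : ℂ) (𝟙 (qupits p 0)), IsStab.sqrt⟩
      inv := ⟨smulMap (1 / Real.sqrt p : ℂ) (𝟙 (qupits p 0)), IsStab.invSqrt⟩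
      hom_inv_id := HilbTheory.hom_ext
        (smulMap_comp_smulMap _ _ (mul_one_div_cancel sqrt_p_ne_zero))
      inv_hom_id := HilbTheory.hom_ext
        (smulMap_comp_smulMap _ _ (one_div_mul_cancel sqrt_p_ne_zero)) }

variable [NeZero (2 : ZMod p)]

theorem scalarVal_scalarP : CPM.scalarVal (scalarP p).hom = p := by
  rw [CPM.scalarVal_eq _ (0 : Word p 0)]
  refine (congrFun (congrFun (supMat_pure (smulMap (Real.sqrt p : ℂ) (𝟙 (qupits p 0)))
    IsStab.sqrt) (0, 0)) (0, 0)).trans ?_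
  rw [kroneckerMap_apply, map_apply, qmat_smulMap, qmat_id, Matrix.smul_apply, one_apply_eq,
    smul_eq_mul, mul_one, sqrt_mul_star, zpow_one]

/-- The pure scalar √p doubles to p, and 1/√p to its inverse. This is what the scalar generators are
for. -/
theorem exists_scalar (k : ℤ) :
    ∃ s : 𝟙_ (CPM (Stab p)) ≅ 𝟙_ (CPM (Stab p)), CPM.scalarVal s.hom = (p : ℂ) ^ k := by
  induction k using Int.induction_on with
  | zero => exact ⟨Iso.refl _, by rw [Iso.refl_hom, CPM.scalarVal_id, zpow_zero]⟩
  | succ k ih =>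
    obtain ⟨s, hs⟩ := ih
    exact ⟨s ≪≫ scalarP p, by rw [Iso.trans_hom, CPM.scalarVal_comp, hs, scalarVal_scalarP,
      zpow_add_one₀ p_cast_ne_zero]⟩
  | pred k ih =>
    obtain ⟨s, hs⟩ := ih
    refine ⟨s ≪≫ (scalarP p).symm, ?_⟩
    have h := CPM.scalarVal_comp (scalarP p).hom (scalarP p).inv
    rw [Iso.hom_inv_id, CPM.scalarVal_id, scalarVal_scalarP] at h
    rw [Iso.trans_hom, CPM.scalarVal_comp, hs, zpow_sub_one₀ p_cast_ne_zero, Iso.symm_hom,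
      eq_inv_of_mul_eq_one_right h.symm]

/-- A nonzero factor does not change where a Wigner matrix is nonzero. The factor need not be a
stabiliser scalar. -/
theorem relOf_eq_of_smul {n m : ℕ} {Φ Ψ : nQupits p n ⟶ nQupits p m} {c : ℂ} (hc : c ≠ 0)
    (h : supMat Φ = c • supMat Ψ) : relOf Φ = relOf Ψ := by
  refine hom_ext_holds fun v w => ?_
  rw [(supports_relOf Φ).holds_iff, (supports_relOf Ψ).holds_iff, h, wigner_smul,
    Matrix.smul_apply, smul_eq_mul, mul_ne_zero_iff, and_iff_right hc]

theorem relOf_scale {n m : ℕ} (s : 𝟙_ (CPM (Stab p)) ≅ 𝟙_ (CPM (Stab p)))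
    (Φ : nQupits p n ⟶ nQupits p m) : relOf (scale s.hom Φ : nQupits p n ⟶ nQupits p m) = relOf Φ :=
  relOf_eq_of_smul (CPM.scalarVal_ne_zero s) (supMat_scale s.hom Φ)

/-- Both Wigner matrices are powers of p on the same relation and zero elsewhere; their ratio is a
power of p, which is an invertible scalar, and Wigner matrices are faithful. -/
theorem projRel_of_relOf_eq {n m : ℕ} {Φ Ψ : nQupits p n ⟶ nQupits p m}
    (h : relOf Φ = relOf Ψ) : projRel (CPM (Stab p)) Φ Ψ := by
  obtain ⟨k, hk⟩ := supports_relOf Φ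
  obtain ⟨j, hj⟩ := supports_relOf Ψ
  obtain ⟨s, hs⟩ := exists_scalar (p := p) (k - j)
  refine ⟨s, supMat_injective (wigner_injective ?_)⟩
  rw [supMat_scale, hs, wigner_smul]
  ext w v
  rw [Matrix.smul_apply, smul_eq_mul]
  by_cases hv : Holds (relOf Ψ) v w
  · rw [(hj v w).1 hv, (hk v w).1 (h ▸ hv), ← zpow_add₀ p_cast_ne_zero, sub_add_cancel]
  · rw [(hj v w).2 hv, (hk v w).2 (h ▸ hv), mul_zero]

/-- The discarding map. -/
def discard (p n : ℕ) [Fact p.Prime] : nQupits p n ⟶ nQupits p 0 := CPM.tr (nQupits p n)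

theorem supMat_discard (n : ℕ) (y : Word p 0 × Word p 0) (x : Word p n × Word p n) :
    supMat (discard p n) y x = if x.1 = x.2 then 1 else 0 :=
  CPM.trDilation_dbl (T := Stab p) ⟨n⟩ y.1 y.2 x.1 x.2

/-- Discarding takes the trace, and each phase point operator has trace one. So the discarding map
relates everything. -/
theorem wigner_discard (n : ℕ) (w : Phase p 0) (v : Phase p n) :
    wigner (supMat (discard p n)) w v = 1 := by
  have h := congrArg star (sum_phaseMat_diag n v)
  rw [star_sum, star_one] at h
  have h0 := sum_phaseMat_diag 0 w
  rw [wigner_apply]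
  have h1 (y : Word p 0 × Word p 0) : ∑ x, supMat (discard p n) y x * phaseMat p n x v =
      if y.1 = y.2 then 1 else 0 := by
    rw [if_pos (Subsingleton.elim _ _), ← h]
    refine Finset.sum_congr rfl fun x _ => ?_
    rw [supMat_discard, star_mul', star_star, mul_comm, apply_ite star, star_one, star_zero]
  simp only [h1]
  rw [h0, pow_zero, inv_one, mul_one]

theorem holds_discard {n : ℕ} (v : Phase p n) (w : Phase p 0) : Holds (relOf (discard p n)) v w := by
  rw [(supports_relOf _).holds_iff, wigner_discard]
  exact one_ne_zero

/-- After discarding the output, the relation only records whether v has some partner. -/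
theorem relOf_comp_discard {n m : ℕ} {Φ : nQupits p n ⟶ nQupits p m} :
    relOf (Φ ≫ discard p m) = relOf (discard p n) ↔ ∀ v, ∃ w, Holds (relOf Φ) v w := by
  rw [relOf_comp]
  constructor
  · intro h v
    have := holds_discard v 0
    rw [← h, holds_comp] at this
    obtain ⟨w, hw, _⟩ := this
    exact ⟨w, hw⟩
  · intro h
    refine hom_ext_holds fun v w => iff_of_true ?_ (holds_discard v w)
    obtain ⟨u, hu⟩ := h v
    exact ⟨u, hu, holds_discard u w⟩

theorem total_of_causal {n m : ℕ} {Φ : nQupits p n ⟶ nQupits p m}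
    (h : CPM.causal (Stab p) Φ) (v : Phase p n) : ∃ w, Holds (relOf Φ) v w :=
  relOf_comp_discard.1 (congrArg (fun k => relOf k) h) v

/-- Totality says that Φ followed by discarding has the same relation as discarding, hence agrees
with it up to an invertible scalar; Φ is multiplied by that scalar. -/
theorem exists_causal {n m : ℕ} (Φ : nQupits p n ⟶ nQupits p m)
    (h : ∀ v, ∃ w, Holds (relOf Φ) v w) :
    ∃ Ψ : nQupits p n ⟶ nQupits p m, CPM.causal (Stab p) Ψ ∧ relOf Ψ = relOf Φ := by
  obtain ⟨s, hs⟩ := projRel_of_relOf_eq (relOf_comp_discard.2 h).symm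
  refine ⟨scale s.hom Φ, ?_, relOf_scale s Φ⟩
  change scale s.hom Φ ≫ discard p m = discard p n
  rw [scale_comp, ← hs]

/-- Equal relations leave only an invertible scalar between the two maps. Composing with the
discarding map shows that this scalar fixes a nonzero map, so it is 1. -/
theorem causal_ext {n m : ℕ} {Φ Ψ : nQupits p n ⟶ nQupits p m} (hΦ : CPM.causal (Stab p) Φ)
    (hΨ : CPM.causal (Stab p) Ψ) (h : relOf Φ = relOf Ψ) : Φ = Ψ := by
  obtain ⟨s, rfl⟩ := projRel_of_relOf_eq h
  have h1 : scale s.hom (discard p n) = discard p n := by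
    have h2 : scale s.hom Ψ ≫ discard p m = discard p n := hΦ
    have h3 : Ψ ≫ discard p m = discard p n := hΨ
    rwa [scale_comp, h3] at h2
  -- The discarding map has entry 1 at this position, so the scalar can be read off.
  have h4 := congrFun (congrFun (congrArg supMat h1) (0, 0)) (0, 0)
  rw [supMat_scale, Matrix.smul_apply, supMat_discard, if_pos rfl, smul_eq_mul, mul_one] at h4
  refine supMat_injective ?_
  rw [supMat_scale, h4, one_smul]

end StabScalar

/-! ### Stabiliser states of affine Lagrangian subspaces -/

section Lagrangian
open Matrix SympSpace
variable {p : ℕ} [Fact p.Prime]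

theorem exists_normalised_column {n : ℕ} {P : QMatrix p n} (hP : P ≠ 0) :
    ∃ (j : Word p n) (r : ℝ), ∑ y, star ((r : ℂ) * P y j) * ((r : ℂ) * P y j) = 1 := by
  obtain ⟨i, j, hij⟩ : ∃ i j, P i j ≠ 0 := by
    by_contra! h
    exact hP (Matrix.ext h)
  have hpos : 0 < ∑ y, ‖P y j‖ ^ 2 :=
    Finset.sum_pos' (fun _ _ => by positivity) ⟨i, Finset.mem_univ _, by positivity⟩
  refine ⟨j, (Real.sqrt (∑ y, ‖P y j‖ ^ 2))⁻¹, ?_⟩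
  have h (y : Word p n) (r : ℝ) :
      star ((r : ℂ) * P y j) * ((r : ℂ) * P y j) = ((r ^ 2 * ‖P y j‖ ^ 2 : ℝ) : ℂ) := by
    have h2 : star (P y j) * P y j = ((‖P y j‖ ^ 2 : ℝ) : ℂ) := by
      rw [mul_comm, Complex.ofReal_pow]; exact Complex.mul_conj' _
    rw [star_mul', mul_mul_mul_comm, h2, show star (r : ℂ) = r from Complex.conj_ofReal r,
      Complex.ofReal_mul, Complex.ofReal_pow r, sq (r : ℂ)]
  simp only [h]
  rw [← Complex.ofReal_sum, ← Finset.mul_sum, inv_pow, Real.sq_sqrt hpos.le,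
    inv_mul_cancel₀ hpos.ne', Complex.ofReal_one]

variable [NeZero (2 : ZMod p)]

/-- The Pauli operator that stabilises the translate by `u` of a Lagrangian subspace. -/
def stabOp {n : ℕ} (u b : Phase p n) : QMatrix p n := heis (-symp u b) b

theorem stabOp_mul {n : ℕ} (u : Phase p n) {b b' : Phase p n} (h : symp b b' = 0) :
    stabOp u b * stabOp u b' = stabOp u (b + b') := by
  rw [stabOp, stabOp, heis_mul, h, stabOp, symp_add_right]
  congr 1
  ring

/-- The stabiliser group of a translated Lagrangian subspace. -/
def stabGroup {n : ℕ} (u : Phase p n) (M : Submodule (ZMod p) (Phase p n))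
    (hM : ∀ b ∈ M, ∀ b' ∈ M, symp b b' = 0) : Subgroup (QMatrix p n)ˣ where
  carrier := {P | ∃ b ∈ M, P = heisUnit (-symp u b) b}
  one_mem' := ⟨0, M.zero_mem, Units.ext (by simp [heisUnit])⟩
  mul_mem' := by
    rintro _ _ ⟨b, hb, rfl⟩ ⟨b', hb', rfl⟩
    exact ⟨b + b', M.add_mem hb hb', Units.ext (stabOp_mul u (hM b hb b' hb'))⟩
  inv_mem' := by
    rintro _ ⟨b, hb, rfl⟩
    exact ⟨-b, M.neg_mem hb, by rw [heisUnit_inv, symp_neg_right]⟩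

/-- An element π(t, c) of a larger such group commutes with the stabilisers, so c lies in M because
M is Lagrangian. Its quotient by the stabiliser over c is a scalar, which must be trivial. -/
theorem stabGroup_maximal {n : ℕ} (u : Phase p n) (M : Submodule (ZMod p) (Phase p n))
    (hM : ∀ b ∈ M, ∀ b' ∈ M, symp b b' = 0) (hM' : ∀ c, (∀ b ∈ M, symp c b = 0) → c ∈ M) :
    Maximal IsScalarFreeAbelian (stabGroup u M hM) := by
  refine ⟨⟨?_, ?_, ?_⟩, ?_⟩
  · rintro _ ⟨b, _, rfl⟩
    exact ⟨_, _, _, rfl⟩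
  · rintro _ ⟨b, hb, rfl⟩ _ ⟨b', hb', rfl⟩
    exact heisUnit_commute (hM b hb b' hb')
  · rintro _ ⟨b, hb, rfl⟩ a ha
    have h2 : (heis (-symp u b) b : QMatrix p n) = heis a 0 := by
      rw [heis_eq_smul a, heis_zero]
      exact ha
    obtain ⟨h3, h4⟩ := heis_injective h2
    rw [← h3, h4, symp_zero_right, neg_zero]
  · intro S hS hle P hP
    obtain ⟨t, c, rfl⟩ := hS.exists_heisUnit hP
    have hmem (b) (hb : b ∈ M) : heisUnit (-symp u b) b ∈ S := hle ⟨b, hb, rfl⟩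
    have hc : c ∈ M := hM' c fun b hb =>
      symp_eq_zero_of_commute (congrArg Units.val (hS.comm _ hP _ (hmem b hb)))
    refine ⟨c, hc, ?_⟩
    have h1 := S.mul_mem hP (S.inv_mem (hmem c hc))
    rw [heisUnit_inv, heisUnit_mul, add_neg_cancel, symp_neg_right, symp_self, neg_zero,
      mul_zero, sub_zero, neg_neg] at h1
    have h2 := hS.scalar _ h1 (t + symp u c)
      ((heis_eq_smul (t + symp u c) (0 : Phase p n)).trans (by rw [heis_zero]))
    rw [eq_neg_of_add_eq_zero_left h2]

/-- The sum of all stabilisers absorbs each stabiliser from the left, so its columns are fixed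
vectors; it is nonzero because its trace is, and a nonzero column is normalised. -/
theorem exists_stabiliserState {n : ℕ} (u : Phase p n) (M : Submodule (ZMod p) (Phase p n))
    (hM : ∀ b ∈ M, ∀ b' ∈ M, symp b b' = 0) (hM' : ∀ c, (∀ b ∈ M, symp c b = 0) → c ∈ M) :
    ∃ ψ : qupits p 0 ⟶ qupits p n, IsStabiliserState ψ ∧
      ∀ b ∈ M, stabOp u b * qmat ψ = qmat ψ := by
  classical
  set P : QMatrix p n := ∑ b : M, stabOp u b with hPdef
  have hP (b) (hb : b ∈ M) : stabOp u b * P = P := by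
    rw [hPdef, Finset.mul_sum, ← Equiv.sum_comp (Equiv.addLeft (⟨b, hb⟩ : M)) (fun c : M => stabOp u c)]
    exact Finset.sum_congr rfl fun c _ => stabOp_mul u (hM b hb c c.2)
  -- Only the identity, from b = 0, has nonzero trace.
  have htr : P.trace = (p : ℂ) ^ n := by
    rw [hPdef, trace_sum, Finset.sum_eq_single 0]
    · rw [stabOp, trace_heis]; simp
    · intro b _ hb
      rw [stabOp, trace_heis, if_neg fun h : (b : Phase p n) = 0 => hb (Subtype.ext h)]
    · simp
  have hP0 : P ≠ 0 := by
    intro h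
    rw [h, trace_zero] at htr
    exact cast_pow_ne_zero n htr.symm
  obtain ⟨j, r, hr⟩ := exists_normalised_column hP0
  let F : Matrix (Word p n) (Word p 0) ℂ := Matrix.of fun y _ => (r : ℂ) * P y j
  have hF (b) (hb : b ∈ M) : stabOp u b * F = F := by
    ext y x
    have := congrFun (congrFun (hP b hb) y) j
    rw [Matrix.mul_apply] at this ⊢
    simp only [F, Matrix.of_apply]
    rw [← this, Finset.mul_sum]
    exact Finset.sum_congr rfl fun z _ => by ring
  have h1 : Fᴴ * F = 1 := by
    ext a b
    rw [Matrix.mul_apply, Subsingleton.elim a b, Matrix.one_apply_eq]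
    exact hr
  refine ⟨⟨F⟩, ⟨FHilb.hom_ext h1, stabGroup u M hM, stabGroup_maximal u M hM hM', ?_⟩, hF⟩
  rintro _ ⟨b, hb, rfl⟩
  exact FHilb.hom_ext (hF b hb)

theorem IsStabiliserState.ne_zero {n : ℕ} {ψ : qupits p 0 ⟶ qupits p n}
    (hψ : IsStabiliserState ψ) : qmat ψ ≠ 0 := by
  intro h
  have h1 : (qmat ψ)ᴴ * qmat ψ = 1 := by
    rw [← qmat_adj, ← qmat_comp, hψ.1, qmat_id]
  rw [h, Matrix.mul_zero] at h1
  exact one_ne_zero h1.symm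

/-- Every affine Lagrangian subspace is the relation of a stabiliser state. -/
theorem exists_pure_of_lagrangian {n : ℕ} (u : Phase p n) (M : Submodule (ZMod p) (Phase p n))
    (hM : ∀ b ∈ M, ∀ b' ∈ M, symp b b' = 0) (hM' : ∀ c, (∀ b ∈ M, symp c b = 0) → c ∈ M) :
    ∃ Φ : nQupits p 0 ⟶ nQupits p n, ∀ v w, Holds (relOf Φ) v w ↔ w - u ∈ M := by
  obtain ⟨ψ, hψ, hfix⟩ := exists_stabiliserState u M hM hM'
  obtain ⟨A, hA⟩ := exists_supports_state hψ
  refine ⟨pureStab ψ (.state hψ), fun v w => ?_⟩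
  rw [relOf_pure _ hA, ← hA.matRel_iff]
  have hi (b) (hb : b ∈ M) : Intertwines (qmat ψ) (-symp u b) 0 b := by
    rw [Intertwines, heis_zero, Matrix.mul_one]
    exact (hfix b hb).symm
  -- The stabiliser equations say that w - u is orthogonal to M, which for a Lagrangian subspace
  -- means w - u ∈ M; conversely every intertwined pair comes from M, since it is orthogonal to the
  -- stabilisers.
  constructor
  · intro h
    refine hM' _ fun b hb => ?_
    have := h _ _ _ (hi b hb)
    rw [symp_zero_right] at this
    rw [symp_sub_left]
    linear_combination this
  · intro h t b c hc
    have hf : qmat ψ ≠ 0 := hψ.ne_zero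
    rw [phase_zero_eq b] at hc ⊢
    have hcM : c ∈ M := hM' _ fun b' hb' => by
      rw [← hc.symp_eq hf (hi b' hb'), symp_zero_right]
    rw [hc.unique hf (hi c hcM), symp_zero_right]
    have := hM _ h _ hcM
    rw [symp_sub_left] at this
    linear_combination this

end Lagrangian

/-! ### Every affine coisotropic relation is the relation of a mixed stabiliser map -/

section Full
open Matrix SympSpace
variable {p : ℕ} [Fact p.Prime]

/-- The double orthogonal complement, obtained from the version for pairs by taking a source of zero
qupits. -/
theorem mem_of_symp_orthogonal {n : ℕ} (D : Submodule (ZMod p) (Phase p n)) {b : Phase p n}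
    (h : ∀ i, (∀ u ∈ D, symp u i = 0) → symp i b = 0) : b ∈ D := by
  let E : Submodule (ZMod p) (Phase p 0 × Phase p n) := D.comap (LinearMap.snd _ _ _)
  suffices hE : ((0, b) : Phase p 0 × Phase p n) ∈ E from hE
  rw [← relSymp_orthogonal_orthogonal E, LinearMap.BilinForm.mem_orthogonal_iff]
  intro x hx
  rw [LinearMap.BilinForm.mem_orthogonal_iff] at hx
  change relSymp p n 0 x (0, b) = 0
  rw [relSymp_apply, symp_zero_right, sub_zero]
  refine h x.2 fun u hu => ?_
  have h1 : relSymp p n 0 (0, u) x = 0 := hx (0, u) hu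
  rwa [relSymp_apply, symp_zero_left, sub_zero] at h1

/-- The doubled Lagrangian subspace of a coisotropic subspace. -/
def purification {n : ℕ} (D : Submodule (ZMod p) (Phase p n)) :
    Submodule (ZMod p) (Phase p (n + n)) where
  -- The elements are the pairs formed by d and the conjugate of d + i, with d ∈ D and i orthogonal
  -- to D. The dimensions of D and of its complement add up to 2n, half of 4n, and the first halves
  -- range over all of D.
  carrier := {a | a.left ∈ D ∧ ∀ u ∈ D, symp u (a.right.conj - a.left) = 0}
  zero_mem' := ⟨D.zero_mem, fun u _ => by
    have : (0 : Phase p (n + n)).right.conj - (0 : Phase p (n + n)).left = 0 :=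
      Prod.ext (sub_self 0) (funext fun i => by
        change -(0 : ZMod p) - 0 = 0
        ring)
    rw [this, symp_zero_right]⟩
  add_mem' := by
    rintro a b ⟨ha, ha'⟩ ⟨hb, hb'⟩
    refine ⟨D.add_mem ha hb, fun u hu => ?_⟩
    rw [Phase.right_add, Phase.left_add, Phase.conj_add, add_sub_add_comm, symp_add_right,
      ha' u hu, hb' u hu, add_zero]
  smul_mem' := by
    rintro c a ⟨ha, ha'⟩
    refine ⟨D.smul_mem c ha, fun u hu => ?_⟩
    have e1 : (c • a).left = c • a.left := rfl
    have e2 : (c • a).right = c • a.right := rfl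
    rw [e1, e2, Phase.conj_smul, ← smul_sub, symp_smul_right, ha' u hu, mul_zero]

theorem symp_conj_conj {n : ℕ} (v w : Phase p n) : symp v.conj w.conj = -symp v w := by
  rw [symp_conj, Phase.conj_conj]

/-- Conjugation reverses the sign of ω, so the pairing of two elements is ω(d, d') - ω(d + i, d' +
i'). This vanishes because i and i' are orthogonal to D and, by coisotropy, also lie in D. -/
theorem purification_isotropic {n : ℕ} {D : Submodule (ZMod p) (Phase p n)}
    (hD : ∀ c, (∀ b ∈ D, symp c b = 0) → c ∈ D) :
    ∀ a ∈ purification D, ∀ b ∈ purification D, symp a b = 0 := by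
  rintro a ⟨ha, ha'⟩ b ⟨hb, hb'⟩
  have h1 : a.right.conj - a.left ∈ D := hD _ fun u hu => by rw [symp_swap, ha' u hu, neg_zero]
  have h2 : symp (a.right.conj - a.left) (b.right.conj - b.left) = 0 := hb' _ h1
  have h3 : symp a.left (b.right.conj - b.left) = 0 := hb' _ ha
  have h4 : symp b.left (a.right.conj - a.left) = 0 := ha' _ hb
  have h5 := symp_conj_conj a.right b.right
  rw [symp_swap] at h4
  simp only [symp_sub_left, symp_sub_right] at h2 h3 h4
  rw [symp_split]
  linear_combination (-1 : ZMod p) * h2 - h3 + h5 + h4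

/-- Testing c with i = 0 shows that the two halves of c agree modulo the complement of D, after
conjugation; testing with d = 0 shows that the conjugated right half is orthogonal to the
complement, hence in D. Coisotropy then puts the left half in D. -/
theorem purification_maximal {n : ℕ} {D : Submodule (ZMod p) (Phase p n)}
    (hD : ∀ c, (∀ b ∈ D, symp c b = 0) → c ∈ D) (c : Phase p (n + n))
    (hc : ∀ a ∈ purification D, symp c a = 0) : c ∈ purification D := by
  have key (u i : Phase p n) (hu : u ∈ D) (hi : ∀ b ∈ D, symp b i = 0) :
      symp c.left u - symp c.right.conj (u + i) = 0 := by
    have h1 := hc (Phase.append u (u + i).conj) ⟨by simpa using hu, fun b hb => by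
      rw [Phase.right_append, Phase.left_append, Phase.conj_conj, add_sub_cancel_left, hi b hb]⟩
    rw [symp_split, Phase.left_append, Phase.right_append] at h1
    rw [symp_conj, sub_neg_eq_add]
    exact h1
  have h2 (u) (hu : u ∈ D) : symp u (c.right.conj - c.left) = 0 := by
    have := key u 0 hu fun b _ => symp_zero_right b
    rw [add_zero] at this
    rw [symp_sub_right, symp_swap u, symp_swap u]
    linear_combination this
  have h3 : c.right.conj ∈ D := mem_of_symp_orthogonal D fun i hi => by
    have := key 0 i D.zero_mem hi
    rw [zero_add, symp_zero_right, zero_sub, ← symp_swap] at this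
    exact this
  refine ⟨?_, h2⟩
  have h4 : c.right.conj - c.left ∈ D := hD _ fun b hb => by rw [symp_swap, h2 b hb, neg_zero]
  have := D.sub_mem h3 h4
  rwa [sub_sub_cancel] at this

variable [NeZero (2 : ZMod p)]

theorem holds_relOf_id {n : ℕ} (v w : Phase p n) : Holds (relOf (𝟙 (nQupits p n))) v w ↔ w = v := by
  rw [relOf_id]; exact Iff.rfl

theorem holds_relOf_comp {n m l : ℕ} (Φ : nQupits p n ⟶ nQupits p m) (Ψ : nQupits p m ⟶ nQupits p l)
    (v : Phase p n) (w : Phase p l) :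
    Holds (relOf (Φ ≫ Ψ)) v w ↔ ∃ u, Holds (relOf Φ) v u ∧ Holds (relOf Ψ) u w := by
  rw [relOf_comp, holds_comp]

theorem holds_relOf_tensor {n m n' m' : ℕ} (Φ : nQupits p n ⟶ nQupits p m)
    (Ψ : nQupits p n' ⟶ nQupits p m') (v : Phase p (n + n')) (w : Phase p (m + m')) :
    Holds (relOf (mixedTensor Φ Ψ)) v w ↔
      Holds (relOf Φ) v.left w.left ∧ Holds (relOf Ψ) v.right w.right := by
  rw [relOf_tensor, holds_tensorRel]

/-- Every affine coisotropic subspace is the relation of a mixed state. -/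
theorem exists_state_of_coisotropic {n : ℕ} (u : Phase p n) (D : Submodule (ZMod p) (Phase p n))
    (hD : ∀ c, (∀ b ∈ D, symp c b = 0) → c ∈ D) :
    ∃ Φ : nQupits p 0 ⟶ nQupits p n, ∀ v w, Holds (relOf Φ) v w ↔ w - u ∈ D := by
  -- The purifying system is centred at the origin since it is discarded afterwards.
  obtain ⟨Ψ, hΨ⟩ := exists_pure_of_lagrangian (Phase.append u 0) (purification D)
    (purification_isotropic hD) (purification_maximal hD)
  let Θ : nQupits p (n + n) ⟶ nQupits p n := mixedTensor (𝟙 (nQupits p n)) (discard p n)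
  have hΘ (v w) : Holds (relOf Θ) v w ↔ w = v.left := by
    refine (holds_relOf_tensor (𝟙 (nQupits p n)) (discard p n) v w).trans ?_
    rw [holds_relOf_id, and_iff_left (holds_discard _ _)]
    rfl
  refine ⟨Ψ ≫ Θ, fun v w => ?_⟩
  rw [holds_relOf_comp]
  simp only [hΘ, hΨ]
  constructor
  · rintro ⟨a, ⟨ha, _⟩, rfl⟩
    rwa [Phase.left_sub, Phase.left_append] at ha
  · intro h
    -- The preimage of w in the purification with i = 0.
    refine ⟨Phase.append w (w - u).conj, ⟨?_, fun b hb => ?_⟩, (Phase.left_append _ _).symm⟩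
    · rwa [Phase.left_sub, Phase.left_append, Phase.left_append]
    · rw [Phase.left_sub, Phase.left_append, Phase.left_append, Phase.right_sub,
        Phase.right_append, Phase.right_append, sub_zero, Phase.conj_conj, sub_self,
        symp_zero_right]

/-- Relabelling along an equality. -/
def castMap {n m : ℕ} (h : n = m) : nQupits p n ⟶ nQupits p m :=
  pureStab (FHilb.perm (relabelWord (finCongr h))) (IsStab.perm_cast h _ fun _ _ => rfl)

theorem holds_castMap {n m : ℕ} (h : n = m) (v : Phase p n) (w : Phase p m) :
    Holds (relOf (castMap h)) v w ↔ w = relabelPhase (finCongr h) v :=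
  isGraph_pureStab rfl _ v w

/-- The cap of `n` qupits. -/
def capMap (p n : ℕ) [Fact p.Prime] : nQupits p (n + n) ⟶ nQupits p 0 :=
  pureStab (FHilb.adj (qupitCup p n)) (IsStab.adj (IsStab.cup n))

theorem holds_capMap {n : ℕ} (v : Phase p (n + n)) (w : Phase p 0) :
    Holds (relOf (capMap p n)) v w ↔ v.left = v.right.conj := by
  have h2 : Supports (cupRel p n).swap (pureWigner (qmat (FHilb.adj (qupitCup p n)))) := by
    rw [qmat_adj, pureWigner_conjTranspose]
    exact (supports_cup n).transpose.smul _
  rw [capMap, relOf_pure _ h2]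
  exact Iff.rfl

theorem relabelPhase_symm_assoc {n m l : ℕ} (u : Phase p n) (v : Phase p m) (w : Phase p l) :
    relabelPhase (finCongr (Nat.add_assoc n m l).symm) (Phase.append u (Phase.append v w)) =
      Phase.append (Phase.append u v) w := by
  rw [← relabelPhase_assoc]
  rfl

/-- The process `n ⟶ m` obtained by bending a state of `n + m` qupits. -/
def bend {n m : ℕ} (ρ : nQupits p 0 ⟶ nQupits p (n + m)) : nQupits p n ⟶ nQupits p m :=
  (mixedTensor (𝟙 (nQupits p n)) ρ : nQupits p n ⟶ nQupits p (n + (n + m))) ≫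
    castMap (Nat.add_assoc n n m).symm ≫
      mixedTensor (capMap p n) (𝟙 (nQupits p m)) ≫ castMap (Nat.zero_add m)

/-- The cap forces the first half of the state to be conjugate to the input; the second half becomes
the output, and the casts only re-bracket. -/
theorem holds_bend {n m : ℕ} (ρ : nQupits p 0 ⟶ nQupits p (n + m)) (v : Phase p n) (w : Phase p m) :
    Holds (relOf (bend ρ)) v w ↔ Holds (relOf ρ) 0 (Phase.append v.conj w) := by
  have h1 (a : Phase p (n + (n + m))) :
      Holds (relOf (mixedTensor (𝟙 (nQupits p n)) ρ : nQupits p n ⟶ nQupits p (n + (n + m)))) v a ↔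
        a.left = v ∧ Holds (relOf ρ) 0 a.right := by
    refine (holds_relOf_tensor (𝟙 (nQupits p n)) ρ v a).trans ?_
    rw [holds_relOf_id, phase_zero_eq (Phase.right (m := 0) v)]
    rfl
  rw [bend, holds_relOf_comp]
  simp only [h1, holds_relOf_comp, holds_castMap, holds_relOf_tensor, holds_relOf_id, holds_capMap]
  constructor
  · rintro ⟨a, ⟨rfl, ha⟩, b, rfl, c, ⟨h2, h3⟩, h4⟩
    have e : a = Phase.append a.left (Phase.append a.right.left a.right.right) := by simp
    rw [e, relabelPhase_symm_assoc] at h2 h3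
    simp only [Phase.left_append, Phase.right_append] at h2 h3
    rw [← Phase.append_left_right c, relabelPhase_zero_add] at h4
    rw [h2, h4, h3, Phase.conj_conj, Phase.append_left_right]
    exact ha
  · intro h
    refine ⟨Phase.append v (Phase.append v.conj w), ⟨by simp, by simpa using h⟩, _, rfl,
      Phase.append 0 w, ?_, (relabelPhase_zero_add _ _).symm⟩
    rw [relabelPhase_symm_assoc]
    simp

/-- Every nonempty affine coisotropic relation is the relation of a mixed stabiliser map. -/
theorem exists_relOf_eq_of_holds {n m : ℕ} (A : Hom (stdSymp p n) (stdSymp p m)) {v₀ : Phase p n}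
    {w₀ : Phase p m} (h₀ : Holds A v₀ w₀) : ∃ Φ : nQupits p n ⟶ nQupits p m, relOf Φ = A := by
  have hs (c : ZMod p) {v : Phase p n} {w : Phase p m} (h : Holds A (v + v₀) (w + w₀)) :
      Holds A (c • v + v₀) (c • w + w₀) := by
    have := h.affine c h₀ h₀
    rwa [add_sub_cancel_right, add_sub_cancel_right] at this
  -- The direction of A with its input conjugated. Conjugation reverses the sign of ω, so the form
  -- -ω ⊕ ω becomes the standard form on n + m qupits and coisotropy is preserved.
  let D : Submodule (ZMod p) (Phase p (n + m)) :=
    { carrier := {d | Holds A (d.left.conj + v₀) (d.right + w₀)}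
      zero_mem' := by
        have e1 : (0 : Phase p (n + m)).left.conj = 0 := Prod.ext rfl neg_zero
        have e2 : (0 : Phase p (n + m)).right = 0 := rfl
        change Holds A _ _
        rw [e1, e2, zero_add, zero_add]
        exact h₀
      add_mem' := by
        intro a b ha hb
        have := Holds.affine 1 ha h₀ hb
        rw [add_sub_cancel_right, add_sub_cancel_right, one_smul, one_smul, ← add_assoc,
          ← add_assoc] at this
        change Holds A _ _
        rw [Phase.left_add, Phase.right_add, Phase.conj_add]
        exact this
      smul_mem' := by
        intro c a ha
        have e1 : (c • a).left = c • a.left := rfl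
        have e2 : (c • a).right = c • a.right := rfl
        change Holds A _ _
        rw [e1, e2, Phase.conj_smul]
        exact hs c ha }
  have hmem (d) : d ∈ D ↔ Holds A (d.left.conj + v₀) (d.right + w₀) := Iff.rfl
  have hD (c) (hc : ∀ b ∈ D, symp c b = 0) : c ∈ D := by
    rw [hmem]
    refine h₀.coisotropic _ _ fun v' w' h' => ?_
    have := hc (Phase.append (v' - v₀).conj (w' - w₀)) (by
      rw [hmem, Phase.left_append, Phase.right_append, Phase.conj_conj, sub_add_cancel,
        sub_add_cancel]
      exact h')
    rw [symp_split, Phase.left_append, Phase.right_append] at this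
    rw [symp_swap (w' - w₀), symp_swap (v' - v₀), symp_conj]
    linear_combination (-1 : ZMod p) * this
  obtain ⟨ρ, hρ⟩ := exists_state_of_coisotropic (Phase.append v₀.conj w₀) D hD
  refine ⟨bend ρ, hom_ext_holds fun v w => ?_⟩
  rw [holds_bend, hρ, hmem]
  simp [Phase.conj_sub]

/-- The relation of all pairs. -/
def topRel (p n m : ℕ) [Fact p.Prime] : Hom (stdSymp p n) (stdSymp p m) :=
  ofHolds (fun _ _ => True) (fun _ _ _ _ _ _ _ _ _ _ => trivial) (fun _ _ _ _ _ _ => trivial)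

/-- The relation of the position eigenstate `|a⟩` of one qupit. -/
def positionRel (a : ZMod p) : Hom (stdSymp p 0) (stdSymp p 1) :=
  ofHolds (fun _ w => w.1 0 = a)
    (fun c v₁ v₂ v₃ w₁ w₂ w₃ h₁ h₂ h₃ => by
      change c * (w₁.1 0 - w₂.1 0) + w₃.1 0 = a
      rw [h₁, h₂, h₃, sub_self, mul_zero, zero_add])
    (fun v₀ w₀ h₀ v w h => by
      have := h 0 ((0, fun _ => 1) + w₀) (by
        change (0 : ZMod p) + w₀.1 0 = a
        rw [h₀, zero_add])
      rw [phase_zero_eq v, symp_zero_right, add_sub_cancel_right, sub_zero] at this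
      simp only [symp, dotProduct, Finset.univ_unique, Finset.sum_singleton] at this
      change w.1 0 + w₀.1 0 = a
      simp at this
      rw [h₀, this, zero_add])

/-- The empty relation has no base point and is realised separately, by a composite that prepares
position 0 and then tests for position 1. -/
theorem exists_relOf_eq {n m : ℕ} (A : Hom (stdSymp p n) (stdSymp p m)) :
    ∃ Φ : nQupits p n ⟶ nQupits p m, relOf Φ = A := by
  by_cases h : ∃ v w, Holds A v w
  · obtain ⟨v, w, hvw⟩ := h
    exact exists_relOf_eq_of_holds A hvw
  · obtain ⟨Φ₁, h1⟩ := exists_relOf_eq_of_holds (topRel p n 0) (v₀ := 0) (w₀ := 0) trivial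
    obtain ⟨Φ₂, h2⟩ := exists_relOf_eq_of_holds (positionRel (p := p) 0) (v₀ := 0) (w₀ := 0) rfl
    obtain ⟨Φ₃, h3⟩ := exists_relOf_eq_of_holds (positionRel (p := p) 1).swap
      (v₀ := (fun _ => 1, 0)) (w₀ := 0) rfl
    obtain ⟨Φ₄, h4⟩ := exists_relOf_eq_of_holds (topRel p 0 m) (v₀ := 0) (w₀ := 0) trivial
    refine ⟨Φ₁ ≫ Φ₂ ≫ Φ₃ ≫ Φ₄, hom_ext_holds fun v w => iff_of_false ?_ fun hA => h ⟨v, w, hA⟩⟩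
    simp only [holds_relOf_comp, h2, h3]
    rintro ⟨_, _, a, h5, _, h6, _⟩
    have h5 : a.1 0 = 0 := h5
    have h6 : a.1 0 = 1 := h6
    exact zero_ne_one (h5.symm.trans h6)

end Full

/-! ### Symplectic bases -/

section Darboux
open SympSpace

namespace SympSpace
variable {k : Type} [Field k]

theorem form_swap (V : SympSpace k) (x y : V) : V.form x y = -V.form y x :=
  (LinearMap.IsAlt.neg V.alt y x).symm

theorem exists_hyperbolic_pair {V : SympSpace k} {v : V} (hv : v ≠ 0) : ∃ w, V.form v w = 1 := by
  have : ∃ w, V.form v w ≠ 0 := by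
    by_contra! h
    exact hv (V.nondegenerate.1 v h)
  obtain ⟨w, hw⟩ := this
  exact ⟨(V.form v w)⁻¹ • w, by rw [map_smul, smul_eq_mul, inv_mul_cancel₀ hw]⟩

/-- The orthogonal complement of a hyperbolic plane. -/
def planeCompl (V : SympSpace k) (v w : V) : Submodule k V :=
  LinearMap.ker (V.form v) ⊓ LinearMap.ker (V.form w)

/-- The projection along the hyperbolic plane: the coefficients are the pairings of x with w and v,
with signs fixed by ω(v, w) = 1. -/
theorem sub_mem_planeCompl {V : SympSpace k} {v w : V} (h : V.form v w = 1) (x : V) :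
    x - (V.form x w • v + V.form v x • w) ∈ planeCompl V v w := by
  have hv : V.form v v = 0 := V.alt v
  have hw : V.form w w = 0 := V.alt w
  constructor
  · change V.form v _ = 0
    simp only [map_sub, map_add, map_smul, smul_eq_mul, hv, h]
    ring
  · change V.form w _ = 0
    simp only [map_sub, map_add, map_smul, smul_eq_mul, hw, form_swap V w v, h, form_swap V w x]
    ring

/-- The orthogonal complement of a hyperbolic plane, as a symplectic space. -/
def compl (V : SympSpace k) (v w : V) (h : V.form v w = 1) : SympSpace k where
  carrier := planeCompl V v w
  form := V.form.restrict (planeCompl V v w)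
  alt x := V.alt x
  nondegenerate := by
    have key (x : planeCompl V v w) (hx : ∀ y : planeCompl V v w, V.form x y = 0) : x = 0 := by
      refine Subtype.ext (V.nondegenerate.1 _ fun y => ?_)
      -- An arbitrary y differs from a vector of the complement by a combination of v and w, both of
      -- which pair to zero with x.
      have h1 := hx ⟨_, sub_mem_planeCompl h y⟩
      have h2 : V.form v x = 0 := x.2.1
      have h3 : V.form w x = 0 := x.2.2
      simp only [map_sub, map_add, map_smul, smul_eq_mul, form_swap V x v, form_swap V x w, h2,
        h3] at h1
      simpa using h1
    refine ⟨key, fun x hx => key x fun y => ?_⟩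
    rw [form_swap, neg_eq_zero]
    exact hx y

end SympSpace

variable {p : ℕ} [Fact p.Prime]

/-- Symplectic coordinates on a space with a hyperbolic pair. -/
def extendCoords {n : ℕ} {V : SympSpace (ZMod p)} (v w : V) (f : Phase p n →ₗ[ZMod p] V) :
    Phase p (1 + n) →ₗ[ZMod p] V where
  toFun a := a.left.1 0 • v + a.left.2 0 • w + f a.right
  map_add' a b := by
    rw [Phase.left_add, Phase.right_add, map_add, Prod.fst_add, Prod.snd_add, Pi.add_apply,
      Pi.add_apply, add_smul, add_smul]
    abel
  map_smul' c a := by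
    have e1 : (c • a).left = c • a.left := rfl
    have e2 : (c • a).right = c • a.right := rfl
    rw [e1, e2, map_smul, Prod.smul_fst, Prod.smul_snd, Pi.smul_apply, Pi.smul_apply, smul_assoc,
      smul_assoc, RingHom.id_apply, smul_add, smul_add]

theorem extendCoords_apply {n : ℕ} {V : SympSpace (ZMod p)} (v w : V)
    (f : Phase p n →ₗ[ZMod p] V) (a : Phase p (1 + n)) :
    extendCoords v w f a = a.left.1 0 • v + a.left.2 0 • w + f a.right := rfl

/-- A hyperbolic plane is split off and coordinates are found on its orthogonal complement. The
induction is on an upper bound for the dimension, so it is enough that the complement is a proper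
subspace. -/
theorem exists_symplectic_coords (d : ℕ) (V : SympSpace (ZMod p))
    (hd : Module.finrank (ZMod p) V ≤ d) : ∃ (n : ℕ) (e : Phase p n ≃ₗ[ZMod p] V),
      ∀ x y, V.form (e x) (e y) = symp x y := by
  induction d generalizing V with
  | zero =>
    have : Subsingleton V := Module.finrank_zero_iff.1 (Nat.le_zero.1 hd)
    refine ⟨0, LinearEquiv.ofSubsingleton _ _, fun x y => ?_⟩
    rw [phase_zero_eq x, map_zero, LinearMap.map_zero, symp_zero_left]
    rfl
  | succ d ih =>
    by_cases hV : ∀ v : V, v = 0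
    · have : Subsingleton V := ⟨fun a b => (hV a).trans (hV b).symm⟩
      refine ⟨0, LinearEquiv.ofSubsingleton _ _, fun x y => ?_⟩
      rw [phase_zero_eq x, map_zero, LinearMap.map_zero, symp_zero_left]
      rfl
    push Not at hV
    obtain ⟨v, hv⟩ := hV
    obtain ⟨w, hw⟩ := exists_hyperbolic_pair hv
    have hlt : Module.finrank (ZMod p) (planeCompl V v w) < Module.finrank (ZMod p) V := by
      refine Submodule.finrank_lt (lt_top_iff_ne_top.2 fun h => ?_).ne
      have : w ∈ planeCompl V v w := h ▸ Submodule.mem_top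
      have : V.form v w = 0 := this.1
      rw [hw] at this
      exact one_ne_zero this
    obtain ⟨n, e, he⟩ := ih (compl V v w hw) (Nat.le_of_lt_succ (hlt.trans_le hd))
    let f : Phase p n →ₗ[ZMod p] V := (planeCompl V v w).subtype ∘ₗ e.toLinearMap
    have hf (x y) : V.form (f x) (f y) = symp x y := he x y
    have hfv (x) : V.form v (f x) = 0 := (e x).2.1
    have hfw (x) : V.form w (f x) = 0 := (e x).2.2
    have hform (x y : Phase p (1 + n)) :
        V.form (extendCoords v w f x) (extendCoords v w f y) = symp x y := by
      have hv : V.form v v = 0 := V.alt v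
      have hw' : V.form w w = 0 := V.alt w
      have e1 : symp x.left y.left = x.left.1 0 * y.left.2 0 - x.left.2 0 * y.left.1 0 := by
        simp [symp, dotProduct]
      rw [extendCoords_apply, extendCoords_apply, symp_split, e1, ← hf]
      simp only [map_add, map_smul, LinearMap.add_apply, LinearMap.smul_apply, smul_eq_mul,
        hfv, hfw, hv, hw', hw, form_swap V w v, form_swap V (f x.right) v,
        form_swap V (f x.right) w]
      ring
    -- A map that preserves a nondegenerate form is injective.
    have hinj : Function.Injective (extendCoords v w f) := by
      rw [injective_iff_map_eq_zero]
      intro x hx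
      refine eq_zero_of_symp fun u => ?_
      rw [← hform, hx, map_zero]
    have hsurj : Function.Surjective (extendCoords v w f) := by
      intro x
      refine ⟨Phase.append (fun _ => V.form x w, fun _ => V.form v x)
        (e.symm ⟨_, sub_mem_planeCompl hw x⟩), ?_⟩
      rw [extendCoords_apply, Phase.left_append, Phase.right_append]
      have : f (e.symm ⟨_, sub_mem_planeCompl hw x⟩) =
          x - (V.form x w • v + V.form v x • w) :=
        congrArg Subtype.val (e.apply_symm_apply _)
      rw [this]
      exact add_sub_cancel _ _
    exact ⟨1 + n, LinearEquiv.ofBijective _ ⟨hinj, hsurj⟩, hform⟩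

/-- Every symplectic space has a symplectic basis. -/
theorem exists_stdSymp_iso (V : SympSpace (ZMod p)) :
    ∃ (n : ℕ) (i : stdSymp p n ≅ V), total (ZMod p) i.hom ∧ total (ZMod p) i.inv := by
  obtain ⟨n, e, he⟩ := exists_symplectic_coords _ V le_rfl
  refine ⟨n, graphIso (V := stdSymp p n) e he, (isGraph_hom (V := stdSymp p n) e he).total,
    (isGraph_inv (V := stdSymp p n) e he).total⟩

end Darboux

/-! ### Wide subcategories and quotients by scalars -/

section ProjWide
universe v w v' w'
open Functor.LaxMonoidal Functor.OplaxMonoidal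

section Scale
variable {C : Type w} [Category.{v} C] [MonoidalCategory C]

theorem scale_id {X Y : C} (f : X ⟶ Y) : scale (𝟙 (𝟙_ C)) f = f := by
  simp [scale]

theorem scale_scale (s t : 𝟙_ C ⟶ 𝟙_ C) {X Y : C} (f : X ⟶ Y) :
    scale s (scale t f) = scale (s ≫ t) f := by
  simp [scale]

/-- The invertible scalars form a group acting compatibly with composition. So equality in the
quotient category is the relation itself, not just the congruence it generates. -/
instance projRel_congruence : Congruence (projRel C) where
  equivalence :=
    { refl := fun f => ⟨Iso.refl _, (scale_id f).symm⟩
      symm := by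
        rintro _ g ⟨s, rfl⟩
        exact ⟨s.symm, by rw [scale_scale, Iso.symm_hom, s.inv_hom_id, scale_id]⟩
      trans := by
        rintro _ _ h ⟨s, rfl⟩ ⟨t, rfl⟩
        exact ⟨s ≪≫ t, scale_scale _ _ _⟩ }
  comp_left f _ _ := by
    rintro ⟨s, rfl⟩
    exact ⟨s, comp_scale _ _ _⟩
  comp_right g := by
    rintro ⟨s, rfl⟩
    exact ⟨s, scale_comp _ _ _⟩

end Scale

variable {C : Type w} [Category.{v} C] [MonoidalCategory C] [BraidedCategory C]
variable {D : Type w'} [Category.{v'} D] [MonoidalCategory D]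

theorem Proj.lift_full (F : C ⥤ D) [F.Full] (h) : (Proj.lift F h).Full where
  map_surjective {X Y} f := ⟨(quot C).map (F.preimage f), F.map_preimage f⟩

theorem Proj.lift_essSurj (F : C ⥤ D) [F.EssSurj] (h) : (Proj.lift F h).EssSurj where
  mem_essImage Y := ⟨(quot C).obj (F.objPreimage Y), ⟨F.objObjPreimageIso Y⟩⟩

theorem Proj.lift_faithful (F : C ⥤ D) (h)
    (hF : ∀ ⦃X Y : C⦄ (f g : X ⟶ Y), F.map f = F.map g → projRel C f g) :
    (Proj.lift F h).Faithful where
  map_injective {X Y} f g e := by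
    obtain ⟨f, rfl⟩ := quot_surj f
    obtain ⟨g, rfl⟩ := quot_surj g
    exact CategoryTheory.Quotient.sound _ (hF f g e)

theorem projRel_of_quot_eq {X Y : C} {f g : X ⟶ Y} (h : (Proj.quot C).map f = (Proj.quot C).map g) :
    projRel C f g := (CategoryTheory.Quotient.functor_map_eq_iff _ f g).1 h

/-- A fully faithful monoidal functor lifts an invertible scalar of the target through the unit
isomorphism. -/
theorem projRel_of_map [BraidedCategory D] (F : C ⥤ D) [F.Braided] [F.Full] [F.Faithful] {X Y : C}
    {f g : X ⟶ Y} (h : projRel D (F.map f) (F.map g)) : projRel C f g := by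
  obtain ⟨s, hs⟩ := h
  let t := F.preimageIso ((Functor.Monoidal.εIso F).symm ≪≫ s ≪≫ Functor.Monoidal.εIso F)
  refine ⟨t, F.map_injective ?_⟩
  rw [map_scale, hs]
  congr 1
  simp [t]

theorem Proj.map_isEquivalence [BraidedCategory D] (F : C ⥤ D) [F.Braided] [F.IsEquivalence] :
    (Proj.map F).IsEquivalence where
  faithful := Proj.lift_faithful _ _ fun _ _ f g e => projRel_of_map F (projRel_of_quot_eq e)
  full := Proj.lift_full _ _
  essSurj := Proj.lift_essSurj _ _

section Restrict
variable [BraidedCategory D] (F : C ⥤ D) [F.Braided] (P : MorphismProperty C)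
    (Q : MorphismProperty D)
    [P.IsStableUnderBraiding] [Q.IsStableUnderBraiding]
    (h : ∀ ⦃X Y : C⦄ (f : X ⟶ Y), P f → Q (F.map f))

/-- The structure maps of the restriction of a monoidal functor to wide subcategories. -/
def restrictCoreMonoidal (hε : Q (ε F)) (hη : Q (η F)) (hμ : ∀ X Y, Q (μ F X Y))
    (hδ : ∀ X Y, Q (δ F X Y)) : (restrictWide F P Q h).CoreMonoidal where
  εIso := WideSubcategory.isoMk (X := 𝟙_ (WideSubcategory Q)) (Y := ⟨F.obj (𝟙_ C)⟩)
    (Functor.Monoidal.εIso F) hε hη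
  μIso X Y := WideSubcategory.isoMk (X := (⟨F.obj X.obj ⊗ F.obj Y.obj⟩ : WideSubcategory Q))
    (Y := ⟨F.obj (X.obj ⊗ Y.obj)⟩)
    (Functor.Monoidal.μIso F X.obj Y.obj) (hμ _ _) (hδ _ _)
  μIso_hom_natural_left f X := WideSubcategory.hom_ext _ (μ_natural_left F f.hom X.obj)
  μIso_hom_natural_right X f := WideSubcategory.hom_ext _ (μ_natural_right F X.obj f.hom)
  associativity X Y Z := WideSubcategory.hom_ext _
    (Functor.LaxMonoidal.associativity F X.obj Y.obj Z.obj)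
  left_unitality X := WideSubcategory.hom_ext _ (Functor.LaxMonoidal.left_unitality F X.obj)
  right_unitality X := WideSubcategory.hom_ext _ (Functor.LaxMonoidal.right_unitality F X.obj)

/-- The restriction of a symmetric monoidal functor to wide subcategories. -/
@[reducible]
def restrictBraided (hε : Q (ε F)) (hη : Q (η F)) (hμ : ∀ X Y, Q (μ F X Y))
    (hδ : ∀ X Y, Q (δ F X Y)) : (restrictWide F P Q h).Braided where
  toMonoidal := (restrictCoreMonoidal F P Q h hε hη hμ hδ).toMonoidal
  braided X Y := WideSubcategory.hom_ext _ (Functor.LaxBraided.braided (F := F) X.obj Y.obj)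

/-- The two composites agree on the nose, so the isomorphism has identity components and only the
structure maps have to be compared. The hypotheses on these maps let them live in the wide
subcategory. -/
theorem monoidallyIso_restrict (hε : Q (ε F)) (hη : Q (η F)) (hμ : ∀ X Y, Q (μ F X Y))
    (hδ : ∀ X Y, Q (δ F X Y)) :
    letI := restrictBraided F P Q h hε hη hμ hδ
    MonoidallyIso (restrictWide F P Q h ⋙ wideSubcategoryInclusion Q)
      (wideSubcategoryInclusion P ⋙ F) := by
  let _ := restrictBraided F P Q h hε hη hμ hδ
  refine ⟨NatIso.ofComponents (fun X => Iso.refl (F.obj X.obj)) fun f =>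
    (Category.comp_id (F.map f.hom)).trans (Category.id_comp (F.map f.hom)).symm, ⟨?_, fun X Y => ?_⟩⟩
  · change (𝟙 _ ≫ ε F) ≫ 𝟙 _ = ε F ≫ F.map (𝟙 _)
    simp
  · change (𝟙 _ ≫ μ F X.obj Y.obj) ≫ 𝟙 _ = (𝟙 _ ⊗ₘ 𝟙 _) ≫ μ F X.obj Y.obj ≫ F.map (𝟙 _)
    simp

theorem monoidallyIso_restrict_lift (hε : Q (ε F)) (hη : Q (η F)) (hμ : ∀ X Y, Q (μ F X Y))
    (hδ : ∀ X Y, Q (δ F X Y)) (hS : ∀ ⦃X Y : C⦄ (f g : X ⟶ Y), projRel C f g → F.map f = F.map g) :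
    letI := restrictBraided F P Q h hε hη hμ hδ
    MonoidallyIso (restrictWide F P Q h ⋙ wideSubcategoryInclusion Q)
      (wideSubcategoryInclusion P ⋙ Proj.quot C ⋙ Proj.lift F hS) := by
  let _ := restrictBraided F P Q h hε hη hμ hδ
  refine ⟨NatIso.ofComponents (fun X => Iso.refl (F.obj X.obj)) fun f =>
    (Category.comp_id (F.map f.hom)).trans (Category.id_comp (F.map f.hom)).symm, ⟨?_, fun X Y => ?_⟩⟩
  · change (𝟙 _ ≫ ε F) ≫ 𝟙 _ = (ε F ≫ F.map (𝟙 _)) ≫ F.map (𝟙 _)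
    simp
  · change (𝟙 _ ≫ μ F X.obj Y.obj) ≫ 𝟙 _ =
      (𝟙 _ ⊗ₘ 𝟙 _) ≫ (μ F X.obj Y.obj ≫ F.map (𝟙 _)) ≫ F.map (𝟙 _)
    simp

end Restrict

theorem monoidallyIso_lift (F : C ⥤ D) [F.Monoidal]
    (hS : ∀ ⦃X Y : C⦄ (f g : X ⟶ Y), projRel C f g → F.map f = F.map g) :
    MonoidallyIso F (Proj.quot C ⋙ Proj.lift F hS) := by
  refine ⟨NatIso.ofComponents (fun X => Iso.refl (F.obj X)) fun f =>
    (Category.comp_id (F.map f)).trans (Category.id_comp (F.map f)).symm, ⟨?_, fun X Y => ?_⟩⟩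
  · change ε F ≫ 𝟙 _ = ε F ≫ F.map (𝟙 _)
    simp
  · change μ F X Y ≫ 𝟙 _ = (𝟙 _ ⊗ₘ 𝟙 _) ≫ μ F X Y ≫ F.map (𝟙 _)
    simp

theorem monoidallyIso_map [BraidedCategory D] (F : C ⥤ D) [F.Braided] :
    MonoidallyIso (F ⋙ Proj.quot D) (Proj.quot C ⋙ Proj.map F) :=
  monoidallyIso_lift (F ⋙ Proj.quot D) (Proj.map_sound F)

end ProjWide

/-! ### Monoidal structures detected by a faithful functor -/

section Detect
universe v₁ v₂ v₃ w₁ w₂ w₃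
open Functor.LaxMonoidal Functor.OplaxMonoidal
variable {C : Type w₁} [Category.{v₁} C] [MonoidalCategory C]
variable {D : Type w₂} [Category.{v₂} D] [MonoidalCategory D]
variable {E : Type w₃} [Category.{v₃} E] [MonoidalCategory E]

/-- A functor is monoidal if its composite with a faithful monoidal functor is, through structure
maps that lift. -/
def coreMonoidalOfFaithful (F : C ⥤ D) (G : D ⥤ E) [G.Monoidal] [G.Faithful] [(F ⋙ G).Monoidal]
    (i : 𝟙_ D ≅ F.obj (𝟙_ C)) (m : ∀ X Y, F.obj X ⊗ F.obj Y ≅ F.obj (X ⊗ Y))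
    (hi : ε G ≫ G.map i.hom = ε (F ⋙ G))
    (hm : ∀ X Y, μ G _ _ ≫ G.map (m X Y).hom = μ (F ⋙ G) X Y) : F.CoreMonoidal where
  εIso := i
  μIso := m
  μIso_hom_natural_left {X Y} f X' := G.map_injective <| by
    -- The structure maps of G are invertible. Once one of them is restored on the left, the
    -- equation is the one already known for the composite F ⋙ G; the remaining axioms are treated
    -- in the same way.
    rw [← cancel_epi (μ G _ _), G.map_comp, G.map_comp, ← μ_natural_left_assoc, hm,
      ← Category.assoc, hm]
    exact μ_natural_left (F ⋙ G) f X'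
  μIso_hom_natural_right {X Y} X' f := G.map_injective <| by
    rw [← cancel_epi (μ G _ _), G.map_comp, G.map_comp, ← μ_natural_right_assoc, hm,
      ← Category.assoc, hm]
    exact μ_natural_right (F ⋙ G) X' f
  associativity X Y Z := G.map_injective <| by
    have h := Functor.LaxMonoidal.associativity (F ⋙ G) X Y Z
    rw [← cancel_epi (μ G _ _), ← cancel_epi (μ G _ _ ▷ _)]
    simp only [G.map_comp, Functor.LaxMonoidal.associativity_assoc]
    rw [← μ_natural_left_assoc, ← μ_natural_right_assoc, reassoc_of% hm, hm,
      ← comp_whiskerRight_assoc, hm, ← MonoidalCategory.whiskerLeft_comp_assoc, hm]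
    exact h
  left_unitality X := G.map_injective <| by
    have h := Functor.LaxMonoidal.left_unitality (F ⋙ G) X
    rw [← cancel_epi (μ G _ _), ← cancel_epi (ε G ▷ _)]
    simp only [G.map_comp]
    rw [← μ_natural_left_assoc, reassoc_of% hm, ← comp_whiskerRight_assoc, hi,
      ← Functor.LaxMonoidal.left_unitality]
    exact h
  right_unitality X := G.map_injective <| by
    have h := Functor.LaxMonoidal.right_unitality (F ⋙ G) X
    rw [← cancel_epi (μ G _ _), ← cancel_epi (_ ◁ ε G)]
    simp only [G.map_comp]
    rw [← μ_natural_right_assoc, reassoc_of% hm, ← MonoidalCategory.whiskerLeft_comp_assoc, hi,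
      ← Functor.LaxMonoidal.right_unitality]
    exact h

theorem braided_of_faithful [BraidedCategory C] [BraidedCategory D] [BraidedCategory E]
    (F : C ⥤ D) (G : D ⥤ E) [G.Braided] [G.Faithful] [F.Monoidal] (m : ∀ X Y,
      (F ⋙ G).obj X ⊗ (F ⋙ G).obj Y ⟶ (F ⋙ G).obj (X ⊗ Y))
    (hm : ∀ X Y, μ G _ _ ≫ G.map (μ F X Y) = m X Y)
    (h : ∀ X Y, m X Y ≫ (F ⋙ G).map (β_ X Y).hom = (β_ _ _).hom ≫ m Y X) (X Y : C) :
    μ F X Y ≫ F.map (β_ X Y).hom = (β_ (F.obj X) (F.obj Y)).hom ≫ μ F Y X := by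
  apply G.map_injective
  rw [← cancel_epi (μ G _ _), G.map_comp, G.map_comp, reassoc_of% hm, ← Category.assoc,
    Functor.LaxBraided.braided, Category.assoc, hm]
  exact h X Y

end Detect

/-! ### Passage to all finite-dimensional Hilbert spaces -/

section ToFull
universe w
open Functor.LaxMonoidal Functor.OplaxMonoidal HilbTheory

namespace CPM
variable (T : HilbTheory.{w})

theorem dbl_toFull {X Y : CPM T} (Φ : X ⟶ Y) : Hom.dbl ((toFull T).map Φ) = Hom.dbl Φ := by
  obtain ⟨f, rfl⟩ := mk_surjective Φ
  exact f.toFull_dbl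

/-- Doubling factors through the passage to all Hilbert spaces. -/
def doubleIso : double T ≅ toFull T ⋙ double HilbTheory.full :=
  NatIso.ofComponents (fun X => Iso.refl ((double T).obj X)) fun Φ =>
    (Category.comp_id ((double T).map Φ)).trans
      ((dbl_toFull T Φ).symm.trans (Category.id_comp _).symm)

/-- A relabelling of bases, as a pure isomorphism of all Hilbert spaces. -/
def fullPermIso {X Y : CPM HilbTheory.full} 
    (e : (HilbTheory.full.space X.obj.obj).basis ≃ (HilbTheory.full.space Y.obj.obj).basis) : X ≅ Y :=
  (pure HilbTheory.full).mapIso (permIso (T := HilbTheory.full) e trivial)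

theorem dbl_fullPermIso {X Y : CPM HilbTheory.full} 
    (e : (HilbTheory.full.space X.obj.obj).basis ≃ (HilbTheory.full.space Y.obj.obj).basis) :
    (double HilbTheory.full).map (fullPermIso e).hom =
      (FHilb.perm e ⊗ₘ FHilb.perm e : dblSpace X.obj ⟶ dblSpace Y.obj) :=
  double_pure_perm (T := HilbTheory.full) e trivial

instance : (toFull T ⋙ double HilbTheory.full).Monoidal := Functor.Monoidal.transport (doubleIso T)

/-- The structure map `H_X ⊗ H_Y ≅ H_(X ⊗ Y)`. -/
def toFullμ (X Y : CPM T) : (toFull T).obj X ⊗ (toFull T).obj Y ≅ (toFull T).obj (X ⊗ Y) :=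
  fullPermIso (X := (toFull T).obj X ⊗ (toFull T).obj Y) (T.tensorEquiv X.obj.obj Y.obj.obj).symm

/-- The structure map `ℂ ≅ H_I`. -/
def toFullε : 𝟙_ (CPM HilbTheory.full) ≅ (toFull T).obj (𝟙_ (CPM T)) :=
  fullPermIso (X := 𝟙_ (CPM HilbTheory.full)) (Y := (toFull T).obj (𝟙_ (CPM T))) T.unitEquiv.symm

-- Both sides relabel basis vectors, and the two bijections have the same values.
open FHilb in
theorem double_toFullμ (X Y : CPM T) :
    μ (double HilbTheory.full) _ _ ≫ (double HilbTheory.full).map (toFullμ T X Y).hom =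
      μ (double T) X Y := by
  refine (congrArg (fun k => (doubleμ ((toFull T).obj X) ((toFull T).obj Y)).hom ≫ k)
    (dbl_fullPermIso _)).trans ?_
  refine (congrArg (fun k => (doubleμ ((toFull T).obj X) ((toFull T).obj Y)).hom ≫ k)
    (perm_tensor _ _)).trans ?_
  exact (perm_comp _ _).trans (congrArg FHilb.perm (Equiv.ext fun x => rfl))

open FHilb in
theorem double_toFullε :
    ε (double HilbTheory.full) ≫ (double HilbTheory.full).map (toFullε T).hom =
      ε (double T) := by
  refine (congrArg (fun k => (doubleε (T := HilbTheory.full)).hom ≫ k)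
    (dbl_fullPermIso _)).trans ?_
  refine (congrArg (fun k => (doubleε (T := HilbTheory.full)).hom ≫ k)
    (perm_tensor _ _)).trans ?_
  exact (perm_comp _ _).trans (congrArg FHilb.perm (Equiv.ext fun x => rfl))

/-- The isomorphism along which the structure is transported has identity components, so the
transported structure map is the original one. -/
theorem μ_toFull_double (X Y : CPM T) :
    μ (toFull T ⋙ double HilbTheory.full) X Y = μ (double T) X Y :=
  (Functor.Monoidal.transport_μ (doubleIso T) X Y).trans <|
    (congrArg₂ (fun a b => a ≫ b) (id_tensorHom_id ((double T).obj X) ((double T).obj Y))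
      (Category.comp_id (μ (double T) X Y))).trans (Category.id_comp (μ (double T) X Y))

/-- The passage to all Hilbert spaces is monoidal. -/
def toFullCoreMonoidal : (toFull T).CoreMonoidal :=
  coreMonoidalOfFaithful (toFull T) (double HilbTheory.full) (toFullε T) (toFullμ T)
    ((double_toFullε T).trans (Category.comp_id _).symm)
    (fun X Y => (double_toFullμ T X Y).trans (μ_toFull_double T X Y).symm)

/-- The passage to all Hilbert spaces is symmetric monoidal. -/
@[reducible]
def toFullBraided : (toFull T).Braided where
  toMonoidal := (toFullCoreMonoidal T).toMonoidal
  braided X Y := by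
    let _ := (toFullCoreMonoidal T).toMonoidal
    refine braided_of_faithful (toFull T) (double HilbTheory.full) (fun X Y => μ (double T) X Y)
      (fun X Y => double_toFullμ T X Y) (fun X Y => ?_) X Y
    refine (congrArg (fun k => μ (double T) X Y ≫ k) (dbl_toFull T (β_ X Y).hom)).trans ?_
    exact Functor.LaxBraided.braided (F := double T) X Y

theorem toFull_faithful : (toFull T).Faithful where
  map_injective {X Y} Φ Ψ h := Hom.dbl_injective <|
    (dbl_toFull T Φ).symm.trans ((congrArg Hom.dbl h).trans (dbl_toFull T Ψ))

/-- Causality is a condition on the doubled matrix, which the inclusion does not change. -/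
theorem causal_toFull {X Y : CPM T} (Φ : X ⟶ Y) :
    causal HilbTheory.full ((toFull T).map Φ) ↔ causal T Φ := by
  rw [causal_iff, causal_iff, dbl_toFull]
  exact Iff.rfl

theorem causal_fullPermIso {X Y : CPM HilbTheory.full} 
    (e : (HilbTheory.full.space X.obj.obj).basis ≃ (HilbTheory.full.space Y.obj.obj).basis) :
    causal HilbTheory.full (fullPermIso e).hom ∧ causal HilbTheory.full (fullPermIso e).inv :=
  ⟨causal_perm (T := HilbTheory.full) e trivial, causal_perm_inv (T := HilbTheory.full) e trivial⟩

end CPM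
end ToFull

/-! ### Comparison with matrix algebras -/

section ToMatAlg
open Functor.LaxMonoidal Functor.OplaxMonoidal HilbTheory

namespace CPM

theorem supMap_toMatAlg {X Y : CPM HilbTheory.full} (Φ : X ⟶ Y) :
    MatAlg.supMap (toMatAlg.map Φ) = Hom.dbl Φ := by
  obtain ⟨f, rfl⟩ := mk_surjective Φ
  exact supMap_kraus f.under

/-- Doubling factors through the matrix algebras. -/
def doubleSupIso : double HilbTheory.full ≅ toMatAlg ⋙ MatAlg.sup :=
  NatIso.ofComponents (fun X => Iso.refl ((double HilbTheory.full).obj X)) fun Φ =>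
    (Category.comp_id ((double HilbTheory.full).map Φ)).trans
      ((supMap_toMatAlg Φ).symm.trans (Category.id_comp _).symm)

instance : (toMatAlg ⋙ MatAlg.sup).Monoidal := Functor.Monoidal.transport doubleSupIso

def toMatAlgμ (X Y : CPM HilbTheory.full) :
    toMatAlg.obj X ⊗ toMatAlg.obj Y ≅ toMatAlg.obj (X ⊗ Y) :=
  Iso.refl (⟨X.obj.obj ⊗ Y.obj.obj⟩ : MatAlg)

def toMatAlgε : 𝟙_ MatAlg ≅ toMatAlg.obj (𝟙_ (CPM HilbTheory.full)) := Iso.refl (𝟙_ MatAlg)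

theorem sup_toMatAlgμ (X Y : CPM HilbTheory.full) :
    μ MatAlg.sup _ _ ≫ MatAlg.sup.map (toMatAlgμ X Y).hom = μ (double HilbTheory.full) X Y :=
  (congrArg (fun k => (MatAlg.supμ (toMatAlg.obj X) (toMatAlg.obj Y)).hom ≫ k)
    (MatAlg.supMap_id _)).trans
    ((Category.comp_id _).trans (congrArg FHilb.perm (Equiv.ext fun x => rfl)))

theorem sup_toMatAlgε :
    ε MatAlg.sup ≫ MatAlg.sup.map toMatAlgε.hom = ε (double HilbTheory.full) :=
  (congrArg (fun k => MatAlg.supε.hom ≫ k) (MatAlg.supMap_id _)).trans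
    ((Category.comp_id _).trans (congrArg FHilb.perm (Equiv.ext fun x => rfl)))

theorem μ_toMatAlg_sup (X Y : CPM HilbTheory.full) :
    μ (toMatAlg ⋙ MatAlg.sup) X Y = μ (double HilbTheory.full) X Y :=
  (Functor.Monoidal.transport_μ (doubleSupIso) X Y).trans <|
    (congrArg₂ (fun a b => a ≫ b) (id_tensorHom_id ((double HilbTheory.full).obj X) ((double HilbTheory.full).obj Y))
      (Category.comp_id (μ (double HilbTheory.full) X Y))).trans (Category.id_comp (μ (double HilbTheory.full) X Y))

/-- The comparison with matrix algebras is monoidal. -/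
def toMatAlgCoreMonoidal : toMatAlg.CoreMonoidal :=
  coreMonoidalOfFaithful toMatAlg MatAlg.sup toMatAlgε toMatAlgμ
    (sup_toMatAlgε.trans (Category.comp_id _).symm)
    (fun X Y => (sup_toMatAlgμ X Y).trans (μ_toMatAlg_sup X Y).symm)

/-- The comparison with matrix algebras is symmetric monoidal. -/
@[reducible]
def toMatAlgBraided : toMatAlg.Braided where
  toMonoidal := toMatAlgCoreMonoidal.toMonoidal
  braided X Y := by
    let _ := toMatAlgCoreMonoidal.toMonoidal
    refine braided_of_faithful toMatAlg MatAlg.sup (fun X Y => μ (double HilbTheory.full) X Y)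
      (fun X Y => sup_toMatAlgμ X Y) (fun X Y => ?_) X Y
    refine (congrArg (fun k => μ (double HilbTheory.full) X Y ≫ k)
      (supMap_toMatAlg (β_ X Y).hom)).trans ?_
    exact Functor.LaxBraided.braided (F := double HilbTheory.full) X Y

end CPM

namespace MatAlg

/-- Trace preservation needs to be checked only on matrix units, where it is the condition that
expresses causality of a doubled map. -/
theorem tracePreserving_iff {X Y : MatAlg} (Φ : X ⟶ Y) : tracePreserving Φ ↔
    ∀ x x' : X.space.basis, ∑ y : Y.space.basis, (supMap Φ).mat (y, y) (x, x') =
      if x = x' then 1 else 0 := by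
  constructor
  · intro h x x'
    refine (h (Matrix.single x x' 1)).trans ?_
    split_ifs with e
    · rw [e, Matrix.trace_single_eq_same]
    · exact Matrix.trace_single_eq_of_ne _ _ _ e
  · intro h M
    refine (Finset.sum_congr rfl fun y _ => lin_apply Φ M y y).trans ?_
    rw [Finset.sum_comm]
    refine Finset.sum_congr rfl fun x _ => ?_
    rw [Finset.sum_comm]
    simp only [← Finset.sum_mul, h, ite_mul, one_mul, zero_mul, Finset.sum_ite_eq,
      Finset.mem_univ, if_true]
    rfl

-- This block matrix is the rank-one operator of the unnormalised maximally entangled vector; a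
-- completely positive map applied to its blocks gives the Choi matrix.
open scoped ComplexOrder in
theorem posSemidef_entangled (X : Type) [Fintype X] [DecidableEq X] :
    (Matrix.comp X X X X ℂ (Matrix.of fun i j => Matrix.single i j 1)).PosSemidef := by
  have h : Matrix.comp X X X X ℂ (Matrix.of fun i j => Matrix.single i j 1) =
      Matrix.vecMulVec (fun a : X × X => if a.1 = a.2 then (1 : ℂ) else 0)
        (star fun a : X × X => if a.1 = a.2 then (1 : ℂ) else 0) := by
    ext ⟨i, x⟩ ⟨j, y⟩
    rw [Matrix.comp_apply, Matrix.of_apply, Matrix.vecMulVec_apply, Matrix.single_apply]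
    by_cases h1 : i = x <;> by_cases h2 : j = y <;> simp [h1, h2]
  rw [h]
  exact Matrix.posSemidef_vecMulVec_self_star _

open scoped Matrix.Norms.L2Operator MatrixOrder ComplexOrder in
/-- The Choi matrix of a completely positive map factors as `Kᴴ K`. -/
theorem exists_choi {X Y : MatAlg} (Φ : X ⟶ Y) :
    ∃ K : Matrix (X.space.basis × Y.space.basis) (X.space.basis × Y.space.basis) ℂ,
      ∀ y y' x x', (supMap Φ).mat (y, y') (x, x') = ∑ s, star (K s (x, y)) * K s (x', y') := by
  have h := Hom.pos Φ X.space.basis (Matrix.of fun i j => Matrix.single i j 1)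
    (posSemidef_entangled _)
  rw [← Matrix.nonneg_iff_posSemidef, CStarAlgebra.nonneg_iff_eq_star_mul_self] at h
  obtain ⟨K, hK⟩ := h
  exact ⟨K, fun y y' x x' => (congrFun (congrFun hK (x, y)) (x', y')).trans Matrix.mul_apply⟩

/-- The rows of the factor K of the Choi matrix, conjugated, are Kraus operators. The ancilla
indexes these rows, so it can be taken to be X ⊗ Y. -/
theorem exists_kraus {X Y : MatAlg} (Φ : X ⟶ Y) :
    ∃ f : X.space ⊗ (X.space ⊗ Y.space) ⟶ Y.space, supMap Φ = FHilb.double f := by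
  obtain ⟨K, hK⟩ := exists_choi Φ
  refine ⟨⟨Matrix.of fun y (a : X.space.basis × (X.space.basis × Y.space.basis)) =>
    star (K a.2 (a.1, y))⟩, ?_⟩
  ext ⟨y, y'⟩ ⟨x, x'⟩
  refine (hK y y' x x').trans (Eq.trans ?_ (FHilb.double_apply _ y y' x x').symm)
  exact Finset.sum_congr rfl fun s _ =>
    congrArg (star (K s (x, y)) * ·) (star_star (K s (x', y'))).symm

end MatAlg

namespace CPM

theorem tracePreserving_toMatAlg {X Y : CPM HilbTheory.full} (Φ : X ⟶ Y) :
    MatAlg.tracePreserving (toMatAlg.map Φ) ↔ causal HilbTheory.full Φ := by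
  rw [causal_iff, MatAlg.tracePreserving_iff, supMap_toMatAlg]
  exact Iff.rfl

/-- Any linear map with an ancilla, as a dilation in all Hilbert spaces. -/
def fullDilation {X S Y : FHilb} (f : X ⊗ S ⟶ Y) : Dilation (T := HilbTheory.full) ⟨X⟩ ⟨Y⟩ :=
  ⟨⟨S⟩, ⟨f, trivial⟩⟩

theorem fullDilation_dbl {X S Y : FHilb} (f : X ⊗ S ⟶ Y) :
    (fullDilation f).dbl = FHilb.double f := by
  have h : FHilb.perm (Y := X ⊗ S) (Equiv.refl (X ⊗ S).basis) ≫ f = f := by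
    rw [FHilb.perm_refl, Category.id_comp]
  exact congrArg (fun k : X ⊗ S ⟶ Y => FHilb.double k) h

theorem exists_toMatAlg_eq {X Y : CPM HilbTheory.full} (Φ : toMatAlg.obj X ⟶ toMatAlg.obj Y) :
    ∃ Ψ : X ⟶ Y, toMatAlg.map Ψ = Φ := by
  obtain ⟨f, hf⟩ := MatAlg.exists_kraus Φ
  exact ⟨mk (fullDilation f), MatAlg.supMap_injective
    ((supMap_toMatAlg (mk (fullDilation f))).trans ((fullDilation_dbl f).trans hf.symm))⟩

/-- Two dilations are identified exactly when their doubled maps agree, and the doubled map is the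
matrix of the Kraus map; this gives faithfulness. Fullness is the existence of Kraus operators. -/
theorem toMatAlg_isEquivalence : toMatAlg.IsEquivalence where
  faithful := ⟨fun {X Y Φ Ψ} h => Hom.dbl_injective <|
    (supMap_toMatAlg Φ).symm.trans ((congrArg MatAlg.supMap h).trans (supMap_toMatAlg Ψ))⟩
  full := ⟨fun Φ => exists_toMatAlg_eq Φ⟩
  essSurj := ⟨fun Y => ⟨⟨⟨Y.space⟩⟩, ⟨Iso.refl Y⟩⟩⟩

end CPM
end ToMatAlg

/-! ### Equivalences -/

section Equivalences
variable {p : ℕ} [Fact p.Prime]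

theorem restrictWide_faithful {C D : Type*} [Category* C] [Category* D] (F : C ⥤ D) [F.Faithful]
    (P : MorphismProperty C) (Q : MorphismProperty D) [P.IsMultiplicative] [Q.IsMultiplicative]
    (h : ∀ ⦃X Y : C⦄ (f : X ⟶ Y), P f → Q (F.map f)) : (restrictWide F P Q h).Faithful where
  map_injective e := WideSubcategory.hom_ext _ (F.map_injective (congrArg (fun k => k.hom) e))

theorem restrictWide_toMatAlg_isEquivalence (h : ∀ ⦃X Y⦄ (Φ : X ⟶ Y),
    CPM.causal HilbTheory.full Φ → MatAlg.tracePreserving (CPM.toMatAlg.map Φ)) :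
    (restrictWide CPM.toMatAlg _ _ h).IsEquivalence where
  faithful :=
    have := CPM.toMatAlg_isEquivalence
    restrictWide_faithful _ _ _ h
  full := ⟨fun {X Y} Φ => by
    obtain ⟨Ψ, hΨ⟩ := CPM.exists_toMatAlg_eq (X := X.obj) (Y := Y.obj) Φ.hom
    refine ⟨⟨Ψ, (CPM.tracePreserving_toMatAlg Ψ).1 ?_⟩, WideSubcategory.hom_ext _ hΨ⟩
    rw [hΨ]
    exact Φ.property⟩
  essSurj := ⟨fun Y => ⟨⟨⟨⟨Y.obj.space⟩⟩⟩, ⟨Iso.refl Y⟩⟩⟩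

/-- Passing to all Hilbert spaces adds many invertible scalars, so faithfulness is not formal.
Stabiliser maps that are proportional by any nonzero complex number have the same relation, and
hence already differ by a power of p. -/
theorem proj_toFull_faithful [NeZero (2 : ZMod p)] :
    letI := CPM.toFullBraided (Stab p)
    (Proj.map (CPM.toFull (Stab p))).Faithful := by
  let _ := CPM.toFullBraided (Stab p)
  refine Proj.lift_faithful _ _ fun X Y Φ Ψ h => ?_
  obtain ⟨s, hs⟩ := projRel_of_quot_eq h
  refine projRel_of_relOf_eq (n := X.obj.obj) (m := Y.obj.obj)
    (relOf_eq_of_smul (CPM.scalarVal_ne_zero s) ?_)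
  have h2 := (congrArg FHilb.Hom.mat (congrArg CPM.Hom.dbl hs)).trans (CPM.dbl_scale s.hom _)
  rw [CPM.dbl_toFull, CPM.dbl_toFull] at h2
  exact h2

theorem proj_stabRel_isEquivalence [NeZero (2 : ZMod p)]
    (hS : ∀ ⦃X Y⦄ (Φ Ψ : X ⟶ Y), projRel (CPM (Stab p)) Φ Ψ →
      (stabRel p).functor.map Φ = (stabRel p).functor.map Ψ) :
    (Proj.lift (stabRel p).functor hS).IsEquivalence where
  faithful := Proj.lift_faithful _ _ fun X Y Φ Ψ h =>
    projRel_of_relOf_eq (n := X.obj.obj) (m := Y.obj.obj) h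
  full :=
    have : (stabRel p).functor.Full :=
      ⟨fun {X Y} A => exists_relOf_eq (n := X.obj.obj) (m := Y.obj.obj) A⟩
    Proj.lift_full _ _
  essSurj :=
    have : (stabRel p).functor.EssSurj := ⟨fun V => by
      obtain ⟨n, i, -⟩ := exists_stdSymp_iso (p := p) V
      exact ⟨nQupits p n, ⟨i⟩⟩⟩
    Proj.lift_essSurj _ _

theorem restrictWide_stabRel_isEquivalence [NeZero (2 : ZMod p)]
    (hR : ∀ ⦃X Y⦄ (Φ : X ⟶ Y), CPM.causal (Stab p) Φ →
      SympSpace.total (ZMod p) ((stabRel p).functor.map Φ)) :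
    (restrictWide (stabRel p).functor _ _ hR).IsEquivalence where
  faithful := ⟨fun {X Y Φ Ψ} h => WideSubcategory.hom_ext _
    (causal_ext (n := X.obj.obj.obj) (m := Y.obj.obj.obj) Φ.property Ψ.property
      (congrArg (fun k => k.hom) h))⟩
  full := ⟨fun {X Y} A => by
    obtain ⟨Φ, hΦ⟩ := exists_relOf_eq (n := X.obj.obj.obj) (m := Y.obj.obj.obj) A.hom
    have hA : SympSpace.total (ZMod p) (relOf Φ) := hΦ ▸ A.property
    obtain ⟨Ψ, hc, hΨ⟩ := exists_causal Φ hA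
    exact ⟨⟨Ψ, hc⟩, WideSubcategory.hom_ext _ (hΨ.trans hΦ)⟩⟩
  essSurj := ⟨fun V => by
    obtain ⟨n, i, h1, h2⟩ := exists_stdSymp_iso (p := p) V.obj
    exact ⟨⟨nQupits p n⟩, ⟨WideSubcategory.isoMk (X := ⟨stdSymp p n⟩) i h1 h2⟩⟩⟩

open Functor.LaxMonoidal Functor.OplaxMonoidal

/-- Graphs of bijections are total in both directions. This is what allows the symmetric monoidal
structure of Rel to be restricted to causal maps and total relations. -/
theorem relBraided_total [NeZero (2 : ZMod p)] :
    letI := relBraided p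
    (SympSpace.total (ZMod p) (ε (stabRel p).functor) ∧
      SympSpace.total (ZMod p) (η (stabRel p).functor)) ∧
    (∀ X Y, SympSpace.total (ZMod p) (μ (stabRel p).functor X Y)) ∧
    ∀ X Y, SympSpace.total (ZMod p) (δ (stabRel p).functor X Y) :=
  ⟨⟨isGraph_unitSympIso.total, (SympSpace.isGraph_inv (unitEquivPhase p) _).total⟩,
    fun X Y => (isGraph_splitIso X.obj.obj Y.obj.obj).total,
    fun X Y => (SympSpace.isGraph_inv (V := stdSymp p X.obj.obj ⊗ stdSymp p Y.obj.obj)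
      (W := stdSymp p ((Stab p).tensor X.obj.obj Y.obj.obj)) (splitEquiv p X.obj.obj Y.obj.obj).symm
      (splitEquiv_symm_form X.obj.obj Y.obj.obj)).total⟩

theorem toFullBraided_causal (T : HilbTheory.{u}) :
    letI := CPM.toFullBraided T
    (CPM.causal HilbTheory.full (ε (CPM.toFull T)) ∧
      CPM.causal HilbTheory.full (η (CPM.toFull T))) ∧
    (∀ X Y, CPM.causal HilbTheory.full (μ (CPM.toFull T) X Y)) ∧
    ∀ X Y, CPM.causal HilbTheory.full (δ (CPM.toFull T) X Y) :=
  ⟨CPM.causal_fullPermIso _, fun X Y => (CPM.causal_fullPermIso _).1,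
    fun X Y => (CPM.causal_fullPermIso _).2⟩

theorem toMatAlgBraided_tracePreserving :
    letI := CPM.toMatAlgBraided
    (MatAlg.tracePreserving (ε CPM.toMatAlg) ∧ MatAlg.tracePreserving (η CPM.toMatAlg)) ∧
    (∀ X Y, MatAlg.tracePreserving (μ CPM.toMatAlg X Y)) ∧
    ∀ X Y, MatAlg.tracePreserving (δ CPM.toMatAlg X Y) :=
  ⟨⟨fun _ => rfl, fun _ => rfl⟩, fun _ _ _ => rfl, fun _ _ _ => rfl⟩

end Equivalences

end

/-! ### Assembly of the diagram -/

theorem mainTheorem5 (p : ℕ) [Fact p.Prime] (hp : p ≠ 2) :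
    ∃ (R : StabRel p) (_ : R.functor.Braided) (_ : (CPM.toFull (Stab p)).Braided)
      (_ : CPM.toMatAlg.Braided),
      (∀ X Y v w a, SympSpace.Related (V := stdSymp p X.obj.obj ⊗ stdSymp p Y.obj.obj)
        (Functor.LaxMonoidal.μ R.functor X Y) (v, w) a ↔
          splitEquiv p X.obj.obj Y.obj.obj a = (v, w)) ∧
      (∀ X Y, Functor.LaxMonoidal.μ (CPM.toFull (Stab p)) X Y =
        (CPM.pure HilbTheory.full).map ⟨((Stab p).μ X.obj.obj Y.obj.obj).hom, trivial⟩) ∧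
      (∀ X Y, Functor.LaxMonoidal.μ CPM.toMatAlg X Y = 𝟙 (⟨X.obj.obj ⊗ Y.obj.obj⟩ : MatAlg)) ∧
      ∃ (hR : ∀ ⦃X Y⦄ (Φ : X ⟶ Y), CPM.causal (Stab p) Φ →
          SympSpace.total (ZMod p) (R.functor.map Φ))
        (hE : ∀ ⦃X Y⦄ (Φ : X ⟶ Y), CPM.causal (Stab p) Φ →
          CPM.causal HilbTheory.full ((CPM.toFull (Stab p)).map Φ))
        (hK : ∀ ⦃X Y⦄ (Φ : X ⟶ Y), CPM.causal HilbTheory.full Φ →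
          MatAlg.tracePreserving (CPM.toMatAlg.map Φ))
        (hS : ∀ ⦃X Y⦄ (Φ Ψ : X ⟶ Y), projRel (CPM (Stab p)) Φ Ψ →
          R.functor.map Φ = R.functor.map Ψ)
        (_ : (restrictWide R.functor _ _ hR).Braided)
        (_ : (restrictWide (CPM.toFull (Stab p)) _ _ hE).Braided)
        (_ : (restrictWide CPM.toMatAlg _ _ hK).Braided),
        (restrictWide R.functor _ _ hR).IsEquivalence ∧
        (Proj.lift R.functor hS).IsEquivalence ∧
        (CPM.toFull (Stab p)).Faithful ∧
        (restrictWide (CPM.toFull (Stab p)) _ _ hE).Faithful ∧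
        (Proj.map (CPM.toFull (Stab p))).Faithful ∧
        CPM.toMatAlg.IsEquivalence ∧
        (restrictWide CPM.toMatAlg _ _ hK).IsEquivalence ∧
        (Proj.map CPM.toMatAlg).IsEquivalence ∧
        MonoidallyIso (restrictWide R.functor _ _ hR ⋙ wideSubcategoryInclusion _)
          (wideSubcategoryInclusion _ ⋙ Proj.quot _ ⋙ Proj.lift R.functor hS) ∧
        MonoidallyIso R.functor (Proj.quot _ ⋙ Proj.lift R.functor hS) ∧
        MonoidallyIso (restrictWide (CPM.toFull (Stab p)) _ _ hE ⋙ wideSubcategoryInclusion _)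
          (wideSubcategoryInclusion _ ⋙ CPM.toFull (Stab p)) ∧
        MonoidallyIso (CPM.toFull (Stab p) ⋙ Proj.quot _)
          (Proj.quot _ ⋙ Proj.map (CPM.toFull (Stab p))) ∧
        MonoidallyIso (restrictWide CPM.toMatAlg _ _ hK ⋙ wideSubcategoryInclusion _)
          (wideSubcategoryInclusion _ ⋙ CPM.toMatAlg) ∧
        MonoidallyIso (CPM.toMatAlg ⋙ Proj.quot _) (Proj.quot _ ⋙ Proj.map CPM.toMatAlg) := by
  have : NeZero (2 : ZMod p) := ⟨fun h => hp <| by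
    have h2 : p ∣ 2 := (ZMod.natCast_eq_zero_iff 2 p).1 (by exact_mod_cast h)
    exact (Nat.prime_dvd_prime_iff_eq Fact.out Nat.prime_two).1 h2⟩
  let iR := relBraided p
  let iE := CPM.toFullBraided (Stab p)
  let iK := CPM.toMatAlgBraided
  have hR : ∀ ⦃X Y⦄ (Φ : X ⟶ Y), CPM.causal (Stab p) Φ →
      SympSpace.total (ZMod p) ((stabRel p).functor.map Φ) := fun X Y Φ h =>
    total_of_causal (n := X.obj.obj) (m := Y.obj.obj) h
  have hE : ∀ ⦃X Y⦄ (Φ : X ⟶ Y), CPM.causal (Stab p) Φ →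
      CPM.causal HilbTheory.full ((CPM.toFull (Stab p)).map Φ) := fun X Y Φ h =>
    (CPM.causal_toFull (Stab p) Φ).2 h
  have hK : ∀ ⦃X Y⦄ (Φ : X ⟶ Y), CPM.causal HilbTheory.full Φ →
      MatAlg.tracePreserving (CPM.toMatAlg.map Φ) := fun X Y Φ h =>
    (CPM.tracePreserving_toMatAlg Φ).2 h
  have hS : ∀ ⦃X Y⦄ (Φ Ψ : X ⟶ Y), projRel (CPM (Stab p)) Φ Ψ →
      (stabRel p).functor.map Φ = (stabRel p).functor.map Ψ := by
    rintro X Y _ Ψ ⟨s, rfl⟩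
    exact relOf_scale (n := X.obj.obj) (m := Y.obj.obj) s Ψ
  obtain ⟨⟨a₁, a₂⟩, a₃, a₄⟩ := relBraided_total (p := p)
  obtain ⟨⟨b₁, b₂⟩, b₃, b₄⟩ := toFullBraided_causal (Stab p)
  obtain ⟨⟨c₁, c₂⟩, c₃, c₄⟩ := toMatAlgBraided_tracePreserving
  have : (CPM.toFull (Stab p)).Faithful := CPM.toFull_faithful (Stab p)
  have : CPM.toMatAlg.IsEquivalence := CPM.toMatAlg_isEquivalence
  -- The structure maps of the inclusion and of the comparison with matrix algebras were chosen to
  -- be the canonical ones, so their descriptions hold by definition.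
  exact ⟨stabRel p, iR, iE, iK, relBraided_μ, fun X Y => rfl, fun X Y => rfl, hR, hE, hK, hS,
    restrictBraided (stabRel p).functor _ _ hR a₁ a₂ a₃ a₄,
    restrictBraided (CPM.toFull (Stab p)) _ _ hE b₁ b₂ b₃ b₄,
    restrictBraided CPM.toMatAlg _ _ hK c₁ c₂ c₃ c₄,
    restrictWide_stabRel_isEquivalence hR, proj_stabRel_isEquivalence hS,
    CPM.toFull_faithful (Stab p), restrictWide_faithful _ _ _ hE, proj_toFull_faithful,
    CPM.toMatAlg_isEquivalence, restrictWide_toMatAlg_isEquivalence hK,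
    Proj.map_isEquivalence CPM.toMatAlg,
    monoidallyIso_restrict_lift (stabRel p).functor _ _ hR a₁ a₂ a₃ a₄ hS,
    monoidallyIso_lift (stabRel p).functor hS,
    monoidallyIso_restrict (CPM.toFull (Stab p)) _ _ hE b₁ b₂ b₃ b₄,
    monoidallyIso_map (CPM.toFull (Stab p)),
    monoidallyIso_restrict CPM.toMatAlg _ _ hK c₁ c₂ c₃ c₄,
    monoidallyIso_map CPM.toMatAlg⟩
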